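/- **Setting.** Let $X$ be a connected (Hausdorff, paracompact) complex manifold with sheaf $\mathcal O$ of holomorphic functions, and let $\mathcal U=(U_\alpha)_{\alpha\in I}$ be a cover of $X$ by nonempty Stein open subsets. For a tuple $\sigma=(\alpha_0,\dots,\alpha_p)$ put $U_\sigma=U_{\alpha_0}\cap\dots\cap U_{\alpha_p}$; below, tuples always have $U_\sigma\neq\emptyset$, repetitions are allowed, and a monotone map $t:[q]\to[p]$ gives the reindexed tuple $t^*\sigma$, with $U_\sigma\subseteq U_{t^*\sigma}$. Fix a set $S\subseteq\mathbb Z$ of allowed degrees ($S=\mathbb Z_{\ge0}$ for non-negatively graded complexes, $S=\mathbb Z$ for all bounded complexes). For a ring $R$, $\mathrm{Free}(R)$ is the dg-category of bounded cochain complexes of finite-rank free $R$-modules in degrees in $S$, a free module being identified with $R^r$ (skeleton), so that morphisms are matrices; put $\mathrm{Free}(V)=\mathrm{Free}(\mathcal O(V))$. **Simplicial presheaves.** - $\mathcal N$ is the nerve of the category of chain maps, and $\mathcal N^{\mathrm{dg}}$ the dg-nerve. A $p$-simplex of the latter consists of complexes $C_0,\dots,C_p$ and, for $J=\{j_0<\dots<j_k\}\subseteq[p]$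 with $k\ge1$, maps $\varphi_J:C_{j_k}\to C_{j_0}$ of degree $1-k$ with $$\partial\varphi_J=\sum_{m=1}^{k-1}(-1)^{m-1}\varphi_{J\setminus j_m}+\sum_{m=1}^{k-1}(-1)^{k(m-1)+1}\varphi_{\{j_0<\dots<j_m\}}\varphi_{\{j_m<\dots<j_k\}} ,$$ where $\partial f=f d+(-1)^{\deg f+1}d f$; degeneracies insert identities (and zeros in higher dimensions). In both nerves the edge $i<j$ is labelled by a map $C_j\to C_i$. $[\![-]\!]$ is the core: the simplices all of whose edges are equivalences. - $\mathcal Twist(V)=[\![\mathcal N^{\mathrm{dg}}\mathrm{Free}(V)]\!]$. - An elementary complex is a finite list of summands $R^m\xrightarrow{\mathrm{id}}R^m$ placed in degrees $(d,d+1)$; the elementary morphism between two such lists is the identity on the positions where the entries agree, and zero elsewhere. - $s\mathcal Twist(V)_p$ is the set of GTT-labellings of $\Delta[p]$: each nonempty face $\sigma$ of $\Delta[p]$ carries a simplex $(C_i(\sigma),\varphi_J(\sigma))$ of $\mathcal Twist(V)$; each pair $\tau\subset\sigma$ and each vertex $i\in\tau$ carry an elementary complex $C_i^{\perp\sigma}(\tau)$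 and an isomorphism of complexes $C_i(\tau)\oplus C_i^{\perp\sigma}(\tau)\cong C_i(\sigma)$; for $J\subseteq\tau$ with $|J|\ge2$, with respect to these isomorphisms, $\varphi_J(\sigma)=\begin{pmatrix}\varphi_J(\tau)&*\\0&e\end{pmatrix}$ with $e$ the elementary morphism if $|J|=2$ and $e=0$ if $|J|>2$; the inclusions $C_i(\tau)\hookrightarrow C_i(\sigma)$ compose strictly for $\rho\subset\tau\subset\sigma$. Degenerate faces are labelled by degenerate data, with zero complements. - $\mathcal Green(V)_p\subseteq s\mathcal Twist(V)_p$ is the set of labellings whose simplices lie in $[\![\mathcal N\mathrm{Free}(V)]\!]$: $\varphi_J(\sigma)=0$ for $|J|\ge3$, and $\varphi_J(\sigma)$ is an isomorphism for $|J|=2$. For such a simplicial presheaf $F$, evaluation on the Čech nerve gives the cosimplicial simplicial set $F(\check{\mathcal N}\mathcal U_p)=\prod_{\sigma=(\alpha_0,\dots,\alpha_p)}F(U_\sigma)$, and $\mathrm{Tot}^0F(\check{\mathcal N}\mathcal U_\bullet)$ is the set of morphisms $\Delta[\star]\to F(\check{\mathcal N}\mathcal U_\star)$. Such a $v$ has a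 component $v_\sigma\in F(U_\sigma)_p$ for each tuple $\sigma=(\alpha_0,\dots,\alpha_p)$. **Theorem.** (a) $\mathrm{Tot}^0[\![\mathcal N\mathrm{Free}(\check{\mathcal N}\mathcal U_\bullet)]\!]$ is in bijection with the set of bounded complexes $E^\bullet$ of sheaves of $\mathcal O$-modules, in degrees in $S$, that are free of finite rank on each $U_\alpha$ and come with a frame of each $E^n|_{U_\alpha}$, up to isomorphisms of complexes preserving the frames. The bijection is given by taking matrices: the complexes in $v_\sigma$ are the matrices of the differential, and the maps in $v_\sigma$ the change-of-frame matrices. (b) $\mathrm{Tot}^0\mathcal Twist(\check{\mathcal N}\mathcal U_\bullet)$ is in bijection with the set of twisting cochains on $(X,\mathcal U)$: graded free modules $E_\alpha$ of finite total rank, in degrees in $S$, and $\mathfrak a=\sum_k\mathfrak a^{k,1-k}$ with $\mathfrak a_{\alpha_0\dots\alpha_k}:E_{\alpha_k}\to E_{\alpha_0}$ of degree $1-k$ over $U_{\alpha_0\dots\alpha_k}$, satisfying the Maurer–Cartan equation $\hat\delta\mathfrak a+\mathfrak a\cdot\mathfrak a=0$ (where $\hat\delta$ is the alternating sum over the inner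 faces, and the product carries the usual sign), normalised by $\mathfrak a_{\alpha\alpha}=\mathrm{id}$ and $\mathfrak a_{\alpha_0\dots\alpha_k}=0$ if $k\ge2$ and $\alpha_i=\alpha_{i+1}$ for some $i$. Under the bijection, the labels of $v_\sigma$ are the components of $\mathfrak a$. (c) $\mathrm{Tot}^0\mathcal Green(\check{\mathcal N}\mathcal U_\bullet)$ is in bijection with the set of Green complexes on $(X,\mathcal U)$, i.e. complexes of simplicial vector bundles with elementary complements, up to isomorphism compatible with all the data. The data are: for each $\sigma$ a bounded complex $E_\sigma$ of free $\mathcal O(U_\sigma)$-modules in degrees in $S$, with a frame for each member of $\sigma$; functorial maps of complexes $E_\tau\to E_\sigma$, linear over $\mathcal O(U_\tau)\to\mathcal O(U_\sigma)$, for $\tau=t^*\sigma$; for each member $m$ of $\tau$ an elementary subcomplex (with its standard basis) of $E_\sigma$ complementary to the extension of $E_\tau$, the bases for two members $m\le m'$ being related by the elementary morphism modulo $E_\tau$; the data on degenerate tuples are degenerate. The bijection is given by taking matrices in the frames. (d) $\mathrm{Tot}^0s\mathcal Twist(\check{\mathcal N}\mathcal U_\bullet)$ is in bijection with the set of simplicial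 twisting cochains on $(X,\mathcal U)$: for each $\sigma$, graded free modules $E_{\sigma,i}$ over $U_\sigma$ (for the members $i$ of $\sigma$), in degrees in $S$, and a normalised Maurer–Cartan element ${}^\sigma\mathfrak a$ for these; for each $\tau=t^*\sigma$ and each member $m$ of $\tau$, an elementary complex $E_{\sigma,\tau,m}$ and an isomorphism of complexes $E_{\sigma,t(m)}\cong E_{\tau,m}|_{U_\sigma}\oplus E_{\sigma,\tau,m}$, the inclusions being coherent, such that ${}^\sigma\mathfrak a$ is upper triangular, with ${}^\tau\mathfrak a$ and the elementary morphisms on the diagonal; the data on degenerate tuples are degenerate. Under the bijection, these data are the labels of $v_\sigma$ on the full simplex and on the pairs that contain it. -/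

import Mathlib

open CategoryTheory Simplicial Opposite TopologicalSpace
open scoped Manifold ContDiff

noncomputable section

namespace CechTot

/-! ### Complexes of free modules and matrices -/

/-- Index of a basis vector of a graded free module: its degree and its position. -/
abbrev Ix : Type := Σ _ : ℤ, ℕ

/-- Rank functions of bounded graded free modules of finite rank that are concentrated in the
set of degrees `S`. A free module is recorded by its rank. -/
abbrev Rk (S : Set ℤ) : Type := {r : ℤ →₀ ℕ // ∀ n, r n ≠ 0 → n ∈ S}

/-- The standard basis of the graded free module `⨁ₙ R ^ (r n)`. -/
def basis {S : Set ℤ} (r : Rk S) : Finset Ix :=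
  r.1.support.sigma fun n => Finset.range (r.1 n)

/-- Product of matrices, the summation running over a given finite set of indices. -/
def mcomp {A B C R : Type} [CommRing R] (s : Finset B) (M : Matrix A B R) (N : Matrix B C R) :
    Matrix A C R :=
  fun a c => ∑ b ∈ s, M a b * N b c

/-- `M` is the matrix of a homogeneous map of degree `q` from the graded free module of rank
`r` to the one of rank `s` (columns are indexed by the source, rows by the target, and the
entries outside the relevant range are zero). -/
def IsHom {S : Set ℤ} {R : Type} [CommRing R] (r s : Rk S) (q : ℤ) (M : Matrix Ix Ix R) : Prop :=
  ∀ x y, M x y ≠ 0 → x ∈ basis s ∧ y ∈ basis r ∧ x.1 = y.1 + q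

/-- The matrix of the identity of the graded free module of rank `r`. -/
def idMat {S : Set ℤ} (R : Type) [CommRing R] (r : Rk S) : Matrix Ix Ix R :=
  fun x y => if x = y ∧ y ∈ basis r then 1 else 0

section matrixLemmas

variable {S : Set ℤ} {A B C D R R' : Type} [CommRing R] [CommRing R']

theorem mcomp_map (f : R →+* R') (s : Finset B) (M : Matrix A B R) (N : Matrix B C R) :
    (mcomp s M N).map f = mcomp s (M.map f) (N.map f) := by
  ext a c
  simp [mcomp, Matrix.map_apply, map_sum, map_mul]

theorem idMat_map (f : R →+* R') (r : Rk S) : (idMat R r).map f = idMat R' r := by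
  ext x y
  simp only [idMat, Matrix.map_apply]
  split_ifs <;> simp

theorem IsHom.map {r s : Rk S} {q : ℤ} {M : Matrix Ix Ix R} (h : IsHom r s q M) (f : R →+* R') :
    IsHom r s q (M.map f) := by
  intro x y hxy
  refine h x y fun h0 => hxy ?_
  simp [Matrix.map_apply, h0]

theorem isHom_idMat (r : Rk S) : IsHom r r 0 (idMat R r) := by
  intro x y hxy
  by_cases h : x = y ∧ y ∈ basis r
  · exact ⟨h.1 ▸ h.2, h.2, by rw [h.1, add_zero]⟩
  · simp [idMat, h] at hxy

theorem IsHom.comp {r s t : Rk S} {p q : ℤ} {M N : Matrix Ix Ix R} (hM : IsHom s t p M)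
    (hN : IsHom r s q N) : IsHom r t (q + p) (mcomp (basis s) M N) := by
  intro x y hxy
  obtain ⟨b, -, hb⟩ := Finset.exists_ne_zero_of_sum_ne_zero hxy
  obtain ⟨h1, -, h2⟩ := hM x b (left_ne_zero_of_mul hb)
  obtain ⟨-, h3, h4⟩ := hN b y (right_ne_zero_of_mul hb)
  exact ⟨h1, h3, by rw [h2, h4, add_assoc]⟩

theorem mcomp_assoc (s : Finset B) (t : Finset C) (L : Matrix A B R) (M : Matrix B C R)
    (N : Matrix C D R) : mcomp t (mcomp s L M) N = mcomp s L (mcomp t M N) := by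
  ext a d
  simp only [mcomp, Finset.sum_mul, Finset.mul_sum, mul_assoc]
  exact Finset.sum_comm

theorem idMat_mcomp {r s : Rk S} {q : ℤ} {M : Matrix Ix Ix R} (h : IsHom r s q M) :
    mcomp (basis s) (idMat R s) M = M := by
  ext x y
  simp only [mcomp, idMat, ite_mul, one_mul, zero_mul]
  by_cases hx : x ∈ basis s
  · rw [Finset.sum_eq_single x]
    · simp [hx]
    · intro b _ hb
      simp [Ne.symm hb]
    · simp [hx]
  · rw [Finset.sum_eq_zero]
    · by_contra h0
      exact hx (h x y (Ne.symm h0)).1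
    · intro b hb
      rw [if_neg]
      rintro ⟨rfl, -⟩
      exact hx hb

theorem mcomp_idMat {r s : Rk S} {q : ℤ} {M : Matrix Ix Ix R} (h : IsHom r s q M) :
    mcomp (basis r) M (idMat R r) = M := by
  ext x y
  simp only [mcomp, idMat, mul_ite, mul_one, mul_zero]
  by_cases hy : y ∈ basis r
  · rw [Finset.sum_eq_single y]
    · simp [hy]
    · intro b _ hb
      simp [hb]
    · simp [hy]
  · rw [Finset.sum_eq_zero]
    · by_contra h0
      exact hy (h x y (Ne.symm h0)).2.1
    · intro b hb
      rw [if_neg]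
      rintro ⟨-, h2⟩
      exact hy h2

end matrixLemmas

/-! ### The category of bounded complexes of finite-rank free modules, and its nerve -/

/-- A bounded complex of free modules of finite rank over `R`, in degrees belonging to `S`. -/
@[ext]
structure FreeCpx (S : Set ℤ) (R : Type) [CommRing R] where
  /-- the ranks -/
  rank : Rk S
  /-- the differential -/
  d : Matrix Ix Ix R
  isHom : IsHom rank rank 1 d
  sq : mcomp (basis rank) d d = 0

/-- A chain map (of degree zero) between complexes of free modules. -/
@[ext]
structure ChainMap {S : Set ℤ} {R : Type} [CommRing R] (C D : FreeCpx S R) where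
  /-- the matrix of the chain map -/
  mat : Matrix Ix Ix R
  isHom : IsHom C.rank D.rank 0 mat
  comm : mcomp (basis C.rank) mat C.d = mcomp (basis D.rank) D.d mat

instance (S : Set ℤ) (R : Type) [CommRing R] : Category (FreeCpx S R) where
  Hom C D := ChainMap C D
  id C := ⟨idMat R C.rank, isHom_idMat _, by rw [idMat_mcomp C.isHom, mcomp_idMat C.isHom]⟩
  comp {C D E} f g := ⟨mcomp (basis D.rank) g.mat f.mat, by simpa using g.isHom.comp f.isHom, by
    rw [mcomp_assoc, f.comm, ← mcomp_assoc, g.comm, mcomp_assoc]⟩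
  id_comp f := ChainMap.ext (mcomp_idMat f.isHom)
  comp_id f := ChainMap.ext (idMat_mcomp f.isHom)
  assoc f g h := ChainMap.ext (mcomp_assoc _ _ _ _ _).symm

/-- Base change of complexes of free modules along a ring homomorphism. -/
def baseChange (S : Set ℤ) {R R' : Type} [CommRing R] [CommRing R'] (f : R →+* R') :
    FreeCpx S R ⥤ FreeCpx S R' where
  obj C := ⟨C.rank, C.d.map f, C.isHom.map f, by
    rw [← mcomp_map, C.sq]; ext; simp⟩
  map g := ⟨g.mat.map f, g.isHom.map f, by
    simp only [← mcomp_map]; exact congrArg (fun M => Matrix.map M f) g.comm⟩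
  map_id C := ChainMap.ext (idMat_map f _)
  map_comp g h := ChainMap.ext (mcomp_map f _ _ _)

theorem ChainMap.heq_of_mat {S : Set ℤ} {R : Type} [CommRing R] {C D C' D' : FreeCpx S R}
    (hC : C = C') (hD : D = D') (f : C ⟶ D) (g : C' ⟶ D')
    (h : ChainMap.mat f = ChainMap.mat g) : f ≍ g := by
  subst hC hD
  exact heq_of_eq (ChainMap.ext h)

theorem baseChange_id (S : Set ℤ) (R : Type) [CommRing R] :
    baseChange S (RingHom.id R) = 𝟭 (FreeCpx S R) := by
  have h : ∀ C, (baseChange S (RingHom.id R)).obj C = C := fun C => by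
    ext <;> simp [baseChange]
  refine CategoryTheory.Functor.hext h fun C D f => ?_
  exact ChainMap.heq_of_mat (h C) (h D) _ _ (by ext; simp [baseChange])

theorem baseChange_comp (S : Set ℤ) {R R' R'' : Type} [CommRing R] [CommRing R'] [CommRing R'']
    (f : R →+* R') (g : R' →+* R'') :
    baseChange S (g.comp f) = baseChange S f ⋙ baseChange S g := rfl

/-- The nerve of the category of bounded complexes of finite-rank free modules, as a functor of
the ring. In a simplex, the edge from the vertex `i` to the vertex `j` (where `i ≤ j`) is labelled
by a chain map from the `j`-th complex to the `i`-th one: this is the convention used for the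
differential graded nerve below. -/
def nerveFree (S : Set ℤ) : CommRingCat.{0} ⥤ SSet.{0} where
  obj R := nerve (FreeCpx S R)ᵒᵖ
  map f := nerveMap (baseChange S f.hom).op
  map_id R := by
    have : (baseChange S (𝟙 R : R ⟶ R).hom) = 𝟭 (FreeCpx S R) := baseChange_id S R
    rw [this]; rfl
  map_comp f g := by
    have : (baseChange S (f ≫ g).hom) = baseChange S f.hom ⋙ baseChange S g.hom :=
      baseChange_comp S f.hom g.hom
    rw [this]; rfl

/-! ### The differential graded nerve -/

/-- An `n`-simplex of the differential graded nerve of the dg-category of bounded complexes of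
finite-rank free `R`-modules. All monotone maps `J : ⦋k⦌ ⟶ n` carry a label `φ k J`, of degree
`1 - k`, from the complex at the last vertex of `J` to the complex at its first vertex; the label
of a vertex is the differential, and degenerate faces carry identities if `k = 1` and zero if
`k ≥ 2`. -/
@[ext]
structure DGSimplex (S : Set ℤ) (R : Type) [CommRing R] (n : SimplexCategory) where
  /-- the ranks of the complexes at the vertices -/
  rank : Fin (n.len + 1) → Rk S
  /-- the labels -/
  φ : ∀ k : ℕ, (⦋k⦌ ⟶ n) → Matrix Ix Ix R
  isHom : ∀ (k : ℕ) (J : ⦋k⦌ ⟶ n), IsHom (rank (J (Fin.last k))) (rank (J 0)) (1 - k) (φ k J)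
  sq : ∀ J : ⦋0⦌ ⟶ n, mcomp (basis (rank (J 0))) (φ 0 J) (φ 0 J) = 0
  degen_one : ∀ J : ⦋1⦌ ⟶ n, J 0 = J 1 → φ 1 J = idMat R (rank (J 0))
  degen : ∀ (k : ℕ) (J : ⦋k⦌ ⟶ n), 2 ≤ k → ¬ Function.Injective J → φ k J = 0
  /-- the differential of `φ J` in the complex of morphisms, for a face `J` of dimension `k + 1`,
  is the alternating sum of the labels of its inner faces and of the products of the labels of
  its front and back faces -/
  rel : ∀ (k : ℕ) (J : ⦋k + 1⦌ ⟶ n),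
    mcomp (basis (rank (J (Fin.last (k + 1))))) (φ (k + 1) J)
        (φ 0 (SimplexCategory.const ⦋0⦌ n (J (Fin.last (k + 1)))))
      + (-1 : ℤ) ^ (k + 1) • mcomp (basis (rank (J 0)))
        (φ 0 (SimplexCategory.const ⦋0⦌ n (J 0))) (φ (k + 1) J)
    = ∑ i : Fin k, (-1 : ℤ) ^ (i : ℕ) • φ k (SimplexCategory.δ i.succ.castSucc ≫ J)
      + ∑ i : Fin k, (-1 : ℤ) ^ ((k + 1) * (i : ℕ) + 1) •
        mcomp (basis (rank (J i.succ.castSucc)))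
          (φ (i + 1) (SimplexCategory.subinterval 0 (i + 1) (by omega) ≫ J))
          (φ (k - i) (SimplexCategory.subinterval (i + 1) (k - i) (by omega) ≫ J))

namespace DGSimplex

variable {S : Set ℤ} {R R' : Type} [CommRing R] [CommRing R']

/-- Faces and degeneracies of simplices of the differential graded nerve. -/
def pull {m n : SimplexCategory} (f : m ⟶ n) (x : DGSimplex S R n) : DGSimplex S R m where
  rank i := x.rank (f i)
  φ k J := x.φ k (J ≫ f)
  isHom k J := x.isHom k (J ≫ f)
  sq J := x.sq (J ≫ f)
  degen_one J h := x.degen_one (J ≫ f) (congrArg f h)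
  degen k J hk h := x.degen k (J ≫ f) hk fun h' => h (Function.Injective.of_comp h')
  rel k J := x.rel k (J ≫ f)

theorem pull_id {n : SimplexCategory} (x : DGSimplex S R n) : x.pull (𝟙 n) = x := by
  have h : ∀ (k : ℕ) (J : ⦋k⦌ ⟶ n), J ≫ 𝟙 n = J := fun k J => Category.comp_id J
  ext1
  · rfl
  · simp [pull, h]

/-- Base change of simplices of the differential graded nerve. -/
def base (f : R →+* R') {n : SimplexCategory} (x : DGSimplex S R n) : DGSimplex S R' n where
  rank := x.rank
  φ k J := (x.φ k J).map f
  isHom k J := (x.isHom k J).map f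
  sq J := by rw [← mcomp_map, x.sq]; ext; simp
  degen_one J h := by rw [x.degen_one J h, idMat_map]
  degen k J hk h := by rw [x.degen k J hk h]; ext; simp
  rel k J := by
    have := congrArg (fun M => Matrix.map M f) (x.rel k J)
    simp only [← mcomp_map]
    ext a b
    have h2 := congrFun (congrFun this a) b
    simpa [Matrix.sum_apply, Matrix.add_apply, Matrix.smul_apply, map_sum, map_add] using h2

end DGSimplex

/-- The differential graded nerve of the dg-category of bounded complexes of finite-rank free
modules, as a functor of the ring. -/
def dgNerve (S : Set ℤ) : CommRingCat.{0} ⥤ SSet.{0} where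
  obj R :=
    { obj n := DGSimplex S R n.unop
      map f := ↾(DGSimplex.pull f.unop)
      map_id _ := ConcreteCategory.hom_ext _ _ fun x => DGSimplex.pull_id x
      map_comp _ _ := rfl }
  map f :=
    { app _ := ↾(DGSimplex.base f.hom)
      naturality _ _ _ := rfl }
  map_id _ := rfl
  map_comp _ _ := rfl

/-! ### The core of a simplicial set -/

/-- An edge `e : x ⟶ y` of a simplicial set is an equivalence if there are an edge `g : y ⟶ x`
and 2-simplices exhibiting identities as compositions of `e` and `g` in both orders. -/
def IsEquivEdge (X : SSet.{0}) (e : X _⦋1⦌) : Prop :=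
  ∃ (g : X _⦋1⦌) (s t : X _⦋2⦌),
    (X.δ 2 s = e ∧ X.δ 0 s = g ∧ X.δ 1 s = X.σ 0 (X.δ 1 e)) ∧
    (X.δ 2 t = g ∧ X.δ 0 t = e ∧ X.δ 1 t = X.σ 0 (X.δ 0 e))

theorem IsEquivEdge.map {X Y : SSet.{0}} (f : X ⟶ Y) {e : X _⦋1⦌} (h : IsEquivEdge X e) :
    IsEquivEdge Y (f.app _ e) := by
  obtain ⟨g, s, t, ⟨h1, h2, h3⟩, h4, h5, h6⟩ := h
  refine ⟨f.app _ g, f.app _ s, f.app _ t, ⟨?_, ?_, ?_⟩, ?_, ?_, ?_⟩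
  · rw [← SSet.δ_naturality_apply, h1]
  · rw [← SSet.δ_naturality_apply, h2]
  · rw [← SSet.δ_naturality_apply, h3, SSet.σ_naturality_apply, SSet.δ_naturality_apply]
  · rw [← SSet.δ_naturality_apply, h4]
  · rw [← SSet.δ_naturality_apply, h5]
  · rw [← SSet.δ_naturality_apply, h6, SSet.σ_naturality_apply, SSet.δ_naturality_apply]

/-- The core of a simplicial set: the simplices all of whose edges are equivalences. If `X` is a
quasi-category, this is the largest Kan complex contained in `X`. -/
def core (X : SSet.{0}) : SSet.{0} where
  obj n := {x : X.obj n // ∀ f : ⦋1⦌ ⟶ n.unop, IsEquivEdge X (X.map f.op x)}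
  map {n m} g := ↾fun x => ⟨X.map g x.1, fun f => by
    have := x.2 (f ≫ g.unop)
    simpa using this⟩

/-- The core as a functor. -/
def coreFunctor : SSet.{0} ⥤ SSet.{0} where
  obj := core
  map {X Y} f :=
    { app n := ↾fun x => ⟨f.app n x.1, fun g => by
        have := (x.2 g).map f
        rw [← NatTrans.naturality_apply]
        exact this⟩
      naturality n m g := ConcreteCategory.hom_ext _ _ fun x =>
        Subtype.ext (NatTrans.naturality_apply f g (x : (core X).obj n).1) }

/-- The core of the differential graded nerve, `⟦N^dg Free⟧`. -/
def Twist (S : Set ℤ) : CommRingCat.{0} ⥤ SSet.{0} := dgNerve S ⋙ coreFunctor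

/-- The core of the nerve, `⟦N Free⟧`. -/
def coreNerveFree (S : Set ℤ) : CommRingCat.{0} ⥤ SSet.{0} := nerveFree S ⋙ coreFunctor

/-! ### Elementary complexes and elementary morphisms -/

/-- A (presentation of an) elementary complex of free modules: the entry `(m, p)` of the list
stands for the summand `R ^ m ⟶ R ^ m`, an identity map placed in the degrees `p` and `p + 1`. -/
abbrev El : Type := List (ℕ × ℤ)

/-- Index of a basis vector of an elementary complex: the position of the summand in the list, the
lower (`false`) or the upper (`true`) of the two copies of `R ^ m`, and a basis vector of it. -/
abbrev EIx : Type := Σ _ : ℕ, Bool × ℕ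

/-- The standard basis of an elementary complex. -/
def ebasis (el : El) : Finset EIx :=
  (Finset.range el.length).sigma fun j => Finset.univ ×ˢ Finset.range (el.getD j (0, 0)).1

/-- The degree of a basis vector of an elementary complex. -/
def edeg (el : El) (x : EIx) : ℤ := (el.getD x.1 (0, 0)).2 + if x.2.1 then 1 else 0

/-- The identity matrix of an elementary complex. -/
def eid (R : Type) [CommRing R] (el : El) : Matrix EIx EIx R :=
  fun x y => if x = y ∧ y ∈ ebasis el then 1 else 0

/-- The differential of an elementary complex. -/
def ediff (R : Type) [CommRing R] (el : El) : Matrix EIx EIx R :=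
  fun x y => if y ∈ ebasis el ∧ y.2.1 = false ∧ x = ⟨y.1, true, y.2.2⟩ then 1 else 0

/-- The elementary morphism between two elementary complexes (of degree zero): the identity on
the summands with the same position in both lists that agree, and zero on the other ones. -/
def emor (R : Type) [CommRing R] (el el' : El) : Matrix EIx EIx R :=
  fun x y => if x = y ∧ y ∈ ebasis el ∧ el[y.1]? = el'[y.1]? then 1 else 0

/-- Data for a complement: an elementary complex `E`, and the matrices of maps `C' ⟶ C` and
`E ⟶ C`, which are to be the two inclusions of a direct sum decomposition. -/
@[ext]
structure Cmpl (R : Type) where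
  /-- the elementary complement -/
  el : El
  /-- the inclusion of the smaller complex -/
  inc : Matrix Ix Ix R
  /-- the inclusion of the complement -/
  perp : Matrix Ix EIx R

/-- Base change of a complement. -/
def Cmpl.map {R R' : Type} (c : Cmpl R) (f : R → R') : Cmpl R' := ⟨c.el, c.inc.map f, c.perp.map f⟩

/-- `c` is a direct sum decomposition `C' ⊕ E ≅ C` of complexes, where `E` is the elementary
complex of `c`, and `C'` and `C` have ranks `r'`, `r` and differentials `d'`, `d`. -/
structure IsSplitting {S : Set ℤ} {R : Type} [CommRing R] (r' : Rk S) (d' : Matrix Ix Ix R)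
    (r : Rk S) (d : Matrix Ix Ix R) (c : Cmpl R) : Prop where
  isHom : IsHom r' r 0 c.inc
  perp_supp : ∀ x y, c.perp x y ≠ 0 → x ∈ basis r ∧ y ∈ ebasis c.el ∧ x.1 = edeg c.el y
  inc_comm : mcomp (basis r') c.inc d' = mcomp (basis r) d c.inc
  perp_comm : mcomp (ebasis c.el) c.perp (ediff R c.el) = mcomp (basis r) d c.perp
  exists_inverse : ∃ (π : Matrix Ix Ix R) (ϖ : Matrix EIx Ix R),
    IsHom r r' 0 π ∧ (∀ x y, ϖ x y ≠ 0 → x ∈ ebasis c.el ∧ y ∈ basis r ∧ edeg c.el x = y.1) ∧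
    mcomp (basis r) π c.inc = idMat R r' ∧ mcomp (basis r) π c.perp = 0 ∧
    mcomp (basis r) ϖ c.inc = 0 ∧ mcomp (basis r) ϖ c.perp = eid R c.el ∧
    mcomp (basis r') c.inc π + mcomp (ebasis c.el) c.perp ϖ = idMat R r

/-- With respect to the decompositions `c₁ : C₁' ⊕ E₁ ≅ C₁` and `c₀ : C₀' ⊕ E₀ ≅ C₀`, the map
`φ : C₁ ⟶ C₀` is the block matrix with rows `(φ', star)` and `(0, e)`, where `e` is the elementary
morphism `E₁ ⟶ E₀` if the degree `-k` of `φ` is zero, and `e = 0` otherwise. -/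
def IsUpper {S : Set ℤ} {R : Type} [CommRing R] (k : ℕ) (r₁ r₀' : Rk S) (φ φ' : Matrix Ix Ix R)
    (c₁ c₀ : Cmpl R) : Prop :=
  mcomp (basis r₁) φ c₁.inc = mcomp (basis r₀') c₀.inc φ' ∧
  ∃ star : Matrix Ix EIx R,
    mcomp (basis r₁) φ c₁.perp = mcomp (basis r₀') c₀.inc star +
      mcomp (ebasis c₀.el) c₀.perp (if k = 0 then emor R c₁.el c₀.el else 0)

section complementLemmas

variable {S : Set ℤ} {R R' : Type} [CommRing R] [CommRing R']

theorem zero_map {A B : Type} (f : R →+* R') : (0 : Matrix A B R).map f = 0 := by ext; simp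

theorem eid_map (f : R →+* R') (el : El) : (eid R el).map f = eid R' el := by
  ext x y
  simp only [eid, Matrix.map_apply]
  split_ifs <;> simp

theorem ediff_map (f : R →+* R') (el : El) : (ediff R el).map f = ediff R' el := by
  ext x y
  simp only [ediff, Matrix.map_apply]
  split_ifs <;> simp

theorem emor_map (f : R →+* R') (el el' : El) : (emor R el el').map f = emor R' el el' := by
  ext x y
  simp only [emor, Matrix.map_apply]
  split_ifs <;> simp

theorem add_map {A B : Type} (f : R →+* R') (M N : Matrix A B R) :
    (M + N).map f = M.map f + N.map f := by ext; simp

theorem IsSplitting.map (f : R →+* R') {r' : Rk S} {d' : Matrix Ix Ix R} {r : Rk S}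
    {d : Matrix Ix Ix R} {c : Cmpl R} (h : IsSplitting r' d' r d c) :
    IsSplitting r' (d'.map f) r (d.map f) (c.map f) where
  isHom := h.isHom.map f
  perp_supp x y hxy := h.perp_supp x y fun h0 => hxy (by simp [Cmpl.map, h0])
  inc_comm := by
    have := congrArg (fun M => Matrix.map M f) h.inc_comm
    simpa only [Cmpl.map, mcomp_map] using this
  perp_comm := by
    have := congrArg (fun M => Matrix.map M f) h.perp_comm
    simpa only [Cmpl.map, mcomp_map, ediff_map] using this
  exists_inverse := by
    obtain ⟨π, ϖ, h1, h2, h3, h4, h5, h6, h7⟩ := h.exists_inverse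
    refine ⟨π.map f, ϖ.map f, h1.map f, fun x y hxy => h2 x y fun h0 => hxy (by simp [h0]),
      ?_, ?_, ?_, ?_, ?_⟩
    · simpa only [Cmpl.map, mcomp_map, idMat_map] using congrArg (fun M => Matrix.map M f) h3
    · simpa only [Cmpl.map, mcomp_map, zero_map] using congrArg (fun M => Matrix.map M f) h4
    · simpa only [Cmpl.map, mcomp_map, zero_map] using congrArg (fun M => Matrix.map M f) h5
    · simpa only [Cmpl.map, mcomp_map, eid_map] using congrArg (fun M => Matrix.map M f) h6
    · simpa only [Cmpl.map, mcomp_map, add_map, idMat_map] using congrArg (fun M => Matrix.map M f) h7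

theorem IsUpper.map (f : R →+* R') {k : ℕ} {r₁ r₀' : Rk S} {φ φ' : Matrix Ix Ix R}
    {c₁ c₀ : Cmpl R} (h : IsUpper k r₁ r₀' φ φ' c₁ c₀) :
    IsUpper k r₁ r₀' (φ.map f) (φ'.map f) (c₁.map f) (c₀.map f) := by
  obtain ⟨h1, star, h2⟩ := h
  have h1' := congrArg (fun M => Matrix.map M f) h1
  have h2' := congrArg (fun M => Matrix.map M f) h2
  refine ⟨by simpa only [Cmpl.map, mcomp_map] using h1', star.map f, ?_⟩
  simp only [mcomp_map, add_map, apply_ite (fun M : Matrix EIx EIx R => M.map f), emor_map,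
    zero_map] at h2'
  exact h2'

end complementLemmas

/-! ### Labellings by complexes with elementary complements, and the simplicial presheaves -/

/-- The complex at the vertex `i` has this differential. -/
def DGSimplex.d {S : Set ℤ} {R : Type} [CommRing R] {n : SimplexCategory} (x : DGSimplex S R n)
    (i : Fin (n.len + 1)) : Matrix Ix Ix R :=
  x.φ 0 (SimplexCategory.const ⦋0⦌ n i)

/-- A Green-Toledo-Tong labelling of the `n`-simplex over `R`. Every face `s : b ⟶ n` carries a
`b`-simplex of the core of the differential graded nerve; every pair of faces `t ≫ s ⊆ s` and every
vertex `m` of the smaller face carry an elementary complement. Degenerate faces are labelled by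
degenerate data, so that the data amount to their values on nondegenerate faces. -/
@[ext]
structure GTT (S : Set ℤ) (R : CommRingCat.{0}) (n : SimplexCategory) where
  /-- the label of a face -/
  lab : ∀ {b : SimplexCategory}, (b ⟶ n) → ((Twist S).obj R).obj (op b)
  /-- the complement of the face `t ≫ s` in the face `s`, at the vertex `m` -/
  cmpl : ∀ {a b : SimplexCategory}, (a ⟶ b) → (b ⟶ n) → Fin (a.len + 1) → Cmpl R
  split : ∀ {a b : SimplexCategory} (t : a ⟶ b) (s : b ⟶ n) (m : Fin (a.len + 1)),
    IsSplitting ((lab (t ≫ s)).1.rank m) ((lab (t ≫ s)).1.d m)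
      ((lab s).1.rank (t m)) ((lab s).1.d (t m)) (cmpl t s m)
  upper : ∀ {a b : SimplexCategory} (t : a ⟶ b) (s : b ⟶ n) (k : ℕ) (K : ⦋k + 1⦌ ⟶ a),
    IsUpper k ((lab s).1.rank (t (K (Fin.last (k + 1))))) ((lab (t ≫ s)).1.rank (K 0))
      ((lab s).1.φ (k + 1) (K ≫ t)) ((lab (t ≫ s)).1.φ (k + 1) K)
      (cmpl t s (K (Fin.last (k + 1)))) (cmpl t s (K 0))
  /-- the inclusions are coherent -/
  coherent : ∀ {a' a b : SimplexCategory} (t' : a' ⟶ a) (t : a ⟶ b) (s : b ⟶ n)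
    (m : Fin (a'.len + 1)),
    (cmpl (t' ≫ t) s m).inc =
      mcomp (basis ((lab (t ≫ s)).1.rank (t' m))) (cmpl t s (t' m)).inc (cmpl t' (t ≫ s) m).inc
  lab_degen : ∀ {b' b : SimplexCategory} (d : b' ⟶ b) (s : b ⟶ n), Function.Surjective d →
    lab (d ≫ s) = ((Twist S).obj R).map d.op (lab s)
  cmpl_surj : ∀ {a b : SimplexCategory} (t : a ⟶ b) (s : b ⟶ n) (m : Fin (a.len + 1)),
    Function.Surjective t → (cmpl t s m).el = [] ∧
      (cmpl t s m).inc = idMat R ((lab s).1.rank (t m))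
  cmpl_degen_left : ∀ {a' a b : SimplexCategory} (d : a' ⟶ a) (t : a ⟶ b) (s : b ⟶ n)
    (m : Fin (a'.len + 1)), Function.Surjective d → cmpl (d ≫ t) s m = cmpl t s (d m)
  cmpl_degen_right : ∀ {a b' b : SimplexCategory} (t : a ⟶ b') (d : b' ⟶ b) (s : b ⟶ n)
    (m : Fin (a.len + 1)), Function.Surjective d → cmpl (t ≫ d) s m = cmpl t (d ≫ s) m

namespace GTT

variable {S : Set ℤ} {R R' : CommRingCat.{0}}

/-- Faces and degeneracies of labellings. -/
def pull {m n : SimplexCategory} (f : m ⟶ n) (x : GTT S R n) : GTT S R m where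
  lab s := x.lab (s ≫ f)
  cmpl t s j := x.cmpl t (s ≫ f) j
  split t s j := x.split t (s ≫ f) j
  upper t s k K := x.upper t (s ≫ f) k K
  coherent t' t s j := x.coherent t' t (s ≫ f) j
  lab_degen d s hd := x.lab_degen d (s ≫ f) hd
  cmpl_surj t s j ht := x.cmpl_surj t (s ≫ f) j ht
  cmpl_degen_left d t s j hd := x.cmpl_degen_left d t (s ≫ f) j hd
  cmpl_degen_right t d s j hd := x.cmpl_degen_right t d (s ≫ f) j hd

theorem pull_id {n : SimplexCategory} (x : GTT S R n) : x.pull (𝟙 n) = x := by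
  have h : ∀ (b : SimplexCategory) (J : b ⟶ n), J ≫ 𝟙 n = J := fun k J => Category.comp_id J
  ext1
  · funext b s
    simp [pull, h]
  · funext a b t s j
    simp [pull, h]

/-- Base change of labellings. -/
def base (f : R ⟶ R') {n : SimplexCategory} (x : GTT S R n) : GTT S R' n where
  lab s := ((Twist S).map f).app _ (x.lab s)
  cmpl t s j := (x.cmpl t s j).map f.hom
  split t s j := (x.split t s j).map f.hom
  upper t s k K := (x.upper t s k K).map f.hom
  coherent t' t s j := (congrArg (fun M => Matrix.map M f.hom) (x.coherent t' t s j)).trans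
    (mcomp_map _ _ _ _)
  lab_degen d s hd := by
    rw [x.lab_degen d s hd, NatTrans.naturality_apply]
  cmpl_surj t s j ht := ⟨(x.cmpl_surj t s j ht).1,
    (congrArg (fun M => Matrix.map M f.hom) (x.cmpl_surj t s j ht).2).trans (idMat_map _ _)⟩
  cmpl_degen_left d t s j hd := by rw [x.cmpl_degen_left d t s j hd]
  cmpl_degen_right t d s j hd := by rw [x.cmpl_degen_right t d s j hd]

end GTT

/-- The simplicial presheaf of Green-Toledo-Tong labellings, as a functor of the ring. -/
def sTwist (S : Set ℤ) : CommRingCat.{0} ⥤ SSet.{0} where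
  obj R :=
    { obj n := GTT S R n.unop
      map f := ↾(GTT.pull f.unop)
      map_id _ := ConcreteCategory.hom_ext _ _ fun x => GTT.pull_id x
      map_comp _ _ := rfl }
  map f :=
    { app _ := ↾(GTT.base f)
      naturality _ _ _ := rfl }
  map_id _ := rfl
  map_comp _ _ := rfl

/-- A matrix of a degree zero map that is invertible. -/
def IsIsoMat {S : Set ℤ} {R : Type} [CommRing R] (r s : Rk S) (M : Matrix Ix Ix R) : Prop :=
  ∃ N : Matrix Ix Ix R, IsHom s r 0 N ∧
    mcomp (basis s) N M = idMat R r ∧ mcomp (basis r) M N = idMat R s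

theorem IsIsoMat.map {S : Set ℤ} {R R' : Type} [CommRing R] [CommRing R'] (f : R →+* R')
    {r s : Rk S} {M : Matrix Ix Ix R} (h : IsIsoMat r s M) : IsIsoMat r s (M.map f) := by
  obtain ⟨N, h1, h2, h3⟩ := h
  refine ⟨N.map f, h1.map f, ?_, ?_⟩
  · simpa only [Cmpl.map, mcomp_map, idMat_map] using congrArg (fun M => Matrix.map M f) h2
  · simpa only [Cmpl.map, mcomp_map, idMat_map] using congrArg (fun M => Matrix.map M f) h3

/-- The labels lie in `⟦N Free⟧ ⊆ ⟦N^dg Free⟧`: labels of faces of dimension at least two vanish,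
and labels of edges are isomorphisms. -/
def GTT.IsOne {S : Set ℤ} {R : CommRingCat.{0}} {n : SimplexCategory} (x : GTT S R n) : Prop :=
  ∀ {b : SimplexCategory} (s : b ⟶ n),
    (∀ (k : ℕ) (J : ⦋k⦌ ⟶ b), 2 ≤ k → (x.lab s).1.φ k J = 0) ∧
    ∀ J : ⦋1⦌ ⟶ b, IsIsoMat ((x.lab s).1.rank (J 1)) ((x.lab s).1.rank (J 0)) ((x.lab s).1.φ 1 J)

/-- The simplicial presheaf of Green-Toledo-Tong labellings by `⟦N Free⟧`. -/
def Green (S : Set ℤ) : CommRingCat.{0} ⥤ SSet.{0} where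
  obj R :=
    { obj n := {x : GTT S R n.unop // x.IsOne}
      map f := ↾fun x => ⟨x.1.pull f.unop, fun s => x.2 (s ≫ f.unop)⟩
      map_id _ := ConcreteCategory.hom_ext _ _ fun x => Subtype.ext (GTT.pull_id x.1)
      map_comp _ _ := rfl }
  map f :=
    { app _ := ↾fun x => ⟨x.1.base f, fun s =>
        ⟨fun k J hk => (congrArg (fun M => Matrix.map M f.hom) ((x.2 s).1 k J hk)).trans
          (zero_map _), fun J => ((x.2 s).2 J).map f.hom⟩⟩
      naturality _ _ _ := rfl }
  map_id _ := rfl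
  map_comp _ _ := rfl

/-! ### The Čech nerve of an open cover -/

section cech

variable {X : Type} [TopologicalSpace X] {ι : Type}

/-- The components of the `b`-th term of the Čech nerve of the family `U` of open sets: tuples of
indices such that the corresponding open sets have a nonempty intersection. -/
@[ext]
structure CechSimplex (U : ι → Opens X) (b : SimplexCategory) where
  /-- the indices -/
  vertex : Fin (b.len + 1) → ι
  nonempty : (⋂ i, (U (vertex i) : Set X)).Nonempty

namespace CechSimplex

variable {U : ι → Opens X}

/-- The intersection of the members of a tuple. -/
def opens {b : SimplexCategory} (σ : CechSimplex U b) : Opens X :=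
  ⟨⋂ i, (U (σ.vertex i) : Set X), isOpen_iInter_of_finite fun i => (U (σ.vertex i)).isOpen⟩

/-- Reindexing of tuples. -/
def pull {a b : SimplexCategory} (f : a ⟶ b) (σ : CechSimplex U b) : CechSimplex U a where
  vertex i := σ.vertex (f i)
  nonempty := σ.nonempty.mono fun _ hx => Set.mem_iInter.2 fun i => Set.mem_iInter.1 hx (f i)

/-- Reindexing enlarges intersections. -/
def incl {a b : SimplexCategory} (f : a ⟶ b) (σ : CechSimplex U b) :
    σ.opens ⟶ (σ.pull f).opens :=
  homOfLE fun _ hx => Set.mem_iInter.2 fun i => Set.mem_iInter.1 hx (f i)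

theorem pull_id {b : SimplexCategory} (σ : CechSimplex U b) : σ.pull (𝟙 b) = σ := rfl

/-- The intersection of the members of a tuple is contained in each of these members. -/
def toVertex {b : SimplexCategory} (σ : CechSimplex U b) (i : Fin (b.len + 1)) :
    σ.opens ⟶ U (σ.vertex i) :=
  homOfLE fun _ hx => Set.mem_iInter.1 hx i

end CechSimplex

/-- The product over the components of the `b`-th term of the Čech nerve of the values of a
simplicial presheaf. -/
def cechTerm (F : (Opens X)ᵒᵖ ⥤ SSet.{0}) (U : ι → Opens X) (b : SimplexCategory) : SSet.{0} where
  obj n := ∀ σ : CechSimplex U b, (F.obj (op σ.opens)).obj n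
  map g := ↾fun x σ => (F.obj (op σ.opens)).map g (x σ)
  map_id n := ConcreteCategory.hom_ext _ _ fun x => funext fun σ => by simp
  map_comp f g := ConcreteCategory.hom_ext _ _ fun x => funext fun σ => by simp

theorem cechTerm_hom_ext {F : (Opens X)ᵒᵖ ⥤ SSet.{0}} {U : ι → Opens X} {K : SSet.{0}}
    {b : SimplexCategory} {f g : K ⟶ cechTerm F U b}
    (h : ∀ (n : SimplexCategoryᵒᵖ) (x : K.obj n) (σ : CechSimplex U b),
      (f.app n x : (cechTerm F U b).obj n) σ = (g.app n x : (cechTerm F U b).obj n) σ) : f = g :=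
  NatTrans.ext (funext fun n => ConcreteCategory.hom_ext _ _ fun x => funext fun σ => h n x σ)

/-- Cosimplicial structure maps of the value on the Čech nerve. -/
def cechMap (F : (Opens X)ᵒᵖ ⥤ SSet.{0}) (U : ι → Opens X) {a b : SimplexCategory} (f : a ⟶ b) :
    cechTerm F U a ⟶ cechTerm F U b where
  app n := ↾fun (x : (cechTerm F U a).obj n) (σ : CechSimplex U b) =>
    (F.map (σ.incl f).op).app n (x (σ.pull f))
  naturality n _ g := ConcreteCategory.hom_ext _ _ fun x => funext fun (σ : CechSimplex U b) =>
    NatTrans.naturality_apply (F.map (σ.incl f).op) g ((x : (cechTerm F U a).obj n) (σ.pull f))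

/-- The value of a simplicial presheaf `F` on the Čech nerve of `U`. The terms of the Čech nerve are
disjoint unions, which are turned into products. -/
def cechEval (F : (Opens X)ᵒᵖ ⥤ SSet.{0}) (U : ι → Opens X) : SimplexCategory ⥤ SSet.{0} where
  obj b := cechTerm F U b
  map f := cechMap F U f
  map_id _ := cechTerm_hom_ext fun n x σ =>
    congrArg (fun g : F.obj (op σ.opens) ⟶ F.obj (op σ.opens) => g.app n (x σ))
      (F.map_id (op σ.opens))
  map_comp f g := cechTerm_hom_ext fun n x σ =>
    congrArg (fun h : F.obj (op ((σ.pull g).pull f).opens) ⟶ F.obj (op σ.opens) =>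
      h.app n (x ((σ.pull g).pull f))) (F.map_comp ((σ.pull g).incl f).op (σ.incl g).op)

end cech

/-! ### Totalisation -/

/-- The standard simplices, as a cosimplicial simplicial set. -/
abbrev stdCosimplicial : SimplexCategory ⥤ SSet.{0} := SSet.stdSimplex

/-- The cosimplicial simplicial sets `Δ[⋆] × Δ[n]`, functorially in `n`. -/
def stdProd : SimplexCategory ⥤ (SimplexCategory ⥤ SSet.{0}) :=
  stdCosimplicial ⋙ MonoidalCategory.tensoringRight SSet.{0} ⋙
    (Functor.whiskeringLeft SimplexCategory SSet.{0} SSet.{0}).obj stdCosimplicial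

/-- The totalisation of a cosimplicial simplicial set: its `n`-simplices are the morphisms of
cosimplicial simplicial sets from `Δ[⋆] × Δ[n]`. -/
def Tot (Y : SimplexCategory ⥤ SSet.{0}) : SSet.{0} := stdProd.op ⋙ yoneda.obj Y

section component

variable {X : Type} [TopologicalSpace X] {ι : Type}

/-- The set of vertices of the Čech totalisation of the simplicial presheaf `V ↦ F (O V)`. -/
abbrev TotZero (O : (Opens X)ᵒᵖ ⥤ CommRingCat.{0}) (F : CommRingCat.{0} ⥤ SSet.{0})
    (U : ι → Opens X) : Type :=
  (Tot (cechEval (O ⋙ F) U)).obj (op ⦋0⦌)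

/-- The component of a vertex of the Čech totalisation at a tuple `σ`: the value of
`Δ[b] × Δ[0] ⟶ F (O U_σ)` at the tautological `b`-simplex. -/
def TotZero.comp {O : (Opens X)ᵒᵖ ⥤ CommRingCat.{0}} {F : CommRingCat.{0} ⥤ SSet.{0}}
    {U : ι → Opens X} (v : TotZero O F U) {b : SimplexCategory} (σ : CechSimplex U b) :
    (F.obj (O.obj (op σ.opens))).obj (op b) :=
  let w : stdProd.obj ⦋0⦌ ⟶ cechEval (O ⋙ F) U := v
  let y : (cechTerm (O ⋙ F) U b).obj (op b) := (NatTrans.app (NatTrans.app w b) (op b))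
    (SSet.stdSimplex.objEquiv.symm (𝟙 b), SSet.stdSimplex.objEquiv.symm
      (SimplexCategory.const b ⦋0⦌ 0))
  y σ

end component

/-! ### Twisting cochains -/

section twisting

variable {X : Type} [TopologicalSpace X] {ι : Type}

/-- The restriction of a matrix of functions along an inclusion of open sets. -/
def resMat (O : (Opens X)ᵒᵖ ⥤ CommRingCat.{0}) {A B : Type} {V W : Opens X} (h : V ⟶ W)
    (M : Matrix A B (O.obj (op W))) : Matrix A B (O.obj (op V)) :=
  M.map (O.map h.op).hom

/-- The alternating sum of the components of `A` on the inner faces of the `K`-simplex: the deleted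
Čech differential. -/
def cechDelta {R : Type} [CommRing R] (K : ℕ) (A : ∀ m : ℕ, (⦋m⦌ ⟶ ⦋K⦌) → Matrix Ix Ix R) :
    Matrix Ix Ix R :=
  match K, A with
  | 0, _ => 0
  | k + 1, A => ∑ i : Fin k, (-1 : ℤ) ^ ((i : ℕ) + 1) • A k (SimplexCategory.δ i.succ.castSucc)

/-- The product `A · A` in bidegree `(K, 2 - K)`, with the usual sign: the product of components of
bidegrees `(p, q)` and `(r, s)` carries the sign `(-1) ^ (q * r)`. -/
def cechSquare {S : Set ℤ} {R : Type} [CommRing R] (K : ℕ) (r : Fin (K + 1) → Rk S)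
    (A : ∀ m : ℕ, (⦋m⦌ ⟶ ⦋K⦌) → Matrix Ix Ix R) : Matrix Ix Ix R :=
  ∑ j : Fin (K + 1), (-1 : ℤ) ^ (((j : ℕ) + 1) * (K - j)) • mcomp (basis (r j))
    (A j (SimplexCategory.subinterval 0 j (by omega)))
    (A (K - j) (SimplexCategory.subinterval j (K - j) (by omega)))

/-- A twisting cochain on the family `U`: graded free modules `E_α` on the `U α`, and elements
`a = ∑ a^{k, 1 - k}` where the component of `a^{k, 1 - k}` at a tuple `(α₀, …, α_k)` is a
homomorphism `E_{α_k} ⟶ E_{α₀}` of degree `1 - k` over the intersection, such that the Maurer-Cartan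
equation `δ a + a · a = 0` holds and such that `a` is normalised: the `(α, α)` component is the
identity, and the higher components vanish on degenerate tuples. -/
@[ext]
structure TwistingCochain (O : (Opens X)ᵒᵖ ⥤ CommRingCat.{0}) (S : Set ℤ) (U : ι → Opens X) where
  /-- the ranks of the graded modules -/
  rank : ι → Rk S
  /-- the components of the cochain -/
  a : ∀ (k : ℕ) (σ : CechSimplex U ⦋k⦌), Matrix Ix Ix (O.obj (op σ.opens))
  isHom : ∀ (k : ℕ) (σ : CechSimplex U ⦋k⦌),
    IsHom (rank (σ.vertex (Fin.last k))) (rank (σ.vertex 0)) (1 - k) (a k σ)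
  maurerCartan : ∀ (K : ℕ) (σ : CechSimplex U ⦋K⦌),
    cechDelta K (fun m f => resMat O (σ.incl f) (a m (σ.pull f))) +
      cechSquare K (fun i => rank (σ.vertex i))
        (fun m f => resMat O (σ.incl f) (a m (σ.pull f))) = 0
  norm_one : ∀ σ : CechSimplex U ⦋1⦌, σ.vertex 0 = σ.vertex 1 →
    a 1 σ = idMat _ (rank (σ.vertex 0))
  norm : ∀ (k : ℕ) (σ : CechSimplex U ⦋k⦌), 2 ≤ k →
    (∃ i : Fin k, σ.vertex i.castSucc = σ.vertex i.succ) → a k σ = 0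

/-- The labels of the vertex `v` of the totalisation are the components of the twisting cochain. -/
def TwistingCochain.IsDataOf {O : (Opens X)ᵒᵖ ⥤ CommRingCat.{0}} {S : Set ℤ} {U : ι → Opens X}
    (A : TwistingCochain O S U) (v : TotZero O (Twist S) U) : Prop :=
  ∀ {b : SimplexCategory} (σ : CechSimplex U b),
    (∀ i, (v.comp σ).1.rank i = A.rank (σ.vertex i)) ∧
    ∀ (k : ℕ) (J : ⦋k⦌ ⟶ b), (v.comp σ).1.φ k J = resMat O (σ.incl J) (A.a k (σ.pull J))

/-- A simplicial twisting cochain on the family `U`: for every tuple `σ`, graded free modules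
`E_{σ, i}` on `U_σ` for the members `i` of `σ`, and a twisting cochain `a σ` for these on the cover
of `U_σ` that consists of copies of `U_σ`, one for every member of `σ`; for every pair `τ ⊆ σ`,
where `τ` is given by a monotone map `t`, and every member `m` of `τ`, an elementary complex
`E_{σ, τ, m}` and a direct sum decomposition `E_{σ, t m} ≅ E_{τ, m} ⊕ E_{σ, τ, m}` over `U_σ`; with
respect to these, `a σ` is upper triangular, with `a τ` and the elementary morphisms on the
diagonal. The inclusions are coherent, and the data on degenerate tuples are degenerate. -/
@[ext]
structure SimplicialTwistingCochain (O : (Opens X)ᵒᵖ ⥤ CommRingCat.{0}) (S : Set ℤ)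
    (U : ι → Opens X) where
  /-- the ranks of the graded modules -/
  rank : ∀ {b : SimplexCategory}, CechSimplex U b → Fin (b.len + 1) → Rk S
  /-- the components of the twisting cochains `a σ` -/
  a : ∀ {b : SimplexCategory} (σ : CechSimplex U b) (k : ℕ),
    (⦋k⦌ ⟶ b) → Matrix Ix Ix (O.obj (op σ.opens))
  /-- the complements -/
  cmpl : ∀ {c b : SimplexCategory} (_ : c ⟶ b) (σ : CechSimplex U b), Fin (c.len + 1) →
    Cmpl (O.obj (op σ.opens))
  isHom : ∀ {b : SimplexCategory} (σ : CechSimplex U b) (k : ℕ) (J : ⦋k⦌ ⟶ b),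
    IsHom (rank σ (J (Fin.last k))) (rank σ (J 0)) (1 - k) (a σ k J)
  maurerCartan : ∀ {b : SimplexCategory} (σ : CechSimplex U b) (K : ℕ) (J : ⦋K⦌ ⟶ b),
    cechDelta K (fun m f => a σ m (f ≫ J)) +
      cechSquare K (fun i => rank σ (J i)) (fun m f => a σ m (f ≫ J)) = 0
  norm_one : ∀ {b : SimplexCategory} (σ : CechSimplex U b) (J : ⦋1⦌ ⟶ b), J 0 = J 1 →
    a σ 1 J = idMat _ (rank σ (J 0))
  norm : ∀ {b : SimplexCategory} (σ : CechSimplex U b) (k : ℕ) (J : ⦋k⦌ ⟶ b), 2 ≤ k →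
    ¬ Function.Injective J → a σ k J = 0
  split : ∀ {c b : SimplexCategory} (t : c ⟶ b) (σ : CechSimplex U b) (m : Fin (c.len + 1)),
    IsSplitting (rank (σ.pull t) m)
      (resMat O (σ.incl t) (a (σ.pull t) 0 (SimplexCategory.const ⦋0⦌ c m)))
      (rank σ (t m)) (a σ 0 (SimplexCategory.const ⦋0⦌ b (t m))) (cmpl t σ m)
  upper : ∀ {c b : SimplexCategory} (t : c ⟶ b) (σ : CechSimplex U b) (k : ℕ) (K : ⦋k + 1⦌ ⟶ c),
    IsUpper k (rank σ (t (K (Fin.last (k + 1))))) (rank (σ.pull t) (K 0))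
      (a σ (k + 1) (K ≫ t)) (resMat O (σ.incl t) (a (σ.pull t) (k + 1) K))
      (cmpl t σ (K (Fin.last (k + 1)))) (cmpl t σ (K 0))
  coherent : ∀ {c' c b : SimplexCategory} (t' : c' ⟶ c) (t : c ⟶ b) (σ : CechSimplex U b)
    (m : Fin (c'.len + 1)),
    (cmpl (t' ≫ t) σ m).inc =
      mcomp (basis (rank (σ.pull t) (t' m))) (cmpl t σ (t' m)).inc
        (resMat O (σ.incl t) (cmpl t' (σ.pull t) m).inc)
  rank_degen : ∀ {b' b : SimplexCategory} (d : b' ⟶ b) (σ : CechSimplex U b)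
    (i : Fin (b'.len + 1)), Function.Surjective d → rank (σ.pull d) i = rank σ (d i)
  a_degen : ∀ {b' b : SimplexCategory} (d : b' ⟶ b) (σ : CechSimplex U b) (k : ℕ) (J : ⦋k⦌ ⟶ b'),
    Function.Surjective d → resMat O (σ.incl d) (a (σ.pull d) k J) = a σ k (J ≫ d)
  cmpl_surj : ∀ {c b : SimplexCategory} (t : c ⟶ b) (σ : CechSimplex U b) (m : Fin (c.len + 1)),
    Function.Surjective t → (cmpl t σ m).el = [] ∧ (cmpl t σ m).inc = idMat _ (rank σ (t m))
  cmpl_degen_left : ∀ {c' c b : SimplexCategory} (d : c' ⟶ c) (t : c ⟶ b) (σ : CechSimplex U b)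
    (m : Fin (c'.len + 1)), Function.Surjective d → cmpl (d ≫ t) σ m = cmpl t σ (d m)
  cmpl_degen_right : ∀ {c b' b : SimplexCategory} (t : c ⟶ b') (d : b' ⟶ b) (σ : CechSimplex U b)
    (m : Fin (c.len + 1)), Function.Surjective d →
    cmpl (t ≫ d) σ m = (cmpl t (σ.pull d) m).map (O.map (σ.incl d).op).hom

/-- The labels of the vertex `v` of the totalisation are the components of the simplicial twisting
cochain. -/
def SimplicialTwistingCochain.IsDataOf {O : (Opens X)ᵒᵖ ⥤ CommRingCat.{0}} {S : Set ℤ}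
    {U : ι → Opens X} (A : SimplicialTwistingCochain O S U) (v : TotZero O (sTwist S) U) : Prop :=
  ∀ {b : SimplexCategory} (σ : CechSimplex U b),
    (∀ i, ((v.comp σ).lab (𝟙 b)).1.rank i = A.rank σ i) ∧
    (∀ (k : ℕ) (J : ⦋k⦌ ⟶ b), ((v.comp σ).lab (𝟙 b)).1.φ k J = A.a σ k J) ∧
    ∀ {c : SimplexCategory} (t : c ⟶ b) (m : Fin (c.len + 1)),
      (v.comp σ).cmpl t (𝟙 b) m = A.cmpl t σ m

end twisting

/-! ### Green complexes -/

section green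

/-- `e` is an ordered basis of length `r` of the module `M`, extended by zero. -/
def IsFrame (R : Type) {M : Type} [CommRing R] [AddCommGroup M] [Module R M] (r : ℕ) (e : ℕ → M) :
    Prop :=
  (∀ x, r ≤ x → e x = 0) ∧ Function.Bijective fun c : Fin r → R => ∑ x : Fin r, c x • e x

variable {X : Type} [TopologicalSpace X] {ι : Type}

/-- A Green complex on the family `U`. To every tuple `σ` it associates a complex `E σ` of free
modules over the ring `O (U_σ)`, with a frame for each member of `σ`; to every inclusion `τ ⊆ σ` of
tuples, where `τ` is given by a monotone map `t`, a map of complexes `E τ ⟶ E σ` over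
`O (U_τ) ⟶ O (U_σ)`, functorially: this is a complex of simplicial vector bundles. Moreover, for
every member `m` of `τ`, it contains the choice of an elementary subcomplex of `E σ` that is
complementary to the extension of `E τ`; the subcomplexes for two members of `τ` correspond to each
other under the elementary morphism modulo `E τ`. The data on degenerate tuples are degenerate. -/
structure GreenComplex (O : (Opens X)ᵒᵖ ⥤ CommRingCat.{0}) (S : Set ℤ) (U : ι → Opens X) where
  /-- the complex of modules of sections -/
  E : ∀ {b : SimplexCategory} (σ : CechSimplex U b),
    CochainComplex (ModuleCat.{0} (O.obj (op σ.opens))) ℤ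
  /-- the ranks -/
  rank : ∀ {b : SimplexCategory}, CechSimplex U b → Fin (b.len + 1) → Rk S
  /-- the frames -/
  frame : ∀ {b : SimplexCategory} (σ : CechSimplex U b) (_ : Fin (b.len + 1)) (n : ℤ),
    ℕ → (E σ).X n
  isFrame : ∀ {b : SimplexCategory} (σ : CechSimplex U b) (i : Fin (b.len + 1)) (n : ℤ),
    IsFrame (O.obj (op σ.opens)) ((rank σ i).1 n) (frame σ i n)
  /-- the maps of complexes -/
  tr : ∀ {c b : SimplexCategory} (t : c ⟶ b) (σ : CechSimplex U b) (n : ℤ),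
    (E (σ.pull t)).X n →ₛₗ[(O.map (σ.incl t).op).hom] (E σ).X n
  tr_d : ∀ {c b : SimplexCategory} (t : c ⟶ b) (σ : CechSimplex U b) (n : ℤ)
    (z : (E (σ.pull t)).X n), tr t σ (n + 1) ((E (σ.pull t)).d n (n + 1) z) =
      (E σ).d n (n + 1) (tr t σ n z)
  tr_comp : ∀ {c' c b : SimplexCategory} (t' : c' ⟶ c) (t : c ⟶ b) (σ : CechSimplex U b) (n : ℤ)
    (z : (E (σ.pull (t' ≫ t))).X n), tr (t' ≫ t) σ n z = tr t σ n (tr t' (σ.pull t) n z)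
  /-- the elementary complements -/
  el : ∀ {c b : SimplexCategory}, (c ⟶ b) → CechSimplex U b → Fin (c.len + 1) → El
  /-- the basis vectors of the elementary complements -/
  evec : ∀ {c b : SimplexCategory} (_ : c ⟶ b) (σ : CechSimplex U b) (_ : Fin (c.len + 1)) (n : ℤ),
    EIx → (E σ).X n
  evec_supp : ∀ {c b : SimplexCategory} (t : c ⟶ b) (σ : CechSimplex U b) (m : Fin (c.len + 1))
    (n : ℤ) (y : EIx), evec t σ m n y ≠ 0 → y ∈ ebasis (el t σ m) ∧ edeg (el t σ m) y = n
  evec_d_lower : ∀ {c b : SimplexCategory} (t : c ⟶ b) (σ : CechSimplex U b) (m : Fin (c.len + 1))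
    (n : ℤ) (j a : ℕ),
    (E σ).d n (n + 1) (evec t σ m n ⟨j, false, a⟩) = evec t σ m (n + 1) ⟨j, true, a⟩
  evec_d_upper : ∀ {c b : SimplexCategory} (t : c ⟶ b) (σ : CechSimplex U b) (m : Fin (c.len + 1))
    (n : ℤ) (j a : ℕ), (E σ).d n (n + 1) (evec t σ m n ⟨j, true, a⟩) = 0
  decomposition : ∀ {c b : SimplexCategory} (t : c ⟶ b) (σ : CechSimplex U b)
    (m : Fin (c.len + 1)) (n : ℤ), Function.Bijective fun
      z : (Fin ((rank (σ.pull t) m).1 n) → O.obj (op σ.opens)) ×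
        ({y // y ∈ (ebasis (el t σ m)).filter fun y => edeg (el t σ m) y = n} →
          O.obj (op σ.opens)) =>
      ∑ x, z.1 x • tr t σ n (frame (σ.pull t) m n x) + ∑ y, z.2 y • evec t σ m n y.1
  elementary : ∀ {c b : SimplexCategory} (t : c ⟶ b) (σ : CechSimplex U b) (m m' : Fin (c.len + 1))
    (n : ℤ) (y : EIx), m ≤ m' →
    evec t σ m' n y -
        (if (el t σ m')[y.1]? = (el t σ m)[y.1]? then evec t σ m n y else 0) ∈
      Submodule.span (O.obj (op σ.opens)) (Set.range (tr t σ n))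
  el_surj : ∀ {c b : SimplexCategory} (t : c ⟶ b) (σ : CechSimplex U b) (m : Fin (c.len + 1)),
    Function.Surjective t → el t σ m = []
  rank_surj : ∀ {c b : SimplexCategory} (t : c ⟶ b) (σ : CechSimplex U b) (m : Fin (c.len + 1)),
    Function.Surjective t → rank (σ.pull t) m = rank σ (t m)
  frame_surj : ∀ {c b : SimplexCategory} (t : c ⟶ b) (σ : CechSimplex U b) (m : Fin (c.len + 1))
    (n : ℤ) (x : ℕ), Function.Surjective t →
    tr t σ n (frame (σ.pull t) m n x) = frame σ (t m) n x
  degen_left : ∀ {c' c b : SimplexCategory} (d : c' ⟶ c) (t : c ⟶ b) (σ : CechSimplex U b)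
    (m : Fin (c'.len + 1)), Function.Surjective d →
    el (d ≫ t) σ m = el t σ (d m) ∧ ∀ n y, evec (d ≫ t) σ m n y = evec t σ (d m) n y
  degen_right : ∀ {c b' b : SimplexCategory} (t : c ⟶ b') (d : b' ⟶ b) (σ : CechSimplex U b)
    (m : Fin (c.len + 1)), Function.Surjective d →
    el (t ≫ d) σ m = el t (σ.pull d) m ∧
      ∀ n y, evec (t ≫ d) σ m n y = tr d σ n (evec t (σ.pull d) m n y)

namespace GreenComplex

variable {O : (Opens X)ᵒᵖ ⥤ CommRingCat.{0}} {S : Set ℤ} {U : ι → Opens X}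

/-- Two Green complexes are isomorphic if there are isomorphisms between their complexes that are
compatible with all the data. -/
def Iso (G G' : GreenComplex O S U) : Prop :=
  (∀ {b : SimplexCategory} (σ : CechSimplex U b), G.rank σ = G'.rank σ) ∧
  (∀ {c b : SimplexCategory} (t : c ⟶ b) (σ : CechSimplex U b), G.el t σ = G'.el t σ) ∧
  ∃ f : ∀ {b : SimplexCategory} (σ : CechSimplex U b), G.E σ ≅ G'.E σ,
    (∀ {b : SimplexCategory} (σ : CechSimplex U b) (i : Fin (b.len + 1)) (n : ℤ) (x : ℕ),
      (f σ).hom.f n (G.frame σ i n x) = G'.frame σ i n x) ∧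
    (∀ {c b : SimplexCategory} (t : c ⟶ b) (σ : CechSimplex U b) (n : ℤ)
      (z : (G.E (σ.pull t)).X n),
      (f σ).hom.f n (G.tr t σ n z) = G'.tr t σ n ((f (σ.pull t)).hom.f n z)) ∧
    ∀ {c b : SimplexCategory} (t : c ⟶ b) (σ : CechSimplex U b) (m : Fin (c.len + 1)) (n : ℤ)
      (y : EIx), (f σ).hom.f n (G.evec t σ m n y) = G'.evec t σ m n y

/-- The vertex `v` of the totalisation consists of the matrices of the Green complex `G` in its
frames: the component of `v` at `σ` contains the matrices of the differential of `E σ`, the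
matrices of change of frame, and the matrices that express, in the frames of `E σ`, the image of the
frames of `E τ` and the basis vectors of the elementary complements. -/
def IsMatrixOf (G : GreenComplex O S U) (v : TotZero O (Green S) U) : Prop :=
  ∀ {b : SimplexCategory} (σ : CechSimplex U b),
    (∀ i, ((v.comp σ).1.lab (𝟙 b)).1.rank i = G.rank σ i) ∧
    (∀ (i : Fin (b.len + 1)) (n : ℤ) (y : ℕ),
      (G.E σ).d n (n + 1) (G.frame σ i n y) =
        ∑ x ∈ Finset.range ((G.rank σ i).1 (n + 1)),
          ((v.comp σ).1.lab (𝟙 b)).1.d i ⟨n + 1, x⟩ ⟨n, y⟩ • G.frame σ i (n + 1) x) ∧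
    (∀ (J : ⦋1⦌ ⟶ b) (n : ℤ) (y : ℕ),
      G.frame σ (J 1) n y = ∑ x ∈ Finset.range ((G.rank σ (J 0)).1 n),
        ((v.comp σ).1.lab (𝟙 b)).1.φ 1 J ⟨n, x⟩ ⟨n, y⟩ • G.frame σ (J 0) n x) ∧
    ∀ {c : SimplexCategory} (t : c ⟶ b) (m : Fin (c.len + 1)),
      ((v.comp σ).1.cmpl t (𝟙 b) m).el = G.el t σ m ∧
      (∀ (n : ℤ) (y : ℕ), G.tr t σ n (G.frame (σ.pull t) m n y) =
        ∑ x ∈ Finset.range ((G.rank σ (t m)).1 n),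
          ((v.comp σ).1.cmpl t (𝟙 b) m).inc ⟨n, x⟩ ⟨n, y⟩ • G.frame σ (t m) n x) ∧
      ∀ (n : ℤ) (y : EIx), G.evec t σ m n y =
        ∑ x ∈ Finset.range ((G.rank σ (t m)).1 n),
          ((v.comp σ).1.cmpl t (𝟙 b) m).perp ⟨n, x⟩ y • G.frame σ (t m) n x

end GreenComplex

end green

/-! ### Complexes of locally free sheaves -/

section locallyFree

variable {X : TopCat.{0}}

/-- The sheaf of rings underlying a sheaf of commutative rings. -/
abbrev ringSheaf (O : TopCat.Sheaf CommRingCat.{0} X) : TopCat.Sheaf RingCat.{0} X :=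
  (sheafCompose _ (forget₂ CommRingCat RingCat.{0})).obj O

instance (O : TopCat.Sheaf CommRingCat.{0} X) (M : SheafOfModules.{0} (ringSheaf O))
    (V : (Opens X)ᵒᵖ) : Module (O.obj.obj V) (M.val.obj V) :=
  (M.val.obj V).isModule

/-- A bounded complex of sheaves of `O`-modules in degrees `S` that are free of finite rank on every
member of the open cover `U`, where frames on the members of the cover are chosen. -/
structure LocallyFreeComplex (O : TopCat.Sheaf CommRingCat.{0} X) (S : Set ℤ) {ι : Type}
    (U : ι → Opens X) where
  /-- the complex of sheaves -/
  E : CochainComplex (SheafOfModules.{0} (ringSheaf O)) ℤ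
  bounded : ∃ F : Finset ℤ, ∀ n, n ∉ F → Limits.IsZero (E.X n)
  /-- the ranks -/
  rank : ι → Rk S
  /-- the frames -/
  frame : ∀ (α : ι) (n : ℤ), ℕ → (E.X n).val.obj (op (U α))
  isFrame : ∀ (α : ι) (n : ℤ) (V : Opens X) (h : V ⟶ U α),
    IsFrame (M := (E.X n).val.obj (op V)) (O.obj.obj (op V)) ((rank α).1 n)
      fun x => (E.X n).val.map h.op (frame α n x)

namespace LocallyFreeComplex

variable {O : TopCat.Sheaf CommRingCat.{0} X} {S : Set ℤ} {ι : Type} {U : ι → Opens X}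

/-- Two complexes of locally free sheaves with frames are isomorphic if there is an isomorphism of
complexes of sheaves that maps the frames to the frames. -/
def Iso (G G' : LocallyFreeComplex O S U) : Prop :=
  G.rank = G'.rank ∧ ∃ f : G.E ≅ G'.E, ∀ (α : ι) (n : ℤ) (x : ℕ),
    (f.hom.f n).val.app (op (U α)) (G.frame α n x) = G'.frame α n x

/-- The frame on the `i`-th member of a tuple, restricted to the intersection of the tuple. -/
def resFrame (G : LocallyFreeComplex O S U) {b : SimplexCategory} (σ : CechSimplex U b)
    (i : Fin (b.len + 1)) (n : ℤ) (x : ℕ) : (G.E.X n).val.obj (op σ.opens) :=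
  (G.E.X n).val.map (σ.toVertex i).op (G.frame (σ.vertex i) n x)

/-- The vertex `v` of the totalisation consists of the matrices of the complex of sheaves in its
frames: the component of `v` at `σ` contains the matrices of the differential, and the matrices of
change of frame. -/
def IsMatrixOf (G : LocallyFreeComplex O S U) (v : TotZero O.obj (coreNerveFree S) U) : Prop :=
  ∀ {b : SimplexCategory} (σ : CechSimplex U b),
    (∀ i, ((v.comp σ).1.obj i).unop.rank = G.rank (σ.vertex i)) ∧
    (∀ (i : Fin (b.len + 1)) (n : ℤ) (y : ℕ),
      (G.E.d n (n + 1)).val.app (op σ.opens) (G.resFrame σ i n y) =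
        ∑ x ∈ Finset.range ((G.rank (σ.vertex i)).1 (n + 1)),
          ((v.comp σ).1.obj i).unop.d ⟨n + 1, x⟩ ⟨n, y⟩ • G.resFrame σ i (n + 1) x) ∧
    ∀ (i j : Fin (b.len + 1)) (h : i ≤ j) (n : ℤ) (y : ℕ),
      G.resFrame σ j n y = ∑ x ∈ Finset.range ((G.rank (σ.vertex i)).1 n),
        ChainMap.mat ((v.comp σ).1.map (homOfLE h)).unop ⟨n, x⟩ ⟨n, y⟩ • G.resFrame σ i n x

end LocallyFreeComplex

end locallyFree

/-! ### Complex manifolds and Stein covers -/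

section manifold

variable (E : Type) [NormedAddCommGroup E] [NormedSpace ℂ E]

/-- The sheaf of holomorphic functions (smooth over `ℂ`) on a complex manifold. -/
abbrev holSheaf (X : Type) [TopologicalSpace X] [ChartedSpace E X] :
    TopCat.Sheaf CommRingCat.{0} (TopCat.of X) :=
  smoothSheafCommRing 𝓘(ℂ, E) 𝓘(ℂ) X ℂ

variable {X : Type} [TopologicalSpace X] [ChartedSpace E X]

/-- The holomorphically convex hull of a subset of an open set. -/
def holHull (V : Opens X) (K : Set V) : Set V :=
  {x | ∀ (f : (holSheaf E X).obj.obj (op V)) (c : ℝ),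
    (∀ y ∈ K, norm (f.1 y : ℂ) ≤ c) → norm (f.1 x : ℂ) ≤ c}

/-- An open subset of a complex manifold is Stein if it is holomorphically convex and holomorphic
functions on it separate points. -/
def IsStein (V : Opens X) : Prop :=
  (∀ K : Set V, IsCompact K → IsCompact (holHull E V K)) ∧
  ∀ x y : V, x ≠ y → ∃ f : (holSheaf E X).obj.obj (op V), (f.1 x : ℂ) ≠ (f.1 y : ℂ)

/-- A Stein cover: an open cover by nonempty Stein open subsets. -/
structure IsSteinCover {ι : Type} (U : ι → Opens X) : Prop where
  covers : ∀ x : X, ∃ α, x ∈ U α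
  nonempty : ∀ α, (U α : Set X).Nonempty
  stein : ∀ α, IsStein E (U α)

end manifold

end CechTot

end

/-! By the Yoneda lemma for `Δ[b]`, a point of Tot^0 is a family of simplices `x σ` in
`F(O(U_σ))_b`, one for each tuple, such that for every monotone `f` the restriction of `x (f^*σ)` to
`U_σ` equals `f^* (x σ)` (`TotZero.comp_compat`, `TotZero.ofCompat`, `TotZero.ext`). Each of the
four bijections unpacks such families, and each has one point that is not formal.

Twisting cochains. The label of `x σ` on a face `J` is the restriction of the top label of the tuple
`J^*σ`, so one cochain carries all the data. The relation in the dg-nerve is the Maurer-Cartan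
equation with its terms sorted differently (`maurerCartan_succ_iff`). Normalisation comes from
repeated indices: a reindexing that collapses two equal neighbours fixes the tuple, so the simplex
is degenerate. Conversely, the edges built from a cochain must be equivalences; since tuples may be
written in any order, `(α, β, α)` and `(β, α, β)` supply the required triangles
(`isEquivEdge_of_indiscrete`).

Simplicial twisting cochains. Compatibility determines a labelling by its full simplices and the
pairs containing them. The core condition is subtler here, as longer tuples carry larger complexes.
Inclusions with elementary complement are homotopy equivalences, because elementary complexes are
contractible (`IsSplitting.isHtpyEquiv_incl`). In the tuple `(α, β, α, β)` the edges 02 and 13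
reduce along such inclusions to edges of the degenerate tuples `(α, α)` and `(β, β)`, which are
identities. The triangles 012 and 123 and the two-out-of-six property then make the edge 01 a
homotopy equivalence, and the statement descends to the tuple `(α, β)` (`isHtpyEquiv_edge`).
Finally, homotopy equivalences are equivalences in the dg-nerve (`isEquivEdge_of_isHtpyEquiv`).

Green complexes. These are the simplicial twisting cochains with vanishing higher labels and
invertible edges, rewritten without coordinates. Matrices of a Green complex satisfy the axioms
because vectors can be compared in a basis. Conversely, modules of columns in the frame of the first
member, with change-of-frame matrices as the other frames, give a Green complex with prescribed
matrices (`toGreen`). Equal matrices mean isomorphic Green complexes.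

Complexes of sheaves. A compatible family amounts to a `Cocycle`: matrices of differentials and of
changes of frame on all small open sets. Compatible families of columns form a sheaf, which glues
the cocycle to a complex with frames. Coordinates identify any framed complex with the one glued
from its matrices (`coord_bijective`). Boundedness uses connectedness: ranks agree on nonempty
overlaps, since a nontrivial commutative ring has invariant basis number, hence everywhere. -/

noncomputable section

namespace CechTot

/-! ### Vertices of the totalisation are compatible families -/

section compatibleFamilies

variable {X : Type} [TopologicalSpace X] {ι : Type} {O : (Opens X)ᵒᵖ ⥤ CommRingCat.{0}}
  {F : CommRingCat.{0} ⥤ SSet.{0}} {U : ι → Opens X}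

/-- Families of simplices indexed by the tuples of the cover that are compatible with
reindexing. -/
def IsCompat (O : (Opens X)ᵒᵖ ⥤ CommRingCat.{0}) (F : CommRingCat.{0} ⥤ SSet.{0})
    (x : ∀ {b : SimplexCategory} (σ : CechSimplex U b),
      (F.obj (O.obj (op σ.opens))).obj (op b)) : Prop :=
  ∀ {a b : SimplexCategory} (f : a ⟶ b) (σ : CechSimplex U b),
    (F.map (O.map (σ.incl f).op)).app (op a) (x (σ.pull f)) =
      (F.obj (O.obj (op σ.opens))).map f.op (x σ)

/-- The simplices of `Δ[b] × Δ[0]`. -/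
def stdElt {n : SimplexCategoryᵒᵖ} {b : SimplexCategory} (f : n.unop ⟶ b) :
    ((stdProd.obj ⦋0⦌).obj b).obj n :=
  show (SSet.stdSimplex.obj b).obj n × (SSet.stdSimplex.obj ⦋0⦌).obj n from
    (SSet.stdSimplex.objEquiv.symm f, SSet.stdSimplex.objEquiv.symm
      (SimplexCategory.const n.unop ⦋0⦌ 0))

/-- The factor `Δ[0]` is terminal and carries no information. -/
theorem exists_eq_stdElt {n : SimplexCategoryᵒᵖ} {b : SimplexCategory}
    (p : ((stdProd.obj ⦋0⦌).obj b).obj n) : ∃ f : n.unop ⟶ b, p = stdElt f := by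
  let p' : (SSet.stdSimplex.obj b).obj n × (SSet.stdSimplex.obj ⦋0⦌).obj n := p
  refine ⟨SSet.stdSimplex.objEquiv p'.1, ?_⟩
  refine Prod.ext (x := p') (Equiv.symm_apply_apply _ _).symm ?_
  apply SSet.stdSimplex.objEquiv.injective
  exact SimplexCategory.isTerminalZero.hom_ext _ _

/-- The value of a morphism `Δ[⋆] × Δ[0] ⟶ F (Č U)` at a simplex of `Δ[b] × Δ[0]`. -/
def TotZero.val (v : TotZero O F U) {n : SimplexCategoryᵒᵖ} {b : SimplexCategory}
    (f : n.unop ⟶ b) (σ : CechSimplex U b) : (F.obj (O.obj (op σ.opens))).obj n :=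
  let w : stdProd.obj ⦋0⦌ ⟶ cechEval (O ⋙ F) U := v
  let y : (cechTerm (O ⋙ F) U b).obj n := (NatTrans.app (NatTrans.app w b) n) (stdElt f)
  y σ

theorem TotZero.comp_eq_val (v : TotZero O F U) {b : SimplexCategory} (σ : CechSimplex U b) :
    v.comp σ = v.val (n := op b) (𝟙 b) σ := rfl

theorem TotZero.val_naturality (v : TotZero O F U) {n m : SimplexCategoryᵒᵖ} {b : SimplexCategory}
    (f : n.unop ⟶ b) (g : n ⟶ m) (σ : CechSimplex U b) :
    v.val (g.unop ≫ f) σ = (F.obj (O.obj (op σ.opens))).map g (v.val f σ) := by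
  let w : stdProd.obj ⦋0⦌ ⟶ cechEval (O ⋙ F) U := v
  let wb : (stdProd.obj ⦋0⦌).obj b ⟶ cechTerm (O ⋙ F) U b := w.app b
  exact congrArg (fun h : ((stdProd.obj ⦋0⦌).obj b).obj n ⟶ (cechTerm (O ⋙ F) U b).obj m =>
    (h (stdElt f) : (cechTerm (O ⋙ F) U b).obj m) σ) (NatTrans.naturality wb g)

theorem TotZero.val_comp (v : TotZero O F U) {n : SimplexCategoryᵒᵖ} {a b : SimplexCategory}
    (f : n.unop ⟶ a) (g : a ⟶ b) (σ : CechSimplex U b) :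
    v.val (f ≫ g) σ = (F.map (O.map (σ.incl g).op)).app n (v.val f (σ.pull g)) := by
  let w : stdProd.obj ⦋0⦌ ⟶ cechEval (O ⋙ F) U := v
  exact congrArg (fun h : (stdProd.obj ⦋0⦌).obj a ⟶ cechTerm (O ⋙ F) U b =>
    (NatTrans.app h n (stdElt f) : (cechTerm (O ⋙ F) U b).obj n) σ) (NatTrans.naturality w g)

/-- The Yoneda step: every simplex of `Δ[b]` is a pullback of the tautological one, so the
components `v.comp σ` determine all values of `v`. -/
theorem TotZero.val_eq_map_comp (v : TotZero O F U) {n : SimplexCategoryᵒᵖ} {b : SimplexCategory}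
    (f : n.unop ⟶ b) (σ : CechSimplex U b) :
    v.val f σ = (F.obj (O.obj (op σ.opens))).map f.op (v.comp σ) := by
  rw [comp_eq_val, ← v.val_naturality (n := op b) (𝟙 b) f.op σ]
  exact congrArg (fun g => v.val g σ) (Category.comp_id f).symm

/-- The value of `v` at the simplex `f` of `Δ[b]` is computed twice: by naturality in the
cosimplicial variable (`val_comp`) and in the simplicial variable (`val_eq_map_comp`). -/
theorem TotZero.comp_compat (v : TotZero O F U) : IsCompat O F (fun σ => v.comp σ) := by
  intro a b f σ
  have h1 := v.val_comp (n := op a) (𝟙 a) f σ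
  have h2 := v.val_eq_map_comp (n := op a) (𝟙 a ≫ f) σ
  have h3 : 𝟙 a ≫ f = f := Category.id_comp f
  rw [h1] at h2
  exact h2.trans (by rw [h3])

theorem TotZero.ext {v w : TotZero O F U}
    (h : ∀ {b : SimplexCategory} (σ : CechSimplex U b), v.comp σ = w.comp σ) : v = w := by
  let v' : stdProd.obj ⦋0⦌ ⟶ cechEval (O ⋙ F) U := v
  let w' : stdProd.obj ⦋0⦌ ⟶ cechEval (O ⋙ F) U := w
  suffices v' = w' from this
  refine NatTrans.ext (funext fun b => cechTerm_hom_ext fun n p σ => ?_)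
  obtain ⟨f, rfl⟩ := exists_eq_stdElt p
  exact (v.val_eq_map_comp f σ).trans (Eq.trans (by rw [h σ]) (w.val_eq_map_comp f σ).symm)

/-- The vertex of the totalisation with given components. -/
def TotZero.ofCompat (x : ∀ {b : SimplexCategory} (σ : CechSimplex U b),
      (F.obj (O.obj (op σ.opens))).obj (op b)) (hx : IsCompat O F x) : TotZero O F U :=
  show stdProd.obj ⦋0⦌ ⟶ cechEval (O ⋙ F) U from
  { app b :=
      { app n := ↾fun p (σ : CechSimplex U b) =>
          (F.obj (O.obj (op σ.opens))).map (SSet.stdSimplex.objEquiv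
            (Prod.fst (show (SSet.stdSimplex.obj b).obj n × (SSet.stdSimplex.obj ⦋0⦌).obj n
              from p))).op (x σ)
        naturality n m g := ConcreteCategory.hom_ext _ _ fun p => funext fun σ => by
          obtain ⟨f, rfl⟩ := exists_eq_stdElt p
          exact congrArg (fun h : (F.obj (O.obj (op σ.opens))).obj (op b) ⟶
            (F.obj (O.obj (op σ.opens))).obj m => h (x σ))
            ((F.obj (O.obj (op σ.opens))).map_comp f.op g) }
    naturality a b f := cechTerm_hom_ext fun n p σ => by
      obtain ⟨g, rfl⟩ := exists_eq_stdElt p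
      have h1 := NatTrans.naturality_apply (F.map (O.map (σ.incl f).op))
        g.op (x (σ.pull f))
      refine Eq.trans ?_ h1.symm
      rw [hx f σ]
      exact congrArg (fun h : (F.obj (O.obj (op σ.opens))).obj (op b) ⟶
            (F.obj (O.obj (op σ.opens))).obj n => h (x σ))
            ((F.obj (O.obj (op σ.opens))).map_comp f.op g.op) }

theorem TotZero.comp_ofCompat (x : ∀ {b : SimplexCategory} (σ : CechSimplex U b),
      (F.obj (O.obj (op σ.opens))).obj (op b)) (hx : IsCompat O F x) {b : SimplexCategory}
    (σ : CechSimplex U b) : (TotZero.ofCompat x hx).comp σ = x σ :=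
  congrArg (fun h : (F.obj (O.obj (op σ.opens))).obj (op b) ⟶
            (F.obj (O.obj (op σ.opens))).obj (op b) => h (x σ))
            ((F.obj (O.obj (op σ.opens))).map_id (op b))

end compatibleFamilies

/-! ### Equivalences -/

/-- In a simplicial set that receives a map from the nerve of an indiscrete groupoid, the edges in
the image are equivalences. -/
theorem isEquivEdge_of_indiscrete {Y : SSet.{0}} {I : Type}
    (N : ∀ n : SimplexCategory, (Fin (n.len + 1) → I) → Y.obj (op n))
    (hN : ∀ {m n : SimplexCategory} (f : m ⟶ n) (w : Fin (n.len + 1) → I),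
      Y.map f.op (N n w) = N m (fun i => w (f i)))
    {n : SimplexCategory} (w : Fin (n.len + 1) → I) (f : ⦋1⦌ ⟶ n) :
    IsEquivEdge Y (Y.map f.op (N n w)) := by
  have hδ : ∀ {k : ℕ} (i : Fin (k + 2)) (u : Fin (k + 2) → I),
      Y.δ i (N ⦋k + 1⦌ u) = N ⦋k⦌ (fun j => u (i.succAbove j)) := fun i u =>
    hN (SimplexCategory.δ i) u
  have hσ : ∀ {k : ℕ} (i : Fin (k + 1)) (u : Fin (k + 1) → I),
      Y.σ i (N ⦋k⦌ u) = N ⦋k + 1⦌ (fun j => u (i.predAbove j)) := fun i u =>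
    hN (SimplexCategory.σ i) u
  rw [hN]
  -- Any word in `I` is a simplex. For the edge `xy` take the inverse `yx` and the triangles `xyx`
  -- and `yxy`; deleting the middle letter leaves `xx` or `yy`, a degenerate edge.
  refine ⟨N ⦋1⦌ ![w (f 1), w (f 0)], N ⦋2⦌ ![w (f 0), w (f 1), w (f 0)],
    N ⦋2⦌ ![w (f 1), w (f 0), w (f 1)], ⟨?_, ?_, ?_⟩, ?_, ?_, ?_⟩
  all_goals
    rw [hδ]
    try rw [hδ, hσ]
    refine congrArg (N _) (funext fun j => ?_)
    fin_cases j <;> rfl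

/-! ### Tuples that are fixed by a reindexing. -/

section component

variable {X : Type} [TopologicalSpace X] {ι : Type} {O : (Opens X)ᵒᵖ ⥤ CommRingCat.{0}}
  {F : CommRingCat.{0} ⥤ SSet.{0}} {U : ι → Opens X}

/-- The equality of tuples is a hypothesis because the type of a component depends on the tuple;
after substitution the inclusion is the identity. -/
theorem IsCompat.map_app_of_eq {x : ∀ {b : SimplexCategory} (σ : CechSimplex U b),
      (F.obj (O.obj (op σ.opens))).obj (op b)} {a : SimplexCategory}
    {σ τ : CechSimplex U a} (h : σ.opens ⟶ τ.opens) (hστ : τ = σ) :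
    (F.map (O.map h.op)).app (op a) (x τ) = x σ := by
  subst hστ
  obtain rfl : h = 𝟙 _ := Subsingleton.elim _ _
  rw [op_id, O.map_id, F.map_id]
  rfl

/-- A component at a tuple that does not change under a reindexing does not change either. -/
theorem IsCompat.map_eq_self {x : ∀ {b : SimplexCategory} (σ : CechSimplex U b),
      (F.obj (O.obj (op σ.opens))).obj (op b)} (hx : IsCompat O F x) {b : SimplexCategory}
    (f : b ⟶ b) (σ : CechSimplex U b) (h : σ.pull f = σ) :
    (F.obj (O.obj (op σ.opens))).map f.op (x σ) = x σ := by
  rw [← hx f σ]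
  exact IsCompat.map_app_of_eq (x := x) (σ.incl f) h

end component

/-! ### The Maurer-Cartan equation and the relations in the differential graded nerve -/

section maurerCartan

/-- Serves to transport labels along equations such as `K - j = m` between dimensions, which do not
hold by computation. -/
theorem label_congr {n : SimplexCategory} {α : Type} (A : ∀ m : ℕ, (⦋m⦌ ⟶ n) → α) {m m' : ℕ}
    (h : m = m') (f : ⦋m⦌ ⟶ n) (f' : ⦋m'⦌ ⟶ n)
    (hf : ∀ (i : ℕ) (hi : i < m + 1) (hi' : i < m' + 1), f ⟨i, hi⟩ = f' ⟨i, hi'⟩) :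
    A m f = A m' f' := by
  subst h
  congr 1
  ext ⟨i, hi⟩ : 3
  exact hf i hi hi

variable {S : Set ℤ} {R : Type} [CommRing R]

theorem maurerCartan_zero_iff (r : Fin 1 → Rk S) (A : ∀ m : ℕ, (⦋m⦌ ⟶ ⦋0⦌) → Matrix Ix Ix R) :
    cechDelta 0 A + cechSquare 0 r A = 0 ↔ mcomp (basis (r 0)) (A 0 (𝟙 _)) (A 0 (𝟙 _)) = 0 := by
  have h : ∀ f g : ⦋0⦌ ⟶ ⦋0⦌, A 0 f = A 0 g := fun f g =>
    congrArg _ (SimplexCategory.isTerminalZero.hom_ext f g)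
  -- The dimension `0 - 0` of the back face is generalised to a variable, so that it can be
  -- substituted away.
  have key : ∀ (l : ℕ) (hl : l = 0) (h1 : 0 + 0 ≤ 0) (h2 : 0 + l ≤ 0),
      (-1 : ℤ) ^ ((0 + 1) * l) • mcomp (basis (r 0))
        (A 0 (SimplexCategory.subinterval 0 0 h1)) (A l (SimplexCategory.subinterval 0 l h2)) =
      mcomp (basis (r 0)) (A 0 (𝟙 _)) (A 0 (𝟙 _)) := by
    intro l hl h1 h2
    subst hl
    rw [Nat.mul_zero, pow_zero, one_smul, h _ (𝟙 _)]
  rw [cechDelta, cechSquare, zero_add, Fin.sum_univ_one]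
  exact Eq.congr_left (key _ (by simp) _ _)

/-- The two equations have the same terms on different sides. The extreme summands `j = 0` and `j =
k + 1` of the square are the two compositions with the differentials; the inner summands and the
deleted Čech differential are the right hand side of the dg-nerve relation with the opposite sign.
-/
theorem maurerCartan_succ_iff (k : ℕ) (r : Fin (k + 2) → Rk S)
    (A : ∀ m : ℕ, (⦋m⦌ ⟶ ⦋k + 1⦌) → Matrix Ix Ix R) :
    cechDelta (k + 1) A + cechSquare (k + 1) r A = 0 ↔
    mcomp (basis (r (Fin.last (k + 1)))) (A (k + 1) (𝟙 _))
        (A 0 (SimplexCategory.const ⦋0⦌ ⦋k + 1⦌ (Fin.last (k + 1))))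
      + (-1 : ℤ) ^ (k + 1) • mcomp (basis (r 0))
        (A 0 (SimplexCategory.const ⦋0⦌ ⦋k + 1⦌ 0)) (A (k + 1) (𝟙 _))
    = ∑ i : Fin k, (-1 : ℤ) ^ (i : ℕ) • A k (SimplexCategory.δ i.succ.castSucc)
      + ∑ i : Fin k, (-1 : ℤ) ^ ((k + 1) * (i : ℕ) + 1) •
        mcomp (basis (r i.succ.castSucc))
          (A (i + 1) (SimplexCategory.subinterval 0 (i + 1) (by omega)))
          (A (k - i) (SimplexCategory.subinterval (i + 1) (k - i) (by omega))) := by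
  have hδ : cechDelta (k + 1) A =
      - ∑ i : Fin k, (-1 : ℤ) ^ (i : ℕ) • A k (SimplexCategory.δ i.succ.castSucc) := by
    rw [cechDelta, ← Finset.sum_neg_distrib]
    refine Finset.sum_congr rfl fun i _ => ?_
    rw [pow_succ, mul_neg_one, neg_smul]
  have hsq : cechSquare (k + 1) r A = mcomp (basis (r (Fin.last (k + 1)))) (A (k + 1) (𝟙 _))
        (A 0 (SimplexCategory.const ⦋0⦌ ⦋k + 1⦌ (Fin.last (k + 1))))
      + (-1 : ℤ) ^ (k + 1) • mcomp (basis (r 0))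
        (A 0 (SimplexCategory.const ⦋0⦌ ⦋k + 1⦌ 0)) (A (k + 1) (𝟙 _))
      - ∑ i : Fin k, (-1 : ℤ) ^ ((k + 1) * (i : ℕ) + 1) •
        mcomp (basis (r i.succ.castSucc))
          (A (i + 1) (SimplexCategory.subinterval 0 (i + 1) (by omega)))
          (A (k - i) (SimplexCategory.subinterval (i + 1) (k - i) (by omega))) := by
    have h0 : ∀ (l : ℕ) (hl : l = k + 1) (h1 : 0 + 0 ≤ k + 1) (h2 : 0 + l ≤ k + 1),
        (-1 : ℤ) ^ ((0 + 1) * l) • mcomp (basis (r 0))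
          (A 0 (SimplexCategory.subinterval 0 0 h1)) (A l (SimplexCategory.subinterval 0 l h2)) =
        (-1 : ℤ) ^ (k + 1) • mcomp (basis (r 0))
        (A 0 (SimplexCategory.const ⦋0⦌ ⦋k + 1⦌ 0)) (A (k + 1) (𝟙 _)) := by
      intro l hl h1 h2
      subst hl
      rw [Nat.zero_add, one_mul]
      congr 2
      · refine label_congr A rfl _ _ fun i hi _ => Fin.ext ?_
        obtain rfl : i = 0 := by omega
        rfl
    have h1 : ∀ (l : ℕ) (hl : l = 0) (h1 : 0 + (k + 1) ≤ k + 1) (h2 : (k + 1) + l ≤ k + 1),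
        (-1 : ℤ) ^ ((k + 1 + 1) * l) • mcomp (basis (r (Fin.last (k + 1))))
          (A (k + 1) (SimplexCategory.subinterval 0 (k + 1) h1))
          (A l (SimplexCategory.subinterval (k + 1) l h2)) =
        mcomp (basis (r (Fin.last (k + 1)))) (A (k + 1) (𝟙 _))
        (A 0 (SimplexCategory.const ⦋0⦌ ⦋k + 1⦌ (Fin.last (k + 1)))) := by
      intro l hl h1 h2
      subst hl
      rw [Nat.mul_zero, pow_zero, one_smul]
      congr 1
      refine label_congr A rfl _ _ fun i hi _ => Fin.ext ?_
      obtain rfl : i = 0 := by omega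
      exact Nat.zero_add _
    have h2 : ∀ (i l m : ℕ) (hi : i < k) (hl : l = k - i) (hm : m = i + 1)
        (h1 : 0 + m ≤ k + 1) (h2 : m + l ≤ k + 1) (h3 : 0 + (i + 1) ≤ k + 1)
        (h4 : (i + 1) + (k - i) ≤ k + 1) (s : Finset Ix),
        (-1 : ℤ) ^ ((m + 1) * l) • mcomp s (A m (SimplexCategory.subinterval 0 m h1))
          (A l (SimplexCategory.subinterval m l h2)) =
        -((-1 : ℤ) ^ ((k + 1) * i + 1) • mcomp s
          (A (i + 1) (SimplexCategory.subinterval 0 (i + 1) h3))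
          (A (k - i) (SimplexCategory.subinterval (i + 1) (k - i) h4))) := by
      intro i l m hi hl hm h1 h2 h3 h4 s
      subst hl hm
      rw [← neg_smul]
      congr 1
      obtain ⟨j, rfl⟩ := Nat.exists_eq_add_of_lt hi
      rw [show i + j + 1 - i = j + 1 by omega, show -(-1 : ℤ) ^ ((i + j + 1 + 1) * i + 1) =
        (-1) ^ ((i + j + 1 + 1) * i) by ring]
      refine neg_one_pow_congr ?_
      simp only [Nat.even_add, Nat.even_mul, Nat.even_add_one]
      tauto
    rw [cechSquare, Fin.sum_univ_succ, Fin.sum_univ_castSucc]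
    have key : ∀ a b c d e f : Matrix Ix Ix R, a = d → b = - e → c = f →
        a + (b + c) = f + d - e := by
      rintro a b c d e f rfl rfl rfl
      abel
    refine key _ _ _ _ _ _ (h0 _ (by simp) _ _) ?_ ?_
    · rw [← Finset.sum_neg_distrib]
      refine Finset.sum_congr rfl fun i _ => h2 i _ _ i.2 ?_ ?_ _ _ _ _ _
      · simp
      · simp
    · exact h1 _ (by simp) _ _
  rw [hδ, hsq]
  constructor
  · intro h
    rw [← sub_eq_zero, ← h]
    abel
  · intro h
    rw [← sub_eq_zero] at h
    rw [← h]
    abel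

end maurerCartan

/-! ### Simplices of the dg-nerve in terms of the Maurer-Cartan equation. -/

section maurerCartanSimplices

variable {S : Set ℤ} {R R' : Type} [CommRing R] [CommRing R']

theorem DGSimplex.maurerCartan {n : SimplexCategory} (x : DGSimplex S R n) (K : ℕ) (J : ⦋K⦌ ⟶ n) :
    cechDelta K (fun m f => x.φ m (f ≫ J)) +
      cechSquare K (fun i => x.rank (J i)) (fun m f => x.φ m (f ≫ J)) = 0 := by
  cases K with
  | zero =>
    rw [maurerCartan_zero_iff, Category.id_comp]
    exact x.sq J
  | succ k =>
    rw [maurerCartan_succ_iff, Category.id_comp]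
    exact x.rel k J

/-- A simplex of the differential graded nerve, from labels satisfying the Maurer-Cartan
equation. -/
def DGSimplex.ofMaurerCartan {n : SimplexCategory} (rank : Fin (n.len + 1) → Rk S)
    (φ : ∀ k : ℕ, (⦋k⦌ ⟶ n) → Matrix Ix Ix R)
    (isHom : ∀ (k : ℕ) (J : ⦋k⦌ ⟶ n),
      IsHom (rank (J (Fin.last k))) (rank (J 0)) (1 - k) (φ k J))
    (mc : ∀ (K : ℕ) (J : ⦋K⦌ ⟶ n), cechDelta K (fun m f => φ m (f ≫ J)) +
      cechSquare K (fun i => rank (J i)) (fun m f => φ m (f ≫ J)) = 0)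
    (degen_one : ∀ J : ⦋1⦌ ⟶ n, J 0 = J 1 → φ 1 J = idMat R (rank (J 0)))
    (degen : ∀ (k : ℕ) (J : ⦋k⦌ ⟶ n), 2 ≤ k → ¬ Function.Injective J → φ k J = 0) :
    DGSimplex S R n where
  rank := rank
  φ := φ
  isHom := isHom
  sq J := by
    have h := mc 0 J
    rwa [maurerCartan_zero_iff, Category.id_comp] at h
  degen_one := degen_one
  degen := degen
  rel k J := by
    have h := mc (k + 1) J
    rwa [maurerCartan_succ_iff, Category.id_comp] at h

/-- The left hand side is a polynomial with integer coefficients in the matrix entries, so it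
commutes with ring homomorphisms. -/
theorem maurerCartan_map (f : R →+* R') (K : ℕ) (r : Fin (K + 1) → Rk S)
    (A : ∀ m : ℕ, (⦋m⦌ ⟶ ⦋K⦌) → Matrix Ix Ix R) (h : cechDelta K A + cechSquare K r A = 0) :
    cechDelta K (fun m g => (A m g).map f) + cechSquare K r (fun m g => (A m g).map f) = 0 := by
  have hsmul : ∀ (a : ℕ) (M : Matrix Ix Ix R), ((-1 : ℤ) ^ a • M).map f =
      (-1 : ℤ) ^ a • M.map f := fun a M => by
    ext
    simp
  have hsum : ∀ (l : ℕ) (M : Fin l → Matrix Ix Ix R), (∑ i, M i).map f = ∑ i, (M i).map f :=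
    fun l M => by
      ext
      simp [Matrix.sum_apply]
  have h1 : cechDelta K (fun m g => (A m g).map f) = (cechDelta K A).map f := by
    cases K with
    | zero => exact (zero_map f).symm
    | succ k => simp only [cechDelta, hsum, hsmul]
  have h2 : cechSquare K r (fun m g => (A m g).map f) = (cechSquare K r A).map f := by
    simp only [cechSquare, hsum, hsmul, mcomp_map]
  rw [h1, h2, ← add_map, h, zero_map]

/-- A monotone map without equal neighbouring values is strictly monotone. This reconciles the
normalisation of the dg-nerve (noninjective faces) with that of cochains (equal neighbouring
indices). -/
theorem not_injective_iff_exists_castSucc_eq_succ {n : SimplexCategory} {k : ℕ} (J : ⦋k⦌ ⟶ n) :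
    ¬ Function.Injective J ↔ ∃ i : Fin k, J i.castSucc = J i.succ := by
  constructor
  · intro h
    by_contra! hne
    refine h (StrictMono.injective (f := (J : Fin (k + 1) → Fin (n.len + 1)))
      (Fin.strictMono_iff_lt_succ.2 fun i => lt_of_le_of_ne ?_ (hne i)))
    exact J.toOrderHom.monotone (Fin.castSucc_lt_succ).le
  · rintro ⟨i, hi⟩ h
    exact (Fin.castSucc_lt_succ).ne (h hi)

end maurerCartanSimplices

/-! ### Restriction of matrices, and tuples of members containing a given open set. -/

section restriction

variable {X : Type} [TopologicalSpace X] {ι : Type} {O : (Opens X)ᵒᵖ ⥤ CommRingCat.{0}}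
  {S : Set ℤ} {U : ι → Opens X} {A B C : Type} {V W Z : Opens X}

theorem resMat_resMat (h : V ⟶ W) (h' : W ⟶ Z) (h'' : V ⟶ Z) (M : Matrix A B (O.obj (op Z))) :
    resMat O h (resMat O h' M) = resMat O h'' M := by
  obtain rfl : h'' = h ≫ h' := Subsingleton.elim _ _
  ext i j
  simp [resMat]

theorem resMat_id (h : V ⟶ V) (M : Matrix A B (O.obj (op V))) : resMat O h M = M := by
  obtain rfl : h = 𝟙 V := Subsingleton.elim _ _
  ext i j
  simp [resMat]

/-- A tuple of members of the cover that contain a given nonempty open set. -/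
def CechSimplex.ofLE (hV : (V : Set X).Nonempty) {b : SimplexCategory} (w : Fin (b.len + 1) → ι)
    (h : ∀ i, V ≤ U (w i)) : CechSimplex U b where
  vertex := w
  nonempty := hV.mono fun _ hx => Set.mem_iInter.2 fun i => h i hx

/-- The open set is contained in the intersection of the members of the tuple. -/
def CechSimplex.homOfLE {b : SimplexCategory} (σ : CechSimplex U b) (h : ∀ i, V ≤ U (σ.vertex i)) :
    V ⟶ σ.opens :=
  CategoryTheory.homOfLE fun _ hx => Set.mem_iInter.2 fun i => h i hx

theorem CechSimplex.opens_le {b : SimplexCategory} (σ : CechSimplex U b) (i : Fin (b.len + 1)) :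
    σ.opens ≤ U (σ.vertex i) :=
  leOfHom (σ.toVertex i)

/-- The tuple with a single member. -/
def CechSimplex.single (hU : ∀ α, (U α : Set X).Nonempty) (α : ι) : CechSimplex U ⦋0⦌ :=
  CechSimplex.ofLE (hU α) (fun _ => α) fun _ => le_rfl

end restriction

/-! ### Twisting cochains are vertices of the totalisation -/

section twistingCochains

variable {X : Type} [TopologicalSpace X] {ι : Type} {O : (Opens X)ᵒᵖ ⥤ CommRingCat.{0}}
  {S : Set ℤ} {U : ι → Opens X}

namespace TotZero

variable (v : TotZero O (Twist S) U)

theorem base_twist_comp {a b : SimplexCategory} (f : a ⟶ b) (σ : CechSimplex U b) :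
    DGSimplex.base (O.map (σ.incl f).op).hom (v.comp (σ.pull f)).1 = (v.comp σ).1.pull f :=
  congrArg Subtype.val (v.comp_compat f σ)

theorem twist_rank_pull {a b : SimplexCategory} (f : a ⟶ b) (σ : CechSimplex U b)
    (i : Fin (a.len + 1)) : (v.comp (σ.pull f)).1.rank i = (v.comp σ).1.rank (f i) :=
  congrArg (fun y : DGSimplex S (O.obj (op σ.opens)) a => y.rank i) (v.base_twist_comp f σ)

theorem twist_φ_pull {a b : SimplexCategory} (f : a ⟶ b) (σ : CechSimplex U b) (k : ℕ)
    (J : ⦋k⦌ ⟶ a) :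
    resMat O (σ.incl f) ((v.comp (σ.pull f)).1.φ k J) = (v.comp σ).1.φ k (J ≫ f) :=
  congrArg (fun y : DGSimplex S (O.obj (op σ.opens)) a => y.φ k J) (v.base_twist_comp f σ)

/-- The source of normalisation: if the tuple repeats an index, `f` can be chosen noninjective, and
the simplex is then degenerate. -/
theorem twist_pull_eq_self {b : SimplexCategory} (f : b ⟶ b) (σ : CechSimplex U b)
    (h : σ.pull f = σ) : (v.comp σ).1.pull f = (v.comp σ).1 :=
  congrArg Subtype.val (IsCompat.map_eq_self (x := fun σ => v.comp σ) v.comp_compat f σ h)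

theorem twist_rank_single (hU : ∀ α, (U α : Set X).Nonempty) {b : SimplexCategory}
    (σ : CechSimplex U b) (i : Fin (b.len + 1)) :
    (v.comp (CechSimplex.single hU (σ.vertex i))).1.rank 0 = (v.comp σ).1.rank i :=
  v.twist_rank_pull (SimplexCategory.const ⦋0⦌ b i) σ 0

theorem twist_φ_eq {b : SimplexCategory} (σ : CechSimplex U b) (k : ℕ)
    (J : ⦋k⦌ ⟶ b) :
    resMat O (σ.incl J) ((v.comp (σ.pull J)).1.φ k (𝟙 _)) = (v.comp σ).1.φ k J := by
  rw [twist_φ_pull, Category.id_comp]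

/-- The twisting cochain that consists of the labels of a vertex of the totalisation. -/
def toTwistingCochain (hU : ∀ α, (U α : Set X).Nonempty) : TwistingCochain O S U where
  rank α := (v.comp (CechSimplex.single hU α)).1.rank 0
  a k σ := (v.comp σ).1.φ k (𝟙 _)
  isHom k σ := by
    rw [twist_rank_single, twist_rank_single]
    exact (v.comp σ).1.isHom k (𝟙 _)
  maurerCartan K σ := by
    simp only [twist_φ_eq, twist_rank_single]
    have h := (v.comp σ).1.maurerCartan K (𝟙 _)
    simp only [Category.comp_id] at h
    exact h
  norm_one σ h := by
    rw [twist_rank_single]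
    -- A tuple `(α, α)` is fixed by the constant reindexing at 0, so its edge is a degenerate edge
    -- and carries the identity.
    have h1 := v.twist_pull_eq_self (SimplexCategory.const ⦋1⦌ ⦋1⦌ 0) σ (by
      ext i
      fin_cases i
      · rfl
      · exact h)
    have h2 := congrArg (fun y : DGSimplex S (O.obj (op σ.opens)) ⦋1⦌ => y.φ 1 (𝟙 _)) h1
    refine h2.symm.trans ?_
    exact (v.comp σ).1.degen_one (𝟙 _ ≫ SimplexCategory.const ⦋1⦌ ⦋1⦌ 0) rfl
  norm k σ hk := by
    rintro ⟨i, hi⟩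
    -- Moves `i + 1` to `i` and fixes all other vertices. It is monotone, it preserves `σ` since
    -- these two members coincide, and it is not injective, so the top label vanishes.
    let f : ⦋k⦌ ⟶ ⦋k⦌ := SimplexCategory.mkHom
      { toFun := fun j => if j = i.succ then i.castSucc else j
        monotone' := fun j j' hjj' => by
          dsimp only
          split_ifs <;> simp only [Fin.le_def, Fin.ext_iff, Fin.val_succ, Fin.val_castSucc] at * <;>
            omega }
    have hf0 : f i.castSucc = i.castSucc := if_neg (Fin.castSucc_lt_succ).ne
    have hf1 : f i.succ = i.castSucc := if_pos rfl
    have h1 := v.twist_pull_eq_self f σ (by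
      ext j
      by_cases hj : j = i.succ
      · subst hj
        exact (congrArg σ.vertex hf1).trans hi
      · exact congrArg σ.vertex (if_neg hj))
    have h2 := congrArg (fun y : DGSimplex S (O.obj (op σ.opens)) ⦋k⦌ => y.φ k (𝟙 _)) h1
    refine h2.symm.trans ?_
    refine (v.comp σ).1.degen k (𝟙 _ ≫ f) hk ?_
    rw [not_injective_iff_exists_castSucc_eq_succ]
    exact ⟨i, hf0.trans hf1.symm⟩

theorem toTwistingCochain_isDataOf (hU : ∀ α, (U α : Set X).Nonempty) :
    (v.toTwistingCochain hU).IsDataOf v := fun σ =>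
  ⟨fun i => (v.twist_rank_single hU σ i).symm, fun k J => (v.twist_φ_eq σ k J).symm⟩

end TotZero

namespace TwistingCochain

variable (A : TwistingCochain O S U) {V : Opens X} (hV : (V : Set X).Nonempty)

/-- The components of a twisting cochain, as a simplex of the differential graded nerve over a
nonempty open set that is contained in the given members of the cover. -/
def dgSimplex {n : SimplexCategory} (σ : CechSimplex U n) (h : ∀ i, V ≤ U (σ.vertex i)) :
    DGSimplex S (O.obj (op V)) n :=
  DGSimplex.ofMaurerCartan (fun i => A.rank (σ.vertex i))
    (fun k J => resMat O ((σ.pull J).homOfLE fun i => h (J i)) (A.a k (σ.pull J)))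
    (fun k J => (A.isHom k (σ.pull J)).map _)
    (fun K J => by
      have h1 := maurerCartan_map (O.map ((σ.pull J).homOfLE fun i => h (J i)).op).hom _ _ _
        (A.maurerCartan K (σ.pull J))
      have h2 : (fun (m : ℕ) (g : ⦋m⦌ ⟶ ⦋K⦌) =>
          (resMat O ((σ.pull J).incl g) (A.a m ((σ.pull J).pull g))).map
            (O.map ((σ.pull J).homOfLE fun i => h (J i)).op).hom) =
          fun m g => resMat O ((σ.pull (g ≫ J)).homOfLE fun i => h ((g ≫ J) i))
            (A.a m (σ.pull (g ≫ J))) :=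
        funext fun m => funext fun g => resMat_resMat _ _ _ _
      rw [h2] at h1
      exact h1)
    (fun J hJ => by
      rw [A.norm_one (σ.pull J) (congrArg σ.vertex hJ)]
      exact idMat_map _ _)
    (fun k J hk hJ => by
      rw [not_injective_iff_exists_castSucc_eq_succ] at hJ
      obtain ⟨i, hi⟩ := hJ
      rw [A.norm k (σ.pull J) hk ⟨i, congrArg σ.vertex hi⟩]
      exact zero_map _)

/-- The components of a twisting cochain, as a simplex of the core of the differential graded
nerve. -/
def simplex {n : SimplexCategory} (σ : CechSimplex U n) :
    ((Twist S).obj (O.obj (op σ.opens))).obj (op n) :=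
  ⟨A.dgSimplex σ σ.opens_le, fun f => by
    let Y : SSet.{0} := (dgNerve S).obj (O.obj (op σ.opens))
    have hne : (σ.opens : Set X).Nonempty := σ.nonempty
    -- Over `σ.opens` the cochain gives a simplex for every word in the indices whose members
    -- contain `σ.opens`, in any order and with repetitions: a map from the nerve of the indiscrete
    -- groupoid on these indices.
    exact isEquivEdge_of_indiscrete (Y := Y) (I := {α // σ.opens ≤ U α})
      (fun n w => A.dgSimplex (V := σ.opens) (CechSimplex.ofLE hne (fun i => (w i).1)
        fun i => (w i).2) fun i => (w i).2)
      (fun f w => rfl) (fun i => ⟨σ.vertex i, σ.opens_le i⟩) f⟩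

theorem simplex_compat : IsCompat O (Twist S) (fun σ => A.simplex σ) := by
  intro a b f σ
  refine Subtype.ext (DGSimplex.ext rfl ?_)
  funext k J
  exact resMat_resMat _ _ _ _

/-- The vertex of the totalisation that is given by a twisting cochain. -/
def toTotZero : TotZero O (Twist S) U :=
  TotZero.ofCompat (fun σ => A.simplex σ) A.simplex_compat

theorem isDataOf_toTotZero : A.IsDataOf A.toTotZero := fun σ => by
  rw [toTotZero, TotZero.comp_ofCompat]
  exact ⟨fun _ => rfl, fun _ _ => rfl⟩

theorem IsDataOf.unique_left {A B : TwistingCochain O S U} {v : TotZero O (Twist S) U}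
    (hU : ∀ α, (U α : Set X).Nonempty) (hA : A.IsDataOf v) (hB : B.IsDataOf v) : A = B := by
  refine TwistingCochain.ext ?_ ?_
  · funext α
    exact ((hA (CechSimplex.single hU α)).1 0).symm.trans ((hB (CechSimplex.single hU α)).1 0)
  · funext k σ
    have h1 := (hA σ).2 k (𝟙 _)
    rw [(hB σ).2 k (𝟙 _)] at h1
    -- The tuples `σ.pull (𝟙 _)` and `σ` agree by definition, so this is a restriction from an open
    -- set to itself.
    have h2 : ∀ h : σ.opens ⟶ (σ.pull (𝟙 _)).opens, ∀ M : Matrix Ix Ix (O.obj (op σ.opens)),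
      resMat O h M = M := fun h M => resMat_id (h : σ.opens ⟶ σ.opens) M
    exact (h2 _ (A.a k σ)).symm.trans (h1.symm.trans (h2 _ (B.a k σ)))

theorem IsDataOf.unique_right {A : TwistingCochain O S U} {v w : TotZero O (Twist S) U}
    (hv : A.IsDataOf v) (hw : A.IsDataOf w) : v = w := by
  refine TotZero.ext fun σ => Subtype.ext (DGSimplex.ext ?_ ?_)
  · funext i
    exact ((hv σ).1 i).trans ((hw σ).1 i).symm
  · funext k J
    exact ((hv σ).2 k J).trans ((hw σ).2 k J).symm

end TwistingCochain

/-- Vertices of the totalisation of the core of the differential graded nerve are the same as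
twisting cochains. -/
theorem exists_equiv_twistingCochain (hU : ∀ α, (U α : Set X).Nonempty) :
    ∃ Φ : TotZero O (Twist S) U ≃ TwistingCochain O S U, ∀ v, (Φ v).IsDataOf v :=
  ⟨{ toFun v := v.toTwistingCochain hU
     invFun A := A.toTotZero
     left_inv v := TwistingCochain.IsDataOf.unique_right
      (TwistingCochain.isDataOf_toTotZero _)
      (v.toTwistingCochain_isDataOf hU)
     right_inv A :=
        TwistingCochain.IsDataOf.unique_left hU (A.toTotZero.toTwistingCochain_isDataOf hU)
      A.isDataOf_toTotZero },
    fun v => v.toTwistingCochain_isDataOf hU⟩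

end twistingCochains

/-! ### Simplices of the differential graded nerve with few nonzero labels -/

section truncated

variable {S : Set ℤ} {R : Type} [CommRing R]

theorem mcomp_zero {A B C : Type} (s : Finset B) (M : Matrix A B R) :
    mcomp s M (0 : Matrix B C R) = 0 := by
  ext a c
  simp [mcomp]

theorem zero_mcomp {A B C : Type} (s : Finset B) (M : Matrix B C R) :
    mcomp s (0 : Matrix A B R) M = 0 := by
  ext a c
  simp [mcomp]

theorem isHom_zero (r s : Rk S) (q : ℤ) : IsHom r s q (0 : Matrix Ix Ix R) :=
  fun _ _ h => absurd rfl h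

/-- Labels of simplices that vanish in dimensions at least three. -/
def truncLabel {n : SimplexCategory} (d : Fin (n.len + 1) → Matrix Ix Ix R)
    (g : Fin (n.len + 1) → Fin (n.len + 1) → Matrix Ix Ix R)
    (h : Fin (n.len + 1) → Fin (n.len + 1) → Fin (n.len + 1) → Matrix Ix Ix R) :
    ∀ k : ℕ, (⦋k⦌ ⟶ n) → Matrix Ix Ix R := fun k J =>
  match k, J with
  | 0, J => d (J 0)
  | 1, J => g (J 0) (J 1)
  | 2, J => h (J 0) (J 1) (J 2)
  | _ + 3, _ => 0

/-- A simplex of the differential graded nerve whose labels vanish in dimensions at least three. -/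
def DGSimplex.ofTrunc {n : SimplexCategory} (rank : Fin (n.len + 1) → Rk S)
    (d : Fin (n.len + 1) → Matrix Ix Ix R)
    (g : Fin (n.len + 1) → Fin (n.len + 1) → Matrix Ix Ix R)
    (h : Fin (n.len + 1) → Fin (n.len + 1) → Fin (n.len + 1) → Matrix Ix Ix R)
    (isHom_d : ∀ i, IsHom (rank i) (rank i) 1 (d i))
    (isHom_g : ∀ i j, i ≤ j → IsHom (rank j) (rank i) 0 (g i j))
    (isHom_h : ∀ i j k, i ≤ j → j ≤ k → IsHom (rank k) (rank i) (-1) (h i j k))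
    (sq : ∀ i, mcomp (basis (rank i)) (d i) (d i) = 0)
    (comm : ∀ i j, i ≤ j → mcomp (basis (rank j)) (g i j) (d j) =
      mcomp (basis (rank i)) (d i) (g i j))
    (g_self : ∀ i, g i i = idMat R (rank i))
    (h_left : ∀ i j, h i i j = 0) (h_right : ∀ i j, h i j j = 0)
    (htpy : ∀ i j k, i ≤ j → j ≤ k → mcomp (basis (rank k)) (h i j k) (d k) +
      mcomp (basis (rank i)) (d i) (h i j k) = g i k - mcomp (basis (rank j)) (g i j) (g j k))
    (three : ∀ i j k l, i ≤ j → j ≤ k → k ≤ l → h i k l + mcomp (basis (rank k)) (h i j k) (g k l) =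
      h i j l + mcomp (basis (rank j)) (g i j) (h j k l))
    (four : ∀ i j k l m, i ≤ j → j ≤ k → k ≤ l → l ≤ m →
      mcomp (basis (rank k)) (h i j k) (h k l m) = 0) : DGSimplex S R n where
  rank := rank
  φ := truncLabel d g h
  isHom k J := by
    have hJ : Monotone (J : Fin (k + 1) → Fin (n.len + 1)) := J.toOrderHom.monotone
    match k, J with
    | 0, J => exact isHom_d (J 0)
    | 1, J => exact isHom_g _ _ (hJ (Fin.zero_le 1))
    | 2, J => exact isHom_h _ _ _ (hJ (Fin.zero_le 1)) (hJ (show (1 : Fin 3) ≤ 2 by decide))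
    | _ + 3, _ => exact isHom_zero _ _ _
  sq J := sq (J 0)
  degen_one J hJ := by
    rw [← g_self]
    exact congrArg (g (J 0)) hJ.symm
  degen k J hk hJ := by
    rw [not_injective_iff_exists_castSucc_eq_succ] at hJ
    obtain ⟨i, hi⟩ := hJ
    match k, J with
    | 0, _ => exact absurd hk (by decide)
    | 1, _ => exact absurd hk (by decide)
    | 2, J =>
      fin_cases i
      · replace hi : J 0 = J 1 := hi
        change h (J 0) (J 1) (J 2) = 0
        rw [hi, h_left]
      · replace hi : J 1 = J 2 := hi
        change h (J 0) (J 1) (J 2) = 0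
        rw [hi, h_right]
    | _ + 3, _ => rfl
  rel k J := by
    have hJ : Monotone (J : Fin (k + 2) → Fin (n.len + 1)) := J.toOrderHom.monotone
    match k, J with
    | 0, J =>
      have := comm (J 0) (J 1) (hJ (Fin.zero_le 1))
      simp only [Finset.univ_eq_empty, Finset.sum_empty, zero_add, pow_one, neg_smul, one_smul,
        add_zero, ← sub_eq_add_neg, sub_eq_zero]
      exact this
    | 1, J =>
      have := htpy (J 0) (J 1) (J 2) (hJ (Fin.zero_le 1)) (hJ (by decide))
      rw [Fin.sum_univ_one, Fin.sum_univ_one]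
      simp only [Fin.val_zero, mul_zero, pow_zero, zero_add, pow_one, neg_smul, one_smul,
        ← sub_eq_add_neg, Even.neg_one_pow (show Even (1 + 1) by decide)]
      exact this
    | 2, J =>
      have := three (J 0) (J 1) (J 2) (J 3) (hJ (Fin.zero_le 1)) (hJ (by decide)) (hJ (by decide))
      rw [Fin.sum_univ_two, Fin.sum_univ_two]
      change mcomp _ 0 _ + _ • mcomp _ _ 0 = (1 : ℤ) • h (J 0) (J 2) (J 3) +
        (-1 : ℤ) ^ 1 • h (J 0) (J 1) (J 3) +
        ((-1 : ℤ) ^ 1 • mcomp (basis (rank (J 1))) (g (J 0) (J 1)) (h (J 1) (J 2) (J 3)) +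
          (-1 : ℤ) ^ 4 • mcomp (basis (rank (J 2))) (h (J 0) (J 1) (J 2)) (g (J 2) (J 3)))
      simp only [zero_mcomp, mcomp_zero, smul_zero, add_zero, pow_one, neg_smul, one_smul,
        Even.neg_one_pow (show Even 4 by decide)]
      rw [← sub_eq_zero.2 this]
      abel
    -- In dimension four the only product without a label of dimension at least three is that of the
    -- two triangles which meet at the middle vertex.
    | 3, J =>
      have := four (J 0) (J 1) (J 2) (J 3) (J 4) (hJ (Fin.zero_le 1)) (hJ (by decide))
        (hJ (by decide)) (hJ (by decide))
      rw [Fin.sum_univ_three, Fin.sum_univ_three]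
      change mcomp _ 0 _ + _ • mcomp _ _ 0 = _ • 0 + _ • 0 + _ • 0 + (_ • mcomp _ _ 0 +
        _ • mcomp (basis (rank (J 2))) (h (J 0) (J 1) (J 2)) (h (J 2) (J 3) (J 4)) +
        _ • mcomp _ 0 _)
      rw [this]
      simp only [zero_mcomp, mcomp_zero, smul_zero, add_zero]
    -- From dimension five on, the dimensions of a front and a back face add up to at least five, so
    -- one factor of every product has dimension at least three.
    | k + 4, J =>
      have hz : ∀ (m : ℕ) (K : ⦋m⦌ ⟶ n), 3 ≤ m → truncLabel d g h m K = 0 := by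
        intro m K hm
        obtain ⟨m, rfl⟩ := Nat.exists_eq_add_of_le' hm
        rfl
      rw [hz _ J (by omega), zero_mcomp, mcomp_zero, smul_zero, add_zero, Finset.sum_eq_zero,
        Finset.sum_eq_zero, add_zero]
      · intro i _
        by_cases hi : 2 ≤ (i : ℕ)
        · rw [hz _ _ (by omega : 3 ≤ (i : ℕ) + 1), zero_mcomp, smul_zero]
        · rw [hz (k + 4 - i) _ (by omega), mcomp_zero, smul_zero]
      · intro i _
        rw [hz _ _ (by omega), smul_zero]

theorem eq_zero_of_ne_of_le {i j : Fin 2} (h : i ≠ j) (h' : i ≤ j) : i = 0 := by omega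

theorem eq_one_of_ne_of_le {i j : Fin 2} (h : i ≠ j) (h' : i ≤ j) : j = 1 := by omega

/-- All other labels of a 1-simplex lie on degenerate faces and are prescribed. It is used to
recognise the faces of triangles. -/
theorem DGSimplex.ext_one {x y : DGSimplex S R ⦋1⦌} (hr0 : x.rank 0 = y.rank 0)
    (hr1 : x.rank 1 = y.rank 1) (hd0 : x.d 0 = y.d 0) (hd1 : x.d 1 = y.d 1)
    (h1 : x.φ 1 (𝟙 _) = y.φ 1 (𝟙 _)) : x = y := by
  have hr : x.rank = y.rank := by
    funext i
    fin_cases i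
    · exact hr0
    · exact hr1
  refine DGSimplex.ext hr ?_
  funext k J
  match k, J with
  | 0, J =>
    obtain ⟨i, rfl⟩ : ∃ i, J = SimplexCategory.const ⦋0⦌ ⦋1⦌ i := ⟨J 0, by
      ext i : 3
      fin_cases i
      rfl⟩
    fin_cases i
    · exact hd0
    · exact hd1
  | 1, J =>
    by_cases hJ : J 0 = J 1
    · rw [x.degen_one J hJ, y.degen_one J hJ, hr]
    · have hmono : J 0 ≤ J 1 := J.toOrderHom.monotone (Fin.zero_le 1)
      obtain rfl : J = 𝟙 _ := by
        ext i : 3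
        fin_cases i
        · change J 0 = (0 : Fin 2)
          exact eq_zero_of_ne_of_le hJ hmono
        · change J 1 = (1 : Fin 2)
          exact eq_one_of_ne_of_le hJ hmono
      exact h1
  | k + 2, J =>
    have hJ : ¬ Function.Injective J := fun h => by
      simpa using Fintype.card_le_of_injective _ h
    rw [x.degen _ J (by omega) hJ, y.degen _ J (by omega) hJ]

end truncated

/-! ### The homotopy category of complexes of free modules -/

section homotopy

variable {S : Set ℤ} {A B C R R' : Type} [CommRing R] [CommRing R']

theorem mcomp_add (s : Finset B) (M : Matrix A B R) (N N' : Matrix B C R) :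
    mcomp s M (N + N') = mcomp s M N + mcomp s M N' := by
  ext a c
  simp [mcomp, mul_add, Finset.sum_add_distrib]

theorem add_mcomp (s : Finset B) (M M' : Matrix A B R) (N : Matrix B C R) :
    mcomp s (M + M') N = mcomp s M N + mcomp s M' N := by
  ext a c
  simp [mcomp, add_mul, Finset.sum_add_distrib]

theorem mcomp_neg (s : Finset B) (M : Matrix A B R) (N : Matrix B C R) :
    mcomp s M (-N) = -mcomp s M N := by
  ext a c
  simp [mcomp]

theorem neg_mcomp (s : Finset B) (M : Matrix A B R) (N : Matrix B C R) :
    mcomp s (-M) N = -mcomp s M N := by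
  ext a c
  simp [mcomp]

theorem mcomp_sub (s : Finset B) (M : Matrix A B R) (N N' : Matrix B C R) :
    mcomp s M (N - N') = mcomp s M N - mcomp s M N' := by
  rw [sub_eq_add_neg, mcomp_add, mcomp_neg, sub_eq_add_neg]

theorem sub_mcomp (s : Finset B) (M M' : Matrix A B R) (N : Matrix B C R) :
    mcomp s (M - M') N = mcomp s M N - mcomp s M' N := by
  rw [sub_eq_add_neg, add_mcomp, neg_mcomp, sub_eq_add_neg]

theorem IsHom.add {r s : Rk S} {q : ℤ} {M N : Matrix Ix Ix R} (hM : IsHom r s q M)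
    (hN : IsHom r s q N) : IsHom r s q (M + N) := by
  intro x y hxy
  by_cases h : M x y = 0
  · exact hN x y fun h' => hxy (by rw [Matrix.add_apply, h, h', add_zero])
  · exact hM x y h

theorem IsHom.neg {r s : Rk S} {q : ℤ} {M : Matrix Ix Ix R} (hM : IsHom r s q M) :
    IsHom r s q (-M) :=
  fun x y hxy => hM x y (by simpa using hxy)

variable (S R) in
/-- The homotopy relation between chain maps. -/
def Htpy : HomRel (FreeCpx S R) := fun C D f g =>
  ∃ h : Matrix Ix Ix R, IsHom C.rank D.rank (-1) h ∧
    mcomp (basis C.rank) h C.d + mcomp (basis D.rank) D.d h = ChainMap.mat f - ChainMap.mat g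

/-- Makes the homotopy category a quotient category, so that two-out-of-three and two-out-of-six
become statements about isomorphisms. -/
instance : Congruence (Htpy S R) where
  equivalence {C D} :=
    { refl f := ⟨0, isHom_zero _ _ _, by rw [zero_mcomp, mcomp_zero, sub_self, add_zero]⟩
      symm := fun ⟨h, h1, h2⟩ => ⟨-h, h1.neg, by
        rw [mcomp_neg, neg_mcomp, ← neg_add, h2, neg_sub]⟩
      trans := fun ⟨h, h1, h2⟩ ⟨k, k1, k2⟩ => ⟨h + k, h1.add k1, by
        rw [mcomp_add, add_mcomp, add_add_add_comm, h2, k2, sub_add_sub_cancel]⟩ }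
  comp_left {C D E} f g g' := fun ⟨h, h1, h2⟩ => by
    refine ⟨mcomp (basis D.rank) h (ChainMap.mat f), ?_, ?_⟩
    · simpa using h1.comp (ChainMap.isHom f)
    · rw [mcomp_assoc, ChainMap.comm f, ← mcomp_assoc, ← mcomp_assoc, ← add_mcomp, h2, sub_mcomp]
      rfl
  comp_right {C D E} f f' g := fun ⟨h, h1, h2⟩ => by
    refine ⟨mcomp (basis D.rank) (ChainMap.mat g) h, ?_, ?_⟩
    · simpa using (ChainMap.isHom g).comp h1
    · rw [← mcomp_assoc, ← ChainMap.comm g, mcomp_assoc, mcomp_assoc, ← mcomp_add, h2, mcomp_sub]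
      rfl

variable (S R) in
/-- The localisation functor to the homotopy category. -/
abbrev toHtpyCat : FreeCpx S R ⥤ Quotient (Htpy S R) := Quotient.functor _

theorem htpy_iff {C D : FreeCpx S R} {f g : C ⟶ D} :
    Htpy S R f g ↔ (toHtpyCat S R).map f = (toHtpyCat S R).map g :=
  (Quotient.functor_map_eq_iff (Htpy S R) f g).symm

/-- A chain map is a homotopy equivalence. -/
def IsHtpyEquiv {C D : FreeCpx S R} (f : C ⟶ D) : Prop := IsIso ((toHtpyCat S R).map f)

/-- The quotient functor is full, so an inverse in the homotopy category is represented by a chain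
map. -/
theorem isHtpyEquiv_iff {C D : FreeCpx S R} (f : C ⟶ D) :
    IsHtpyEquiv f ↔ ∃ g : D ⟶ C, Htpy S R (f ≫ g) (𝟙 C) ∧ Htpy S R (g ≫ f) (𝟙 D) := by
  constructor
  · intro h
    obtain ⟨g', h1, h2⟩ := h
    obtain ⟨g, rfl⟩ := (toHtpyCat S R).map_surjective g'
    refine ⟨g, ?_, ?_⟩
    · rwa [htpy_iff, Functor.map_comp, CategoryTheory.Functor.map_id]
    · rwa [htpy_iff, Functor.map_comp, CategoryTheory.Functor.map_id]
  · rintro ⟨g, h1, h2⟩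
    refine ⟨(toHtpyCat S R).map g, ?_, ?_⟩
    · rwa [htpy_iff, Functor.map_comp, CategoryTheory.Functor.map_id] at h1
    · rwa [htpy_iff, Functor.map_comp, CategoryTheory.Functor.map_id] at h2

theorem Htpy.map (φ : R →+* R') {C D : FreeCpx S R} {f g : C ⟶ D} (h : Htpy S R f g) :
    Htpy S R' ((baseChange S φ).map f) ((baseChange S φ).map g) := by
  obtain ⟨k, h1, h2⟩ := h
  refine ⟨k.map φ, h1.map φ, ?_⟩
  have h3 := congrArg (fun M => Matrix.map M φ) h2
  simp only [add_map, mcomp_map] at h3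
  refine h3.trans ?_
  ext
  simp [baseChange]

theorem IsHtpyEquiv.map (φ : R →+* R') {C D : FreeCpx S R} {f : C ⟶ D} (h : IsHtpyEquiv f) :
    IsHtpyEquiv ((baseChange S φ).map f) := by
  rw [isHtpyEquiv_iff] at h ⊢
  obtain ⟨g, h1, h2⟩ := h
  refine ⟨(baseChange S φ).map g, ?_, ?_⟩
  · have h3 := h1.map φ
    rwa [Functor.map_comp, CategoryTheory.Functor.map_id] at h3
  · have h3 := h2.map φ
    rwa [Functor.map_comp, CategoryTheory.Functor.map_id] at h3

theorem IsHtpyEquiv.of_htpy {C D : FreeCpx S R} {f g : C ⟶ D} (h : Htpy S R f g)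
    (hf : IsHtpyEquiv f) : IsHtpyEquiv g := by
  unfold IsHtpyEquiv
  rw [← (Quotient.functor_map_eq_iff (Htpy S R) f g).2 h]
  exact hf

theorem isHtpyEquiv_iff_of_comm {C D C' D' : FreeCpx S R} {f : C ⟶ D} {g : C' ⟶ D'} {a : C ⟶ C'}
    {b : D ⟶ D'} (ha : IsHtpyEquiv a) (hb : IsHtpyEquiv b) (h : f ≫ b = a ≫ g) :
    IsHtpyEquiv f ↔ IsHtpyEquiv g := by
  unfold IsHtpyEquiv at *
  have h' := congrArg (toHtpyCat S R).map h
  rw [Functor.map_comp, Functor.map_comp] at h'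
  constructor
  · intro hf
    have : IsIso ((toHtpyCat S R).map a ≫ (toHtpyCat S R).map g) := by
      rw [← h']
      infer_instance
    exact IsIso.of_isIso_comp_left ((toHtpyCat S R).map a) _
  · intro hg
    have : IsIso ((toHtpyCat S R).map f ≫ (toHtpyCat S R).map b) := by
      rw [h']
      infer_instance
    exact IsIso.of_isIso_comp_right _ ((toHtpyCat S R).map b)

/-- The two-out-of-six property, for the first of three composable maps. -/
theorem isHtpyEquiv_of_two_out_of_six {C D E F : FreeCpx S R} (f : C ⟶ D) (g : D ⟶ E) (h : E ⟶ F)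
    (hfg : IsHtpyEquiv (f ≫ g)) (hgh : IsHtpyEquiv (g ≫ h)) : IsHtpyEquiv h := by
  unfold IsHtpyEquiv at *
  rw [Functor.map_comp] at hfg hgh
  -- Since `g ≫ h` is invertible, `g` is a monomorphism; since `f ≫ g` is invertible, `g` is a split
  -- epimorphism. So `g` is invertible, and then so is `h`.
  have hmono : Mono ((toHtpyCat S R).map g) := mono_of_mono _ ((toHtpyCat S R).map h)
  have hsplit : IsSplitEpi ((toHtpyCat S R).map g) :=
    ⟨⟨⟨inv ((toHtpyCat S R).map f ≫ (toHtpyCat S R).map g) ≫ (toHtpyCat S R).map f, by simp⟩⟩⟩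
  have := isIso_of_mono_of_isSplitEpi ((toHtpyCat S R).map g)
  exact IsIso.of_isIso_comp_left ((toHtpyCat S R).map g) _

end homotopy

/-! ### Inclusions with elementary complement are homotopy equivalences -/

section elementary

variable {S : Set ℤ} {R : Type} [CommRing R]

/-- The transpose of the differential maps each upper copy of `R ^ m` back to the lower one: it is
the standard contraction of a sum of identity maps. -/
theorem ediff_contraction (el : El) :
    mcomp (ebasis el) (ediff R el).transpose (ediff R el) +
      mcomp (ebasis el) (ediff R el) (ediff R el).transpose = eid R el := by
  have hmem : ∀ (j a : ℕ) (b b' : Bool), (⟨j, b, a⟩ : EIx) ∈ ebasis el →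
      (⟨j, b', a⟩ : EIx) ∈ ebasis el := by
    intro j a b b' h
    simpa [ebasis] using h
  ext ⟨i, b, a⟩ ⟨j, b', a'⟩
  simp only [Matrix.add_apply, mcomp, Matrix.transpose_apply, ediff, eid]
  by_cases hy : (⟨j, b', a'⟩ : EIx) ∈ ebasis el
  swap
  · rw [Finset.sum_eq_zero, Finset.sum_eq_zero, if_neg (fun h => hy h.2), add_zero]
    · rintro ⟨k, c, e⟩ hk
      rw [mul_ite, if_neg, mul_zero]
      rintro ⟨h1, h2, h3⟩
      simp only [Sigma.mk.injEq, heq_eq_eq, Prod.mk.injEq] at h3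
      obtain ⟨rfl, rfl, rfl⟩ := h3
      exact hy (hmem _ _ _ _ h1)
    · rintro ⟨k, c, e⟩ hk
      rw [mul_ite, if_neg (fun h => hy h.1), mul_zero]
  -- On a lower basis vector only the first product contributes, on an upper one only the second.
  cases b'
  · rw [Finset.sum_eq_single (⟨j, true, a'⟩ : EIx), Finset.sum_eq_zero, add_zero]
    · cases b
      · by_cases h : (⟨i, false, a⟩ : EIx) = ⟨j, false, a'⟩
        · simp only [Sigma.mk.injEq, heq_eq_eq, Prod.mk.injEq, true_and] at h
          obtain ⟨rfl, rfl⟩ := h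
          simp [hy]
        · rw [if_neg, zero_mul, if_neg (fun h' => h h'.1)]
          rintro ⟨-, -, h'⟩
          simp only [Sigma.mk.injEq, heq_eq_eq, Prod.mk.injEq, true_and] at h h'
          exact h ⟨h'.1.symm, h'.2.symm⟩
      · simp
    · rintro ⟨k, c, e⟩ hk
      simp
    · rintro ⟨k, c, e⟩ hk h
      rw [mul_ite, if_neg (fun h' => h h'.2.2), mul_zero]
    · exact fun h => absurd (hmem _ _ _ _ hy) h
  · rw [Finset.sum_eq_zero, Finset.sum_eq_single (⟨j, false, a'⟩ : EIx), zero_add]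
    · have hy' := hmem _ _ _ false hy
      cases b
      · simp
      · by_cases h : (⟨i, true, a⟩ : EIx) = ⟨j, true, a'⟩
        · simp [hy, hy', h]
        · rw [if_neg (fun h' => h h'.2.2), zero_mul, if_neg (fun h' => h h'.1)]
    · rintro ⟨k, c, e⟩ hk h
      rw [mul_ite, if_neg, mul_zero]
      rintro ⟨h1, h2, h3⟩
      simp only [Sigma.mk.injEq, heq_eq_eq, Prod.mk.injEq, true_and] at h2 h3
      obtain ⟨rfl, rfl⟩ := h3
      exact h (by rw [h2])
    · exact fun h => absurd (hmem _ _ _ _ hy) h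
    · rintro ⟨k, c, e⟩ hk
      simp

theorem edeg_of_ediff_ne_zero {el : El} {x y : EIx} (h : ediff R el x y ≠ 0) :
    edeg el x = edeg el y + 1 := by
  obtain ⟨i, b, a⟩ := x
  obtain ⟨j, b', a'⟩ := y
  simp only [ediff, ne_eq, ite_eq_right_iff, Classical.not_imp] at h
  obtain ⟨⟨-, h1, h2⟩, -⟩ := h
  simp only [Sigma.mk.injEq, heq_eq_eq, Prod.mk.injEq] at h1 h2
  obtain ⟨rfl, rfl, rfl⟩ := h2
  simp [edeg, h1]

theorem eid_mcomp_ediff (el : El) : mcomp (ebasis el) (eid R el) (ediff R el) = ediff R el := by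
  ext ⟨i, b, a⟩ ⟨j, b', a'⟩
  simp only [mcomp, eid, ite_mul, one_mul, zero_mul]
  by_cases hx : (⟨i, b, a⟩ : EIx) ∈ ebasis el
  · rw [Finset.sum_eq_single (⟨i, b, a⟩ : EIx)]
    · simp [hx]
    · intro c _ hc
      simp [Ne.symm hc]
    · simp [hx]
  · rw [Finset.sum_eq_zero]
    · rw [ediff, if_neg]
      rintro ⟨h1, -, h3⟩
      simp only [Sigma.mk.injEq, heq_eq_eq, Prod.mk.injEq] at h3
      obtain ⟨rfl, rfl, rfl⟩ := h3
      exact hx (by simpa [ebasis] using h1)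
    · intro c hc
      rw [if_neg]
      rintro ⟨rfl, -⟩
      exact hx hc

/-- The inclusion in a direct sum decomposition, as a chain map. -/
def IsSplitting.incl {C' C : FreeCpx S R} {c : Cmpl R}
    (h : IsSplitting C'.rank C'.d C.rank C.d c) : C' ⟶ C :=
  show ChainMap C' C from ⟨c.inc, h.isHom, h.inc_comm⟩

/-- The projection `π` is an inverse up to homotopy: one composition is the identity, and the other
differs from it by the projector onto the contractible complement. -/
theorem IsSplitting.isHtpyEquiv_incl {C' C : FreeCpx S R} {c : Cmpl R}
    (h : IsSplitting C'.rank C'.d C.rank C.d c) : IsHtpyEquiv h.incl := by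
  rw [isHtpyEquiv_iff]
  obtain ⟨π, ϖ, h1, h2, h3, h4, h5, h6, h7⟩ := h.exists_inverse
  -- Compatibility of `π` with the differentials is not assumed; it follows by inserting the
  -- identity `inc π + perp ϖ` before the differential of `C` and using that `inc` and `perp` are
  -- chain maps.
  have hπ : mcomp (basis C.rank) π C.d = mcomp (basis C'.rank) C'.d π := by
    rw [← mcomp_idMat C.isHom, ← h7, mcomp_add, ← mcomp_assoc, ← mcomp_assoc, mcomp_add,
      ← h.inc_comm, ← h.perp_comm]
    simp only [← mcomp_assoc]
    rw [h3, h4, idMat_mcomp C'.isHom, zero_mcomp, zero_mcomp, add_zero]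
  have hϖ : mcomp (basis C.rank) ϖ C.d = mcomp (ebasis c.el) (ediff R c.el) ϖ := by
    rw [← mcomp_idMat C.isHom, ← h7, mcomp_add, ← mcomp_assoc, ← mcomp_assoc, mcomp_add,
      ← h.inc_comm, ← h.perp_comm]
    simp only [← mcomp_assoc]
    rw [h5, h6, eid_mcomp_ediff, zero_mcomp, zero_mcomp, zero_add]
  let p : C ⟶ C' := show ChainMap C C' from ⟨π, h1, hπ⟩
  have e1 : h.incl ≫ p = 𝟙 C' := ChainMap.ext h3
  refine ⟨p, ?_, ?_⟩
  · rw [e1]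
    exact (Congruence.equivalence (r := Htpy S R)).refl _
  · refine (Congruence.equivalence (r := Htpy S R)).symm ?_
    -- The contraction of the complement, transported to `C` by `ϖ` and `perp`.
    refine ⟨mcomp (ebasis c.el) c.perp (mcomp (ebasis c.el) (ediff R c.el).transpose ϖ), ?_, ?_⟩
    · intro x y hxy
      obtain ⟨a, -, ha⟩ := Finset.exists_ne_zero_of_sum_ne_zero hxy
      obtain ⟨b, -, hb⟩ := Finset.exists_ne_zero_of_sum_ne_zero (right_ne_zero_of_mul ha)
      obtain ⟨k1, -, k2⟩ := h.perp_supp x a (left_ne_zero_of_mul ha)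
      obtain ⟨-, k3, k4⟩ := h2 b y (right_ne_zero_of_mul hb)
      have k5 := edeg_of_ediff_ne_zero (left_ne_zero_of_mul hb : ediff R c.el b a ≠ 0)
      exact ⟨k1, k3, by omega⟩
    · have e2 : ChainMap.mat (𝟙 C) - ChainMap.mat (p ≫ h.incl) = mcomp (ebasis c.el) c.perp ϖ := by
        change idMat R C.rank - mcomp (basis C'.rank) c.inc π = _
        rw [← h7, add_sub_cancel_left]
      have e3 : mcomp (ebasis c.el) (eid R c.el) ϖ = ϖ := by
        rw [← h6, mcomp_assoc]
        have e4 : mcomp (basis C.rank) ϖ (mcomp (basis C'.rank) c.inc π +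
            mcomp (ebasis c.el) c.perp ϖ) = ϖ := by
          rw [h7]
          ext x y
          simp only [mcomp, idMat, mul_ite, mul_one, mul_zero]
          by_cases hy : y ∈ basis C.rank
          · rw [Finset.sum_eq_single y]
            · simp [hy]
            · intro b _ hb
              simp [hb]
            · simp [hy]
          · rw [Finset.sum_eq_zero]
            · by_contra h0
              exact hy (h2 x y (Ne.symm h0)).2.1
            · intro b hb
              rw [if_neg]
              rintro ⟨-, k⟩
              exact hy k
        rw [mcomp_add, ← mcomp_assoc, h5, zero_mcomp, zero_add] at e4
        exact e4
      rw [e2, mcomp_assoc, mcomp_assoc, hϖ, ← mcomp_assoc (basis C.rank), ← h.perp_comm,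
        mcomp_assoc, ← mcomp_add, ← mcomp_assoc, ← mcomp_assoc, ← add_mcomp, ediff_contraction, e3]

end elementary

/-! ### Equivalences in the differential graded nerve -/

section dgEquivalences

variable {S : Set ℤ}

theorem IsHom.congr_degree {R : Type} [CommRing R] {r s : Rk S} {p q : ℤ} {M : Matrix Ix Ix R}
    (h : IsHom r s p M) (hpq : p = q) : IsHom r s q M :=
  hpq ▸ h

namespace DGSimplex

variable {R : Type} [CommRing R] {n : SimplexCategory}

/-- The complex at a vertex. -/
def cpx (x : DGSimplex S R n) (i : Fin (n.len + 1)) : FreeCpx S R where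
  rank := x.rank i
  d := x.d i
  isHom := (x.isHom 0 (SimplexCategory.const ⦋0⦌ n i)).congr_degree (by simp)
  sq := x.sq (SimplexCategory.const ⦋0⦌ n i)

theorem edge_comm (x : DGSimplex S R n) (J : ⦋1⦌ ⟶ n) :
    mcomp (basis (x.rank (J 1))) (x.φ 1 J) (x.d (J 1)) =
      mcomp (basis (x.rank (J 0))) (x.d (J 0)) (x.φ 1 J) := by
  have h := x.rel 0 J
  simp only [Finset.univ_eq_empty, Finset.sum_empty, zero_add, pow_one, neg_smul, one_smul,
    add_zero, ← sub_eq_add_neg, sub_eq_zero] at h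
  exact h

/-- The chain map that labels an edge. -/
def edge (x : DGSimplex S R n) (J : ⦋1⦌ ⟶ n) : x.cpx (J 1) ⟶ x.cpx (J 0) :=
  show ChainMap (x.cpx (J 1)) (x.cpx (J 0)) from
    ⟨x.φ 1 J, (x.isHom 1 J).congr_degree (by simp), x.edge_comm J⟩

theorem triangle_rel (x : DGSimplex S R n) (J : ⦋2⦌ ⟶ n) :
    mcomp (basis (x.rank (J 2))) (x.φ 2 J) (x.d (J 2)) +
      mcomp (basis (x.rank (J 0))) (x.d (J 0)) (x.φ 2 J) =
    x.φ 1 (SimplexCategory.δ 1 ≫ J) - mcomp (basis (x.rank (J 1)))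
      (x.φ 1 (SimplexCategory.δ 2 ≫ J)) (x.φ 1 (SimplexCategory.δ 0 ≫ J)) := by
  have h := x.rel 1 J
  have e1 : SimplexCategory.subinterval 0 1 (by omega) = (SimplexCategory.δ 2 : ⦋1⦌ ⟶ ⦋2⦌) := by
    ext i : 3
    fin_cases i <;> rfl
  have e2 : SimplexCategory.subinterval 1 1 (by omega) = (SimplexCategory.δ 0 : ⦋1⦌ ⟶ ⦋2⦌) := by
    ext i : 3
    fin_cases i <;> rfl
  rw [Fin.sum_univ_one, Fin.sum_univ_one] at h
  simp only [Fin.val_zero, mul_zero, pow_zero, zero_add, pow_one, neg_smul, one_smul,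
    ← sub_eq_add_neg, Even.neg_one_pow (show Even (1 + 1) by decide)] at h
  rw [← e1, ← e2]
  exact h

/-- The label of a triangle is itself the homotopy from the long edge to the composition of the
short ones. -/
theorem htpy_triangle (x : DGSimplex S R n) (J : ⦋2⦌ ⟶ n) :
    Htpy S R (x.edge (SimplexCategory.δ 1 ≫ J))
      (x.edge (SimplexCategory.δ 0 ≫ J) ≫ x.edge (SimplexCategory.δ 2 ≫ J)) :=
  ⟨x.φ 2 J, (x.isHom 2 J).congr_degree (by norm_num), x.triangle_rel J⟩

theorem triangle_nondegenerate {i j k : Fin 3} (h1 : i ≤ j) (h2 : j ≤ k)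
    (h : i ≠ j ∧ j ≠ k) : i = 0 ∧ j = 1 ∧ k = 2 := by omega

/-- The triangle in the differential graded nerve given by a homotopy between a chain map and
the composition of two chain maps. -/
def triangle {C₀ C₁ C₂ : FreeCpx S R} (f : C₁ ⟶ C₀) (g : C₂ ⟶ C₁) (h : C₂ ⟶ C₀)
    (H : Matrix Ix Ix R) (hH : IsHom C₂.rank C₀.rank (-1) H)
    (hd : mcomp (basis C₂.rank) H C₂.d + mcomp (basis C₀.rank) C₀.d H =
      ChainMap.mat h - mcomp (basis C₁.rank) (ChainMap.mat f) (ChainMap.mat g)) :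
    DGSimplex S R ⦋2⦌ :=
  let C : Fin 3 → FreeCpx S R := ![C₀, C₁, C₂]
  -- For `i < j` in `Fin 3`, the condition `j = 1` singles out the edge 01, then `i = 1` the edge
  -- 12, and 02 remains. The values for `i > j` are irrelevant.
  let G : Fin 3 → Fin 3 → Matrix Ix Ix R := fun i j =>
    if i = j then idMat R (C i).rank
    else if j = 1 then ChainMap.mat f else if i = 1 then ChainMap.mat g else ChainMap.mat h
  let K : Fin 3 → Fin 3 → Fin 3 → Matrix Ix Ix R := fun i j k => if i ≠ j ∧ j ≠ k then H else 0
  have hGC : ∀ i j : Fin 3, i ≤ j → ∃ u : C j ⟶ C i, ChainMap.mat u = G i j := by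
    intro i j hij
    fin_cases i <;> fin_cases j
    · exact ⟨𝟙 _, rfl⟩
    · exact ⟨f, rfl⟩
    · exact ⟨h, rfl⟩
    · exact absurd hij (by decide)
    · exact ⟨𝟙 _, rfl⟩
    · exact ⟨g, rfl⟩
    · exact absurd hij (by decide)
    · exact absurd hij (by decide)
    · exact ⟨𝟙 _, rfl⟩
  have hG1 : ∀ i, G i i = idMat R (C i).rank := fun i => if_pos rfl
  have hKl : ∀ i j, K i i j = 0 := fun i j => if_neg (by simp)
  have hKr : ∀ i j, K i j j = 0 := fun i j => if_neg (by simp)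
  have hKh : ∀ i j k : Fin 3, i ≤ j → j ≤ k → IsHom (C k).rank (C i).rank (-1) (K i j k) := by
    intro i j k hij hjk
    by_cases hn : i ≠ j ∧ j ≠ k
    · obtain ⟨rfl, rfl, rfl⟩ := triangle_nondegenerate hij hjk hn
      exact hH
    · rw [show K i j k = 0 from if_neg hn]
      exact isHom_zero _ _ _
  DGSimplex.ofTrunc (n := ⦋2⦌) (fun i => (C i).rank) (fun i => (C i).d) G K
    (fun i => (C i).isHom)
    (fun i j hij => by
      obtain ⟨u, hu⟩ := hGC i j hij
      rw [← hu]
      exact ChainMap.isHom u)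
    hKh
    (fun i => (C i).sq)
    (fun i j hij => by
      obtain ⟨u, hu⟩ := hGC i j hij
      rw [← hu]
      exact ChainMap.comm u)
    hG1 hKl hKr
    (fun i j k hij hjk => by
      by_cases h1 : i = j
      · subst h1
        obtain ⟨u, hu⟩ := hGC i k hjk
        rw [hKl, hG1, zero_mcomp, mcomp_zero, ← hu, idMat_mcomp (ChainMap.isHom u), sub_self,
          add_zero]
      by_cases h2 : j = k
      · subst h2
        obtain ⟨u, hu⟩ := hGC i j hij
        rw [hKr, hG1, zero_mcomp, mcomp_zero, ← hu, mcomp_idMat (ChainMap.isHom u), sub_self,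
          add_zero]
      obtain ⟨rfl, rfl, rfl⟩ := triangle_nondegenerate hij hjk ⟨h1, h2⟩
      exact hd)
    -- Every 3-simplex of `Δ[2]` is degenerate: two neighbouring vertices agree, and the relation
    -- reduces to the normalisation.
    (fun i j k l hij hjk hkl => by
      by_cases h1 : i = j
      · subst h1
        rw [hKl, hG1, zero_mcomp, idMat_mcomp (hKh i k l (hij.trans hjk) hkl), hKl, zero_add,
          add_zero]
      by_cases h2 : j = k
      · subst h2
        rw [hKr, hKl, zero_mcomp, mcomp_zero]
      by_cases h3 : k = l
      · subst h3
        rw [hKr, hKr, mcomp_zero, hG1, mcomp_idMat (hKh i j k hij hjk), zero_add, add_zero]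
      obtain ⟨rfl, rfl, rfl⟩ := triangle_nondegenerate hij hjk ⟨h1, h2⟩
      have := (triangle_nondegenerate hjk hkl ⟨h2, h3⟩).1
      exact absurd this (by decide))
    (fun i j k l m hij hjk hkl hlm => by
      by_cases h1 : i ≠ j ∧ j ≠ k
      · by_cases h2 : k ≠ l ∧ l ≠ m
        · have e1 := (triangle_nondegenerate hij hjk h1).2.2
          have e2 := (triangle_nondegenerate hkl hlm h2).1
          exact absurd (e1.symm.trans e2) (by decide)
        · rw [show K k l m = 0 from if_neg h2, mcomp_zero]
      · rw [show K i j k = 0 from if_neg h1, zero_mcomp])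

end DGSimplex

variable {R : CommRingCat.{0}}

/-- A homotopy inverse and its two homotopies fill the two triangles. The homotopies change sign
because `Htpy` measures the composition minus the identity, whereas a triangle measures the long
edge minus the composition. -/
theorem isEquivEdge_of_isHtpyEquiv (e : DGSimplex S R ⦋1⦌) (he : IsHtpyEquiv (e.edge (𝟙 _))) :
    IsEquivEdge ((dgNerve S).obj R) e := by
  obtain ⟨g, ⟨H, hH, hd⟩, K, hK, kd⟩ := (isHtpyEquiv_iff _).1 he
  have hH' : IsHom (e.cpx 1).rank (e.cpx 1).rank (-1) (-H) := hH.neg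
  have hK' : IsHom (e.cpx 0).rank (e.cpx 0).rank (-1) (-K) := hK.neg
  let f : e.cpx 1 ⟶ e.cpx 0 := e.edge (𝟙 _)
  let g' : e.cpx 0 ⟶ e.cpx 1 := g
  let s : DGSimplex S R ⦋2⦌ := DGSimplex.triangle f g' (𝟙 _) (-K) hK' (by
    rw [mcomp_neg, neg_mcomp, ← neg_add]
    refine (congrArg (fun M => -M) kd).trans (neg_sub _ _))
  let t : DGSimplex S R ⦋2⦌ := DGSimplex.triangle g' f (𝟙 _) (-H) hH' (by
    rw [mcomp_neg, neg_mcomp, ← neg_add]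
    refine (congrArg (fun M => -M) hd).trans (neg_sub _ _))
  refine ⟨DGSimplex.pull (SimplexCategory.δ 0) s, s, t, ⟨?_, rfl, ?_⟩, ?_, ?_, ?_⟩
  · exact DGSimplex.ext_one rfl rfl rfl rfl rfl
  · refine DGSimplex.ext_one rfl rfl rfl rfl ?_
    refine Eq.symm (e.degen_one _ ?_)
    rfl
  · exact DGSimplex.ext_one rfl rfl rfl rfl rfl
  · exact DGSimplex.ext_one rfl rfl rfl rfl rfl
  · refine DGSimplex.ext_one rfl rfl rfl rfl ?_
    refine Eq.symm (e.degen_one _ ?_)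
    rfl

theorem mem_core_of_isHtpyEquiv {n : SimplexCategory} (x : DGSimplex S R n)
    (hx : ∀ J : ⦋1⦌ ⟶ n, IsHtpyEquiv (x.edge J)) (f : ⦋1⦌ ⟶ n) :
    IsEquivEdge ((dgNerve S).obj R) (((dgNerve S).obj R).map f.op x) :=
  isEquivEdge_of_isHtpyEquiv (x.pull f) (hx (𝟙 _ ≫ f))

end dgEquivalences

/-! ### The edges of a simplicial twisting cochain are homotopy equivalences -/

section edges

variable {S : Set ℤ}

theorem DGSimplex.isHtpyEquiv_edge_base {R R' : Type} [CommRing R] [CommRing R'] (f : R →+* R')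
    {n : SimplexCategory} (x : DGSimplex S R n) (J : ⦋1⦌ ⟶ n) (h : IsHtpyEquiv (x.edge J)) :
    IsHtpyEquiv ((x.base f).edge J) :=
  h.map f

/-- The faces 012 and 123 exhibit the edges 02 and 13, up to homotopy, as compositions sharing the
edge 12. Two-out-of-six gives the edge 01. -/
theorem DGSimplex.isHtpyEquiv_edge_of_three {R : Type} [CommRing R] (x : DGSimplex S R ⦋3⦌)
    (h02 : IsHtpyEquiv (x.edge (SimplexCategory.δ 1 ≫ SimplexCategory.δ 3)))
    (h13 : IsHtpyEquiv (x.edge (SimplexCategory.δ 1 ≫ SimplexCategory.δ 0))) :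
    IsHtpyEquiv (x.edge (SimplexCategory.δ 2 ≫ SimplexCategory.δ 3)) := by
  let f : x.cpx 3 ⟶ x.cpx 2 := x.edge (SimplexCategory.δ 0 ≫ SimplexCategory.δ 0)
  let g : x.cpx 2 ⟶ x.cpx 1 := x.edge (SimplexCategory.δ 0 ≫ SimplexCategory.δ 3)
  let h : x.cpx 1 ⟶ x.cpx 0 := x.edge (SimplexCategory.δ 2 ≫ SimplexCategory.δ 3)
  have e : (SimplexCategory.δ 2 ≫ SimplexCategory.δ 0 : ⦋1⦌ ⟶ ⦋3⦌) =
      SimplexCategory.δ 0 ≫ SimplexCategory.δ 3 := by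
    ext i : 3
    fin_cases i <;> rfl
  let g' : x.cpx 2 ⟶ x.cpx 1 := x.edge (SimplexCategory.δ 2 ≫ SimplexCategory.δ 0)
  have hg : g' = g := ChainMap.ext (congrArg (x.φ 1) e)
  have t1 : IsHtpyEquiv (g ≫ h) := h02.of_htpy (x.htpy_triangle (SimplexCategory.δ 3))
  have t2 : IsHtpyEquiv (f ≫ g') := h13.of_htpy (x.htpy_triangle (SimplexCategory.δ 0))
  rw [hg] at t2
  exact isHtpyEquiv_of_two_out_of_six f g h t2 t1

variable {X : Type} [TopologicalSpace X] {ι : Type} {O : (Opens X)ᵒᵖ ⥤ CommRingCat.{0}}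
  {U : ι → Opens X}

/-- Restriction of simplices of the differential graded nerve. -/
abbrev DGSimplex.res (O : (Opens X)ᵒᵖ ⥤ CommRingCat.{0}) {V W : Opens X} (h : V ⟶ W)
    {n : SimplexCategory} (x : DGSimplex S (O.obj (op W)) n) : DGSimplex S (O.obj (op V)) n :=
  x.base (O.map h.op).hom

theorem DGSimplex.res_res {V W Z : Opens X} (h : V ⟶ W) (h' : W ⟶ Z) (h'' : V ⟶ Z)
    {n : SimplexCategory} (x : DGSimplex S (O.obj (op Z)) n) :
    (x.res O h').res O h = x.res O h'' :=
  DGSimplex.ext rfl (funext fun _ => funext fun _ => resMat_resMat _ _ _ _)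

namespace SimplicialTwistingCochain

variable (A : SimplicialTwistingCochain O S U)

/-- The simplex of the differential graded nerve that belongs to a tuple. -/
def dgSimplex {b : SimplexCategory} (σ : CechSimplex U b) : DGSimplex S (O.obj (op σ.opens)) b :=
  DGSimplex.ofMaurerCartan (A.rank σ) (A.a σ) (A.isHom σ) (A.maurerCartan σ) (A.norm_one σ)
    (A.norm σ)

theorem dgSimplex_res_surjective {b' b : SimplexCategory} (d : b' ⟶ b) (σ : CechSimplex U b)
    (hd : Function.Surjective d) :
    (A.dgSimplex (σ.pull d)).res O (σ.incl d) = (A.dgSimplex σ).pull d :=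
  DGSimplex.ext (funext fun i => A.rank_degen d σ i hd)
    (funext fun k => funext fun J => A.a_degen d σ k J hd)

/-- Upper triangularity says that the inclusions intertwine the edge of the smaller tuple with that
of the larger one, and the inclusions are homotopy equivalences. -/
theorem isHtpyEquiv_edge_comp_iff {c b : SimplexCategory} (t : c ⟶ b) (σ : CechSimplex U b)
    (J : ⦋1⦌ ⟶ c) : IsHtpyEquiv (((A.dgSimplex (σ.pull t)).res O (σ.incl t)).edge J) ↔
      IsHtpyEquiv ((A.dgSimplex σ).edge (J ≫ t)) := by
  have h : ∀ m : Fin (c.len + 1), IsSplitting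
      (((A.dgSimplex (σ.pull t)).res O (σ.incl t)).cpx m).rank
      (((A.dgSimplex (σ.pull t)).res O (σ.incl t)).cpx m).d ((A.dgSimplex σ).cpx (t m)).rank
      ((A.dgSimplex σ).cpx (t m)).d (A.cmpl t σ m) := fun m => A.split t σ m
  refine isHtpyEquiv_iff_of_comm (h (J 1)).isHtpyEquiv_incl (h (J 0)).isHtpyEquiv_incl ?_
  exact ChainMap.ext (A.upper t σ 0 J).1.symm

/-- Data on degenerate tuples are degenerate, so the edge of `(α, α)` is the pullback of a vertex
and carries an identity. -/
theorem isHtpyEquiv_edge_of_degenerate (τ : CechSimplex U ⦋0⦌) {V : Opens X} (σ : CechSimplex U ⦋1⦌)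
    (hσ : σ = τ.pull (SimplexCategory.const ⦋1⦌ ⦋0⦌ 0)) (h : V ⟶ σ.opens) :
    IsHtpyEquiv (((A.dgSimplex σ).res O h).edge (𝟙 _)) := by
  subst hσ
  let d : ⦋1⦌ ⟶ ⦋0⦌ := SimplexCategory.const ⦋1⦌ ⦋0⦌ 0
  have hd : Function.Surjective d := fun i => ⟨0, Subsingleton.elim (α := Fin 1) _ _⟩
  let h' : V ⟶ τ.opens := τ.homOfLE fun i => by
    obtain ⟨j, rfl⟩ := hd i
    exact (leOfHom h).trans ((τ.pull d).opens_le j)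
  rw [← DGSimplex.res_res h' (τ.incl d) h, A.dgSimplex_res_surjective d τ hd]
  refine DGSimplex.isHtpyEquiv_edge_base _ _ _ ?_
  have e : ((A.dgSimplex τ).pull d).edge (𝟙 _) = 𝟙 ((A.dgSimplex τ).cpx 0) :=
    ChainMap.ext ((A.dgSimplex τ).degen_one (𝟙 _ ≫ d) rfl)
  rw [e]
  change IsIso ((toHtpyCat S _).map (𝟙 _))
  infer_instance

/-- Inside a longer tuple the edge between two equal indices need not be an identity, but it agrees
with that of `(α, α)` up to homotopy equivalences. -/
theorem isHtpyEquiv_edge_of_vertex_eq {b : SimplexCategory} (σ : CechSimplex U b) (J : ⦋1⦌ ⟶ b)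
    (h : σ.vertex (J 0) = σ.vertex (J 1)) : IsHtpyEquiv ((A.dgSimplex σ).edge J) := by
  have h1 := A.isHtpyEquiv_edge_of_degenerate (σ.pull (SimplexCategory.const ⦋0⦌ b (J 0)))
    (σ.pull J) (by
      ext i
      fin_cases i
      · rfl
      · exact h.symm) (σ.incl J)
  have h2 := (A.isHtpyEquiv_edge_comp_iff J σ (𝟙 _)).1 h1
  have e : 𝟙 _ ≫ J = J := Category.id_comp J
  rwa [e] at h2

/-- With `α` and `β` the two indices of the edge, the tuple `(α, β, α, β)` is available over
`σ.opens`. Its edges 02 and 13 join equal indices, so its edge 01 is a homotopy equivalence. This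
descends to the subtuple `(α, β)` and ascends again to `σ`. -/
theorem isHtpyEquiv_edge {b : SimplexCategory} (σ : CechSimplex U b) (J : ⦋1⦌ ⟶ b) :
    IsHtpyEquiv ((A.dgSimplex σ).edge J) := by
  let w : Fin 4 → ι := ![σ.vertex (J 0), σ.vertex (J 1), σ.vertex (J 0), σ.vertex (J 1)]
  have hw : ∀ i, σ.opens ≤ U (w i) := by
    intro i
    fin_cases i
    · exact σ.opens_le (J 0)
    · exact σ.opens_le (J 1)
    · exact σ.opens_le (J 0)
    · exact σ.opens_le (J 1)
  let ρ : CechSimplex U ⦋3⦌ := CechSimplex.ofLE (V := σ.opens) σ.nonempty w hw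
  let K : ⦋1⦌ ⟶ ⦋3⦌ := SimplexCategory.δ 2 ≫ SimplexCategory.δ 3
  have h1 : IsHtpyEquiv ((A.dgSimplex ρ).edge K) :=
    DGSimplex.isHtpyEquiv_edge_of_three _ (A.isHtpyEquiv_edge_of_vertex_eq ρ _ rfl)
      (A.isHtpyEquiv_edge_of_vertex_eq ρ _ rfl)
  have h2 : IsHtpyEquiv (((A.dgSimplex (ρ.pull K)).res O (ρ.incl K)).edge (𝟙 _)) := by
    rw [A.isHtpyEquiv_edge_comp_iff K ρ (𝟙 _)]
    have e : 𝟙 _ ≫ K = K := Category.id_comp K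
    rwa [e]
  have h3 := DGSimplex.isHtpyEquiv_edge_base (O.map (ρ.homOfLE hw).op).hom _ _ h2
  -- The pair `(α, β)` arises from `ρ` and from `σ`; the two tuples are equal, but their data have
  -- types depending on the tuple.
  have key : ∀ (τ τ' : CechSimplex U ⦋1⦌) (h : σ.opens ⟶ τ.opens) (h' : σ.opens ⟶ τ'.opens),
      τ = τ' → IsHtpyEquiv (((A.dgSimplex τ).res O h).edge (𝟙 _)) →
      IsHtpyEquiv (((A.dgSimplex τ').res O h').edge (𝟙 _)) := by
    rintro τ _ h h' rfl
    obtain rfl : h = h' := Subsingleton.elim _ _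
    exact id
  have h4 := key (ρ.pull K) (σ.pull J) (ρ.homOfLE hw ≫ ρ.incl K) (σ.incl J) (by
    ext i
    fin_cases i <;> rfl) (by
    rw [← DGSimplex.res_res (ρ.homOfLE hw) (ρ.incl K)]
    exact h3)
  have h5 := (A.isHtpyEquiv_edge_comp_iff J σ (𝟙 _)).1 h4
  have e : 𝟙 _ ≫ J = J := Category.id_comp J
  rwa [e] at h5

/-- The simplex of the core of the differential graded nerve that belongs to a tuple. -/
def simplex {b : SimplexCategory} (σ : CechSimplex U b) :
    ((Twist S).obj (O.obj (op σ.opens))).obj (op b) :=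
  ⟨A.dgSimplex σ, mem_core_of_isHtpyEquiv _ (A.isHtpyEquiv_edge σ)⟩

end SimplicialTwistingCochain

end edges

/-! ### Vertices of the totalisation of labellings are determined by the full simplices -/

section labellings

variable {X : Type} [TopologicalSpace X] {ι : Type} {O : (Opens X)ᵒᵖ ⥤ CommRingCat.{0}}
  {S : Set ℤ} {U : ι → Opens X}

theorem Cmpl.map_map {V W Z : Opens X} (h : V ⟶ W) (h' : W ⟶ Z) (h'' : V ⟶ Z)
    (c : Cmpl (O.obj (op Z))) :
    (c.map (O.map h'.op).hom).map (O.map h.op).hom = c.map (O.map h''.op).hom :=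
  Cmpl.ext rfl (resMat_resMat h h' h'' c.inc) (resMat_resMat h h' h'' c.perp)

theorem GTT.dgSimplex_ext {R : CommRingCat.{0}} {n : SimplexCategory} {x y : GTT S R n}
    (h1 : ∀ {b : SimplexCategory} (s : b ⟶ n) (i : Fin (b.len + 1)),
      (x.lab s).1.rank i = (y.lab s).1.rank i)
    (h2 : ∀ {b : SimplexCategory} (s : b ⟶ n) (k : ℕ) (J : ⦋k⦌ ⟶ b),
      (x.lab s).1.φ k J = (y.lab s).1.φ k J)
    (h3 : ∀ {a b : SimplexCategory} (t : a ⟶ b) (s : b ⟶ n) (m : Fin (a.len + 1)),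
      x.cmpl t s m = y.cmpl t s m) : x = y := by
  refine GTT.ext ?_ ?_
  · funext b s
    exact Subtype.ext (DGSimplex.ext (funext fun i => h1 s i)
      (funext fun k => funext fun J => h2 s k J))
  · funext a b t s m
    exact h3 t s m

/-- Compatibility of labellings with reindexing. -/
def IsGTTCompat (x : ∀ {b : SimplexCategory} (σ : CechSimplex U b),
    GTT S (O.obj (op σ.opens)) b) : Prop :=
  ∀ {a b : SimplexCategory} (f : a ⟶ b) (σ : CechSimplex U b),
    (x (σ.pull f)).base (O.map (σ.incl f).op) = (x σ).pull f

namespace IsGTTCompat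

variable {x : ∀ {b : SimplexCategory} (σ : CechSimplex U b), GTT S (O.obj (op σ.opens)) b}
  (hx : IsGTTCompat x)

include hx

/-- Restricting `x σ` to the face `s` turns that face into the full simplex of `σ.pull s`. Thus
labels of full simplices determine all labels. -/
theorem lab_eq {b c : SimplexCategory} (σ : CechSimplex U b) (s : c ⟶ b) :
    ((x σ).lab s).1 = ((x (σ.pull s)).lab (𝟙 c)).1.res O (σ.incl s) := by
  have h := congrArg (fun y : GTT S (O.obj (op σ.opens)) c => (y.lab (𝟙 c)).1) (hx s σ)
  have e : 𝟙 c ≫ s = s := Category.id_comp s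
  refine Eq.trans ?_ h.symm
  change _ = ((x σ).lab (𝟙 c ≫ s)).1
  rw [e]

/-- The form in which the axioms of a labelling mention a face of the full simplex. -/
theorem lab_comp_id {b c : SimplexCategory} (σ : CechSimplex U b) (s : c ⟶ b) :
    ((x σ).lab (s ≫ 𝟙 b)).1 = ((x (σ.pull s)).lab (𝟙 c)).1.res O (σ.incl s) := by
  have e : s ≫ 𝟙 b = s := Category.comp_id s
  rw [e, hx.lab_eq]

theorem cmpl_eq {a b c : SimplexCategory} (σ : CechSimplex U b) (t : a ⟶ c) (s : c ⟶ b)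
    (m : Fin (a.len + 1)) :
    (x σ).cmpl t s m = ((x (σ.pull s)).cmpl t (𝟙 c) m).map (O.map (σ.incl s).op).hom := by
  have h := congrArg (fun y : GTT S (O.obj (op σ.opens)) c => y.cmpl t (𝟙 c) m) (hx s σ)
  have e : 𝟙 c ≫ s = s := Category.id_comp s
  refine Eq.trans ?_ h.symm
  change _ = (x σ).cmpl t (𝟙 c ≫ s) m
  rw [e]

theorem cmpl_comp_id {a b c : SimplexCategory} (σ : CechSimplex U b) (t : a ⟶ c) (s : c ⟶ b)
    (m : Fin (a.len + 1)) :
    (x σ).cmpl t (s ≫ 𝟙 b) m = ((x (σ.pull s)).cmpl t (𝟙 c) m).map (O.map (σ.incl s).op).hom := by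
  have e : s ≫ 𝟙 b = s := Category.comp_id s
  rw [e, hx.cmpl_eq]

/-- The simplicial twisting cochain given by the labels of the full simplices. -/
def toSimplicialTwistingCochain : SimplicialTwistingCochain O S U where
  rank {b} σ := ((x σ).lab (𝟙 b)).1.rank
  a {b} σ := ((x σ).lab (𝟙 b)).1.φ
  cmpl {c b} t σ := (x σ).cmpl t (𝟙 b)
  isHom {b} σ := ((x σ).lab (𝟙 b)).1.isHom
  maurerCartan {b} σ := ((x σ).lab (𝟙 b)).1.maurerCartan
  norm_one {b} σ := ((x σ).lab (𝟙 b)).1.degen_one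
  norm {b} σ := ((x σ).lab (𝟙 b)).1.degen
  split {c b} t σ m := by
    have h := (x σ).split t (𝟙 b) m
    rw [hx.lab_comp_id σ t] at h
    exact h
  upper {c b} t σ k K := by
    have h := (x σ).upper t (𝟙 b) k K
    rw [hx.lab_comp_id σ t] at h
    exact h
  coherent {c' c b} t' t σ m := by
    have h := (x σ).coherent t' t (𝟙 b) m
    rw [hx.lab_comp_id σ t, hx.cmpl_comp_id σ t' t] at h
    exact h
  rank_degen {b' b} d σ i hd := by
    have h := congrArg Subtype.val ((x σ).lab_degen d (𝟙 b) hd)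
    rw [hx.lab_comp_id σ d] at h
    exact congrArg (fun y : DGSimplex S (O.obj (op σ.opens)) b' => y.rank i) h
  a_degen {b' b} d σ k J hd := by
    have h := congrArg Subtype.val ((x σ).lab_degen d (𝟙 b) hd)
    rw [hx.lab_comp_id σ d] at h
    exact congrArg (fun y : DGSimplex S (O.obj (op σ.opens)) b' => y.φ k J) h
  cmpl_surj {c b} t σ := (x σ).cmpl_surj t (𝟙 b)
  cmpl_degen_left {c' c b} d t σ := (x σ).cmpl_degen_left d t (𝟙 b)
  cmpl_degen_right {c b' b} t d σ m hd := by
    rw [← hx.cmpl_comp_id σ t d]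
    exact (x σ).cmpl_degen_right t d (𝟙 b) m hd

end IsGTTCompat

theorem IsGTTCompat.ext {x y : ∀ {b : SimplexCategory} (σ : CechSimplex U b),
    GTT S (O.obj (op σ.opens)) b} (hx : IsGTTCompat x) (hy : IsGTTCompat y)
    (h : hx.toSimplicialTwistingCochain = hy.toSimplicialTwistingCochain)
    {b : SimplexCategory} (σ : CechSimplex U b) : x σ = y σ := by
  have hr : ∀ {b : SimplexCategory} (σ : CechSimplex U b) (i : Fin (b.len + 1)),
      ((x σ).lab (𝟙 b)).1.rank i = ((y σ).lab (𝟙 b)).1.rank i := fun σ i =>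
    congrArg (fun A : SimplicialTwistingCochain O S U => A.rank σ i) h
  have ha : ∀ {b : SimplexCategory} (σ : CechSimplex U b) (k : ℕ) (J : ⦋k⦌ ⟶ b),
      ((x σ).lab (𝟙 b)).1.φ k J = ((y σ).lab (𝟙 b)).1.φ k J := fun σ k J =>
    congrArg (fun A : SimplicialTwistingCochain O S U => A.a σ k J) h
  have hc : ∀ {c b : SimplexCategory} (t : c ⟶ b) (σ : CechSimplex U b) (m : Fin (c.len + 1)),
      (x σ).cmpl t (𝟙 b) m = (y σ).cmpl t (𝟙 b) m := fun t σ m =>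
    congrArg (fun A : SimplicialTwistingCochain O S U => A.cmpl t σ m) h
  refine GTT.dgSimplex_ext (fun s i => ?_) (fun s k J => ?_) (fun t s m => ?_)
  · rw [hx.lab_eq, hy.lab_eq]
    exact hr (σ.pull s) i
  · rw [hx.lab_eq, hy.lab_eq]
    exact congrArg (resMat O (σ.incl s)) (ha (σ.pull s) k J)
  · rw [hx.cmpl_eq, hy.cmpl_eq, hc]

namespace SimplicialTwistingCochain

variable (A : SimplicialTwistingCochain O S U)

/-- The labelling that belongs to a tuple. -/
def gtt {n : SimplexCategory} (σ : CechSimplex U n) : GTT S (O.obj (op σ.opens)) n where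
  lab s := ((Twist S).map (O.map (σ.incl s).op)).app _ (A.simplex (σ.pull s))
  cmpl t s m := (A.cmpl t (σ.pull s) m).map (O.map (σ.incl s).op).hom
  split t s m := by
    have h := (A.split t (σ.pull s) m).map (O.map (σ.incl s).op).hom
    have e : ((resMat O ((σ.pull s).incl t) (A.a ((σ.pull s).pull t) 0
      (SimplexCategory.const ⦋0⦌ _ m))).map (O.map (σ.incl s).op).hom) =
      resMat O (σ.incl (t ≫ s)) (A.a (σ.pull (t ≫ s)) 0 (SimplexCategory.const ⦋0⦌ _ m)) :=
      resMat_resMat _ _ _ _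
    rw [e] at h
    exact h
  upper t s k K := by
    have h := (A.upper t (σ.pull s) k K).map (O.map (σ.incl s).op).hom
    have e : ((resMat O ((σ.pull s).incl t) (A.a ((σ.pull s).pull t) (k + 1) K)).map
      (O.map (σ.incl s).op).hom) =
      resMat O (σ.incl (t ≫ s)) (A.a (σ.pull (t ≫ s)) (k + 1) K) :=
      resMat_resMat _ _ _ _
    rw [e] at h
    exact h
  coherent t' t s m := by
    have h := congrArg (resMat O (σ.incl s)) (A.coherent t' t (σ.pull s) m)
    rw [resMat, resMat, mcomp_map] at h
    have e : ((resMat O ((σ.pull s).incl t) (A.cmpl t' ((σ.pull s).pull t) m).inc).map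
      (O.map (σ.incl s).op).hom) =
      resMat O (σ.incl (t ≫ s)) (A.cmpl t' (σ.pull (t ≫ s)) m).inc :=
      resMat_resMat _ _ _ _
    rw [e] at h
    exact h
  lab_degen d s hd := by
    refine Subtype.ext ?_
    have h := congrArg (DGSimplex.res O (σ.incl s)) (A.dgSimplex_res_surjective d (σ.pull s) hd)
    exact (DGSimplex.res_res (σ.incl s) ((σ.pull s).incl d) (σ.incl (d ≫ s)) _).symm.trans h
  cmpl_surj t s m ht := ⟨(A.cmpl_surj t (σ.pull s) m ht).1,
    (congrArg (resMat O (σ.incl s)) (A.cmpl_surj t (σ.pull s) m ht).2).trans (idMat_map _ _)⟩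
  cmpl_degen_left d t s m hd := by rw [A.cmpl_degen_left d t (σ.pull s) m hd]
  cmpl_degen_right t d s m hd := by
    rw [A.cmpl_degen_right t d (σ.pull s) m hd]
    exact Cmpl.map_map _ _ _ _

theorem gtt_compat : IsGTTCompat (fun σ => A.gtt σ) := by
  intro a b f σ
  refine GTT.dgSimplex_ext (fun s i => rfl) (fun s k J => ?_) (fun t s m => ?_)
  · exact resMat_resMat _ _ _ _
  · exact Cmpl.map_map _ _ _ _

theorem gtt_lab_id {b : SimplexCategory} (σ : CechSimplex U b) :
    ((A.gtt σ).lab (𝟙 b)).1 = A.dgSimplex σ :=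
  DGSimplex.ext rfl (funext fun k => funext fun J =>
    resMat_id (show σ.opens ⟶ σ.opens from σ.incl (𝟙 b)) (A.a σ k J))

theorem gtt_cmpl_id {c b : SimplexCategory} (t : c ⟶ b) (σ : CechSimplex U b)
    (m : Fin (c.len + 1)) : (A.gtt σ).cmpl t (𝟙 b) m = A.cmpl t σ m :=
  Cmpl.ext rfl (resMat_id (show σ.opens ⟶ σ.opens from σ.incl (𝟙 b)) _)
    (resMat_id (show σ.opens ⟶ σ.opens from σ.incl (𝟙 b)) _)

theorem toSimplicialTwistingCochain_gtt :
    IsGTTCompat.toSimplicialTwistingCochain A.gtt_compat = A := by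
  refine SimplicialTwistingCochain.ext ?_ ?_ ?_
  · funext b σ i
    rfl
  · funext b σ k J
    exact congrArg (fun y : DGSimplex S (O.obj (op σ.opens)) b => y.φ k J) (A.gtt_lab_id σ)
  · funext c b t σ m
    exact A.gtt_cmpl_id t σ m

end SimplicialTwistingCochain

/-- Vertices of the totalisation of the presheaf of labellings are the same as simplicial twisting
cochains. -/
theorem exists_equiv_simplicialTwistingCochain :
    ∃ Φ : TotZero O (sTwist S) U ≃ SimplicialTwistingCochain O S U, ∀ v, (Φ v).IsDataOf v := by
  have hv : ∀ v : TotZero O (sTwist S) U,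
      IsGTTCompat (fun {b} (σ : CechSimplex U b) => (v.comp σ : GTT S (O.obj (op σ.opens)) b)) :=
    fun v _ _ f σ => v.comp_compat f σ
  refine ⟨{ toFun v := IsGTTCompat.toSimplicialTwistingCochain (hv v)
            invFun A := TotZero.ofCompat (F := sTwist S) (fun σ => A.gtt σ) A.gtt_compat
            left_inv v := ?_
            right_inv A := ?_ }, fun v => ?_⟩
  · refine TotZero.ext fun σ => ?_
    refine (TotZero.comp_ofCompat (F := sTwist S) _ _ σ).trans ?_
    exact IsGTTCompat.ext _ (hv v) (SimplicialTwistingCochain.toSimplicialTwistingCochain_gtt _) σ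
  · refine Eq.trans ?_ A.toSimplicialTwistingCochain_gtt
    congr 1
  · exact fun σ => ⟨fun _ => rfl, fun _ _ => rfl, fun _ _ => rfl⟩

end labellings

/-! ### Linear combinations, and the matrices of vectors with respect to a basis -/

section linearCombinations

variable {S : Set ℤ} {A B C R R' T T' : Type} [CommRing R] [CommRing R'] [AddCommGroup T]
  [Module R T] [AddCommGroup T'] [Module R' T']

/-- The linear combinations of the vectors `e b`, for `b` in a finite set, with coefficients the
columns of a matrix. -/
def lc (s : Finset B) (e : B → T) (M : Matrix B C R) (c : C) : T := ∑ b ∈ s, M b c • e b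

/-- The translation between matrix products and vectors: an identity of products can be checked by
expanding vectors twice. -/
theorem lc_mcomp (s : Finset A) (t : Finset B) (e : A → T) (M : Matrix A B R) (N : Matrix B C R) :
    lc s e (mcomp t M N) = lc t (lc s e M) N := by
  funext c
  simp only [lc, mcomp, Finset.sum_smul, Finset.smul_sum, smul_smul]
  rw [Finset.sum_comm]
  simp only [mul_comm]

theorem map_lc {ρ : R →+* R'} (F : T →ₛₗ[ρ] T') (s : Finset B) (e : B → T) (M : Matrix B C R)
    (c : C) : F (lc s e M c) = lc s (fun b => F (e b)) (M.map ρ) c := by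
  simp [lc, map_sum, LinearMap.map_smulₛₗ]

theorem map_lc_linear {T' : Type} [AddCommGroup T'] [Module R T'] (F : T →ₗ[R] T') (s : Finset B)
    (e : B → T) (M : Matrix B C R) (c : C) : F (lc s e M c) = lc s (fun b => F (e b)) M c := by
  simp [lc, map_sum]

theorem lc_add (s : Finset B) (e : B → T) (M N : Matrix B C R) (c : C) :
    lc s e (M + N) c = lc s e M c + lc s e N c := by
  simp [lc, add_smul, Finset.sum_add_distrib]

/-- The vectors `e b`, for `b` in a finite set, form a basis, and the other ones vanish. -/
structure IsBasisOn (R : Type) [CommRing R] [Module R T] (s : Finset B) (e : B → T) : Prop where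
  zero : ∀ b, b ∉ s → e b = 0
  indep : ∀ a : B → R, ∑ b ∈ s, a b • e b = 0 → ∀ b ∈ s, a b = 0
  span : ∀ z : T, ∃ a : B → R, ∑ b ∈ s, a b • e b = z

theorem lc_idMat {r : Rk S} {e : Ix → T} (he : ∀ b, b ∉ basis r → e b = 0) :
    lc (basis r) e (idMat R r) = e := by
  funext c
  simp only [lc, idMat, ite_smul, one_smul, zero_smul]
  by_cases hc : c ∈ basis r
  · rw [Finset.sum_eq_single c]
    · simp [hc]
    · intro b _ hb
      simp [hb]
    · exact fun h => absurd hc h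
  · rw [he c hc, Finset.sum_eq_zero]
    intro b _
    rw [if_neg (fun h => hc h.2)]

/-- The support conditions are needed because rows outside `s` do not affect linear combinations. -/
theorem IsBasisOn.lc_injective {s : Finset B} {e : B → T} (h : IsBasisOn R s e)
    {M M' : Matrix B C R} (hM : ∀ b c, M b c ≠ 0 → b ∈ s) (hM' : ∀ b c, M' b c ≠ 0 → b ∈ s)
    (heq : ∀ c, lc s e M c = lc s e M' c) : M = M' := by
  ext b c
  by_cases hb : b ∈ s
  · have h1 := h.indep (fun b => M b c - M' b c) (by
      simp only [sub_smul, Finset.sum_sub_distrib]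
      exact sub_eq_zero.2 (heq c)) b hb
    exact sub_eq_zero.1 h1
  · rw [not_ne_iff.1 fun h0 => hb (hM b c h0), not_ne_iff.1 fun h0 => hb (hM' b c h0)]

/-- The matrix of a family of vectors with respect to a basis. -/
def IsBasisOn.mat {s : Finset B} {e : B → T} (h : IsBasisOn R s e) (w : C → T) : Matrix B C R :=
  open scoped Classical in fun b c => if b ∈ s then (h.span (w c)).choose b else 0

theorem IsBasisOn.lc_mat {s : Finset B} {e : B → T} (h : IsBasisOn R s e) (w : C → T) :
    lc s e (h.mat w) = w := by
  funext c
  refine Eq.trans ?_ (h.span (w c)).choose_spec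
  refine Finset.sum_congr rfl fun b hb => ?_
  rw [IsBasisOn.mat, if_pos hb]

theorem IsBasisOn.mem_of_mat_ne_zero {s : Finset B} {e : B → T} (h : IsBasisOn R s e) (w : C → T)
    {b : B} {c : C} (hbc : h.mat w b c ≠ 0) : b ∈ s := by
  by_contra hb
  exact hbc (if_neg hb)

theorem IsBasisOn.mat_eq_zero {s : Finset B} {e : B → T} (h : IsBasisOn R s e) {w : C → T} {c : C}
    (hc : w c = 0) (b : B) : h.mat w b c = 0 := by
  by_cases hb : b ∈ s
  · refine h.indep (fun b => h.mat w b c) ?_ b hb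
    rw [← hc]
    exact congrFun (h.lc_mat w) c
  · exact if_neg hb

end linearCombinations

/-! ### Homogeneous bases of graded modules. -/

section graded

variable {S : Set ℤ} {B C R : Type} [CommRing R] {X : ℤ → Type} [∀ n, AddCommGroup (X n)]
  [∀ n, Module R (X n)]

/-- The vectors `e b` are homogeneous of degree `deg b`. -/
def IsHomogeneous (deg : B → ℤ) (e : B → ∀ n, X n) : Prop := ∀ b n, n ≠ deg b → e b n = 0

theorem sum_apply_eq_sum_filter {s : Finset B} {deg : B → ℤ} {e : B → ∀ n, X n}
    (he : IsHomogeneous deg e) (a : B → R) (n : ℤ) :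
    (∑ b ∈ s, a b • e b) n = ∑ b ∈ s with deg b = n, a b • e b n := by
  rw [Finset.sum_apply, Finset.sum_filter]
  refine Finset.sum_congr rfl fun b _ => ?_
  split_ifs with h
  · rfl
  · rw [Pi.smul_apply, he b n (fun h' => h h'.symm), smul_zero]

/-- A finite family can span the product over all degrees: spanning in each degree makes `X n`
vanish for all degrees that do not occur in `s`. -/
theorem isBasisOn_of_graded {s : Finset B} {deg : B → ℤ} {e : B → ∀ n, X n}
    (he : IsHomogeneous deg e) (zero : ∀ b, b ∉ s → e b = 0)
    (indep : ∀ (n : ℤ) (a : B → R), ∑ b ∈ s with deg b = n, a b • e b n = 0 →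
      ∀ b ∈ s, deg b = n → a b = 0)
    (span : ∀ (n : ℤ) (z : X n), ∃ a : B → R, ∑ b ∈ s with deg b = n, a b • e b n = z) :
    IsBasisOn R s e where
  zero := zero
  indep a ha b hb := by
    refine indep (deg b) a ?_ b hb rfl
    rw [← sum_apply_eq_sum_filter he, ha]
    rfl
  span z := by
    choose a ha using span
    -- The coefficient at `b` is taken from the expansion of the component of `z` in the degree of
    -- `b`.
    refine ⟨fun b => a (deg b) (z (deg b)) b, funext fun n => ?_⟩
    rw [sum_apply_eq_sum_filter he, ← ha n (z n)]
    refine Finset.sum_congr rfl fun b hb => ?_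
    obtain ⟨-, rfl⟩ := Finset.mem_filter.1 hb
    rfl

/-- Discarding the coefficients outside degree `n` does not change a vector that is concentrated in
degree `n`; by uniqueness these coefficients were zero. -/
theorem IsBasisOn.deg_eq_of_mat_ne_zero {s : Finset B} {deg : B → ℤ} {e : B → ∀ n, X n}
    (h : IsBasisOn R s e) (he : IsHomogeneous deg e) {w : C → ∀ n, X n} {b : B} {c : C} {n : ℤ}
    (hw : ∀ m, m ≠ n → w c m = 0) (hbc : h.mat w b c ≠ 0) : deg b = n := by
  classical
  by_contra hn
  refine hbc ?_
  have h1 : (fun b (_ : Unit) => h.mat w b c) =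
      fun b (_ : Unit) => if deg b = n then h.mat w b c else 0 := by
    refine h.lc_injective (fun b _ => h.mem_of_mat_ne_zero w) (fun b _ h' => ?_) fun _ => ?_
    · by_cases hb : deg b = n
      · rw [if_pos hb] at h'
        exact h.mem_of_mat_ne_zero w h'
      · exact absurd (if_neg hb) h'
    · have h2 : lc s e (fun b (_ : Unit) => h.mat w b c) () = w c := congrFun (h.lc_mat w) c
      rw [h2]
      funext m
      change w c m = (∑ b ∈ s, (if deg b = n then h.mat w b c else 0) • e b) m
      rw [sum_apply_eq_sum_filter he]
      by_cases hm : m = n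
      · subst hm
        refine (congrFun h2.symm m).trans ((sum_apply_eq_sum_filter he _ _).trans ?_)
        refine Finset.sum_congr rfl fun b hb => ?_
        rw [if_pos (Finset.mem_filter.1 hb).2]
      · rw [hw m hm, Finset.sum_eq_zero]
        intro b hb
        rw [if_neg, zero_smul]
        rw [(Finset.mem_filter.1 hb).2]
        exact hm
  have h3 := congrFun (congrFun h1 b) ()
  rw [if_neg hn] at h3
  exact h3

theorem sum_basis_filter (r : Rk S) {Y : Type} [AddCommMonoid Y] (f : Ix → Y) (n : ℤ) :
    ∑ b ∈ basis r with b.1 = n, f b = ∑ x ∈ Finset.range (r.1 n), f ⟨n, x⟩ := by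
  have h : (basis r).filter (fun b => b.1 = n) =
      (Finset.range (r.1 n)).map ⟨fun x => (⟨n, x⟩ : Ix), fun x y h => by simpa using h⟩ := by
    ext ⟨m, x⟩
    simp only [basis, Finset.mem_filter, Finset.mem_sigma, Finsupp.mem_support_iff,
      Finset.mem_range, Finset.mem_map]
    constructor
    · rintro ⟨⟨-, h2⟩, rfl⟩
      exact ⟨x, h2, rfl⟩
    · rintro ⟨y, hy, h⟩
      cases h
      exact ⟨⟨by omega, hy⟩, rfl⟩
  rw [h, Finset.sum_map]
  rfl

theorem mem_basis {r : Rk S} {n : ℤ} {x : ℕ} : (⟨n, x⟩ : Ix) ∈ basis r ↔ x < r.1 n := by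
  simp only [basis, Finset.mem_sigma, Finsupp.mem_support_iff, Finset.mem_range]
  omega

/-- The homogeneous vectors of the total module that are given by frames in all degrees. -/
def totalFrame (e : ∀ n, ℕ → X n) (b : Ix) : ∀ n, X n := Pi.single b.1 (e b.1 b.2)

theorem isHomogeneous_totalFrame (e : ∀ n, ℕ → X n) :
    IsHomogeneous (fun b : Ix => b.1) (totalFrame e) :=
  fun _ _ h => Pi.single_eq_of_ne h _

theorem totalFrame_apply (e : ∀ n, ℕ → X n) (n : ℤ) (x : ℕ) : totalFrame e ⟨n, x⟩ n = e n x :=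
  Pi.single_eq_same _ _

theorem lc_totalFrame_apply (r : Rk S) (e : ∀ n, ℕ → X n) (M : Matrix Ix C R) (c : C) (n : ℤ) :
    lc (basis r) (totalFrame e) M c n = ∑ x ∈ Finset.range (r.1 n), M ⟨n, x⟩ c • e n x := by
  rw [lc, sum_apply_eq_sum_filter (isHomogeneous_totalFrame e), sum_basis_filter]
  simp only [totalFrame_apply]

theorem isBasisOn_totalFrame (r : Rk S) (e : ∀ n, ℕ → X n)
    (he : ∀ n, IsFrame R (r.1 n) (e n)) : IsBasisOn R (basis r) (totalFrame e) := by
  refine isBasisOn_of_graded (isHomogeneous_totalFrame e) ?_ ?_ ?_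
  · rintro ⟨n, x⟩ hb
    rw [mem_basis, not_lt] at hb
    rw [totalFrame, (he n).1 x hb, Pi.single_zero]
  · rintro n a ha ⟨m, x⟩ hb rfl
    rw [sum_basis_filter] at ha
    simp only [totalFrame_apply] at ha
    rw [Finset.sum_range] at ha
    have h0 := (he m).2.1 (a₁ := fun x => a ⟨m, x⟩) (a₂ := 0) (by simpa using ha)
    exact congrFun h0 ⟨x, mem_basis.1 hb⟩
  · intro n z
    obtain ⟨c, hc⟩ := (he n).2.2 z
    refine ⟨fun b => if h : b.2 < r.1 n then c ⟨b.2, h⟩ else 0, ?_⟩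
    rw [sum_basis_filter, ← hc, Finset.sum_range]
    simp [totalFrame_apply]

end graded

/-! ### The total modules of a Green complex -/

theorem mem_ebasis {el : El} {y : EIx} :
    y ∈ ebasis el ↔ y.1 < el.length ∧ y.2.2 < (el.getD y.1 (0, 0)).1 := by
  obtain ⟨j, b, a⟩ := y
  simp [ebasis]

theorem mem_ebasis_iff_of_getElem?_eq {el el' : El} {y : EIx} (h : el[y.1]? = el'[y.1]?) :
    y ∈ ebasis el ↔ y ∈ ebasis el' := by
  have h1 : y.1 < el.length ↔ y.1 < el'.length := by
    rw [← not_le, ← not_le, ← List.getElem?_eq_none_iff, ← List.getElem?_eq_none_iff, h]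
  rw [mem_ebasis, mem_ebasis, List.getD_eq_getElem?_getD, List.getD_eq_getElem?_getD, h, h1]

section greenTotal

variable {X : Type} [TopologicalSpace X] {ι : Type} {O : (Opens X)ᵒᵖ ⥤ CommRingCat.{0}}
  {S : Set ℤ} {U : ι → Opens X}

namespace GreenComplex

variable (G : GreenComplex O S U)

/-- The product over all degrees of the modules of a Green complex. -/
abbrev Tot {b : SimplexCategory} (σ : CechSimplex U b) : Type := ∀ n, (G.E σ).X n

/-- The frames as bases of the total module. -/
abbrev basisVec {b : SimplexCategory} (σ : CechSimplex U b) (i : Fin (b.len + 1)) (c : Ix) :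
    G.Tot σ :=
  totalFrame (G.frame σ i) c

/-- The differential of the total module. -/
def totD {b : SimplexCategory} (σ : CechSimplex U b) : G.Tot σ →ₗ[O.obj (op σ.opens)] G.Tot σ :=
  LinearMap.pi fun m => ((G.E σ).d (m - 1) m).hom ∘ₗ LinearMap.proj (m - 1)

/-- The equation `k + 1 = m` as a hypothesis avoids transport along `m - 1 + 1 = m`. -/
theorem totD_apply {b : SimplexCategory} (σ : CechSimplex U b) (z : G.Tot σ) {k m : ℤ}
    (h : k + 1 = m) : G.totD σ z m = (G.E σ).d k m (z k) := by
  obtain rfl : k = m - 1 := by omega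
  rfl

theorem totD_totD {b : SimplexCategory} (σ : CechSimplex U b) (z : G.Tot σ) :
    G.totD σ (G.totD σ z) = 0 := by
  funext m
  rw [G.totD_apply σ _ (show m - 1 + 1 = m by omega),
    G.totD_apply σ _ (show m - 2 + 1 = m - 1 by omega)]
  exact congrArg (fun f : (G.E σ).X (m - 2) ⟶ (G.E σ).X m => f (z (m - 2)))
    ((G.E σ).d_comp_d (m - 2) (m - 1) m)

/-- The maps of complexes on the total modules. -/
def totTr {c b : SimplexCategory} (t : c ⟶ b) (σ : CechSimplex U b) :
    G.Tot (σ.pull t) →ₛₗ[(O.map (σ.incl t).op).hom] G.Tot σ where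
  toFun z n := G.tr t σ n (z n)
  map_add' z w := funext fun n => map_add (G.tr t σ n) (z n) (w n)
  map_smul' a z := funext fun n => LinearMap.map_smulₛₗ (G.tr t σ n) a (z n)

/-- The basis vectors of the elementary complements, in the total module. -/
def totEvec {c b : SimplexCategory} (t : c ⟶ b) (σ : CechSimplex U b) (m : Fin (c.len + 1))
    (y : EIx) : G.Tot σ :=
  fun n => G.evec t σ m n y

theorem isBasisOn_basisVec {b : SimplexCategory} (σ : CechSimplex U b) (i : Fin (b.len + 1)) :
    IsBasisOn (O.obj (op σ.opens)) (basis (G.rank σ i)) (G.basisVec σ i) :=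
  isBasisOn_totalFrame _ _ (G.isFrame σ i)

theorem totTr_totD {c b : SimplexCategory} (t : c ⟶ b) (σ : CechSimplex U b)
    (z : G.Tot (σ.pull t)) : G.totTr t σ (G.totD (σ.pull t) z) = G.totD σ (G.totTr t σ z) := by
  funext m
  obtain ⟨k, rfl⟩ : ∃ k, k + 1 = m := ⟨m - 1, by omega⟩
  rw [G.totD_apply σ _ rfl]
  change G.tr t σ (k + 1) (G.totD (σ.pull t) z (k + 1)) = _
  rw [G.totD_apply (σ.pull t) _ rfl]
  exact G.tr_d t σ k (z k)

theorem totTr_comp {c' c b : SimplexCategory} (t' : c' ⟶ c) (t : c ⟶ b) (σ : CechSimplex U b)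
    (z : G.Tot (σ.pull (t' ≫ t))) :
    G.totTr (t' ≫ t) σ z = G.totTr t σ (G.totTr t' (σ.pull t) z) :=
  funext fun n => G.tr_comp t' t σ n (z n)

theorem totEvec_eq_zero {c b : SimplexCategory} (t : c ⟶ b) (σ : CechSimplex U b)
    (m : Fin (c.len + 1)) (y : EIx) (hy : y ∉ ebasis (G.el t σ m)) : G.totEvec t σ m y = 0 :=
  funext fun n => not_ne_iff.1 fun h => hy (G.evec_supp t σ m n y h).1

theorem isHomogeneous_totEvec {c b : SimplexCategory} (t : c ⟶ b) (σ : CechSimplex U b)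
    (m : Fin (c.len + 1)) : IsHomogeneous (edeg (G.el t σ m)) (G.totEvec t σ m) :=
  fun y n hn => not_ne_iff.1 fun h => hn (G.evec_supp t σ m n y h).2.symm

theorem totD_totEvec_lower {c b : SimplexCategory} (t : c ⟶ b) (σ : CechSimplex U b)
    (m : Fin (c.len + 1)) (j a : ℕ) :
    G.totD σ (G.totEvec t σ m ⟨j, false, a⟩) = G.totEvec t σ m ⟨j, true, a⟩ := by
  funext n
  obtain ⟨k, rfl⟩ : ∃ k, k + 1 = n := ⟨n - 1, by omega⟩
  rw [G.totD_apply σ _ rfl]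
  exact G.evec_d_lower t σ m k j a

theorem totD_totEvec_upper {c b : SimplexCategory} (t : c ⟶ b) (σ : CechSimplex U b)
    (m : Fin (c.len + 1)) (j a : ℕ) : G.totD σ (G.totEvec t σ m ⟨j, true, a⟩) = 0 := by
  funext n
  obtain ⟨k, rfl⟩ : ∃ k, k + 1 = n := ⟨n - 1, by omega⟩
  rw [G.totD_apply σ _ rfl]
  exact G.evec_d_upper t σ m k j a

theorem totTr_basisVec {c b : SimplexCategory} (t : c ⟶ b) (σ : CechSimplex U b)
    (m : Fin (c.len + 1)) (n : ℤ) (x : ℕ) :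
    G.totTr t σ (G.basisVec (σ.pull t) m ⟨n, x⟩) =
      Pi.single n (G.tr t σ n (G.frame (σ.pull t) m n x)) := by
  funext k
  by_cases hk : k = n
  · subst hk
    rw [Pi.single_eq_same]
    exact congrArg (G.tr t σ k) (Pi.single_eq_same _ _)
  · rw [Pi.single_eq_of_ne hk]
    exact (congrArg (G.tr t σ k) (Pi.single_eq_of_ne hk _)).trans (map_zero _)

theorem totTr_basisVec_of_surjective {c b : SimplexCategory} (t : c ⟶ b) (σ : CechSimplex U b)
    (m : Fin (c.len + 1)) (ht : Function.Surjective t) (x : Ix) :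
    G.totTr t σ (G.basisVec (σ.pull t) m x) = G.basisVec σ (t m) x := by
  obtain ⟨n, x⟩ := x
  rw [totTr_basisVec, G.frame_surj t σ m n x ht]
  rfl

/-- The degrees of the vectors in a direct sum decomposition. -/
abbrev sumDeg (el : El) : Ix ⊕ EIx → ℤ := Sum.elim (fun c => c.1) (edeg el)

/-- The vectors in the direct sum decomposition for a pair of tuples. -/
abbrev sumVec {c b : SimplexCategory} (t : c ⟶ b) (σ : CechSimplex U b) (m : Fin (c.len + 1)) :
    Ix ⊕ EIx → G.Tot σ :=
  Sum.elim (fun c => G.totTr t σ (G.basisVec (σ.pull t) m c)) (G.totEvec t σ m)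

theorem isHomogeneous_sumVec {c b : SimplexCategory} (t : c ⟶ b) (σ : CechSimplex U b)
    (m : Fin (c.len + 1)) : IsHomogeneous (sumDeg (G.el t σ m)) (G.sumVec t σ m) := by
  rintro (⟨n, x⟩ | y) k hk
  · change G.totTr t σ (G.basisVec (σ.pull t) m ⟨n, x⟩) k = 0
    rw [totTr_basisVec]
    exact Pi.single_eq_of_ne hk _
  · exact G.isHomogeneous_totEvec t σ m y k hk

theorem sum_filter_sumVec {c b : SimplexCategory} (t : c ⟶ b) (σ : CechSimplex U b)
    (m : Fin (c.len + 1)) (n : ℤ) (a : Ix ⊕ EIx → O.obj (op σ.opens)) :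
    ∑ x ∈ (basis (G.rank (σ.pull t) m)).disjSum (ebasis (G.el t σ m)) with
        sumDeg (G.el t σ m) x = n, a x • G.sumVec t σ m x n =
      ∑ x : Fin ((G.rank (σ.pull t) m).1 n), a (Sum.inl ⟨n, x⟩) •
        G.tr t σ n (G.frame (σ.pull t) m n x) +
      ∑ y : {y // y ∈ (ebasis (G.el t σ m)).filter fun y => edeg (G.el t σ m) y = n},
        a (Sum.inr y.1) • G.evec t σ m n y.1 := by
  rw [Finset.sum_filter, Finset.sum_disjSum, ← Finset.sum_filter, ← Finset.sum_filter]
  congr 1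
  · refine (sum_basis_filter (G.rank (σ.pull t) m)
      (fun x => a (Sum.inl x) • G.sumVec t σ m (Sum.inl x) n) n).trans ?_
    rw [Finset.sum_range]
    refine Finset.sum_congr rfl fun x _ => ?_
    change _ • G.totTr t σ (G.basisVec (σ.pull t) m ⟨n, x⟩) n = _
    rw [totTr_basisVec, Pi.single_eq_same]
  · exact (Finset.sum_coe_sort ((ebasis (G.el t σ m)).filter fun y => edeg (G.el t σ m) y = n)
      fun y => a (Sum.inr y) • G.evec t σ m n y).symm

/-- The axiom `decomposition` in all degrees at once. -/
theorem isBasisOn_sumVec {c b : SimplexCategory} (t : c ⟶ b) (σ : CechSimplex U b)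
    (m : Fin (c.len + 1)) : IsBasisOn (O.obj (op σ.opens))
      ((basis (G.rank (σ.pull t) m)).disjSum (ebasis (G.el t σ m))) (G.sumVec t σ m) := by
  refine isBasisOn_of_graded (G.isHomogeneous_sumVec t σ m) ?_ ?_ ?_
  · rintro (x | y) hx
    · rw [Finset.inl_mem_disjSum] at hx
      change G.totTr t σ (G.basisVec (σ.pull t) m x) = 0
      rw [(G.isBasisOn_basisVec (σ.pull t) m).zero x hx, map_zero]
    · rw [Finset.inr_mem_disjSum] at hx
      exact G.totEvec_eq_zero t σ m y hx
  · intro n a ha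
    rw [sum_filter_sumVec] at ha
    have h := (G.decomposition t σ m n).1
      (a₁ := (fun x => a (Sum.inl ⟨n, x⟩), fun y => a (Sum.inr y.1))) (a₂ := 0) (by simpa using ha)
    rw [Prod.mk_eq_zero] at h
    rintro (⟨k, x⟩ | y) hx hn
    · rw [Finset.inl_mem_disjSum] at hx
      subst hn
      exact congrFun h.1 ⟨x, mem_basis.1 hx⟩
    · rw [Finset.inr_mem_disjSum] at hx
      exact congrFun h.2 ⟨y, Finset.mem_filter.2 ⟨hx, hn⟩⟩
  · intro n z
    classical
    obtain ⟨⟨p, q⟩, hpq⟩ := (G.decomposition t σ m n).2 z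
    refine ⟨Sum.elim (fun x => if h : x.2 < (G.rank (σ.pull t) m).1 n then p ⟨x.2, h⟩ else 0)
      (fun y => if h : y ∈ (ebasis (G.el t σ m)).filter fun y => edeg (G.el t σ m) y = n
        then q ⟨y, h⟩ else 0), ?_⟩
    rw [sum_filter_sumVec, ← hpq]
    congr 1
    · refine Finset.sum_congr rfl fun x _ => ?_
      simp
    · refine Finset.sum_congr rfl fun y _ => ?_
      rw [Sum.elim_inr, dif_pos y.2]

theorem lc_emor {c b : SimplexCategory} (t : c ⟶ b) (σ : CechSimplex U b) (m : Fin (c.len + 1))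
    (el : El) (y : EIx) :
    lc (ebasis (G.el t σ m)) (G.totEvec t σ m) (emor (O.obj (op σ.opens)) el (G.el t σ m)) y =
      if el[y.1]? = (G.el t σ m)[y.1]? then G.totEvec t σ m y else 0 := by
  simp only [lc, emor, ite_smul, one_smul, zero_smul]
  by_cases hel : el[y.1]? = (G.el t σ m)[y.1]?
  · rw [if_pos hel]
    by_cases hy : y ∈ ebasis (G.el t σ m)
    · rw [Finset.sum_eq_single y]
      · rw [if_pos ⟨rfl, (mem_ebasis_iff_of_getElem?_eq hel).2 hy, hel⟩]
      · intro z _ hz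
        rw [if_neg (fun h => hz h.1)]
      · exact fun h => absurd hy h
    · rw [G.totEvec_eq_zero t σ m y hy, Finset.sum_eq_zero]
      intro z hz
      rw [if_neg]
      rintro ⟨rfl, -⟩
      exact hy hz
  · rw [if_neg hel, Finset.sum_eq_zero]
    intro z _
    rw [if_neg (fun h => hel h.2.2)]

/-- The map `tr` is only semilinear, so its image need not be a submodule; the span is the extension
of `E τ` to the smaller open set and is generated by the images of one frame. -/
theorem mem_span_range_tr {c b : SimplexCategory} (t : c ⟶ b) (σ : CechSimplex U b)
    (m : Fin (c.len + 1)) (n : ℤ) {w : (G.E σ).X n}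
    (hw : w ∈ Submodule.span (O.obj (op σ.opens)) (Set.range (G.tr t σ n))) :
    ∃ a : ℕ → O.obj (op σ.opens), w = ∑ x ∈ Finset.range ((G.rank (σ.pull t) m).1 n),
      a x • G.tr t σ n (G.frame (σ.pull t) m n x) := by
  induction hw using Submodule.span_induction with
  | mem w hw =>
    obtain ⟨z, rfl⟩ := hw
    obtain ⟨p, rfl⟩ := (G.isFrame (σ.pull t) m n).2.2 z
    refine ⟨fun x => if h : x < (G.rank (σ.pull t) m).1 n then
      (O.map (σ.incl t).op).hom (p ⟨x, h⟩) else 0, ?_⟩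
    rw [map_sum, Finset.sum_range]
    refine Finset.sum_congr rfl fun x _ => ?_
    rw [LinearMap.map_smulₛₗ]
    simp
  | zero => exact ⟨0, by simp⟩
  | add w w' _ _ h h' =>
    obtain ⟨a, rfl⟩ := h
    obtain ⟨a', rfl⟩ := h'
    exact ⟨a + a', by simp [add_smul, Finset.sum_add_distrib]⟩
  | smul r w _ h =>
    obtain ⟨a, rfl⟩ := h
    exact ⟨fun x => r * a x, by simp [Finset.smul_sum, mul_smul]⟩

/-- Turns the congruence in the field `elementary` into the block form of `IsUpper`: the upper right
block consists of the coefficients of the difference in the transported frame. -/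
theorem exists_star {c b : SimplexCategory} (t : c ⟶ b) (σ : CechSimplex U b)
    {m m' : Fin (c.len + 1)} (hm : m ≤ m') :
    ∃ star : Matrix Ix EIx (O.obj (op σ.opens)), ∀ y, G.totEvec t σ m' y =
      lc (basis (G.rank (σ.pull t) m)) (fun c => G.totTr t σ (G.basisVec (σ.pull t) m c)) star y +
      lc (ebasis (G.el t σ m)) (G.totEvec t σ m)
        (emor (O.obj (op σ.opens)) (G.el t σ m') (G.el t σ m)) y := by
  have h := fun (y : EIx) (n : ℤ) => G.mem_span_range_tr t σ m n (G.elementary t σ m m' n y hm)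
  choose a ha using h
  refine ⟨fun x y => a y x.1 x.2, fun y => ?_⟩
  rw [← sub_eq_iff_eq_add, lc_emor]
  funext n
  have h1 : lc (basis (G.rank (σ.pull t) m)) (fun c => G.totTr t σ (G.basisVec (σ.pull t) m c))
      (fun x y => a y x.1 x.2) y n = ∑ x ∈ Finset.range ((G.rank (σ.pull t) m).1 n),
        a y n x • G.tr t σ n (G.frame (σ.pull t) m n x) := by
    have hh : IsHomogeneous (fun b : Ix => b.1)
        (fun c => G.totTr t σ (G.basisVec (σ.pull t) m c)) := fun x k hk =>
      G.isHomogeneous_sumVec t σ m (Sum.inl x) k hk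
    refine (sum_apply_eq_sum_filter hh _ n).trans ?_
    refine (sum_basis_filter (G.rank (σ.pull t) m)
      (fun x => a y x.1 x.2 • G.totTr t σ (G.basisVec (σ.pull t) m x) n) n).trans ?_
    refine Finset.sum_congr rfl fun x _ => ?_
    rw [totTr_basisVec, Pi.single_eq_same]
  rw [h1, ← ha y n]
  change G.evec t σ m' n y - _ = _
  congr 1
  split_ifs <;> rfl

end GreenComplex

end greenTotal

/-! ### Matrices supported on the rows of a basis. -/

section rowSupport

variable {S : Set ℤ} {A B C R R' T : Type} [CommRing R] [CommRing R'] [AddCommGroup T] [Module R T]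

/-- The nonzero entries of the matrix lie in the given rows. -/
def RowSupp (s : Finset B) (M : Matrix B C R) : Prop := ∀ b c, M b c ≠ 0 → b ∈ s

theorem IsHom.rowSupp {r s : Rk S} {q : ℤ} {M : Matrix Ix Ix R} (h : IsHom r s q M) :
    RowSupp (basis s) M :=
  fun b c hbc => (h b c hbc).1

theorem RowSupp.mcomp {s : Finset A} {M : Matrix A B R} (h : RowSupp s M) (t : Finset B)
    (N : Matrix B C R) : RowSupp s (mcomp t M N) := fun a c hac => by
  obtain ⟨b, -, hb⟩ := Finset.exists_ne_zero_of_sum_ne_zero hac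
  exact h a b (left_ne_zero_of_mul hb)

theorem RowSupp.add {s : Finset B} {M N : Matrix B C R} (hM : RowSupp s M) (hN : RowSupp s N) :
    RowSupp s (M + N) := fun b c hbc => by
  by_cases h : M b c = 0
  · exact hN b c fun h' => hbc (by rw [Matrix.add_apply, h, h', add_zero])
  · exact hM b c h

theorem RowSupp.map {s : Finset B} {M : Matrix B C R} (h : RowSupp s M) (f : R →+* R') :
    RowSupp s (M.map f) := fun b c hbc => h b c fun h0 => hbc (by simp [h0])

theorem rowSupp_idMat (r : Rk S) : RowSupp (basis r) (idMat R r) := (isHom_idMat r).rowSupp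

theorem IsBasisOn.rowSupp_mat {s : Finset B} {e : B → T} (h : IsBasisOn R s e) (w : C → T) :
    RowSupp s (h.mat w) :=
  fun _ _ => h.mem_of_mat_ne_zero w

/-- The working principle for the matrix identities below: compare the vectors that the two matrices
express in a common basis. -/
theorem IsBasisOn.matrix_ext {s : Finset B} {e : B → T} (h : IsBasisOn R s e)
    {M M' : Matrix B C R} (hM : RowSupp s M) (hM' : RowSupp s M') (heq : lc s e M = lc s e M') :
    M = M' :=
  h.lc_injective hM hM' fun c => congrFun heq c

theorem IsBasisOn.isHom_mat {X : ℤ → Type} [∀ n, AddCommGroup (X n)] [∀ n, Module R (X n)]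
    {r s : Rk S} {q : ℤ} {e w : Ix → ∀ n, X n} (h : IsBasisOn R (basis s) e)
    (he : IsHomogeneous (fun c : Ix => c.1) e) (hw : IsHomogeneous (fun c : Ix => c.1 + q) w)
    (hw0 : ∀ c, c ∉ basis r → w c = 0) : IsHom r s q (h.mat w) := fun x y hxy =>
  ⟨h.mem_of_mat_ne_zero w hxy, by
    by_contra hy
    exact hxy (h.mat_eq_zero (hw0 y hy) x), h.deg_eq_of_mat_ne_zero he (hw y) hxy⟩

end rowSupport

/-! ### The matrices of a Green complex satisfy the axioms of a simplicial twisting cochain. -/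

section greenMatrices

variable {X : Type} [TopologicalSpace X] {ι : Type} {O : (Opens X)ᵒᵖ ⥤ CommRingCat.{0}}
  {S : Set ℤ} {U : ι → Opens X}

namespace GreenComplex

variable (G : GreenComplex O S U)

/-- The matrix of the differential in a frame. -/
def dMat {b : SimplexCategory} (σ : CechSimplex U b) (i : Fin (b.len + 1)) :
    Matrix Ix Ix (O.obj (op σ.opens)) :=
  (G.isBasisOn_basisVec σ i).mat fun c => G.totD σ (G.basisVec σ i c)

/-- The change of frame matrices. -/
def gMat {b : SimplexCategory} (σ : CechSimplex U b) (i j : Fin (b.len + 1)) :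
    Matrix Ix Ix (O.obj (op σ.opens)) :=
  (G.isBasisOn_basisVec σ i).mat (G.basisVec σ j)

/-- The matrices of the maps of complexes. -/
def incMat {c b : SimplexCategory} (t : c ⟶ b) (σ : CechSimplex U b) (m : Fin (c.len + 1)) :
    Matrix Ix Ix (O.obj (op σ.opens)) :=
  (G.isBasisOn_basisVec σ (t m)).mat fun c => G.totTr t σ (G.basisVec (σ.pull t) m c)

/-- The matrices of the basis vectors of the elementary complements. -/
def perpMat {c b : SimplexCategory} (t : c ⟶ b) (σ : CechSimplex U b) (m : Fin (c.len + 1)) :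
    Matrix Ix EIx (O.obj (op σ.opens)) :=
  (G.isBasisOn_basisVec σ (t m)).mat (G.totEvec t σ m)

variable {b c : SimplexCategory} (σ : CechSimplex U b)

theorem lc_dMat (i : Fin (b.len + 1)) : lc (basis (G.rank σ i)) (G.basisVec σ i) (G.dMat σ i) =
    fun c => G.totD σ (G.basisVec σ i c) :=
  IsBasisOn.lc_mat _ _

theorem lc_gMat (i j : Fin (b.len + 1)) :
    lc (basis (G.rank σ i)) (G.basisVec σ i) (G.gMat σ i j) = G.basisVec σ j :=
  IsBasisOn.lc_mat _ _

theorem lc_incMat (t : c ⟶ b) (m : Fin (c.len + 1)) :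
    lc (basis (G.rank σ (t m))) (G.basisVec σ (t m)) (G.incMat t σ m) =
    fun c => G.totTr t σ (G.basisVec (σ.pull t) m c) :=
  IsBasisOn.lc_mat _ _

theorem lc_perpMat (t : c ⟶ b) (m : Fin (c.len + 1)) :
    lc (basis (G.rank σ (t m))) (G.basisVec σ (t m)) (G.perpMat t σ m) = G.totEvec t σ m :=
  IsBasisOn.lc_mat _ _

theorem lc_basisVec_idMat (i : Fin (b.len + 1)) : lc (basis (G.rank σ i)) (G.basisVec σ i)
    (idMat (O.obj (op σ.opens)) (G.rank σ i)) = G.basisVec σ i :=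
  lc_idMat (G.isBasisOn_basisVec σ i).zero

theorem rowSupp_dMat (i : Fin (b.len + 1)) : RowSupp (basis (G.rank σ i)) (G.dMat σ i) :=
  IsBasisOn.rowSupp_mat _ _

theorem rowSupp_gMat (i j : Fin (b.len + 1)) : RowSupp (basis (G.rank σ i)) (G.gMat σ i j) :=
  IsBasisOn.rowSupp_mat _ _

theorem rowSupp_incMat (t : c ⟶ b) (m : Fin (c.len + 1)) :
    RowSupp (basis (G.rank σ (t m))) (G.incMat t σ m) :=
  IsBasisOn.rowSupp_mat _ _

theorem rowSupp_perpMat (t : c ⟶ b) (m : Fin (c.len + 1)) :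
    RowSupp (basis (G.rank σ (t m))) (G.perpMat t σ m) :=
  IsBasisOn.rowSupp_mat _ _

theorem isHom_dMat (i : Fin (b.len + 1)) : IsHom (G.rank σ i) (G.rank σ i) 1 (G.dMat σ i) := by
  refine IsBasisOn.isHom_mat _ (isHomogeneous_totalFrame _) ?_ ?_
  · intro x n hn
    obtain ⟨k, rfl⟩ : ∃ k, k + 1 = n := ⟨n - 1, by omega⟩
    change G.totD σ (G.basisVec σ i x) (k + 1) = 0
    change k + 1 ≠ x.1 + 1 at hn
    have hk : G.basisVec σ i x k = 0 := isHomogeneous_totalFrame _ x k (show k ≠ x.1 by omega)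
    rw [G.totD_apply σ _ rfl, hk, map_zero]
  · intro x hx
    rw [(G.isBasisOn_basisVec σ i).zero x hx, map_zero]

theorem isHom_gMat (i j : Fin (b.len + 1)) : IsHom (G.rank σ j) (G.rank σ i) 0 (G.gMat σ i j) := by
  refine IsBasisOn.isHom_mat _ (isHomogeneous_totalFrame _) ?_ ?_
  · intro x n hn
    exact isHomogeneous_totalFrame _ x n (by simpa using hn)
  · exact (G.isBasisOn_basisVec σ j).zero

theorem isHom_incMat (t : c ⟶ b) (m : Fin (c.len + 1)) :
    IsHom (G.rank (σ.pull t) m) (G.rank σ (t m)) 0 (G.incMat t σ m) := by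
  refine IsBasisOn.isHom_mat _ (isHomogeneous_totalFrame _) ?_ ?_
  · intro x n hn
    exact G.isHomogeneous_sumVec t σ m (Sum.inl x) n (by simpa using hn)
  · intro x hx
    rw [(G.isBasisOn_basisVec (σ.pull t) m).zero x hx, map_zero]

theorem gMat_self (i : Fin (b.len + 1)) : G.gMat σ i i = idMat _ (G.rank σ i) :=
  (G.isBasisOn_basisVec σ i).matrix_ext (IsBasisOn.rowSupp_mat _ _) (rowSupp_idMat _)
    ((G.lc_gMat σ i i).trans (G.lc_basisVec_idMat σ i).symm)

theorem mcomp_gMat (i j k : Fin (b.len + 1)) :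
    mcomp (basis (G.rank σ j)) (G.gMat σ i j) (G.gMat σ j k) = G.gMat σ i k :=
  (G.isBasisOn_basisVec σ i).matrix_ext ((IsBasisOn.rowSupp_mat _ _).mcomp _ _)
    (IsBasisOn.rowSupp_mat _ _) (by rw [lc_mcomp, lc_gMat, lc_gMat, lc_gMat])

theorem totD_lc {C : Type} (s : Finset Ix) (e : Ix → G.Tot σ)
    (M : Matrix Ix C (O.obj (op σ.opens))) :
    lc s (fun x => G.totD σ (e x)) M = fun y => G.totD σ (lc s e M y) :=
  funext fun y => (map_lc_linear (G.totD σ) s e M y).symm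

theorem totTr_lc {C : Type} (t : c ⟶ b) (s : Finset Ix) (e : Ix → G.Tot (σ.pull t))
    (M : Matrix Ix C (O.obj (op (σ.pull t).opens))) :
    lc s (fun x => G.totTr t σ (e x)) (resMat O (σ.incl t) M) =
      fun y => G.totTr t σ (lc s e M y) :=
  funext fun y => (map_lc (G.totTr t σ) s e M y).symm

theorem mcomp_dMat_dMat (i : Fin (b.len + 1)) :
    mcomp (basis (G.rank σ i)) (G.dMat σ i) (G.dMat σ i) = 0 :=
  (G.isBasisOn_basisVec σ i).matrix_ext ((IsBasisOn.rowSupp_mat _ _).mcomp _ _)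
    (fun _ _ h => absurd rfl h) (by
      rw [lc_mcomp, lc_dMat, totD_lc, lc_dMat]
      funext x
      rw [totD_totD]
      simp [lc])

theorem gMat_dMat (i j : Fin (b.len + 1)) :
    mcomp (basis (G.rank σ j)) (G.gMat σ i j) (G.dMat σ j) =
      mcomp (basis (G.rank σ i)) (G.dMat σ i) (G.gMat σ i j) :=
  (G.isBasisOn_basisVec σ i).matrix_ext ((IsBasisOn.rowSupp_mat _ _).mcomp _ _)
    ((IsBasisOn.rowSupp_mat _ _).mcomp _ _) (by
      rw [lc_mcomp, lc_mcomp, lc_gMat, lc_dMat, lc_dMat, totD_lc, lc_gMat])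

/-- The matrices of a Green complex, as a simplex of the differential graded nerve. -/
def dgSimplex : DGSimplex S (O.obj (op σ.opens)) b :=
  DGSimplex.ofTrunc (G.rank σ) (G.dMat σ) (G.gMat σ) (fun _ _ _ => 0) (G.isHom_dMat σ)
    (fun i j _ => G.isHom_gMat σ i j) (fun _ _ _ _ _ => isHom_zero _ _ _) (G.mcomp_dMat_dMat σ)
    (fun i j _ => G.gMat_dMat σ i j) (G.gMat_self σ) (fun _ _ => rfl) (fun _ _ => rfl)
    (fun i j k _ _ => by rw [zero_mcomp, mcomp_zero, add_zero, mcomp_gMat, sub_self])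
    (fun _ _ _ _ _ _ _ => by rw [zero_mcomp, mcomp_zero])
    (fun _ _ _ _ _ _ _ _ _ => zero_mcomp _ _)

/-- The complement with the matrices of a Green complex. -/
def matCmpl (t : c ⟶ b) (m : Fin (c.len + 1)) : Cmpl (O.obj (op σ.opens)) where
  el := G.el t σ m
  inc := G.incMat t σ m
  perp := G.perpMat t σ m

theorem incMat_resMat_dMat (t : c ⟶ b) (m : Fin (c.len + 1)) :
    mcomp (basis (G.rank (σ.pull t) m)) (G.incMat t σ m)
      (resMat O (σ.incl t) (G.dMat (σ.pull t) m)) =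
    mcomp (basis (G.rank σ (t m))) (G.dMat σ (t m)) (G.incMat t σ m) :=
  (G.isBasisOn_basisVec σ (t m)).matrix_ext ((IsBasisOn.rowSupp_mat _ _).mcomp _ _)
    ((IsBasisOn.rowSupp_mat _ _).mcomp _ _) (by
      rw [lc_mcomp, lc_mcomp, lc_incMat, lc_dMat, totD_lc, totTr_lc, lc_dMat, lc_incMat]
      funext x
      exact G.totTr_totD t σ _)

theorem lc_ediff (t : c ⟶ b) (m : Fin (c.len + 1)) :
    lc (ebasis (G.el t σ m)) (G.totEvec t σ m) (ediff (O.obj (op σ.opens)) (G.el t σ m)) =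
      fun y => G.totD σ (G.totEvec t σ m y) := by
  funext ⟨j, u, a⟩
  by_cases hy : (⟨j, u, a⟩ : EIx) ∈ ebasis (G.el t σ m)
  swap
  · rw [G.totEvec_eq_zero t σ m _ hy, map_zero, lc, Finset.sum_eq_zero]
    intro x _
    rw [ediff, if_neg (fun h => hy h.1), zero_smul]
  cases u
  · rw [G.totD_totEvec_lower, lc, Finset.sum_eq_single (⟨j, true, a⟩ : EIx)]
    · rw [ediff, if_pos ⟨hy, rfl, rfl⟩, one_smul]
    · intro x _ hx
      rw [ediff, if_neg (fun h => hx h.2.2), zero_smul]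
    · intro h
      rw [G.totEvec_eq_zero t σ m _ h, smul_zero]
  · rw [G.totD_totEvec_upper, lc, Finset.sum_eq_zero]
    intro x _
    rw [ediff, if_neg (fun h => by simp at h), zero_smul]

theorem perpMat_ediff (t : c ⟶ b) (m : Fin (c.len + 1)) :
    mcomp (ebasis (G.el t σ m)) (G.perpMat t σ m) (ediff _ (G.el t σ m)) =
    mcomp (basis (G.rank σ (t m))) (G.dMat σ (t m)) (G.perpMat t σ m) :=
  (G.isBasisOn_basisVec σ (t m)).matrix_ext ((IsBasisOn.rowSupp_mat _ _).mcomp _ _)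
    ((IsBasisOn.rowSupp_mat _ _).mcomp _ _) (by
      rw [lc_mcomp, lc_mcomp, lc_perpMat, lc_dMat, totD_lc, lc_perpMat, lc_ediff])

/-- The inclusions express the basis `sumVec` of the decomposition in the frame; expressing the
frame in `sumVec` gives the inverse, with blocks `π` and `ϖ`. -/
theorem isSplitting_matCmpl (t : c ⟶ b) (m : Fin (c.len + 1)) :
    IsSplitting (G.rank (σ.pull t) m) (resMat O (σ.incl t) (G.dMat (σ.pull t) m))
      (G.rank σ (t m)) (G.dMat σ (t m)) (G.matCmpl σ t m) where
  isHom := G.isHom_incMat σ t m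
  perp_supp x y hxy := by
    have h1 : y ∈ ebasis (G.el t σ m) := by
      by_contra hy
      exact hxy ((G.isBasisOn_basisVec σ (t m)).mat_eq_zero (G.totEvec_eq_zero t σ m y hy) x)
    exact ⟨G.rowSupp_perpMat σ t m _ _ hxy, h1,
      (G.isBasisOn_basisVec σ (t m)).deg_eq_of_mat_ne_zero (isHomogeneous_totalFrame _)
        (G.isHomogeneous_totEvec t σ m y) hxy⟩
  inc_comm := G.incMat_resMat_dMat σ t m
  perp_comm := G.perpMat_ediff σ t m
  exists_inverse := by
    have hs := G.isBasisOn_sumVec t σ m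
    have hb := G.isBasisOn_basisVec σ (t m)
    -- Four of the five identities are blocks of the products of `Q` with `inc` and `perp`; the
    -- fifth is the expansion of the frame in `sumVec`, split along the disjoint union.
    let Q : Matrix (Ix ⊕ EIx) Ix (O.obj (op σ.opens)) := hs.mat (G.basisVec σ (t m))
    have hQ : lc _ (G.sumVec t σ m) Q = G.basisVec σ (t m) := hs.lc_mat _
    have hQ0 : ∀ x y, Q x y ≠ 0 → y ∈ basis (G.rank σ (t m)) := fun x y hxy => by
      by_contra hy
      exact hxy (hs.mat_eq_zero (hb.zero y hy) x)
    have hQd : ∀ x y, Q x y ≠ 0 → sumDeg (G.el t σ m) x = y.1 := fun x y hxy =>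
      hs.deg_eq_of_mat_ne_zero (G.isHomogeneous_sumVec t σ m)
        (isHomogeneous_totalFrame _ y) hxy
    have hinc : mcomp (basis (G.rank σ (t m))) Q (G.incMat t σ m) =
        Matrix.fromRows (idMat _ (G.rank (σ.pull t) m)) 0 := by
      refine hs.matrix_ext ((hs.rowSupp_mat _).mcomp _ _) ?_ ?_
      · rintro (x | y) z hxz
        · exact Finset.inl_mem_disjSum.2 (rowSupp_idMat _ x z hxz)
        · exact absurd rfl hxz
      · rw [lc_mcomp, hQ, lc_incMat]
        funext z
        rw [lc, Finset.sum_disjSum]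
        simp only [Matrix.fromRows_apply_inl, Matrix.fromRows_apply_inr, Matrix.zero_apply,
          zero_smul, Finset.sum_const_zero, add_zero]
        exact (congrFun (lc_idMat (R := O.obj (op σ.opens)) (r := G.rank (σ.pull t) m)
          (e := fun c => G.totTr t σ (G.basisVec (σ.pull t) m c)) fun x hx => by
            rw [(G.isBasisOn_basisVec (σ.pull t) m).zero x hx, map_zero]) z).symm
    have hperp : mcomp (basis (G.rank σ (t m))) Q (G.perpMat t σ m) =
        Matrix.fromRows 0 (eid _ (G.el t σ m)) := by
      refine hs.matrix_ext ((hs.rowSupp_mat _).mcomp _ _) ?_ ?_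
      · rintro (x | y) z hxz
        · exact absurd rfl hxz
        · refine Finset.inr_mem_disjSum.2 ?_
          by_contra hy
          refine hxz ?_
          rw [Matrix.fromRows_apply_inr, eid, if_neg]
          rintro ⟨rfl, h⟩
          exact hy h
      · rw [lc_mcomp, hQ, lc_perpMat]
        funext z
        rw [lc, Finset.sum_disjSum]
        simp only [Matrix.fromRows_apply_inl, Matrix.fromRows_apply_inr, Matrix.zero_apply,
          zero_smul, Finset.sum_const_zero, zero_add]
        by_cases hz : z ∈ ebasis (G.el t σ m)
        · rw [Finset.sum_eq_single z]
          · rw [eid, if_pos ⟨rfl, hz⟩, one_smul]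
            rfl
          · intro x _ hx
            rw [eid, if_neg (fun h => hx h.1), zero_smul]
          · exact fun h => absurd hz h
        · rw [G.totEvec_eq_zero t σ m z hz, Finset.sum_eq_zero]
          intro x _
          rw [eid, if_neg (fun h => hz h.2), zero_smul]
    refine ⟨fun x y => Q (Sum.inl x) y, fun x y => Q (Sum.inr x) y, ?_, ?_, ?_, ?_, ?_, ?_, ?_⟩
    · intro x y hxy
      exact ⟨Finset.inl_mem_disjSum.1 (hs.mem_of_mat_ne_zero _ hxy), hQ0 _ _ hxy,
        (hQd _ _ hxy).trans (add_zero _).symm⟩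
    · intro x y hxy
      exact ⟨Finset.inr_mem_disjSum.1 (hs.mem_of_mat_ne_zero _ hxy), hQ0 _ _ hxy, hQd _ _ hxy⟩
    · exact funext fun x => congrFun hinc (Sum.inl x)
    · exact funext fun x => congrFun hperp (Sum.inl x)
    · exact funext fun x => congrFun hinc (Sum.inr x)
    · exact funext fun x => congrFun hperp (Sum.inr x)
    · refine hb.matrix_ext (((G.rowSupp_incMat σ t m).mcomp _ _).add
        ((G.rowSupp_perpMat σ t m).mcomp _ _)) (rowSupp_idMat _) ?_
      rw [lc_basisVec_idMat]
      funext z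
      rw [lc_add]
      refine (congrArg₂ (· + ·) (congrFun ((lc_mcomp _ _ _ (G.incMat t σ m) _).trans
        (congrArg (fun e => lc (basis (G.rank (σ.pull t) m)) e
          (Matrix.of fun x y => Q (Sum.inl x) y)) (G.lc_incMat σ t m))) z)
        (congrFun ((lc_mcomp _ _ _ (G.perpMat t σ m) _).trans
        (congrArg (fun e => lc (ebasis (G.el t σ m)) e (Matrix.of fun x y => Q (Sum.inr x) y))
          (G.lc_perpMat σ t m))) z)).trans (Eq.trans ?_ (congrFun hQ z))
      rw [lc, lc, lc, Finset.sum_disjSum]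
      rfl

theorem gMat_incMat (t : c ⟶ b) (m m' : Fin (c.len + 1)) :
    mcomp (basis (G.rank σ (t m'))) (G.gMat σ (t m) (t m')) (G.incMat t σ m') =
    mcomp (basis (G.rank (σ.pull t) m)) (G.incMat t σ m)
      (resMat O (σ.incl t) (G.gMat (σ.pull t) m m')) :=
  (G.isBasisOn_basisVec σ (t m)).matrix_ext ((IsBasisOn.rowSupp_mat _ _).mcomp _ _)
    ((IsBasisOn.rowSupp_mat _ _).mcomp _ _) (by
      rw [lc_mcomp, lc_mcomp, lc_incMat, lc_gMat, lc_incMat, totTr_lc, lc_gMat])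

/-- On edges, changing the frame does not change the vectors, so the block form is `exists_star` in
coordinates. In higher dimensions all labels vanish. -/
theorem isUpper_gMat (t : c ⟶ b) (k : ℕ) (K : ⦋k + 1⦌ ⟶ c) :
    IsUpper k (G.rank σ (t (K (Fin.last (k + 1))))) (G.rank (σ.pull t) (K 0))
      ((G.dgSimplex σ).φ (k + 1) (K ≫ t))
      (resMat O (σ.incl t) ((G.dgSimplex (σ.pull t)).φ (k + 1) K))
      (G.matCmpl σ t (K (Fin.last (k + 1)))) (G.matCmpl σ t (K 0)) := by
  match k, K with
  | 0, K =>
    refine ⟨G.gMat_incMat σ t (K 0) (K 1), ?_⟩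
    have hm : K 0 ≤ K 1 := K.toOrderHom.monotone (Fin.zero_le 1)
    obtain ⟨star, hstar⟩ := G.exists_star t σ hm
    refine ⟨star, ?_⟩
    refine (G.isBasisOn_basisVec σ (t (K 0))).matrix_ext
      ((G.rowSupp_gMat σ (t (K 0)) (t (K 1))).mcomp _ _)
      (((G.rowSupp_incMat σ t (K 0)).mcomp _ _).add ((G.rowSupp_perpMat σ t (K 0)).mcomp _ _)) ?_
    funext y
    rw [lc_add]
    change lc _ _ (mcomp _ (G.gMat σ (t (K 0)) (t (K 1))) (G.perpMat t σ (K 1))) y =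
      lc _ _ (mcomp _ (G.incMat t σ (K 0)) _) y + lc _ _ (mcomp _ (G.perpMat t σ (K 0)) _) y
    rw [lc_mcomp, lc_mcomp, lc_mcomp, lc_gMat, lc_incMat, lc_perpMat]
    exact (congrFun (G.lc_perpMat σ t (K 1)) y).trans (hstar y)
  | k + 1, K =>
    have h0 : ∀ {n : SimplexCategory} (σ : CechSimplex U n) (J : ⦋k + 1 + 1⦌ ⟶ n),
        (G.dgSimplex σ).φ (k + 1 + 1) J = 0 := by
      intro n σ J
      cases k <;> rfl
    rw [h0, h0]
    refine ⟨?_, 0, ?_⟩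
    · rw [zero_mcomp, resMat, zero_map, mcomp_zero]
    · rw [zero_mcomp, mcomp_zero, if_neg (Nat.succ_ne_zero k), mcomp_zero, add_zero]

theorem incMat_comp {c' : SimplexCategory} (t' : c' ⟶ c) (t : c ⟶ b) (m : Fin (c'.len + 1)) :
    G.incMat (t' ≫ t) σ m = mcomp (basis (G.rank (σ.pull t) (t' m))) (G.incMat t σ (t' m))
      (resMat O (σ.incl t) (G.incMat t' (σ.pull t) m)) :=
  (G.isBasisOn_basisVec σ (t (t' m))).matrix_ext (IsBasisOn.rowSupp_mat _ _)
    ((IsBasisOn.rowSupp_mat _ _).mcomp _ _) (by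
      rw [lc_mcomp, lc_incMat, totTr_lc, lc_incMat]
      refine Eq.trans (G.lc_incMat σ (t' ≫ t) m) ?_
      funext x
      exact G.totTr_comp t' t σ _)

theorem totTr_comp_basisVec (t : c ⟶ b) (m : Fin (c.len + 1)) (ht : Function.Surjective t) :
    (fun x => G.totTr t σ (G.basisVec (σ.pull t) m x)) = G.basisVec σ (t m) :=
  funext fun x => G.totTr_basisVec_of_surjective t σ m ht x

/-- For a surjective reindexing the transition map carries frame to frame, so corresponding vectors
have equal coordinates after restriction. All degeneracy axioms follow from this. -/
theorem resMat_mat_of_surjective {C : Type} (d : c ⟶ b) (i : Fin (c.len + 1))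
    (hd : Function.Surjective d) {M : Matrix Ix C (O.obj (op (σ.pull d).opens))}
    {N : Matrix Ix C (O.obj (op σ.opens))} (hM : RowSupp (basis (G.rank (σ.pull d) i)) M)
    (hN : RowSupp (basis (G.rank σ (d i))) N)
    (h : ∀ x, G.totTr d σ (lc (basis (G.rank (σ.pull d) i)) (G.basisVec (σ.pull d) i) M x) =
      lc (basis (G.rank σ (d i))) (G.basisVec σ (d i)) N x) : resMat O (σ.incl d) M = N := by
  rw [G.rank_surj d σ i hd] at hM h
  refine (G.isBasisOn_basisVec σ (d i)).matrix_ext (hM.map _) hN ?_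
  rw [← G.totTr_comp_basisVec σ d i hd]
  rw [totTr_lc, G.totTr_comp_basisVec σ d i hd]
  exact funext h

/-- The simplicial twisting cochain that consists of the matrices of a Green complex. -/
def toSimplicialTwistingCochain : SimplicialTwistingCochain O S U where
  rank := G.rank
  a σ := (G.dgSimplex σ).φ
  cmpl t σ := G.matCmpl σ t
  isHom σ := (G.dgSimplex σ).isHom
  maurerCartan σ := (G.dgSimplex σ).maurerCartan
  norm_one σ := (G.dgSimplex σ).degen_one
  norm σ := (G.dgSimplex σ).degen
  split t σ m := G.isSplitting_matCmpl σ t m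
  upper t σ k K := G.isUpper_gMat σ t k K
  coherent t' t σ m := G.incMat_comp σ t' t m
  rank_degen d σ i hd := G.rank_surj d σ i hd
  a_degen d σ k J hd := by
    match k, J with
    | 0, J =>
      refine G.resMat_mat_of_surjective σ d (J 0) hd (G.rowSupp_dMat _ _)
        (G.rowSupp_dMat σ (d (J 0))) fun x => ?_
      refine (congrArg (G.totTr d σ) (congrFun (G.lc_dMat (σ.pull d) (J 0)) x)).trans ?_
      rw [totTr_totD, totTr_basisVec_of_surjective _ _ _ _ hd]
      exact (congrFun (G.lc_dMat σ (d (J 0))) x).symm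
    | 1, J =>
      refine G.resMat_mat_of_surjective σ d (J 0) hd (G.rowSupp_gMat _ _ _)
        (G.rowSupp_gMat σ (d (J 0)) (d (J 1))) fun x => ?_
      refine (congrArg (G.totTr d σ) (congrFun (G.lc_gMat (σ.pull d) (J 0) (J 1)) x)).trans ?_
      rw [totTr_basisVec_of_surjective _ _ _ _ hd]
      exact (congrFun (G.lc_gMat σ (d (J 0)) (d (J 1))) x).symm
    | 2, J => exact zero_map _
    | k + 3, J => exact zero_map _
  cmpl_surj t σ m ht := ⟨G.el_surj t σ m ht,
    (G.isBasisOn_basisVec σ (t m)).matrix_ext (G.rowSupp_incMat σ t m) (rowSupp_idMat _) (by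
      rw [lc_basisVec_idMat]
      exact (G.lc_incMat σ t m).trans (G.totTr_comp_basisVec σ t m ht))⟩
  cmpl_degen_left d t σ m hd := by
    obtain ⟨h1, h2⟩ := G.degen_left d t σ m hd
    refine Cmpl.ext h1 ?_ ?_
    · refine (G.isBasisOn_basisVec σ (t (d m))).matrix_ext
        (G.rowSupp_incMat σ (d ≫ t) m) (G.rowSupp_incMat σ t (d m)) ?_
      refine (G.lc_incMat σ (d ≫ t) m).trans (Eq.trans ?_ (G.lc_incMat σ t (d m)).symm)
      funext x
      refine (G.totTr_comp d t σ _).trans ?_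
      exact congrArg _ (G.totTr_basisVec_of_surjective d (σ.pull t) m hd x)
    · refine (G.isBasisOn_basisVec σ (t (d m))).matrix_ext
        (G.rowSupp_perpMat σ (d ≫ t) m) (G.rowSupp_perpMat σ t (d m)) ?_
      refine (G.lc_perpMat σ (d ≫ t) m).trans (Eq.trans ?_ (G.lc_perpMat σ t (d m)).symm)
      funext y n
      exact h2 n y
  cmpl_degen_right t d σ m hd := by
    obtain ⟨h1, h2⟩ := G.degen_right t d σ m hd
    refine Cmpl.ext h1 ?_ ?_
    · refine (G.resMat_mat_of_surjective σ d (t m) hd (G.rowSupp_incMat (σ.pull d) t m)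
        (G.rowSupp_incMat σ (t ≫ d) m) fun x => ?_).symm
      refine Eq.trans ?_ (congrFun (G.lc_incMat σ (t ≫ d) m) x).symm
      refine (congrArg (G.totTr d σ) (congrFun (G.lc_incMat (σ.pull d) t m) x)).trans ?_
      exact (G.totTr_comp t d σ _).symm
    · refine (G.resMat_mat_of_surjective σ d (t m) hd (G.rowSupp_perpMat (σ.pull d) t m)
        (G.rowSupp_perpMat σ (t ≫ d) m) fun y => ?_).symm
      refine Eq.trans ?_ (congrFun (G.lc_perpMat σ (t ≫ d) m) y).symm
      refine (congrArg (G.totTr d σ) (congrFun (G.lc_perpMat (σ.pull d) t m) y)).trans ?_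
      funext n
      exact (h2 n y).symm

end GreenComplex

end greenMatrices

/-! ### Green complexes and simplicial twisting cochains without higher components -/

section greenData

variable {X : Type} [TopologicalSpace X] {ι : Type} {O : (Opens X)ᵒᵖ ⥤ CommRingCat.{0}}
  {S : Set ℤ} {U : ι → Opens X}

namespace SimplicialTwistingCochain

/-- The higher components vanish, and the components on edges are isomorphisms. -/
structure IsOne (A : SimplicialTwistingCochain O S U) : Prop where
  higher : ∀ {b : SimplexCategory} (σ : CechSimplex U b) (k : ℕ) (J : ⦋k⦌ ⟶ b), 2 ≤ k →
    A.a σ k J = 0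
  iso : ∀ {b : SimplexCategory} (σ : CechSimplex U b) (J : ⦋1⦌ ⟶ b),
    IsIsoMat (A.rank σ (J 1)) (A.rank σ (J 0)) (A.a σ 1 J)

theorem IsOne.gtt {A : SimplicialTwistingCochain O S U} (hA : A.IsOne) {n : SimplexCategory}
    (σ : CechSimplex U n) : (A.gtt σ).IsOne := fun s =>
  ⟨fun k J hk => (congrArg (resMat O (σ.incl s)) (hA.higher (σ.pull s) k J hk)).trans (zero_map _),
    fun J => (hA.iso (σ.pull s) J).map (O.map (σ.incl s).op).hom⟩

end SimplicialTwistingCochain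

/-- Vertices of the totalisation of the presheaf of Green labellings are the same as simplicial
twisting cochains without higher components and with isomorphisms on edges. -/
theorem exists_equiv_isOne :
    ∃ Φ : TotZero O (Green S) U ≃ {A : SimplicialTwistingCochain O S U // A.IsOne},
      ∀ v {b : SimplexCategory} (σ : CechSimplex U b),
        (Φ v).1.rank σ = ((v.comp σ).1.lab (𝟙 b)).1.rank ∧
        (Φ v).1.a σ = ((v.comp σ).1.lab (𝟙 b)).1.φ ∧
        ∀ {c : SimplexCategory} (t : c ⟶ b), (Φ v).1.cmpl t σ = (v.comp σ).1.cmpl t (𝟙 b) := by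
  have hv : ∀ v : TotZero O (Green S) U,
      IsGTTCompat (fun {b} (σ : CechSimplex U b) =>
        ((v.comp σ).1 : GTT S (O.obj (op σ.opens)) b)) :=
    fun v _ _ f σ => congrArg Subtype.val (v.comp_compat f σ)
  have hA : ∀ A : {A : SimplicialTwistingCochain O S U // A.IsOne}, IsCompat O (Green S)
      (fun {b} σ => (⟨A.1.gtt σ, A.2.gtt σ⟩ : {x : GTT S (O.obj (op σ.opens)) b // x.IsOne})) :=
    fun A _ _ f σ => Subtype.ext (A.1.gtt_compat f σ)
  refine ⟨{ toFun v := ⟨IsGTTCompat.toSimplicialTwistingCochain (hv v), ⟨fun {b} σ k J hk =>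
              ((v.comp σ).2 (𝟙 b)).1 k J hk, fun {b} σ J => ((v.comp σ).2 (𝟙 b)).2 J⟩⟩
            invFun A := TotZero.ofCompat (F := Green S) (fun {b} σ =>
              (⟨A.1.gtt σ, A.2.gtt σ⟩ : {x : GTT S (O.obj (op σ.opens)) b // x.IsOne})) (hA A)
            left_inv v := ?_
            right_inv A := ?_ }, fun v => ?_⟩
  · refine TotZero.ext fun σ => ?_
    refine (TotZero.comp_ofCompat (F := Green S) _ _ σ).trans (Subtype.ext ?_)
    exact IsGTTCompat.ext _ (hv v) (SimplicialTwistingCochain.toSimplicialTwistingCochain_gtt _) σ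
  · refine Subtype.ext (Eq.trans ?_ A.1.toSimplicialTwistingCochain_gtt)
    congr 1
  · exact fun σ => ⟨rfl, rfl, fun _ => rfl⟩

namespace GreenComplex

variable (G : GreenComplex O S U)

/-- The simplicial twisting cochain consists of the matrices of the Green complex. -/
structure HasMatrices (A : SimplicialTwistingCochain O S U) : Prop where
  rank : ∀ {b : SimplexCategory} (σ : CechSimplex U b), A.rank σ = G.rank σ
  el : ∀ {c b : SimplexCategory} (t : c ⟶ b) (σ : CechSimplex U b) (m : Fin (c.len + 1)),
    (A.cmpl t σ m).el = G.el t σ m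
  d : ∀ {b : SimplexCategory} (σ : CechSimplex U b) (i : Fin (b.len + 1)),
    lc (basis (G.rank σ i)) (G.basisVec σ i) (A.a σ 0 (SimplexCategory.const ⦋0⦌ b i)) =
      fun c => G.totD σ (G.basisVec σ i c)
  frame : ∀ {b : SimplexCategory} (σ : CechSimplex U b) (J : ⦋1⦌ ⟶ b),
    lc (basis (G.rank σ (J 0))) (G.basisVec σ (J 0)) (A.a σ 1 J) = G.basisVec σ (J 1)
  tr : ∀ {c b : SimplexCategory} (t : c ⟶ b) (σ : CechSimplex U b) (m : Fin (c.len + 1)),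
    lc (basis (G.rank σ (t m))) (G.basisVec σ (t m)) (A.cmpl t σ m).inc =
      fun c => G.totTr t σ (G.basisVec (σ.pull t) m c)
  evec : ∀ {c b : SimplexCategory} (t : c ⟶ b) (σ : CechSimplex U b) (m : Fin (c.len + 1)),
    lc (basis (G.rank σ (t m))) (G.basisVec σ (t m)) (A.cmpl t σ m).perp = G.totEvec t σ m

theorem isOne_toSimplicialTwistingCochain : G.toSimplicialTwistingCochain.IsOne where
  higher σ k J hk := by
    obtain ⟨k, rfl⟩ := Nat.exists_eq_add_of_le' hk
    cases k <;> rfl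
  iso σ J := ⟨G.gMat σ (J 1) (J 0), G.isHom_gMat σ _ _,
    (G.mcomp_gMat σ _ _ _).trans (G.gMat_self σ _), (G.mcomp_gMat σ _ _ _).trans (G.gMat_self σ _)⟩

theorem hasMatrices_toSimplicialTwistingCochain : G.HasMatrices G.toSimplicialTwistingCochain where
  rank _ := rfl
  el _ _ _ := rfl
  d σ i := G.lc_dMat σ i
  frame σ J := G.lc_gMat σ (J 0) (J 1)
  tr t σ m := G.lc_incMat σ t m
  evec t σ m := G.lc_perpMat σ t m

variable {G}

/-- Each nonvanishing label expresses vectors given by `G` in a frame, and `IsOne` removes the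
labels that `HasMatrices` does not mention. -/
theorem HasMatrices.unique {A A' : SimplicialTwistingCochain O S U} (h : G.HasMatrices A)
    (h' : G.HasMatrices A') (hA : A.IsOne) (hA' : A'.IsOne) : A = A' := by
  refine SimplicialTwistingCochain.ext ?_ ?_ ?_
  · funext b σ
    rw [h.rank, h'.rank]
  · funext b σ k J
    have hr := (A.isHom σ k J).rowSupp
    have hr' := (A'.isHom σ k J).rowSupp
    rw [h.rank] at hr
    rw [h'.rank] at hr'
    match k, J with
    | 0, J =>
      obtain ⟨i, rfl⟩ : ∃ i, J = SimplexCategory.const ⦋0⦌ b i := ⟨J 0, by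
        ext i : 3
        fin_cases i
        rfl⟩
      exact (G.isBasisOn_basisVec σ _).matrix_ext hr hr' ((h.d σ i).trans (h'.d σ i).symm)
    | 1, J =>
      exact (G.isBasisOn_basisVec σ _).matrix_ext hr hr' ((h.frame σ J).trans (h'.frame σ J).symm)
    | k + 2, J => rw [hA.higher σ _ J (by omega), hA'.higher σ _ J (by omega)]
  · funext c b t σ m
    have hs := A.split t σ m
    have hs' := A'.split t σ m
    rw [h.rank, h.rank] at hs
    rw [h'.rank, h'.rank] at hs'
    refine Cmpl.ext ((h.el t σ m).trans (h'.el t σ m).symm) ?_ ?_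
    · exact (G.isBasisOn_basisVec σ _).matrix_ext hs.isHom.rowSupp hs'.isHom.rowSupp
        ((h.tr t σ m).trans (h'.tr t σ m).symm)
    · exact (G.isBasisOn_basisVec σ _).matrix_ext (fun x y hxy => (hs.perp_supp x y hxy).1)
        (fun x y hxy => (hs'.perp_supp x y hxy).1) ((h.evec t σ m).trans (h'.evec t σ m).symm)

end GreenComplex

/-- Passes from total modules to sums in a single degree: by homogeneity both sides vanish in all
other degrees. -/
theorem lc_totalFrame_eq_iff {C R : Type} [CommRing R] {X : ℤ → Type} [∀ n, AddCommGroup (X n)]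
    [∀ n, Module R (X n)] (r : Rk S) (e : ∀ n, ℕ → X n) {deg : C → ℤ} {M : Matrix Ix C R}
    (hM : ∀ x y, M x y ≠ 0 → x.1 = deg y) {w : C → ∀ n, X n} (hw : IsHomogeneous deg w) :
    lc (basis r) (totalFrame e) M = w ↔
      ∀ y, w y (deg y) = ∑ x ∈ Finset.range (r.1 (deg y)), M ⟨deg y, x⟩ y • e (deg y) x := by
  constructor
  · rintro rfl y
    exact lc_totalFrame_apply r e M y _
  · intro h
    funext y n
    rw [lc_totalFrame_apply]
    by_cases hn : n = deg y
    · subst hn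
      exact (h y).symm
    · rw [hw y n hn, Finset.sum_eq_zero]
      intro x _
      rw [not_ne_iff.1 fun h0 => hn (hM _ _ h0), zero_smul]

namespace GreenComplex

theorem isHomogeneous_totD_basisVec (G : GreenComplex O S U) {b : SimplexCategory}
    (σ : CechSimplex U b) (i : Fin (b.len + 1)) :
    IsHomogeneous (fun c : Ix => c.1 + 1) fun c => G.totD σ (G.basisVec σ i c) := by
  intro x n hn
  obtain ⟨k, rfl⟩ : ∃ k, k + 1 = n := ⟨n - 1, by omega⟩
  change G.totD σ (G.basisVec σ i x) (k + 1) = 0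
  change k + 1 ≠ x.1 + 1 at hn
  have hk : G.basisVec σ i x k = 0 := isHomogeneous_totalFrame _ x k (show k ≠ x.1 by omega)
  rw [G.totD_apply σ _ rfl, hk, map_zero]

theorem totD_basisVec (G : GreenComplex O S U) {b : SimplexCategory}
    (σ : CechSimplex U b) (i : Fin (b.len + 1)) (n : ℤ) (y : ℕ) :
    G.totD σ (G.basisVec σ i ⟨n, y⟩) (n + 1) = (G.E σ).d n (n + 1) (G.frame σ i n y) := by
  rw [G.totD_apply σ _ rfl]
  exact congrArg _ (totalFrame_apply _ _ _)

theorem totTr_basisVec_apply (G : GreenComplex O S U) {c b : SimplexCategory} (t : c ⟶ b)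
    (σ : CechSimplex U b) (m : Fin (c.len + 1)) (n : ℤ) (y : ℕ) :
    G.totTr t σ (G.basisVec (σ.pull t) m ⟨n, y⟩) n = G.tr t σ n (G.frame (σ.pull t) m n y) := by
  rw [totTr_basisVec, Pi.single_eq_same]

/-- Translates the degreewise formulas for vertices into the total formulation for cochains. -/
theorem isMatrixOf_iff (G : GreenComplex O S U) (v : TotZero O (Green S) U)
    {A : SimplicialTwistingCochain O S U}
    (hA : ∀ {b : SimplexCategory} (σ : CechSimplex U b),
        A.rank σ = ((v.comp σ).1.lab (𝟙 b)).1.rank ∧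
        A.a σ = ((v.comp σ).1.lab (𝟙 b)).1.φ ∧
        ∀ {c : SimplexCategory} (t : c ⟶ b), A.cmpl t σ = (v.comp σ).1.cmpl t (𝟙 b)) :
    G.IsMatrixOf v ↔ G.HasMatrices A := by
  have hd : ∀ {b : SimplexCategory} (σ : CechSimplex U b) (i : Fin (b.len + 1)),
      ((v.comp σ).1.lab (𝟙 b)).1.d i = A.a σ 0 (SimplexCategory.const ⦋0⦌ b i) := fun σ i => by
    rw [(hA σ).2.1]
    rfl
  have h0 : ∀ {b : SimplexCategory} (σ : CechSimplex U b) (i : Fin (b.len + 1)),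
      lc (basis (G.rank σ i)) (G.basisVec σ i) (A.a σ 0 (SimplexCategory.const ⦋0⦌ b i)) =
      (fun c => G.totD σ (G.basisVec σ i c)) ↔ ∀ (n : ℤ) (y : ℕ),
      (G.E σ).d n (n + 1) (G.frame σ i n y) =
        ∑ x ∈ Finset.range ((G.rank σ i).1 (n + 1)),
          A.a σ 0 (SimplexCategory.const ⦋0⦌ b i) ⟨n + 1, x⟩ ⟨n, y⟩ • G.frame σ i (n + 1) x := by
    intro b σ i
    refine (lc_totalFrame_eq_iff _ _ (fun x y hxy =>
      ((A.isHom σ 0 _).congr_degree (by simp) x y hxy).2.2)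
      (G.isHomogeneous_totD_basisVec σ i)).trans ⟨fun h n y => ?_, fun h y => ?_⟩
    · rw [← h ⟨n, y⟩]
      exact (G.totD_basisVec σ i n y).symm
    · exact (G.totD_basisVec σ i _ _).trans (h _ _)
  have h1 : ∀ {b : SimplexCategory} (σ : CechSimplex U b) (J : ⦋1⦌ ⟶ b),
      lc (basis (G.rank σ (J 0))) (G.basisVec σ (J 0)) (A.a σ 1 J) = G.basisVec σ (J 1) ↔
      ∀ (n : ℤ) (y : ℕ), G.frame σ (J 1) n y = ∑ x ∈ Finset.range ((G.rank σ (J 0)).1 n),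
          A.a σ 1 J ⟨n, x⟩ ⟨n, y⟩ • G.frame σ (J 0) n x := by
    intro b σ J
    refine (lc_totalFrame_eq_iff _ _ (deg := fun c : Ix => c.1) (fun x y hxy =>
      (((A.isHom σ 1 _).congr_degree (q := 0) (by simp) x y hxy).2.2).trans (add_zero _))
      (isHomogeneous_totalFrame _)).trans ⟨fun h n y => ?_, fun h y => ?_⟩
    · rw [← h ⟨n, y⟩]
      exact (totalFrame_apply _ _ _).symm
    · exact (totalFrame_apply _ _ _).trans (h _ _)
  have h2 : ∀ {c b : SimplexCategory} (t : c ⟶ b) (σ : CechSimplex U b) (m : Fin (c.len + 1)),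
      lc (basis (G.rank σ (t m))) (G.basisVec σ (t m)) (A.cmpl t σ m).inc =
      (fun c => G.totTr t σ (G.basisVec (σ.pull t) m c)) ↔
      ∀ (n : ℤ) (y : ℕ), G.tr t σ n (G.frame (σ.pull t) m n y) =
        ∑ x ∈ Finset.range ((G.rank σ (t m)).1 n),
          (A.cmpl t σ m).inc ⟨n, x⟩ ⟨n, y⟩ • G.frame σ (t m) n x := by
    intro c b t σ m
    refine (lc_totalFrame_eq_iff _ _ (deg := fun c : Ix => c.1) (fun x y hxy =>
      (((A.split t σ m).isHom x y hxy).2.2).trans (add_zero _))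
      (fun x n hn => G.isHomogeneous_sumVec t σ m (Sum.inl x) n hn)).trans
      ⟨fun h n y => ?_, fun h y => ?_⟩
    · rw [← h ⟨n, y⟩]
      exact (G.totTr_basisVec_apply t σ m n y).symm
    · exact (G.totTr_basisVec_apply t σ m _ _).trans (h _ _)
  have h3 : ∀ {c b : SimplexCategory} (t : c ⟶ b) (σ : CechSimplex U b) (m : Fin (c.len + 1)),
      lc (basis (G.rank σ (t m))) (G.basisVec σ (t m)) (A.cmpl t σ m).perp = G.totEvec t σ m ↔
      ∀ (n : ℤ) (y : EIx), G.evec t σ m n y =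
        ∑ x ∈ Finset.range ((G.rank σ (t m)).1 n),
          (A.cmpl t σ m).perp ⟨n, x⟩ y • G.frame σ (t m) n x := by
    intro c b t σ m
    refine ⟨fun h n y => ?_, fun h => funext fun y => funext fun n => ?_⟩
    · rw [← lc_totalFrame_apply, h]
      rfl
    · rw [lc_totalFrame_apply, ← h]
      rfl
  constructor
  · intro h
    refine ⟨fun σ => ?_, fun t σ m => ?_, fun σ i => (h0 σ i).2 ?_, fun σ J => (h1 σ J).2 ?_,
      fun t σ m => (h2 t σ m).2 ?_, fun t σ m => (h3 t σ m).2 ?_⟩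
    · rw [(hA σ).1]
      exact funext (h σ).1
    · rw [(hA σ).2.2 t]
      exact ((h σ).2.2.2 t m).1
    · rw [← hd]
      exact (h σ).2.1 i
    · rw [(hA σ).2.1]
      exact (h σ).2.2.1 J
    · rw [(hA σ).2.2 t]
      exact ((h σ).2.2.2 t m).2.1
    · rw [(hA σ).2.2 t]
      exact ((h σ).2.2.2 t m).2.2
  · intro h b σ
    refine ⟨fun i => ?_, fun i => ?_, fun J => ?_, fun {c} t m => ?_⟩
    · rw [← h.rank, (hA σ).1]
    · rw [hd]
      exact (h0 σ i).1 (h.d σ i)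
    · rw [← (hA σ).2.1]
      exact (h1 σ J).1 (h.frame σ J)
    · rw [← (hA σ).2.2 t]
      exact ⟨h.el t σ m, (h2 t σ m).1 (h.tr t σ m), (h3 t σ m).1 (h.evec t σ m)⟩

end GreenComplex

end greenData

/-! ### Isomorphisms of Green complexes and matrices -/

section frames

variable {R R' M M' : Type} [CommRing R] [CommRing R'] [AddCommGroup M] [Module R M]
  [AddCommGroup M'] [Module R M']

theorem IsFrame.exists_linearEquiv {r : ℕ} {e : ℕ → M} {e' : ℕ → M'} (h : IsFrame R r e)
    (h' : IsFrame R r e') : ∃ L : M ≃ₗ[R] M', ∀ x, L (e x) = e' x := by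
  let φ : (Fin r → R) ≃ₗ[R] M :=
    LinearEquiv.ofBijective (Fintype.linearCombination R fun x : Fin r => e x) h.2
  let φ' : (Fin r → R) ≃ₗ[R] M' :=
    LinearEquiv.ofBijective (Fintype.linearCombination R fun x : Fin r => e' x) h'.2
  refine ⟨φ.symm.trans φ', fun x => ?_⟩
  by_cases hx : x < r
  · have h1 : φ (Pi.single ⟨x, hx⟩ 1) = e x :=
      (Fintype.linearCombination_apply_single R (fun x : Fin r => e x) ⟨x, hx⟩ 1).trans
        (one_smul _ _)
    rw [LinearEquiv.trans_apply, ← h1, LinearEquiv.symm_apply_apply]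
    exact (Fintype.linearCombination_apply_single R (fun x : Fin r => e' x) ⟨x, hx⟩ 1).trans
      (one_smul _ _)
  · rw [h.1 x (not_lt.1 hx), h'.1 x (not_lt.1 hx), map_zero]

theorem IsFrame.map_eq {r : ℕ} {e : ℕ → M} (h : IsFrame R r e) {T : Type} [AddCommGroup T]
    [Module R' T] {ρ : R →+* R'} {f g : M →ₛₗ[ρ] T} (hfg : ∀ x, f (e x) = g (e x)) (z : M) :
    f z = g z := by
  obtain ⟨c, rfl⟩ := h.2.2 z
  simp [map_sum, LinearMap.map_smulₛₗ, hfg]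

end frames

section greenIso

variable {X : Type} [TopologicalSpace X] {ι : Type} {O : (Opens X)ᵒᵖ ⥤ CommRingCat.{0}}
  {S : Set ℤ} {U : ι → Opens X}

namespace GreenComplex

variable {G G' : GreenComplex O S U} {A : SimplicialTwistingCochain O S U}

theorem HasMatrices.d_frame (h : G.HasMatrices A) {b : SimplexCategory} (σ : CechSimplex U b)
    (i : Fin (b.len + 1)) (n : ℤ) (y : ℕ) : (G.E σ).d n (n + 1) (G.frame σ i n y) =
      ∑ x ∈ Finset.range ((A.rank σ i).1 (n + 1)),
        A.a σ 0 (SimplexCategory.const ⦋0⦌ b i) ⟨n + 1, x⟩ ⟨n, y⟩ • G.frame σ i (n + 1) x := by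
  have h1 := congrFun (congrFun (h.d σ i) ⟨n, y⟩) (n + 1)
  rw [totD_basisVec, lc_totalFrame_apply] at h1
  rw [← h1, h.rank]

theorem HasMatrices.frame_eq (h : G.HasMatrices A) {b : SimplexCategory} (σ : CechSimplex U b)
    (J : ⦋1⦌ ⟶ b) (n : ℤ) (y : ℕ) : G.frame σ (J 1) n y =
      ∑ x ∈ Finset.range ((A.rank σ (J 0)).1 n), A.a σ 1 J ⟨n, x⟩ ⟨n, y⟩ • G.frame σ (J 0) n x := by
  have h1 := congrFun (congrFun (h.frame σ J) ⟨n, y⟩) n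
  rw [lc_totalFrame_apply] at h1
  rw [h.rank, h1]
  exact (totalFrame_apply _ _ _).symm

theorem HasMatrices.tr_frame (h : G.HasMatrices A) {c b : SimplexCategory} (t : c ⟶ b)
    (σ : CechSimplex U b) (m : Fin (c.len + 1)) (n : ℤ) (y : ℕ) :
    G.tr t σ n (G.frame (σ.pull t) m n y) = ∑ x ∈ Finset.range ((A.rank σ (t m)).1 n),
      (A.cmpl t σ m).inc ⟨n, x⟩ ⟨n, y⟩ • G.frame σ (t m) n x := by
  have h1 := congrFun (congrFun (h.tr t σ m) ⟨n, y⟩) n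
  rw [lc_totalFrame_apply, totTr_basisVec_apply] at h1
  rw [h.rank, h1]

theorem HasMatrices.evec_eq (h : G.HasMatrices A) {c b : SimplexCategory} (t : c ⟶ b)
    (σ : CechSimplex U b) (m : Fin (c.len + 1)) (n : ℤ) (y : EIx) :
    G.evec t σ m n y = ∑ x ∈ Finset.range ((A.rank σ (t m)).1 n),
      (A.cmpl t σ m).perp ⟨n, x⟩ y • G.frame σ (t m) n x := by
  have h1 := congrFun (congrFun (h.evec t σ m) y) n
  rw [lc_totalFrame_apply] at h1
  rw [h.rank, h1]
  rfl

/-- Map the frame of the first member to its counterpart. Equal change-of-frame matrices then match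
all frames, and the other equal matrices match the differentials, the transition maps and the
elementary vectors. -/
theorem HasMatrices.iso (h : G.HasMatrices A) (h' : G'.HasMatrices A) : G.Iso G' := by
  have hr : ∀ {b : SimplexCategory} (σ : CechSimplex U b), G.rank σ = G'.rank σ := fun σ =>
    (h.rank σ).symm.trans (h'.rank σ)
  have hL : ∀ {b : SimplexCategory} (σ : CechSimplex U b) (n : ℤ),
      ∃ L : (G.E σ).X n ≃ₗ[O.obj (op σ.opens)] (G'.E σ).X n,
        ∀ x, L (G.frame σ 0 n x) = G'.frame σ 0 n x := fun {b} σ n =>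
    (G.isFrame σ 0 n).exists_linearEquiv (by
      rw [hr]
      exact G'.isFrame σ 0 n)
  choose L hL0 using fun (b : SimplexCategory) (σ : CechSimplex U b) (n : ℤ) => hL σ n
  have hLi : ∀ {b : SimplexCategory} (σ : CechSimplex U b) (i : Fin (b.len + 1)) (n : ℤ) (x : ℕ),
      L b σ n (G.frame σ i n x) = G'.frame σ i n x := fun {b} σ i n x => by
    -- Edges are labelled only for increasing pairs; starting from member 0 reaches every member.
    let J : ⦋1⦌ ⟶ b := SimplexCategory.mkOfLe (n := b.len) 0 i (Fin.zero_le i)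
    refine (congrArg (L b σ n) (h.frame_eq σ J n x)).trans
      (Eq.trans ?_ (h'.frame_eq σ J n x).symm)
    rw [map_sum]
    refine Finset.sum_congr rfl fun y _ => ?_
    rw [map_smul]
    exact congrArg _ (hL0 b σ n y)
  have hLs : ∀ {b : SimplexCategory} (σ : CechSimplex U b) (i : Fin (b.len + 1)) (n : ℤ)
      (a : ℕ → O.obj (op σ.opens)) (s : Finset ℕ),
      L b σ n (∑ x ∈ s, a x • G.frame σ i n x) = ∑ x ∈ s, a x • G'.frame σ i n x := by
    intro b σ i n a s
    rw [map_sum]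
    refine Finset.sum_congr rfl fun y _ => ?_
    rw [map_smul, hLi]
  refine ⟨hr, fun t σ => funext fun m => (h.el t σ m).symm.trans (h'.el t σ m),
    fun {b} σ => HomologicalComplex.Hom.isoOfComponents (fun n => (L b σ n).toModuleIso) ?_,
    fun σ i n x => hLi σ i n x, fun {c b} t σ n z => ?_, fun {c b} t σ m n y => ?_⟩
  · rintro n _ rfl
    refine ModuleCat.hom_ext (LinearMap.ext fun z => ?_)
    refine (G.isFrame σ 0 n).map_eq (f := ((G'.E σ).d n (n + 1)).hom ∘ₗ (L b σ n).toLinearMap)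
      (g := (L b σ (n + 1)).toLinearMap ∘ₗ ((G.E σ).d n (n + 1)).hom) (fun x => ?_) z
    change (G'.E σ).d n (n + 1) (L b σ n (G.frame σ 0 n x)) =
      L b σ (n + 1) ((G.E σ).d n (n + 1) (G.frame σ 0 n x))
    rw [hLi, h.d_frame, h'.d_frame, hLs]
  · refine (G.isFrame (σ.pull t) 0 n).map_eq
      (f := (L b σ n).toLinearMap.comp (G.tr t σ n))
      (g := (G'.tr t σ n).comp (L c (σ.pull t) n).toLinearMap) (fun x => ?_) z
    change L b σ n (G.tr t σ n (G.frame (σ.pull t) 0 n x)) =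
      G'.tr t σ n (L c (σ.pull t) n (G.frame (σ.pull t) 0 n x))
    rw [hLi, h.tr_frame, h'.tr_frame, hLs]
  · change L b σ n (G.evec t σ m n y) = G'.evec t σ m n y
    rw [h.evec_eq, h'.evec_eq, hLs]

/-- An isomorphism that carries frames to frames preserves coefficients of linear expansions. -/
theorem Iso.hasMatrices (e : G.Iso G') (h : G.HasMatrices A) : G'.HasMatrices A := by
  obtain ⟨hr, he, f, hf, ht, hv⟩ := e
  let F : ∀ {b : SimplexCategory} (σ : CechSimplex U b), G.Tot σ →ₗ[O.obj (op σ.opens)] G'.Tot σ :=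
    fun σ => LinearMap.pi fun n => ((f σ).hom.f n).hom ∘ₗ LinearMap.proj n
  have hF : ∀ {b : SimplexCategory} (σ : CechSimplex U b) (i : Fin (b.len + 1)),
      (fun x => F σ (G.basisVec σ i x)) = G'.basisVec σ i := by
    rintro b σ i
    funext ⟨n, x⟩ k
    change (f σ).hom.f k (totalFrame (G.frame σ i) ⟨n, x⟩ k) =
      totalFrame (G'.frame σ i) ⟨n, x⟩ k
    by_cases hk : k = n
    · subst hk
      rw [totalFrame_apply, totalFrame_apply, hf]
    · rw [isHomogeneous_totalFrame (G.frame σ i) ⟨n, x⟩ k hk,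
        isHomogeneous_totalFrame (G'.frame σ i) ⟨n, x⟩ k hk, map_zero]
  have hD : ∀ {b : SimplexCategory} (σ : CechSimplex U b) (z : G.Tot σ),
      F σ (G.totD σ z) = G'.totD σ (F σ z) := fun σ z => funext fun n =>
    (congrArg (fun u : (G.E σ).X (n - 1) ⟶ (G'.E σ).X n => u (z (n - 1)))
      ((f σ).hom.comm (n - 1) n)).symm
  have hT : ∀ {c b : SimplexCategory} (t : c ⟶ b) (σ : CechSimplex U b) (z : G.Tot (σ.pull t)),
      F σ (G.totTr t σ z) = G'.totTr t σ (F (σ.pull t) z) := fun t σ z => funext fun n =>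
    ht t σ n (z n)
  have hlc : ∀ {b : SimplexCategory} (σ : CechSimplex U b) (i : Fin (b.len + 1)) {C : Type}
      (M : Matrix Ix C (O.obj (op σ.opens))), lc (basis (G'.rank σ i)) (G'.basisVec σ i) M =
        fun y => F σ (lc (basis (G.rank σ i)) (G.basisVec σ i) M y) := by
    intro b σ i C M
    funext y
    rw [map_lc_linear, hF, hr]
  refine ⟨fun σ => (h.rank σ).trans (hr σ), fun t σ m => (h.el t σ m).trans
    (congrFun (he t σ) m), fun σ i => ?_, fun σ J => ?_, fun t σ m => ?_, fun t σ m => ?_⟩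
  · rw [hlc, h.d]
    funext x
    rw [hD]
    exact congrArg _ (congrFun (hF σ i) x)
  · rw [hlc, h.frame, hF]
  · rw [hlc, h.tr]
    funext x
    rw [hT]
    exact congrArg _ (congrFun (hF (σ.pull t) m) x)
  · rw [hlc, h.evec]
    funext y n
    exact hv t σ m n y

end GreenComplex

end greenIso

/-- Equivalences with sets of isomorphism classes, from a relation between objects and
invariants and an object in every class. -/
theorem exists_equiv_quot_of_section {V T : Type} {W : Type 1} (e : V ≃ T) (I : W → W → Prop)
    (P : W → T → Prop) (s : T → W) (h1 : ∀ g, ∃ v, P g v) (h2 : ∀ g v v', P g v → P g v' → v = v')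
    (h3 : ∀ v, P (s v) v) (h4 : ∀ g v, P g v → I g (s v))
    (h5 : ∀ g g' v, I g g' → P g v → P g' v) :
    ∃ Φ : V ≃ Quot I, ∀ v g, Φ v = Quot.mk _ g ↔ P g (e v) := by
  choose m hm using h1
  let Φ : T ≃ Quot I :=
    { toFun v := Quot.mk _ (s v)
      -- The invariant descends to the quotient because related objects share their invariants and
      -- each object has only one.
      invFun := Quot.lift m fun g g' h => h2 g' _ _ (h5 g g' _ h (hm g)) (hm g')
      left_inv v := h2 (s v) _ _ (hm (s v)) (h3 v)
      right_inv := by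
        rintro ⟨g⟩
        exact (Quot.sound (h4 _ _ (hm g))).symm }
  refine ⟨e.trans Φ, fun v g => ⟨fun h => ?_, fun h => (Quot.sound (h4 _ _ h)).symm⟩⟩
  have h6 : e v = m g := (Φ.symm_apply_apply (e v)).symm.trans (congrArg Φ.symm h)
  rw [h6]
  exact hm g

/-- Equivalences with sets of isomorphism classes, from a relation between objects and
invariants. -/
theorem exists_equiv_quot {V T : Type} {W : Type 1} (e : V ≃ T) (I : W → W → Prop)
    (P : W → T → Prop) (h1 : ∀ g, ∃ v, P g v) (h2 : ∀ g v v', P g v → P g v' → v = v')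
    (h3 : ∀ v, ∃ g, P g v) (h4 : ∀ g g' v, P g v → P g' v → I g g')
    (h5 : ∀ g g' v, I g g' → P g v → P g' v) :
    ∃ Φ : V ≃ Quot I, ∀ v g, Φ v = Quot.mk _ g ↔ P g (e v) := by
  choose s hs using h3
  exact exists_equiv_quot_of_section e I P s h1 h2 hs (fun g v h => h4 _ _ _ h (hs v)) h5

/-! ### Graded modules of column vectors -/

section columns

variable {S : Set ℤ} {A B C R R' : Type} [CommRing R] [CommRing R']

/-- The homogeneous part of degree `n` of the graded free module of rank `r`, as a module of
columns. -/
def vecs (R : Type) [CommRing R] (r : Rk S) (n : ℤ) : Submodule R (Matrix Ix Unit R) where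
  carrier := {z | ∀ x u, z x u ≠ 0 → x ∈ basis r ∧ x.1 = n}
  add_mem' {z w} hz hw x u h := by
    by_cases h0 : z x u = 0
    · exact hw x u fun h1 => h (by rw [Matrix.add_apply, h0, h1, add_zero])
    · exact hz x u h0
  zero_mem' _ _ h := absurd rfl h
  smul_mem' a z hz x u h := hz x u fun h0 => h (by rw [Matrix.smul_apply, h0, smul_zero])

/-- The map on homogeneous parts given by a matrix and a base change. -/
def vecsMap (ρ : R →+* R') {r s : Rk S} {q : ℤ} {M : Matrix Ix Ix R'} (hM : IsHom r s q M)
    {n m : ℤ} (h : n + q = m) : vecs R r n →ₛₗ[ρ] vecs R' s m where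
  toFun z := ⟨mcomp (basis r) M (z.1.map ρ), fun x u hxu => by
    obtain ⟨b, -, hb⟩ := Finset.exists_ne_zero_of_sum_ne_zero hxu
    have h1 := hM x b (left_ne_zero_of_mul hb)
    have h2 := z.2 b u fun h0 => right_ne_zero_of_mul hb (by rw [Matrix.map_apply, h0, map_zero])
    exact ⟨h1.1, by rw [h1.2.2, h2.2, h]⟩⟩
  map_add' z w := Subtype.ext (by
    ext x u
    simp [mcomp, mul_add, Finset.sum_add_distrib])
  map_smul' a z := Subtype.ext (by
    ext x u
    simp only [mcomp, Submodule.coe_smul, Matrix.map_apply, Matrix.smul_apply, smul_eq_mul,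
      map_mul, Finset.mul_sum]
    exact Finset.sum_congr rfl fun _ _ => by ring)

/-- The columns of the matrix are homogeneous of the given degrees. -/
def HasDeg (r : Rk S) (deg : B → ℤ) (M : Matrix Ix B R) : Prop :=
  ∀ x y, M x y ≠ 0 → x ∈ basis r ∧ x.1 = deg y

theorem IsHom.hasDeg {r s : Rk S} {q : ℤ} {M : Matrix Ix Ix R} (h : IsHom r s q M) :
    HasDeg s (fun y => y.1 + q) M :=
  fun x y hxy => ⟨(h x y hxy).1, (h x y hxy).2.2⟩

theorem IsHom.hasDeg_zero {r s : Rk S} {M : Matrix Ix Ix R} (h : IsHom r s 0 M) :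
    HasDeg s (fun y => y.1) M :=
  fun x y hxy => ⟨(h x y hxy).1, ((h x y hxy).2.2).trans (add_zero _)⟩

theorem HasDeg.mcomp {r s : Rk S} {deg : B → ℤ} {M : Matrix Ix Ix R} (hM : IsHom r s 0 M)
    {N : Matrix Ix B R} (hN : HasDeg r deg N) : HasDeg s deg (mcomp (basis r) M N) := by
  intro x y hxy
  obtain ⟨b, -, hb⟩ := Finset.exists_ne_zero_of_sum_ne_zero hxy
  have h1 := hM x b (left_ne_zero_of_mul hb)
  exact ⟨h1.1, by rw [h1.2.2, (hN b y (right_ne_zero_of_mul hb)).2, add_zero]⟩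

/-- The part of degree `n` of a column of a matrix. -/
def vecsCol {r : Rk S} {deg : B → ℤ} {M : Matrix Ix B R} (hM : HasDeg r deg M) (n : ℤ) (y : B) :
    vecs R r n :=
  ⟨fun x _ => if deg y = n then M x y else 0, fun x _ hx => by
    by_cases h : deg y = n
    · exact ⟨(hM x y fun h0 => hx ((if_pos h).trans h0)).1,
        (hM x y fun h0 => hx ((if_pos h).trans h0)).2.trans h⟩
    · exact absurd (if_neg h) hx⟩

theorem vecsCol_val {r : Rk S} {deg : B → ℤ} {M : Matrix Ix B R} (hM : HasDeg r deg M) (y : B) :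
    (vecsCol hM (deg y) y).1 = fun x _ => M x y :=
  funext fun _ => funext fun _ => if_pos rfl

theorem vecsCol_eq_zero {r : Rk S} {deg : B → ℤ} {M : Matrix Ix B R} (hM : HasDeg r deg M) {n : ℤ}
    {y : B} (h : deg y ≠ n) : vecsCol hM n y = 0 :=
  Subtype.ext (funext fun _ => funext fun _ => if_neg h)

/-- The columns of a product are combinations of the columns of its first factor; homogeneity leaves
only the terms of one degree. -/
theorem sum_smul_vecsCol {r s : Rk S} {deg : B → ℤ} {Q : Matrix Ix Ix R}
    (hQ : HasDeg s (fun y => y.1) Q) {M : Matrix Ix B R} (hM : HasDeg r deg M)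
    (hQM : HasDeg s deg (mcomp (basis r) Q M)) (n : ℤ) (y : B) (h : deg y = n) :
    ∑ x ∈ Finset.range (r.1 n), M ⟨n, x⟩ y • vecsCol hQ n ⟨n, x⟩ = vecsCol hQM n y := by
  refine Subtype.ext ?_
  rw [Submodule.coe_sum]
  ext z u
  rw [Matrix.sum_apply]
  subst h
  rw [vecsCol_val hQM]
  change _ = ∑ b ∈ basis r, Q z b * M b y
  have h1 : ∑ b ∈ basis r, Q z b * M b y = ∑ b ∈ basis r with b.1 = deg y, Q z b * M b y := by
    rw [Finset.sum_filter]
    refine Finset.sum_congr rfl fun b _ => ?_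
    split_ifs with hb
    · rfl
    · rw [not_ne_iff.1 fun h0 => hb (hM b y h0).2, mul_zero]
  rw [h1, sum_basis_filter]
  refine Finset.sum_congr rfl fun x _ => ?_
  change M ⟨deg y, x⟩ y * (if deg y = deg y then Q z ⟨deg y, x⟩ else 0) = _
  rw [if_pos rfl, mul_comm]

/-- The columns of the matrix form a homogeneous basis. -/
structure IsColumnBasis (s : Finset B) (deg : B → ℤ) (r : Rk S) (M : Matrix Ix B R) : Prop where
  hasDeg : HasDeg r deg M
  exists_inverse : ∃ N : Matrix B Ix R, (∀ b x, N b x ≠ 0 → b ∈ s ∧ deg b = x.1) ∧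
    (∀ b ∈ s, ∀ b' ∈ s, b = b' → CechTot.mcomp (basis r) N M b b' = 1) ∧
    (∀ b ∈ s, ∀ b' ∈ s, b ≠ b' → CechTot.mcomp (basis r) N M b b' = 0) ∧
    CechTot.mcomp s M N = idMat R r

/-- The left inverse recovers the coefficients from the vector. -/
theorem IsColumnBasis.indep {s : Finset B} {deg : B → ℤ} {r : Rk S} {M : Matrix Ix B R}
    (h : IsColumnBasis s deg r M) (n : ℤ) (a a' : B → R)
    (ha : ∑ b ∈ s with deg b = n, a b • vecsCol h.hasDeg n b =
      ∑ b ∈ s with deg b = n, a' b • vecsCol h.hasDeg n b) (b : B) (hb : b ∈ s)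
    (hn : deg b = n) : a b = a' b := by
  obtain ⟨N, -, h2, h3, -⟩ := h.exists_inverse
  have hval : ∀ (a : B → R) (x : Ix), (∑ b ∈ s with deg b = n, a b • vecsCol h.hasDeg n b).1 x () =
      ∑ b ∈ s with deg b = n, M x b * a b := by
    intro a x
    rw [Submodule.coe_sum, Matrix.sum_apply]
    refine Finset.sum_congr rfl fun c hc => ?_
    change a c * (if deg c = n then M x c else 0) = _
    rw [if_pos (Finset.mem_filter.1 hc).2, mul_comm]
  have hN : ∀ a : B → R, ∑ x ∈ basis r, N b x *
      (∑ b ∈ s with deg b = n, a b • vecsCol h.hasDeg n b).1 x () = a b := by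
    intro a
    simp only [hval, Finset.mul_sum]
    rw [Finset.sum_comm]
    simp only [← mul_assoc, ← Finset.sum_mul]
    change ∑ c ∈ s with deg c = n, mcomp (basis r) N M b c * a c = a b
    rw [Finset.sum_eq_single b]
    · rw [h2 b hb b hb rfl, one_mul]
    · intro c hc hcb
      rw [h3 b hb c (Finset.mem_filter.1 hc).1 hcb.symm, zero_mul]
    · exact fun hb' => absurd (Finset.mem_filter.2 ⟨hb, hn⟩) hb'
  rw [← hN a, ha, hN a']

/-- The right inverse provides the coefficients `N z`; those of the wrong degree vanish. -/
theorem IsColumnBasis.span {s : Finset B} {deg : B → ℤ} {r : Rk S} {M : Matrix Ix B R}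
    (h : IsColumnBasis s deg r M) (n : ℤ) (z : vecs R r n) :
    ∃ a : B → R, ∑ b ∈ s with deg b = n, a b • vecsCol h.hasDeg n b = z := by
  obtain ⟨N, h1, -, -, h4⟩ := h.exists_inverse
  refine ⟨fun b => mcomp (basis r) N z.1 b (), Subtype.ext ?_⟩
  have hz : mcomp (basis r) (idMat R r) z.1 = z.1 := by
    ext x u
    simp only [mcomp, idMat, ite_mul, one_mul, zero_mul]
    by_cases hx : x ∈ basis r
    · rw [Finset.sum_eq_single x]
      · rw [if_pos ⟨rfl, hx⟩]
      · intro b _ hb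
        rw [if_neg (fun h' => hb h'.1.symm)]
      · exact fun h' => absurd hx h'
    · rw [not_ne_iff.1 fun h0 => hx (z.2 x u h0).1, Finset.sum_eq_zero]
      intro b _
      rw [if_neg]
      rintro ⟨rfl, hb⟩
      exact hx hb
  rw [Submodule.coe_sum]
  ext x u
  rw [Matrix.sum_apply]
  refine Eq.trans ?_ (congrFun (congrFun ((mcomp_assoc s (basis r) M N z.1).symm.trans
    ((congrArg (fun L => mcomp (basis r) L z.1) h4).trans hz)) x) u)
  rw [Finset.sum_filter]
  refine Finset.sum_congr rfl fun b _ => ?_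
  split_ifs with hb
  · change mcomp (basis r) N z.1 b () * (if deg b = n then M x b else 0) = _
    rw [if_pos hb, mul_comm]
  · have h0 : mcomp (basis r) N z.1 b u = 0 := by
      by_contra h0
      obtain ⟨y, -, hy⟩ := Finset.exists_ne_zero_of_sum_ne_zero h0
      exact hb ((h1 b y (left_ne_zero_of_mul hy)).2.trans (z.2 y u (right_ne_zero_of_mul hy)).2)
    rw [h0, mul_zero]

theorem IsIsoMat.isColumnBasis {r s : Rk S} {M : Matrix Ix Ix R} (hM : IsHom r s 0 M)
    (h : IsIsoMat r s M) : IsColumnBasis (basis r) (fun c => c.1) s M where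
  hasDeg := hM.hasDeg_zero
  exists_inverse := by
    obtain ⟨N, h1, h2, h3⟩ := h
    refine ⟨N, fun b x hbx => ⟨(h1 b x hbx).1, ((h1 b x hbx).2.2).trans (add_zero _)⟩,
      fun b hb b' _ hbb' => ?_, fun b _ b' _ hbb' => ?_, h3⟩
    · rw [h2, idMat, if_pos ⟨hbb', hbb' ▸ hb⟩]
    · rw [h2, idMat, if_neg fun h' => hbb' h'.1]

/-- The block row of the two inclusions is inverted by the block column of `π` and `ϖ`. -/
theorem IsSplitting.isColumnBasis {r' r : Rk S} {d' d : Matrix Ix Ix R} {c : Cmpl R}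
    (h : IsSplitting r' d' r d c) : IsColumnBasis ((basis r').disjSum (ebasis c.el))
      (GreenComplex.sumDeg c.el) r (Matrix.fromCols c.inc c.perp) where
  hasDeg := by
    rintro x (y | y) hxy
    · exact h.isHom.hasDeg_zero x y hxy
    · exact ⟨(h.perp_supp x y hxy).1, (h.perp_supp x y hxy).2.2⟩
  exists_inverse := by
    obtain ⟨π, ϖ, h1, h2, h3, h4, h5, h6, h7⟩ := h.exists_inverse
    refine ⟨Matrix.fromRows π ϖ, ?_, ?_, ?_, ?_⟩
    · rintro (b | b) x hbx
      · exact ⟨Finset.inl_mem_disjSum.2 (h1 b x hbx).1, ((h1 b x hbx).2.2).trans (add_zero _)⟩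
      · exact ⟨Finset.inr_mem_disjSum.2 (h2 b x hbx).1, (h2 b x hbx).2.2⟩
    · rintro (b | b) hb _ - rfl
      · refine (congrFun (congrFun h3 b) b).trans (if_pos ⟨rfl, Finset.inl_mem_disjSum.1 hb⟩)
      · refine (congrFun (congrFun h6 b) b).trans (if_pos ⟨rfl, Finset.inr_mem_disjSum.1 hb⟩)
    · rintro (b | b) - (b' | b') - hbb'
      · exact (congrFun (congrFun h3 b) b').trans (if_neg fun h' => hbb' (congrArg Sum.inl h'.1))
      · exact congrFun (congrFun h4 b) b'
      · exact congrFun (congrFun h5 b) b'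
      · exact (congrFun (congrFun h6 b) b').trans (if_neg fun h' => hbb' (congrArg Sum.inr h'.1))
    · rw [← h7]
      ext x y
      exact Finset.sum_disjSum _ _ _

theorem IsColumnBasis.mcomp {s : Finset B} {deg : B → ℤ} {r r' : Rk S} {M : Matrix Ix B R}
    (h : IsColumnBasis s deg r M) {g : Matrix Ix Ix R} (hg : IsHom r r' 0 g)
    (hi : IsIsoMat r r' g) : IsColumnBasis s deg r' (mcomp (basis r) g M) where
  hasDeg := HasDeg.mcomp hg h.hasDeg
  exists_inverse := by
    obtain ⟨N, h1, h2, h3, h4⟩ := h.exists_inverse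
    obtain ⟨g', k1, k2, k3⟩ := hi
    have hM : CechTot.mcomp (basis r) (idMat R r) M = M := by
      ext x y
      by_cases hx : x ∈ basis r
      · refine (Finset.sum_eq_single x (fun b _ hb => ?_) fun h' => absurd hx h').trans ?_
        · rw [idMat, if_neg (fun h' => hb h'.1.symm), zero_mul]
        · rw [idMat, if_pos ⟨rfl, hx⟩, one_mul]
      · rw [not_ne_iff.1 fun h0 => hx (h.hasDeg x y h0).1]
        refine Finset.sum_eq_zero fun b hb => ?_
        rw [idMat, if_neg, zero_mul]
        rintro ⟨rfl, -⟩
        exact hx hb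
    have e : CechTot.mcomp (basis r') (CechTot.mcomp (basis r) N g') (CechTot.mcomp (basis r) g M) =
        CechTot.mcomp (basis r) N M := by
      rw [mcomp_assoc, ← mcomp_assoc (basis r') (basis r) g' g M, k2, hM]
    refine ⟨CechTot.mcomp (basis r) N g', fun b x hbx => ?_, ?_, ?_, ?_⟩
    · obtain ⟨y, -, hy⟩ := Finset.exists_ne_zero_of_sum_ne_zero hbx
      have h5 := h1 b y (left_ne_zero_of_mul hy)
      have h6 := k1 y x (right_ne_zero_of_mul hy)
      exact ⟨h5.1, by rw [h5.2, h6.2.2, add_zero]⟩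
    · rw [e]
      exact h2
    · rw [e]
      exact h3
    · rw [mcomp_assoc, ← mcomp_assoc s (basis r) M N g', h4, idMat_mcomp k1, k3]

theorem IsColumnBasis.isFrame {r s : Rk S} {M : Matrix Ix Ix R}
    (h : IsColumnBasis (basis r) (fun c => c.1) s M) (h0 : ∀ x y, M x y ≠ 0 → y ∈ basis r) (n : ℤ) :
    IsFrame R (r.1 n) fun x => vecsCol h.hasDeg n ⟨n, x⟩ := by
  refine ⟨fun x hx => Subtype.ext (funext fun y => funext fun _ => ?_),
    fun c c' hcc' => ?_, fun z => ?_⟩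
  · change (if n = n then M y ⟨n, x⟩ else 0) = 0
    rw [if_pos rfl]
    by_contra hy
    have := mem_basis.1 (h0 _ _ hy)
    omega
  · have hsum : ∀ c : Fin (r.1 n) → R, ∑ b ∈ basis r with b.1 = n,
        (if hb : b.2 < r.1 n then c ⟨b.2, hb⟩ else 0) • vecsCol h.hasDeg n b =
        ∑ x : Fin (r.1 n), c x • vecsCol h.hasDeg n ⟨n, x⟩ := fun c => by
      rw [sum_basis_filter, Finset.sum_range]
      refine Finset.sum_congr rfl fun x _ => ?_
      rw [dif_pos x.2]
    have h1 := h.indep n (fun b => if hb : b.2 < r.1 n then c ⟨b.2, hb⟩ else 0)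
      (fun b => if hb : b.2 < r.1 n then c' ⟨b.2, hb⟩ else 0)
      ((hsum c).trans (Eq.trans hcc' (hsum c').symm))
    funext x
    have h2 := h1 ⟨n, x⟩ (mem_basis.2 x.2) rfl
    simpa using h2
  · obtain ⟨a, ha⟩ := h.span n z
    refine ⟨fun x => a ⟨n, x⟩, ?_⟩
    rw [← ha, sum_basis_filter, Finset.sum_range]

theorem IsColumnBasis.bijective {r' r : Rk S} {el : El} {M : Matrix Ix (Ix ⊕ EIx) R}
    (h : IsColumnBasis ((basis r').disjSum (ebasis el)) (GreenComplex.sumDeg el) r M) (n : ℤ) :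
    Function.Bijective fun z : (Fin (r'.1 n) → R) ×
        ({y // y ∈ (ebasis el).filter fun y => edeg el y = n} → R) =>
      ∑ x, z.1 x • vecsCol h.hasDeg n (Sum.inl ⟨n, x⟩) +
        ∑ y, z.2 y • vecsCol h.hasDeg n (Sum.inr y.1) := by
  have hsum : ∀ a : Ix ⊕ EIx → R,
      ∑ b ∈ (basis r').disjSum (ebasis el) with GreenComplex.sumDeg el b = n,
      a b • vecsCol h.hasDeg n b =
      ∑ x : Fin (r'.1 n), a (Sum.inl ⟨n, x⟩) • vecsCol h.hasDeg n (Sum.inl ⟨n, x⟩) +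
        ∑ y : {y // y ∈ (ebasis el).filter fun y => edeg el y = n},
          a (Sum.inr y.1) • vecsCol h.hasDeg n (Sum.inr y.1) := by
    intro a
    rw [Finset.sum_filter, Finset.sum_disjSum, ← Finset.sum_filter, ← Finset.sum_filter]
    congr 1
    · refine (sum_basis_filter r' (fun x => a (Sum.inl x) • vecsCol h.hasDeg n (Sum.inl x)) n).trans
        (Finset.sum_range _)
    · exact (Finset.sum_coe_sort ((ebasis el).filter fun y => edeg el y = n)
        fun y => a (Sum.inr y) • vecsCol h.hasDeg n (Sum.inr y)).symm
  have hex : ∀ z : (Fin (r'.1 n) → R) ×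
      ({y // y ∈ (ebasis el).filter fun y => edeg el y = n} → R), ∃ a : Ix ⊕ EIx → R,
      (∀ x : Fin (r'.1 n), a (Sum.inl ⟨n, x⟩) = z.1 x) ∧ ∀ y, a (Sum.inr y.1) = z.2 y := by
    classical
    intro z
    refine ⟨Sum.elim (fun x => if h : x.2 < r'.1 n then z.1 ⟨x.2, h⟩ else 0)
      (fun y => if h : y ∈ (ebasis el).filter fun y => edeg el y = n then z.2 ⟨y, h⟩ else 0),
      fun x => ?_, fun y => ?_⟩
    · simp
    · rw [Sum.elim_inr, dif_pos y.2]
  constructor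
  · intro z z' hzz'
    obtain ⟨a, ha1, ha2⟩ := hex z
    obtain ⟨a', ha1', ha2'⟩ := hex z'
    have h1 := h.indep n a a' (by
      simp only [hsum, ha1, ha2, ha1', ha2']
      exact hzz')
    refine Prod.ext (funext fun x => ?_) (funext fun y => ?_)
    · have := h1 (Sum.inl ⟨n, x⟩) (Finset.inl_mem_disjSum.2 (mem_basis.2 x.2)) rfl
      rwa [← ha1, ← ha1']
    · have := h1 (Sum.inr y.1) (Finset.inr_mem_disjSum.2 (Finset.mem_filter.1 y.2).1)
        (Finset.mem_filter.1 y.2).2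
      rwa [← ha2, ← ha2']
  · intro z
    obtain ⟨a, ha⟩ := h.span n z
    refine ⟨(fun x => a (Sum.inl ⟨n, x⟩), fun y => a (Sum.inr y.1)), ?_⟩
    rw [← ha, hsum]

end columns

/-! ### The Green complex of a simplicial twisting cochain without higher components -/

section toGreen

variable {X : Type} [TopologicalSpace X] {ι : Type} {O : (Opens X)ᵒᵖ ⥤ CommRingCat.{0}}
  {S : Set ℤ} {U : ι → Opens X}

namespace SimplicialTwistingCochain

variable (A : SimplicialTwistingCochain O S U) {b c : SimplexCategory} (σ : CechSimplex U b)

/-- The change of frame matrices from the first member of a tuple to the other ones. -/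
def chg (j : Fin (b.len + 1)) : Matrix Ix Ix (O.obj (op σ.opens)) :=
  A.a σ 1 (SimplexCategory.mkOfLe (n := b.len) 0 j (Fin.zero_le j))

theorem isHom_chg (j : Fin (b.len + 1)) : IsHom (A.rank σ j) (A.rank σ 0) 0 (A.chg σ j) :=
  (A.isHom σ 1 (SimplexCategory.mkOfLe (n := b.len) 0 j (Fin.zero_le j))).congr_degree (by simp)

theorem isHom_d (j : Fin (b.len + 1)) :
    IsHom (A.rank σ j) (A.rank σ j) 1 (A.a σ 0 (SimplexCategory.const ⦋0⦌ b j)) :=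
  (A.isHom σ 0 (SimplexCategory.const ⦋0⦌ b j)).congr_degree (by simp)

theorem chg_d (j : Fin (b.len + 1)) :
    mcomp (basis (A.rank σ j)) (A.chg σ j) (A.a σ 0 (SimplexCategory.const ⦋0⦌ b j)) =
      mcomp (basis (A.rank σ 0)) (A.a σ 0 (SimplexCategory.const ⦋0⦌ b 0)) (A.chg σ j) :=
  (A.dgSimplex σ).edge_comm (SimplexCategory.mkOfLe (n := b.len) 0 j (Fin.zero_le j))

/-- The matrices of the maps of complexes in the frames of the first members. -/
def trMat (t : c ⟶ b) : Matrix Ix Ix (O.obj (op σ.opens)) :=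
  mcomp (basis (A.rank σ (t 0))) (A.chg σ (t 0)) (A.cmpl t σ 0).inc

theorem isHom_trMat (t : c ⟶ b) : IsHom (A.rank (σ.pull t) 0) (A.rank σ 0) 0 (A.trMat σ t) :=
  ((A.isHom_chg σ (t 0)).comp (A.split t σ 0).isHom).congr_degree (add_zero 0)

theorem trMat_d (t : c ⟶ b) : mcomp (basis (A.rank (σ.pull t) 0)) (A.trMat σ t)
      (resMat O (σ.incl t) (A.a (σ.pull t) 0 (SimplexCategory.const ⦋0⦌ c 0))) =
    mcomp (basis (A.rank σ 0)) (A.a σ 0 (SimplexCategory.const ⦋0⦌ b 0)) (A.trMat σ t) := by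
  rw [trMat, mcomp_assoc, (A.split t σ 0).inc_comm, ← mcomp_assoc, chg_d, mcomp_assoc]

/-- The matrices of the elementary complements in the frames of the first members. -/
def perpMat (t : c ⟶ b) (m : Fin (c.len + 1)) : Matrix Ix EIx (O.obj (op σ.opens)) :=
  mcomp (basis (A.rank σ (t m))) (A.chg σ (t m)) (A.cmpl t σ m).perp

theorem hasDeg_perpMat (t : c ⟶ b) (m : Fin (c.len + 1)) :
    HasDeg (A.rank σ 0) (edeg (A.cmpl t σ m).el) (A.perpMat σ t m) :=
  HasDeg.mcomp (A.isHom_chg σ (t m)) fun x y hxy =>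
    ⟨((A.split t σ m).perp_supp x y hxy).1, ((A.split t σ m).perp_supp x y hxy).2.2⟩

theorem perpMat_eq_zero (t : c ⟶ b) (m : Fin (c.len + 1)) (x : Ix) (y : EIx)
    (hy : y ∉ ebasis (A.cmpl t σ m).el) : A.perpMat σ t m x y = 0 :=
  Finset.sum_eq_zero fun z _ => by
    rw [not_ne_iff.1 fun h0 => hy ((A.split t σ m).perp_supp z y h0).2.1, mul_zero]

theorem perpMat_ediff (t : c ⟶ b) (m : Fin (c.len + 1)) :
    mcomp (ebasis (A.cmpl t σ m).el) (A.perpMat σ t m) (ediff _ (A.cmpl t σ m).el) =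
    mcomp (basis (A.rank σ 0)) (A.a σ 0 (SimplexCategory.const ⦋0⦌ b 0)) (A.perpMat σ t m) := by
  rw [perpMat, mcomp_assoc, (A.split t σ m).perp_comm, ← mcomp_assoc, chg_d, mcomp_assoc]

variable {A}

namespace IsOne

variable (hA : A.IsOne)
include hA

/-- The label of the triangle on `0`, `J 0`, `J 1` vanishes, so its relation makes change of frame
strictly multiplicative rather than multiplicative up to homotopy. -/
theorem chg_comp (J : ⦋1⦌ ⟶ b) :
    mcomp (basis (A.rank σ (J 0))) (A.chg σ (J 0)) (A.a σ 1 J) = A.chg σ (J 1) := by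
  have hJ : J 0 ≤ J 1 := J.toOrderHom.monotone (Fin.zero_le 1)
  let T : ⦋2⦌ ⟶ b := SimplexCategory.mkOfLeComp (n := b.len) 0 (J 0) (J 1) (Fin.zero_le _) hJ
  have h := (A.dgSimplex σ).triangle_rel T
  have e0 : SimplexCategory.δ 0 ≫ T = J := by
    ext i : 3
    fin_cases i <;> rfl
  have e1 : SimplexCategory.δ 1 ≫ T =
      SimplexCategory.mkOfLe (n := b.len) 0 (J 1) (Fin.zero_le _) := by
    ext i : 3
    fin_cases i <;> rfl
  have e2 : SimplexCategory.δ 2 ≫ T =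
      SimplexCategory.mkOfLe (n := b.len) 0 (J 0) (Fin.zero_le _) := by
    ext i : 3
    fin_cases i <;> rfl
  rw [e0, e1, e2, show (A.dgSimplex σ).φ 2 T = 0 from hA.higher σ 2 T le_rfl, zero_mcomp,
    mcomp_zero, add_zero] at h
  exact (sub_eq_zero.1 h.symm).symm

theorem isIsoMat_chg (j : Fin (b.len + 1)) :
    IsIsoMat (A.rank σ j) (A.rank σ 0) (A.chg σ j) :=
  hA.iso σ (SimplexCategory.mkOfLe (n := b.len) 0 j (Fin.zero_le j))

/-- The transition map is defined with the first member of `τ`; by upper triangularity of the edges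
any other member yields the same map after change of frame. -/
theorem trMat_chg (t : c ⟶ b) (m : Fin (c.len + 1)) :
    mcomp (basis (A.rank (σ.pull t) 0)) (A.trMat σ t) (resMat O (σ.incl t) (A.chg (σ.pull t) m)) =
      mcomp (basis (A.rank σ (t m))) (A.chg σ (t m)) (A.cmpl t σ m).inc := by
  let K : ⦋1⦌ ⟶ c := SimplexCategory.mkOfLe (n := c.len) 0 m (Fin.zero_le m)
  have h1 : mcomp (basis (A.rank σ (t m))) (A.a σ 1 (K ≫ t)) (A.cmpl t σ m).inc =
    mcomp (basis (A.rank (σ.pull t) 0)) (A.cmpl t σ 0).inc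
      (resMat O (σ.incl t) (A.chg (σ.pull t) m)) := (A.upper t σ 0 K).1
  have h2 : mcomp (basis (A.rank σ (t 0))) (A.chg σ (t 0)) (A.a σ 1 (K ≫ t)) = A.chg σ (t m) :=
    hA.chg_comp σ (K ≫ t)
  rw [trMat, mcomp_assoc, ← h1, ← mcomp_assoc, h2]

/-- Coherence compares inclusions at the member `t' 0`, which need not be the first one; `trMat_chg`
bridges the gap. -/
theorem trMat_comp {c' : SimplexCategory} (t' : c' ⟶ c) (t : c ⟶ b) :
    A.trMat σ (t' ≫ t) = mcomp (basis (A.rank (σ.pull t) 0)) (A.trMat σ t)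
      (resMat O (σ.incl t) (A.trMat (σ.pull t) t')) := by
  have h1 : resMat O (σ.incl t) (A.trMat (σ.pull t) t') =
      mcomp (basis (A.rank (σ.pull t) (t' 0))) (resMat O (σ.incl t) (A.chg (σ.pull t) (t' 0)))
        (resMat O (σ.incl t) (A.cmpl t' (σ.pull t) 0).inc) := mcomp_map _ _ _ _
  rw [h1, ← mcomp_assoc, hA.trMat_chg, mcomp_assoc, ← A.coherent]
  rfl

theorem trMat_chg_of_surjective (t : c ⟶ b) (m : Fin (c.len + 1)) (ht : Function.Surjective t) :
    mcomp (basis (A.rank (σ.pull t) 0)) (A.trMat σ t) (resMat O (σ.incl t) (A.chg (σ.pull t) m)) =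
      A.chg σ (t m) := by
  rw [hA.trMat_chg, (A.cmpl_surj t σ m ht).2, mcomp_idMat (A.isHom_chg σ (t m))]

/-- The second column of the block matrix of an edge, in the frame of the first member: the source
of the field `elementary`. -/
theorem chg_perpMat (t : c ⟶ b) {m m' : Fin (c.len + 1)} (hm : m ≤ m') :
    ∃ star : Matrix Ix EIx (O.obj (op σ.opens)), A.perpMat σ t m' =
      mcomp (basis (A.rank (σ.pull t) m)) (mcomp (basis (A.rank (σ.pull t) 0)) (A.trMat σ t)
        (resMat O (σ.incl t) (A.chg (σ.pull t) m))) star +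
      mcomp (ebasis (A.cmpl t σ m).el) (A.perpMat σ t m)
        (emor _ (A.cmpl t σ m').el (A.cmpl t σ m).el) := by
  let K : ⦋1⦌ ⟶ c := SimplexCategory.mkOfLe (n := c.len) m m' hm
  obtain ⟨-, star, h⟩ := A.upper t σ 0 K
  have h1 : mcomp (basis (A.rank σ (t m'))) (A.a σ 1 (K ≫ t)) (A.cmpl t σ m').perp =
    mcomp (basis (A.rank (σ.pull t) m)) (A.cmpl t σ m).inc star +
      mcomp (ebasis (A.cmpl t σ m).el) (A.cmpl t σ m).perp
        (emor _ (A.cmpl t σ m').el (A.cmpl t σ m).el) := h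
  have h2 : mcomp (basis (A.rank σ (t m))) (A.chg σ (t m)) (A.a σ 1 (K ≫ t)) = A.chg σ (t m') :=
    hA.chg_comp σ (K ≫ t)
  refine ⟨star, ?_⟩
  rw [hA.trMat_chg, perpMat, ← h2, mcomp_assoc, h1, mcomp_add, mcomp_assoc, perpMat, mcomp_assoc]

theorem isColumnBasis_chg (i : Fin (b.len + 1)) :
    IsColumnBasis (basis (A.rank σ i)) (fun c => c.1) (A.rank σ 0) (A.chg σ i) :=
  (hA.isIsoMat_chg σ i).isColumnBasis (A.isHom_chg σ i)

theorem isColumnBasis_sum (t : c ⟶ b) (m : Fin (c.len + 1)) :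
    IsColumnBasis ((basis (A.rank (σ.pull t) m)).disjSum (ebasis (A.cmpl t σ m).el))
      (GreenComplex.sumDeg (A.cmpl t σ m).el) (A.rank σ 0) (Matrix.fromCols
        (mcomp (basis (A.rank (σ.pull t) 0)) (A.trMat σ t)
          (resMat O (σ.incl t) (A.chg (σ.pull t) m))) (A.perpMat σ t m)) := by
  have h := (A.split t σ m).isColumnBasis.mcomp (A.isHom_chg σ (t m)) (hA.isIsoMat_chg σ (t m))
  have e : mcomp (basis (A.rank σ (t m))) (A.chg σ (t m))
      (Matrix.fromCols (A.cmpl t σ m).inc (A.cmpl t σ m).perp) = Matrix.fromCols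
        (mcomp (basis (A.rank (σ.pull t) 0)) (A.trMat σ t)
          (resMat O (σ.incl t) (A.chg (σ.pull t) m))) (A.perpMat σ t m) := by
    rw [hA.trMat_chg]
    ext x (y | y) <;> rfl
  rwa [e] at h

end IsOne

end SimplicialTwistingCochain

end toGreen

/-! ### Maps given by matrices, on columns; elementary differentials and morphisms in coordinates.
-/

section columnMaps

variable {S : Set ℤ} {B R R' : Type} [CommRing R] [CommRing R']

/-- A nonzero entry has a row of the same degree as its column, so the degree may be tested on the
row. This frees the formula from `deg`. -/
theorem vecsCol_apply {r : Rk S} {deg : B → ℤ} {M : Matrix Ix B R} (hM : HasDeg r deg M) (n : ℤ)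
    (y : B) (x : Ix) (u : Unit) : (vecsCol hM n y).1 x u = if x.1 = n then M x y else 0 := by
  change (if deg y = n then M x y else 0) = _
  by_cases h0 : M x y = 0
  · rw [h0, ite_self, ite_self]
  · rw [(hM x y h0).2]

theorem vecsCol_eq_of_eq {r : Rk S} {C : Type} {deg : B → ℤ} {deg' : C → ℤ} {M : Matrix Ix B R}
    {M' : Matrix Ix C R} (hM : HasDeg r deg M) (hM' : HasDeg r deg' M') (n : ℤ) (y : B) (y' : C)
    (h : ∀ x, M x y = M' x y') : vecsCol hM n y = vecsCol hM' n y' := by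
  refine Subtype.ext (funext fun x => funext fun u => ?_)
  rw [vecsCol_apply, vecsCol_apply, h]

theorem vecsMap_vecsCol (ρ : R →+* R') {r s : Rk S} {q : ℤ} {M : Matrix Ix Ix R'}
    (hM : IsHom r s q M) {n m : ℤ} (h : n + q = m) {deg deg' : B → ℤ} {Q : Matrix Ix B R}
    (hQ : HasDeg r deg Q) {N : Matrix Ix B R'} (hN : HasDeg s deg' N)
    (e : mcomp (basis r) M (Q.map ρ) = N) (y : B) :
    vecsMap ρ hM h (vecsCol hQ n y) = vecsCol hN m y := by
  subst e
  refine Subtype.ext (funext fun x => funext fun u => ?_)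
  rw [vecsCol_apply]
  change ∑ b ∈ basis r, M x b * ρ ((vecsCol hQ n y).1 b u) = if x.1 = m then
    ∑ b ∈ basis r, M x b * ρ (Q b y) else 0
  simp only [vecsCol_apply]
  split_ifs with hx
  · refine Finset.sum_congr rfl fun b _ => ?_
    by_cases h0 : M x b = 0
    · rw [h0, zero_mul, zero_mul]
    · rw [if_pos (by have := (hM x b h0).2.2; omega)]
  · refine Finset.sum_eq_zero fun b _ => ?_
    by_cases h0 : M x b = 0
    · rw [h0, zero_mul]
    · rw [if_neg (by have := (hM x b h0).2.2; omega), map_zero, mul_zero]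

theorem mcomp_emor {el el' : El} {P : Matrix B EIx R} (hP : ∀ x y, y ∉ ebasis el → P x y = 0)
    (x : B) (y : EIx) : mcomp (ebasis el) P (emor R el' el) x y =
      if el'[y.1]? = el[y.1]? then P x y else 0 := by
  simp only [mcomp, emor, mul_ite, mul_one, mul_zero]
  by_cases hel : el'[y.1]? = el[y.1]?
  · rw [if_pos hel]
    by_cases hy : y ∈ ebasis el
    · rw [Finset.sum_eq_single y]
      · rw [if_pos ⟨rfl, (mem_ebasis_iff_of_getElem?_eq hel).2 hy, hel⟩]
      · intro z _ hz
        rw [if_neg (fun h => hz h.1)]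
      · exact fun h => absurd hy h
    · rw [hP x y hy, Finset.sum_eq_zero]
      intro z hz
      rw [if_neg]
      rintro ⟨rfl, -⟩
      exact hy hz
  · rw [if_neg hel, Finset.sum_eq_zero]
    intro z _
    rw [if_neg (fun h => hel h.2.2)]

theorem mem_ebasis_lower_iff {el : El} {j a : ℕ} :
    (⟨j, false, a⟩ : EIx) ∈ ebasis el ↔ (⟨j, true, a⟩ : EIx) ∈ ebasis el :=
  mem_ebasis.trans (mem_ebasis (y := ⟨j, true, a⟩)).symm

theorem mcomp_ediff_lower {el : El} {P : Matrix B EIx R} (hP : ∀ x y, y ∉ ebasis el → P x y = 0)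
    (x : B) (j a : ℕ) : mcomp (ebasis el) P (ediff R el) x ⟨j, false, a⟩ = P x ⟨j, true, a⟩ := by
  simp only [mcomp, ediff, mul_ite, mul_one, mul_zero]
  by_cases hy : (⟨j, true, a⟩ : EIx) ∈ ebasis el
  · rw [Finset.sum_eq_single (⟨j, true, a⟩ : EIx)]
    · exact if_pos ⟨mem_ebasis_lower_iff.2 hy, trivial, rfl⟩
    · intro z _ hz
      exact if_neg fun h => hz h.2.2
    · exact fun h => absurd hy h
  · rw [hP _ _ hy, Finset.sum_eq_zero]
    intro z _
    exact if_neg fun h => hy (mem_ebasis_lower_iff.1 h.1)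

theorem mcomp_ediff_upper {el : El} {P : Matrix B EIx R} (x : B) (j a : ℕ) :
    mcomp (ebasis el) P (ediff R el) x ⟨j, true, a⟩ = 0 := by
  simp only [mcomp, ediff, mul_ite, mul_one, mul_zero]
  refine Finset.sum_eq_zero fun z _ => if_neg fun h => ?_
  simp at h

end columnMaps

/-! ### The Green complex of columns in the frame of the first member. -/

section toGreen

variable {X : Type} [TopologicalSpace X] {ι : Type} {O : (Opens X)ᵒᵖ ⥤ CommRingCat.{0}}
  {S : Set ℤ} {U : ι → Opens X}

namespace SimplicialTwistingCochain

variable {A : SimplicialTwistingCochain O S U}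

variable (A) in
/-- The differential of the complex that belongs to the first member of a tuple. -/
def greenD {b : SimplexCategory} (σ : CechSimplex U b) (n : ℤ) :
    ModuleCat.of (O.obj (op σ.opens)) (vecs (O.obj (op σ.opens)) (A.rank σ 0) n) ⟶
      ModuleCat.of (O.obj (op σ.opens)) (vecs (O.obj (op σ.opens)) (A.rank σ 0) (n + 1)) :=
  ModuleCat.ofHom (vecsMap (RingHom.id _) (A.isHom_d σ 0) rfl)

variable (A) in
/-- The complex that belongs to the first member of a tuple. -/
def greenCpx {b : SimplexCategory} (σ : CechSimplex U b) :
    CochainComplex (ModuleCat.{0} (O.obj (op σ.opens))) ℤ :=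
  CochainComplex.of (fun n => ModuleCat.of (O.obj (op σ.opens))
      (vecs (O.obj (op σ.opens)) (A.rank σ 0) n))
    (A.greenD σ) (fun n => by
      refine ModuleCat.hom_ext (LinearMap.ext fun z => Subtype.ext ?_)
      have h : mcomp (basis (A.rank σ 0)) (A.a σ 0 (SimplexCategory.const ⦋0⦌ b 0))
        (A.a σ 0 (SimplexCategory.const ⦋0⦌ b 0)) = 0 := (A.dgSimplex σ).sq _
      refine (mcomp_assoc _ _ _ _ z.1).symm.trans ?_
      rw [h, zero_mcomp]
      rfl)

theorem greenCpx_d {b : SimplexCategory} (σ : CechSimplex U b) (n : ℤ)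
    (z : vecs (O.obj (op σ.opens)) (A.rank σ 0) n) :
    (A.greenCpx σ).d n (n + 1) z = vecsMap (RingHom.id _) (A.isHom_d σ 0) rfl z := by
  have h : (A.greenCpx σ).d n (n + 1) = A.greenD σ n :=
    CochainComplex.of_d (fun n => ModuleCat.of (O.obj (op σ.opens))
      (vecs (O.obj (op σ.opens)) (A.rank σ 0) n)) (A.greenD σ) n
  exact congrArg (fun u : (A.greenCpx σ).X n ⟶ (A.greenCpx σ).X (n + 1) => u z) h

variable (A) in
/-- The frames of the Green complex of a simplicial twisting cochain. -/
def greenFrame {b : SimplexCategory} (σ : CechSimplex U b) (i : Fin (b.len + 1)) (n : ℤ) (x : ℕ) :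
    vecs (O.obj (op σ.opens)) (A.rank σ 0) n :=
  vecsCol (A.isHom_chg σ i).hasDeg_zero n ⟨n, x⟩

variable (A) in
/-- The transition maps of the Green complex of a simplicial twisting cochain. -/
def greenTr {c b : SimplexCategory} (t : c ⟶ b) (σ : CechSimplex U b) (n : ℤ) :
    vecs (O.obj (op (σ.pull t).opens)) (A.rank (σ.pull t) 0) n →ₛₗ[(O.map (σ.incl t).op).hom]
      vecs (O.obj (op σ.opens)) (A.rank σ 0) n :=
  vecsMap _ (A.isHom_trMat σ t) (add_zero n)

variable (A) in
/-- The basis vectors of the elementary complements in the Green complex of a simplicial twisting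
cochain. -/
def greenEvec {c b : SimplexCategory} (t : c ⟶ b) (σ : CechSimplex U b) (m : Fin (c.len + 1))
    (n : ℤ) (y : EIx) : vecs (O.obj (op σ.opens)) (A.rank σ 0) n :=
  vecsCol (A.hasDeg_perpMat σ t m) n y

theorem greenTr_comp (hA : A.IsOne) {c' c b : SimplexCategory} (t' : c' ⟶ c) (t : c ⟶ b)
    (σ : CechSimplex U b) (n : ℤ)
    (z : vecs (O.obj (op (σ.pull (t' ≫ t)).opens)) (A.rank (σ.pull (t' ≫ t)) 0) n) :
    A.greenTr (t' ≫ t) σ n z = A.greenTr t σ n (A.greenTr t' (σ.pull t) n z) := by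
  refine Subtype.ext ?_
  change mcomp (basis (A.rank (σ.pull (t' ≫ t)) 0)) (A.trMat σ (t' ≫ t))
      (resMat O (σ.incl (t' ≫ t)) z.1) =
    mcomp (basis (A.rank (σ.pull t) 0)) (A.trMat σ t) (resMat O (σ.incl t)
      (mcomp (basis (A.rank ((σ.pull t).pull t') 0)) (A.trMat (σ.pull t) t')
        (resMat O ((σ.pull t).incl t') z.1)))
  have h1 : resMat O (σ.incl t) (mcomp (basis (A.rank ((σ.pull t).pull t') 0))
      (A.trMat (σ.pull t) t') (resMat O ((σ.pull t).incl t') z.1)) =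
      mcomp (basis (A.rank ((σ.pull t).pull t') 0)) (resMat O (σ.incl t) (A.trMat (σ.pull t) t'))
        (resMat O (σ.incl (t' ≫ t)) z.1) := by
    refine (mcomp_map _ _ _ _).trans ?_
    congr 1
    exact resMat_resMat _ _ _ _
  rw [h1, hA.trMat_comp, mcomp_assoc]
  rfl

theorem greenTr_greenFrame {c b : SimplexCategory} (t : c ⟶ b)
    (σ : CechSimplex U b) (m : Fin (c.len + 1)) (n : ℤ) (x : ℕ) {N : Matrix Ix Ix _}
    (hN : HasDeg (A.rank σ 0) (fun y => y.1) N)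
    (e : mcomp (basis (A.rank (σ.pull t) 0)) (A.trMat σ t)
      (resMat O (σ.incl t) (A.chg (σ.pull t) m)) = N) :
    A.greenTr t σ n (A.greenFrame (σ.pull t) m n x) = vecsCol hN n ⟨n, x⟩ :=
  vecsMap_vecsCol _ _ _ _ hN e _

theorem hasDeg_d_perpMat {c b : SimplexCategory} (t : c ⟶ b) (σ : CechSimplex U b)
    (m : Fin (c.len + 1)) : HasDeg (A.rank σ 0) (fun y => edeg (A.cmpl t σ m).el y + 1)
      (mcomp (basis (A.rank σ 0)) (A.a σ 0 (SimplexCategory.const ⦋0⦌ b 0))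
        (A.perpMat σ t m)) := by
  intro x y hxy
  obtain ⟨z, -, hz⟩ := Finset.exists_ne_zero_of_sum_ne_zero hxy
  have h1 := A.isHom_d σ 0 x z (left_ne_zero_of_mul hz)
  exact ⟨h1.1, by rw [h1.2.2, (A.hasDeg_perpMat σ t m z y (right_ne_zero_of_mul hz)).2]⟩

/-- The Green complex of a simplicial twisting cochain. -/
def toGreen (hA : A.IsOne) : GreenComplex O S U where
  E σ := A.greenCpx σ
  rank := A.rank
  frame σ i n x := A.greenFrame σ i n x
  isFrame σ i n := (hA.isColumnBasis_chg σ i).isFrame (fun x y h => (A.isHom_chg σ i x y h).2.1) n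
  tr t σ n := A.greenTr t σ n
  tr_d {c b} t σ n z := by
    refine Eq.trans (congrArg (A.greenTr t σ (n + 1)) (greenCpx_d (σ.pull t) n z))
      (Eq.trans ?_ (greenCpx_d σ n (A.greenTr t σ n z)).symm)
    refine Subtype.ext ?_
    change mcomp (basis (A.rank (σ.pull t) 0)) (A.trMat σ t) (resMat O (σ.incl t)
      (mcomp (basis (A.rank (σ.pull t) 0)) (A.a (σ.pull t) 0 (SimplexCategory.const ⦋0⦌ c 0)) z.1))
      = mcomp (basis (A.rank σ 0)) (A.a σ 0 (SimplexCategory.const ⦋0⦌ b 0))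
        (mcomp (basis (A.rank (σ.pull t) 0)) (A.trMat σ t) (resMat O (σ.incl t) z.1))
    rw [resMat, mcomp_map, ← mcomp_assoc, ← mcomp_assoc]
    exact congrArg (fun M => mcomp (basis (A.rank (σ.pull t) 0)) M (resMat O (σ.incl t) z.1))
      (A.trMat_d σ t)
  tr_comp t' t σ n z := greenTr_comp hA t' t σ n z
  el t σ m := (A.cmpl t σ m).el
  evec t σ m n y := A.greenEvec t σ m n y
  evec_supp t σ m n y hy := by
    refine ⟨?_, ?_⟩
    · by_contra h
      refine hy (Subtype.ext (funext fun x => funext fun u => ?_))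
      refine (vecsCol_apply _ _ _ _ _).trans ?_
      rw [A.perpMat_eq_zero σ t m x y h, ite_self]
      rfl
    · by_contra h
      exact hy (vecsCol_eq_zero _ h)
  evec_d_lower {c b} t σ m n j a := by
    refine (greenCpx_d σ n _).trans ?_
    refine (vecsMap_vecsCol _ _ _ _ (hasDeg_d_perpMat t σ m) rfl _).trans ?_
    refine vecsCol_eq_of_eq _ _ _ _ _ fun x => ?_
    rw [← perpMat_ediff]
    exact mcomp_ediff_lower (A.perpMat_eq_zero σ t m) x j a
  evec_d_upper {c b} t σ m n j a := by
    refine (greenCpx_d σ n _).trans ?_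
    refine (vecsMap_vecsCol _ _ _ _ (hasDeg_d_perpMat t σ m) rfl _).trans ?_
    refine Subtype.ext (funext fun x => funext fun u => ?_)
    refine (vecsCol_apply _ _ _ _ _).trans ?_
    rw [← perpMat_ediff, mcomp_ediff_upper, ite_self]
    rfl
  decomposition {c b} t σ m n := by
    -- The transported frame vectors and the elementary vectors are the columns of the matrix in
    -- `isColumnBasis_sum`.
    refine Eq.mp (congrArg Function.Bijective (funext fun z => ?_))
      ((hA.isColumnBasis_sum σ t m).bijective n)
    refine congrArg₂ (· + ·) (Finset.sum_congr rfl fun x _ => congrArg (z.1 x • ·) ?_)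
      (Finset.sum_congr rfl fun y _ => congrArg (z.2 y • ·) ?_)
    · refine Eq.trans ?_ (vecsMap_vecsCol _ _ _ _ (HasDeg.mcomp (A.isHom_trMat σ t)
        ((A.isHom_chg (σ.pull t) m).map _).hasDeg_zero) rfl _).symm
      exact vecsCol_eq_of_eq _ _ _ _ _ fun x => rfl
    · exact vecsCol_eq_of_eq _ _ _ _ _ fun x => rfl
  elementary {c b} t σ m m' n y hm := by
    obtain ⟨star, hs⟩ := hA.chg_perpMat σ t hm
    have hdeg : HasDeg (A.rank σ 0) (fun y => y.1) (mcomp (basis (A.rank (σ.pull t) 0))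
        (A.trMat σ t) (resMat O (σ.incl t) (A.chg (σ.pull t) m))) :=
      HasDeg.mcomp (A.isHom_trMat σ t) ((A.isHom_chg (σ.pull t) m).map _).hasDeg_zero
    -- The difference is the combination of transported frame vectors whose coefficients form the
    -- column `y` of `star`; membership in the span follows.
    have h1 : A.greenEvec t σ m' n y - (if (A.cmpl t σ m').el[y.1]? = (A.cmpl t σ m).el[y.1]? then
        A.greenEvec t σ m n y else 0) =
        ∑ x ∈ basis (A.rank (σ.pull t) m), star x y • vecsCol hdeg n x := by
      refine sub_eq_of_eq_add (Subtype.ext (funext fun x => funext fun u => ?_))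
      have hsum : (∑ x ∈ basis (A.rank (σ.pull t) m), star x y • vecsCol hdeg n x).1 x u =
        if x.1 = n then mcomp (basis (A.rank (σ.pull t) m)) (mcomp (basis (A.rank (σ.pull t) 0))
          (A.trMat σ t) (resMat O (σ.incl t) (A.chg (σ.pull t) m))) star x y else 0 := by
        rw [Submodule.coe_sum, Matrix.sum_apply]
        split_ifs with hx
        · refine Finset.sum_congr rfl fun z _ => ?_
          change star z y * (vecsCol hdeg n z).1 x u = _
          rw [vecsCol_apply, if_pos hx, mul_comm]
        · refine Finset.sum_eq_zero fun z _ => ?_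
          change star z y * (vecsCol hdeg n z).1 x u = _
          rw [vecsCol_apply, if_neg hx, mul_zero]
      have hite : (if (A.cmpl t σ m').el[y.1]? = (A.cmpl t σ m).el[y.1]? then
        A.greenEvec t σ m n y else 0).1 x u = if x.1 = n then mcomp (ebasis (A.cmpl t σ m).el)
          (A.perpMat σ t m) (emor _ (A.cmpl t σ m').el (A.cmpl t σ m).el) x y else 0 := by
        rw [mcomp_emor (A.perpMat_eq_zero σ t m)]
        split_ifs with h1 h2 h2
        · exact (vecsCol_apply _ _ _ _ _).trans (if_pos h2)
        · exact (vecsCol_apply _ _ _ _ _).trans (if_neg h2)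
        · rfl
        · rfl
      refine (vecsCol_apply _ _ _ _ _).trans ?_
      rw [hs]
      refine Eq.trans ?_ (congrArg₂ (· + ·) hsum hite).symm
      split_ifs
      · rfl
      · exact (add_zero 0).symm
    refine Set.mem_of_eq_of_mem h1 (Submodule.sum_mem _ fun x _ => Submodule.smul_mem _ _
      (Submodule.subset_span ⟨vecsCol (A.isHom_chg (σ.pull t) m).hasDeg_zero n x, ?_⟩))
    exact vecsMap_vecsCol _ _ _ _ hdeg rfl x
  el_surj t σ m ht := (A.cmpl_surj t σ m ht).1
  rank_surj t σ m ht := A.rank_degen t σ m ht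
  frame_surj t σ m n x ht :=
    greenTr_greenFrame t σ m n x _ (hA.trMat_chg_of_surjective σ t m ht)
  degen_left d t σ m hd := by
    have h := A.cmpl_degen_left d t σ m hd
    refine ⟨congrArg Cmpl.el h, fun n y => vecsCol_eq_of_eq _ _ _ _ _ fun x => ?_⟩
    rw [perpMat, h]
    rfl
  degen_right {c b' b} t d σ m hd := by
    have h := A.cmpl_degen_right t d σ m hd
    refine ⟨congrArg Cmpl.el h, fun n y => ?_⟩
    refine Eq.symm (vecsMap_vecsCol _ _ _ _ (deg' := edeg (A.cmpl (t ≫ d) σ m).el)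
      (A.hasDeg_perpMat σ (t ≫ d) m) ?_ y)
    -- The complement for `t ≫ d` in `σ` is the restriction of the complement for `t` in `σ.pull d`,
    -- so only the change of frame is left to compare.
    have h1 : resMat O (σ.incl d) (A.perpMat (σ.pull d) t m) =
        mcomp (basis (A.rank (σ.pull d) (t m))) (resMat O (σ.incl d) (A.chg (σ.pull d) (t m)))
          (A.cmpl (t ≫ d) σ m).perp := by
      rw [h]
      exact mcomp_map _ _ _ _
    refine (congrArg (mcomp (basis (A.rank (σ.pull d) 0)) (A.trMat σ d)) h1).trans ?_
    rw [← mcomp_assoc, hA.trMat_chg_of_surjective σ d (t m) hd, A.rank_degen d σ (t m) hd]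
    rfl

end SimplicialTwistingCochain

end toGreen

/-! ### Green complexes up to isomorphism are vertices of the totalisation. -/

section greenEquivalence

variable {X : Type} [TopologicalSpace X] {ι : Type} {O : (Opens X)ᵒᵖ ⥤ CommRingCat.{0}}
  {S : Set ℤ} {U : ι → Opens X}

/-- The frames are the columns of `chg`, so the claims are identities for products with `chg`:
`chg_d` for differentials, `chg_comp` for frames, `trMat_chg` for transition maps, and the
definition of `perpMat` for complements. -/
theorem SimplicialTwistingCochain.hasMatrices_toGreen {A : SimplicialTwistingCochain O S U}
    (hA : A.IsOne) : (toGreen hA).HasMatrices A where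
  rank _ := rfl
  el _ _ _ := rfl
  d {b} σ i := by
    refine (lc_totalFrame_eq_iff _ _ (fun x y hxy => ((A.isHom_d σ i).hasDeg x y hxy).2)
      ((toGreen hA).isHomogeneous_totD_basisVec σ i)).2 fun y => ?_
    refine ((toGreen hA).totD_basisVec σ i _ _).trans ?_
    refine (greenCpx_d σ _ _).trans ?_
    have hdeg : HasDeg (A.rank σ 0) (fun y => y.1 + 1) (mcomp (basis (A.rank σ i)) (A.chg σ i)
      (A.a σ 0 (SimplexCategory.const ⦋0⦌ b i))) :=
      HasDeg.mcomp (A.isHom_chg σ i) (A.isHom_d σ i).hasDeg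
    refine (vecsMap_vecsCol (RingHom.id _) _ _ (A.isHom_chg σ i).hasDeg_zero hdeg
      (A.chg_d σ i).symm _).trans ?_
    exact (sum_smul_vecsCol (A.isHom_chg σ i).hasDeg_zero (A.isHom_d σ i).hasDeg hdeg _ y rfl).symm
  frame {b} σ J := by
    have hJ : IsHom (A.rank σ (J 1)) (A.rank σ (J 0)) 0 (A.a σ 1 J) :=
      (A.isHom σ 1 J).congr_degree (by simp)
    refine (lc_totalFrame_eq_iff _ _ (deg := fun c : Ix => c.1)
      (fun x y hxy => (hJ.hasDeg_zero x y hxy).2) (isHomogeneous_totalFrame _)).2 fun y => ?_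
    refine (totalFrame_apply _ _ _).trans ?_
    have hdeg : HasDeg (A.rank σ 0) (fun y => y.1) (mcomp (basis (A.rank σ (J 0)))
      (A.chg σ (J 0)) (A.a σ 1 J)) := HasDeg.mcomp (A.isHom_chg σ _) hJ.hasDeg_zero
    refine Eq.trans ?_ (sum_smul_vecsCol (A.isHom_chg σ _).hasDeg_zero hJ.hasDeg_zero hdeg _ y
      rfl).symm
    exact vecsCol_eq_of_eq (A.isHom_chg σ (J 1)).hasDeg_zero hdeg _ _ _ fun x =>
      (congrFun (congrFun (hA.chg_comp σ J) x) y).symm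
  tr {c b} t σ m := by
    have hi := (A.split t σ m).isHom
    refine (lc_totalFrame_eq_iff _ _ (deg := fun c : Ix => c.1)
      (fun x y hxy => (hi.hasDeg_zero x y hxy).2)
      (fun x n hn => (toGreen hA).isHomogeneous_sumVec t σ m (Sum.inl x) n hn)).2 fun y => ?_
    refine ((toGreen hA).totTr_basisVec_apply t σ m _ _).trans ?_
    have hdeg : HasDeg (A.rank σ 0) (fun y => y.1) (mcomp (basis (A.rank σ (t m)))
      (A.chg σ (t m)) (A.cmpl t σ m).inc) := HasDeg.mcomp (A.isHom_chg σ _) hi.hasDeg_zero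
    refine Eq.trans ?_ (sum_smul_vecsCol (A.isHom_chg σ _).hasDeg_zero hi.hasDeg_zero hdeg _ y
      rfl).symm
    exact greenTr_greenFrame t σ m _ _ hdeg (hA.trMat_chg σ t m)
  evec {c b} t σ m := by
    have hp : HasDeg (A.rank σ (t m)) (edeg (A.cmpl t σ m).el) (A.cmpl t σ m).perp :=
      fun x y hxy => ⟨((A.split t σ m).perp_supp x y hxy).1,
        ((A.split t σ m).perp_supp x y hxy).2.2⟩
    refine (lc_totalFrame_eq_iff _ _ (fun x y hxy => (hp x y hxy).2)
      ((toGreen hA).isHomogeneous_totEvec t σ m)).2 fun y => ?_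
    exact (sum_smul_vecsCol (A.isHom_chg σ _).hasDeg_zero hp (A.hasDeg_perpMat σ t m) _ y
      rfl).symm

/-- Vertices of the totalisation of the presheaf of Green labellings are the same as isomorphism
classes of Green complexes. -/
theorem exists_equiv_greenComplex : ∃ Φ : TotZero O (Green S) U ≃
    Quot (GreenComplex.Iso (O := O) (S := S) (U := U)), ∀ v G, Φ v = Quot.mk _ G ↔
      G.IsMatrixOf v := by
  obtain ⟨e, he⟩ := exists_equiv_isOne (O := O) (S := S) (U := U)
  obtain ⟨Φ, hΦ⟩ := exists_equiv_quot e (GreenComplex.Iso (O := O) (S := S) (U := U))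
    (fun G A => G.HasMatrices A.1)
    (fun G => ⟨⟨G.toSimplicialTwistingCochain, G.isOne_toSimplicialTwistingCochain⟩,
      G.hasMatrices_toSimplicialTwistingCochain⟩)
    (fun G A A' h h' => Subtype.ext (h.unique h' A.2 A'.2))
    (fun A => ⟨SimplicialTwistingCochain.toGreen A.2,
      SimplicialTwistingCochain.hasMatrices_toGreen A.2⟩)
    (fun G G' A h h' => h.iso h') (fun G G' A h h' => h.hasMatrices h')
  exact ⟨Φ, fun v G => (hΦ v G).trans (G.isMatrixOf_iff v fun σ => he v σ).symm⟩

end greenEquivalence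

/-! ### Cocycles of matrices -/

section cocycles

variable {X : Type} [TopologicalSpace X] {ι : Type}

/-- Matrices of the differential and of changes of frame on all open sets that are contained in
members of the family `U`. -/
@[ext]
structure Cocycle (O : (Opens X)ᵒᵖ ⥤ CommRingCat.{0}) (S : Set ℤ) (U : ι → Opens X) where
  /-- the ranks -/
  rank : ι → Rk S
  /-- the differentials -/
  d : ∀ {V : Opens X} {α : ι}, V ≤ U α → Matrix Ix Ix (O.obj (op V))
  /-- the changes of frame -/
  g : ∀ {V : Opens X} {α β : ι}, V ≤ U α → V ≤ U β → Matrix Ix Ix (O.obj (op V))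
  isHom_d : ∀ {V : Opens X} {α : ι} (h : V ≤ U α), IsHom (rank α) (rank α) 1 (d h)
  isHom_g : ∀ {V : Opens X} {α β : ι} (h : V ≤ U α) (h' : V ≤ U β),
    IsHom (rank β) (rank α) 0 (g h h')
  sq : ∀ {V : Opens X} {α : ι} (h : V ≤ U α), mcomp (basis (rank α)) (d h) (d h) = 0
  comm : ∀ {V : Opens X} {α β : ι} (h : V ≤ U α) (h' : V ≤ U β),
    mcomp (basis (rank β)) (g h h') (d h') = mcomp (basis (rank α)) (d h) (g h h')
  g_self : ∀ {V : Opens X} {α : ι} (h : V ≤ U α), g h h = idMat _ (rank α)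
  g_comp : ∀ {V : Opens X} {α β γ : ι} (h : V ≤ U α) (h' : V ≤ U β) (h'' : V ≤ U γ),
    mcomp (basis (rank β)) (g h h') (g h' h'') = g h h''
  d_res : ∀ {V W : Opens X} {α : ι} (f : V ⟶ W) (h : W ≤ U α),
    resMat O f (d h) = d ((leOfHom f).trans h)
  g_res : ∀ {V W : Opens X} {α β : ι} (f : V ⟶ W) (h : W ≤ U α) (h' : W ≤ U β),
    resMat O f (g h h') = g ((leOfHom f).trans h) ((leOfHom f).trans h')

variable {O : (Opens X)ᵒᵖ ⥤ CommRingCat.{0}} {S : Set ℤ} {U : ι → Opens X}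

namespace Cocycle

variable (c : Cocycle O S U)

/-- The complex of free modules over an open subset of a member of the family. -/
def cpx {V : Opens X} {α : ι} (h : V ≤ U α) : FreeCpx S (O.obj (op V)) :=
  ⟨c.rank α, c.d h, c.isHom_d h, c.sq h⟩

/-- The isomorphism of complexes given by a change of frame. -/
def chg {V : Opens X} {α β : ι} (h : V ≤ U α) (h' : V ≤ U β) : c.cpx h' ⟶ c.cpx h :=
  show ChainMap (c.cpx h') (c.cpx h) from ⟨c.g h h', c.isHom_g h h', c.comm h h'⟩

/-- The simplex of the nerve that belongs to a tuple of members of the family. -/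
def simplex {V : Opens X} {n : SimplexCategory} (w : Fin (n.len + 1) → {α // V ≤ U α}) :
    (nerve (FreeCpx S (O.obj (op V)))ᵒᵖ).obj (op n) :=
  show ComposableArrows (FreeCpx S (O.obj (op V)))ᵒᵖ n.len from
  { obj i := op (c.cpx (w i).2)
    map {i j} _ := (c.chg (w i).2 (w j).2).op
    map_id i := congrArg Quiver.Hom.op (ChainMap.ext (c.g_self (w i).2))
    map_comp {i j k} _ _ :=
      congrArg Quiver.Hom.op (ChainMap.ext (c.g_comp (w i).2 (w j).2 (w k).2).symm) }

end Cocycle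

/-- Reduces equality of functors, with its heterogeneous equality of arrows, to equality of
matrices, whose type does not depend on the complexes. -/
theorem nerveFree_ext {R : Type} [CommRing R] {n : ℕ}
    {F G : ComposableArrows (FreeCpx S R)ᵒᵖ n} (h : ∀ i, (F.obj i).unop = (G.obj i).unop)
    (h' : ∀ (i j : Fin (n + 1)) (f : i ⟶ j),
      ChainMap.mat (F.map f).unop = ChainMap.mat (G.map f).unop) : F = G := by
  refine CategoryTheory.Functor.hext (fun i => congrArg op (h i)) fun i j f => ?_
  have h1 : (F.map f).unop ≍ (G.map f).unop := ChainMap.heq_of_mat (h j) (h i) _ _ (h' i j f)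
  have h2 : ∀ {C D C' D' : FreeCpx S R} (u : C ⟶ D) (u' : C' ⟶ D'), C = C' → D = D' → u ≍ u' →
      u.op ≍ u'.op := by
    rintro C D C' D' u u' rfl rfl h
    exact heq_of_eq (congrArg _ (eq_of_heq h))
  exact h2 _ _ (h j) (h i) h1

namespace Cocycle

variable (c : Cocycle O S U)

/-- The component at a tuple of the vertex of the totalisation given by a cocycle. -/
def comp {b : SimplexCategory} (σ : CechSimplex U b) :
    ((coreNerveFree S).obj (O.obj (op σ.opens))).obj (op b) :=
  ⟨c.simplex fun i => ⟨σ.vertex i, σ.opens_le i⟩, fun f =>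
    isEquivEdge_of_indiscrete (Y := nerve (FreeCpx S (O.obj (op σ.opens)))ᵒᵖ)
      (fun _ w => c.simplex w) (fun _ _ => rfl) _ f⟩

theorem isCompat_comp : IsCompat O (coreNerveFree S) (fun σ => c.comp σ) := by
  intro a b f σ
  refine Subtype.ext ?_
  refine nerveFree_ext (fun i => ?_) fun i j h => ?_
  · exact FreeCpx.ext rfl (c.d_res (σ.incl f) ((σ.pull f).opens_le i))
  · exact c.g_res (σ.incl f) ((σ.pull f).opens_le i) ((σ.pull f).opens_le j)

/-- The vertex of the totalisation given by a cocycle. -/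
def toTot : TotZero O (coreNerveFree S) U :=
  TotZero.ofCompat (F := coreNerveFree S) (fun σ => c.comp σ) c.isCompat_comp

theorem comp_toTot {b : SimplexCategory} (σ : CechSimplex U b) : c.toTot.comp σ = c.comp σ :=
  TotZero.comp_ofCompat (F := coreNerveFree S) _ _ σ

end Cocycle

section toCocycle

variable (v : TotZero O (coreNerveFree S) U)

/-- The complexes in the components of a vertex of the totalisation. -/
def TotZero.cpx {b : SimplexCategory} (σ : CechSimplex U b) (i : Fin (b.len + 1)) :
    FreeCpx S (O.obj (op σ.opens)) :=
  ((v.comp σ).1.obj i).unop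

/-- The maps in the components of a vertex of the totalisation. -/
def TotZero.chg {b : SimplexCategory} (σ : CechSimplex U b) {i j : Fin (b.len + 1)} (h : i ≤ j) :
    v.cpx σ j ⟶ v.cpx σ i :=
  ((v.comp σ).1.map (homOfLE h)).unop

theorem TotZero.cpx_pull {a b : SimplexCategory} (f : a ⟶ b) (σ : CechSimplex U b)
    (i : Fin (a.len + 1)) :
    (v.cpx (σ.pull f) i).rank = (v.cpx σ (f i)).rank ∧
      resMat O (σ.incl f) (v.cpx (σ.pull f) i).d = (v.cpx σ (f i)).d := by
  have h := congrArg Subtype.val (v.comp_compat f σ)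
  exact ⟨congrArg (fun y : ComposableArrows (FreeCpx S (O.obj (op σ.opens)))ᵒᵖ a.len =>
      (y.obj i).unop.rank) h,
    congrArg (fun y : ComposableArrows (FreeCpx S (O.obj (op σ.opens)))ᵒᵖ a.len =>
      (y.obj i).unop.d) h⟩

theorem TotZero.chg_pull {a b : SimplexCategory} (f : a ⟶ b) (σ : CechSimplex U b)
    {i j : Fin (a.len + 1)} (h : i ≤ j) :
    resMat O (σ.incl f) (ChainMap.mat (v.chg (σ.pull f) h)) =
      ChainMap.mat (v.chg σ (f.toOrderHom.monotone h)) := by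
  have h1 := congrArg Subtype.val (v.comp_compat f σ)
  exact congrArg (fun y : ComposableArrows (FreeCpx S (O.obj (op σ.opens)))ᵒᵖ a.len =>
      ChainMap.mat (y.map (homOfLE h)).unop) h1

end toCocycle

end cocycles

/-! ### From vertices of the totalisation to cocycles. -/

section toCocycle

variable {X : Type} [TopologicalSpace X] {ι : Type} {O : (Opens X)ᵒᵖ ⥤ CommRingCat.{0}}
  {S : Set ℤ} {U : ι → Opens X}

namespace TotZero

variable (v : TotZero O (coreNerveFree S) U)

/-- A tuple with one member is the pullback of any tuple containing that index, so the complex at a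
vertex depends only on the index, up to restriction. -/
theorem resMat_cpx {b : SimplexCategory} (σ : CechSimplex U b) (i : Fin (b.len + 1))
    {V : Opens X} (a : V ⟶ σ.opens) (τ : CechSimplex U ⦋0⦌) (a' : V ⟶ τ.opens)
    (h : τ.vertex 0 = σ.vertex i) : (v.cpx τ 0).rank = (v.cpx σ i).rank ∧
      resMat O a' (v.cpx τ 0).d = resMat O a (v.cpx σ i).d := by
  obtain rfl : τ = σ.pull (SimplexCategory.const ⦋0⦌ b i) := by
    refine CechSimplex.ext (funext fun k => ?_)
    obtain rfl : k = 0 := Subsingleton.elim (α := Fin 1) _ _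
    exact h
  obtain ⟨h1, h2⟩ := v.cpx_pull (SimplexCategory.const ⦋0⦌ b i) σ 0
  refine ⟨h1, ?_⟩
  rw [← resMat_resMat a (σ.incl _) a']
  exact congrArg (resMat O a) h2

theorem resMat_chg {b : SimplexCategory} (σ : CechSimplex U b) {i j : Fin (b.len + 1)} (h : i ≤ j)
    {V : Opens X} (a : V ⟶ σ.opens) (τ : CechSimplex U ⦋1⦌) (a' : V ⟶ τ.opens)
    (h0 : τ.vertex 0 = σ.vertex i) (h1 : τ.vertex 1 = σ.vertex j) :
    resMat O a' (ChainMap.mat (v.chg τ (Fin.zero_le 1))) =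
      resMat O a (ChainMap.mat (v.chg σ h)) := by
  obtain rfl : τ = σ.pull (SimplexCategory.mkOfLe (n := b.len) i j h) := by
    refine CechSimplex.ext (funext fun (k : Fin 2) => ?_)
    fin_cases k
    · exact h0
    · exact h1
  rw [← resMat_resMat a (σ.incl _) a']
  exact congrArg (resMat O a) (v.chg_pull (SimplexCategory.mkOfLe (n := b.len) i j h) σ _)

section components

variable (hU : ∀ α, (U α : Set X).Nonempty)

/-- The ranks of a vertex of the totalisation. -/
def cocycleRank (α : ι) : Rk S := (v.cpx (CechSimplex.single hU α) 0).rank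

/-- The differentials of a vertex of the totalisation. -/
def cocycleD {V : Opens X} {α : ι} (h : V ≤ U α) : Matrix Ix Ix (O.obj (op V)) :=
  -- Tuples have nonempty intersections, so there is nothing to evaluate over the empty set; the
  -- default value is harmless where the ring is trivial.
  open scoped Classical in if hV : (V : Set X).Nonempty then
    resMat O ((CechSimplex.ofLE hV (b := ⦋0⦌) (fun _ => α) fun _ => h).homOfLE fun _ => h)
      (v.cpx (CechSimplex.ofLE hV (b := ⦋0⦌) (fun _ => α) fun _ => h) 0).d else 0

theorem forall_le_pair {V : Opens X} {α β : ι} (h : V ≤ U α) (h' : V ≤ U β) (i : Fin 2) :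
    V ≤ U (![α, β] i) := by
  fin_cases i
  · exact h
  · exact h'

theorem forall_le_triple {V : Opens X} {α β γ : ι} (h : V ≤ U α) (h' : V ≤ U β) (h'' : V ≤ U γ)
    (i : Fin 3) : V ≤ U (![α, β, γ] i) := by
  fin_cases i
  · exact h
  · exact h'
  · exact h''

/-- The changes of frame of a vertex of the totalisation. -/
def cocycleG {V : Opens X} {α β : ι} (h : V ≤ U α) (h' : V ≤ U β) : Matrix Ix Ix (O.obj (op V)) :=
  open scoped Classical in if hV : (V : Set X).Nonempty then
    resMat O ((CechSimplex.ofLE hV (b := ⦋1⦌) ![α, β] (forall_le_pair h h')).homOfLE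
        (forall_le_pair h h'))
      (ChainMap.mat (v.chg (CechSimplex.ofLE hV (b := ⦋1⦌) ![α, β] (forall_le_pair h h'))
        (Fin.zero_le 1))) else 0

variable {v} in
theorem cocycleRank_eq {b : SimplexCategory} (σ : CechSimplex U b) (i : Fin (b.len + 1)) :
    v.cocycleRank hU (σ.vertex i) = (v.cpx σ i).rank :=
  (v.resMat_cpx σ i (𝟙 _) (CechSimplex.single hU (σ.vertex i))
    ((CechSimplex.single hU (σ.vertex i)).homOfLE fun _ => σ.opens_le i) rfl).1

-- Frees the definition from the chosen tuple: the differential may be read in any tuple with that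
-- index, over any nonempty open subset of its intersection.
variable {v} in
theorem cocycleD_eq {V : Opens X} (hV : (V : Set X).Nonempty) {b : SimplexCategory}
    (σ : CechSimplex U b) (i : Fin (b.len + 1)) (a : V ⟶ σ.opens) (h : V ≤ U (σ.vertex i)) :
    v.cocycleD h = resMat O a (v.cpx σ i).d := by
  rw [cocycleD, dif_pos hV]
  exact (v.resMat_cpx σ i a _ _ rfl).2

variable {v} in
theorem cocycleG_eq {V : Opens X} (hV : (V : Set X).Nonempty) {b : SimplexCategory}
    (σ : CechSimplex U b) {i j : Fin (b.len + 1)} (hij : i ≤ j) (a : V ⟶ σ.opens)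
    (h : V ≤ U (σ.vertex i)) (h' : V ≤ U (σ.vertex j)) :
    v.cocycleG h h' = resMat O a (ChainMap.mat (v.chg σ hij)) := by
  rw [cocycleG, dif_pos hV]
  exact v.resMat_chg σ hij a _ _ rfl rfl

theorem matrix_eq_of_subsingleton {A B R : Type} [Subsingleton R] (M N : Matrix A B R) : M = N :=
  funext fun _ => funext fun _ => Subsingleton.elim _ _

theorem isHom_of_subsingleton {R : Type} [CommRing R] [Subsingleton R] (r s : Rk S) (q : ℤ)
    (M : Matrix Ix Ix R) : IsHom r s q M :=
  fun _ _ h => absurd (Subsingleton.elim _ _) h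

/-- The cocycle of a vertex of the totalisation. -/
def toCocycle (hO : ∀ V : Opens X, ¬ (V : Set X).Nonempty → Subsingleton (O.obj (op V))) :
    Cocycle O S U where
  rank := v.cocycleRank hU
  d h := v.cocycleD h
  g h h' := v.cocycleG h h'
  isHom_d {V α} h := by
    -- The pattern for all fields: over a nonempty `V` the claim is read off in the tuple of the
    -- indices involved, in the order needed; over the empty set the ring is trivial.
    by_cases hV : (V : Set X).Nonempty
    · let σ : CechSimplex U ⦋0⦌ := CechSimplex.ofLE hV (b := ⦋0⦌) (fun _ => α) fun _ => h
      have h1 : v.cocycleD h = _ :=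
        cocycleD_eq (v := v) hV σ 0 (σ.homOfLE fun _ => h) h
      have h2 : v.cocycleRank hU α = _ := cocycleRank_eq (v := v) hU σ 0
      rw [h1, h2]
      exact (v.cpx σ 0).isHom.map _
    · have := hO V hV
      exact isHom_of_subsingleton _ _ _ _
  isHom_g {V α β} h h' := by
    by_cases hV : (V : Set X).Nonempty
    · let σ : CechSimplex U ⦋1⦌ := CechSimplex.ofLE hV (b := ⦋1⦌) ![α, β] (forall_le_pair h h')
      have h1 : v.cocycleG h h' = _ :=
        cocycleG_eq (v := v) hV σ (Fin.zero_le 1) (σ.homOfLE (forall_le_pair h h')) h h'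
      have h2 : v.cocycleRank hU α = _ := cocycleRank_eq (v := v) hU σ 0
      have h3 : v.cocycleRank hU β = _ := cocycleRank_eq (v := v) hU σ 1
      rw [h1, h2, h3]
      exact (ChainMap.isHom (v.chg σ (Fin.zero_le 1))).map _
    · have := hO V hV
      exact isHom_of_subsingleton _ _ _ _
  sq {V α} h := by
    by_cases hV : (V : Set X).Nonempty
    · let σ : CechSimplex U ⦋0⦌ := CechSimplex.ofLE hV (b := ⦋0⦌) (fun _ => α) fun _ => h
      have h1 : v.cocycleD h = _ :=
        cocycleD_eq (v := v) hV σ 0 (σ.homOfLE fun _ => h) h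
      have h2 : v.cocycleRank hU α = _ := cocycleRank_eq (v := v) hU σ 0
      rw [h1, h2, resMat, ← mcomp_map, (v.cpx σ 0).sq, zero_map]
    · have := hO V hV
      exact matrix_eq_of_subsingleton _ _
  comm {V α β} h h' := by
    by_cases hV : (V : Set X).Nonempty
    · let σ : CechSimplex U ⦋1⦌ := CechSimplex.ofLE hV (b := ⦋1⦌) ![α, β] (forall_le_pair h h')
      let a := σ.homOfLE (forall_le_pair h h')
      have h1 : v.cocycleG h h' = _ :=
        cocycleG_eq (v := v) hV σ (Fin.zero_le 1) a h h'
      have h2 : v.cocycleRank hU α = _ := cocycleRank_eq (v := v) hU σ 0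
      have h3 : v.cocycleRank hU β = _ := cocycleRank_eq (v := v) hU σ 1
      have h4 : v.cocycleD h = _ :=
        cocycleD_eq (v := v) hV σ 0 a h
      have h5 : v.cocycleD h' = _ :=
        cocycleD_eq (v := v) hV σ 1 a h'
      rw [h1, h2, h3, h4, h5, resMat, resMat, resMat, ← mcomp_map, ← mcomp_map,
        ChainMap.comm (v.chg σ (Fin.zero_le 1))]
    · have := hO V hV
      exact matrix_eq_of_subsingleton _ _
  g_self {V α} h := by
    by_cases hV : (V : Set X).Nonempty
    · let σ : CechSimplex U ⦋0⦌ := CechSimplex.ofLE hV (b := ⦋0⦌) (fun _ => α) fun _ => h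
      have h1 : v.cocycleG h h = _ :=
        cocycleG_eq (v := v) hV σ (le_refl 0) (σ.homOfLE fun _ => h) h h
      have h2 : v.cocycleRank hU α = _ := cocycleRank_eq (v := v) hU σ 0
      have h3 : v.chg σ (le_refl 0) = 𝟙 _ :=
        congrArg Quiver.Hom.unop ((v.comp σ).1.map_id 0)
      rw [h1, h2, h3]
      exact idMat_map _ _
    · have := hO V hV
      exact matrix_eq_of_subsingleton _ _
  g_comp {V α β γ} h h' h'' := by
    by_cases hV : (V : Set X).Nonempty
    -- All three changes of frame are edges of one simplex of the nerve, whose functoriality is the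
    -- cocycle condition.
    · let σ : CechSimplex U ⦋2⦌ := CechSimplex.ofLE hV (b := ⦋2⦌) ![α, β, γ]
        (forall_le_triple h h' h'')
      let a := σ.homOfLE (forall_le_triple h h' h'')
      have h01 : (0 : Fin 3) ≤ 1 := Fin.zero_le 1
      have h12 : (1 : Fin 3) ≤ 2 := by decide
      have h1 : v.cocycleG h h' = _ :=
        cocycleG_eq (v := v) hV σ h01 a h h'
      have h2 : v.cocycleG h' h'' = _ :=
        cocycleG_eq (v := v) hV σ h12 a h' h''
      have h3 : v.cocycleG h h'' = _ :=
        cocycleG_eq (v := v) hV σ (h01.trans h12) a h h''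
      have h4 : v.cocycleRank hU β = _ := cocycleRank_eq (v := v) hU σ 1
      have h5 : v.chg σ (h01.trans h12) = v.chg σ h12 ≫ v.chg σ h01 :=
        congrArg Quiver.Hom.unop ((v.comp σ).1.map_comp (homOfLE h01) (homOfLE h12))
      rw [h1, h2, h3, h4, h5]
      exact (mcomp_map _ _ _ _).symm
    · have := hO V hV
      exact matrix_eq_of_subsingleton _ _
  d_res {V W α} f h := by
    by_cases hV : (V : Set X).Nonempty
    · have hW : (W : Set X).Nonempty := hV.mono (leOfHom f)
      let σ : CechSimplex U ⦋0⦌ := CechSimplex.ofLE hW (b := ⦋0⦌) (fun _ => α) fun _ => h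
      have h1 : v.cocycleD h = _ :=
        cocycleD_eq (v := v) hW σ 0 (σ.homOfLE fun _ => h) h
      have h2 : v.cocycleD ((leOfHom f).trans h) = _ :=
        cocycleD_eq (v := v) hV σ 0 (f ≫ σ.homOfLE fun _ => h) ((leOfHom f).trans h)
      rw [h1, h2]
      exact resMat_resMat _ _ _ _
    · have := hO V hV
      exact matrix_eq_of_subsingleton _ _
  g_res {V W α β} f h h' := by
    by_cases hV : (V : Set X).Nonempty
    · have hW : (W : Set X).Nonempty := hV.mono (leOfHom f)
      let σ : CechSimplex U ⦋1⦌ := CechSimplex.ofLE hW (b := ⦋1⦌) ![α, β] (forall_le_pair h h')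
      let a := σ.homOfLE (forall_le_pair h h')
      have h1 : v.cocycleG h h' = _ :=
        cocycleG_eq (v := v) hW σ (Fin.zero_le 1) a h h'
      have h2 : v.cocycleG ((leOfHom f).trans h) ((leOfHom f).trans h') = _ :=
        cocycleG_eq (v := v) hV σ (Fin.zero_le 1) (f ≫ a) ((leOfHom f).trans h)
        ((leOfHom f).trans h')
      rw [h1, h2]
      exact resMat_resMat _ _ _ _
    · have := hO V hV
      exact matrix_eq_of_subsingleton _ _

end components

end TotZero

/-- Vertices of the totalisation of the core of the nerve are cocycles of matrices. -/
def totZeroEquivCocycle (hU : ∀ α, (U α : Set X).Nonempty)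
    (hO : ∀ V : Opens X, ¬ (V : Set X).Nonempty → Subsingleton (O.obj (op V))) :
    TotZero O (coreNerveFree S) U ≃ Cocycle O S U where
  toFun v := v.toCocycle hU hO
  invFun c := c.toTot
  left_inv v := TotZero.ext fun {b} σ => by
    have hσ : ((σ.opens : Opens X) : Set X).Nonempty := σ.nonempty
    rw [Cocycle.comp_toTot]
    refine Subtype.ext ?_
    refine nerveFree_ext (fun i => ?_) fun i j h => ?_
    · refine FreeCpx.ext (TotZero.cocycleRank_eq hU σ i) ?_
      exact (TotZero.cocycleD_eq hσ σ i (𝟙 _) (σ.opens_le i)).trans (resMat_id _ _)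
    · exact (TotZero.cocycleG_eq hσ σ (leOfHom h) (𝟙 _) (σ.opens_le i) (σ.opens_le j)).trans
        (resMat_id _ _)
  right_inv c := by
    refine Cocycle.ext (funext fun α => ?_) (funext fun V => funext fun α => funext fun h => ?_)
      (funext fun V => funext fun α => funext fun β => funext fun h => funext fun h' => ?_)
    · change ((c.toTot.comp (CechSimplex.single hU α)).1.obj 0).unop.rank = c.rank α
      rw [c.comp_toTot]
      rfl
    · by_cases hV : (V : Set X).Nonempty
      · let σ : CechSimplex U ⦋0⦌ := CechSimplex.ofLE hV (b := ⦋0⦌) (fun _ => α) fun _ => h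
        refine (TotZero.cocycleD_eq hV σ 0 (σ.homOfLE fun _ => h) h).trans ?_
        rw [TotZero.cpx, c.comp_toTot]
        exact c.d_res _ _
      · have := hO V hV
        exact TotZero.matrix_eq_of_subsingleton _ _
    · by_cases hV : (V : Set X).Nonempty
      · let σ : CechSimplex U ⦋1⦌ := CechSimplex.ofLE hV (b := ⦋1⦌) ![α, β]
          (TotZero.forall_le_pair h h')
        refine (TotZero.cocycleG_eq hV σ (Fin.zero_le 1)
          (σ.homOfLE (TotZero.forall_le_pair h h')) h h').trans ?_
        have h1 : ChainMap.mat (c.toTot.chg σ (Fin.zero_le 1)) =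
            c.g (σ.opens_le 0) (σ.opens_le 1) :=
          congrArg (fun y : ((coreNerveFree S).obj (O.obj (op σ.opens))).obj (op ⦋1⦌) =>
            ChainMap.mat (y.1.map (homOfLE (Fin.zero_le 1))).unop) (c.comp_toTot σ)
        exact (congrArg (resMat O _) h1).trans (c.g_res _ _ _)
      · have := hO V hV
        exact TotZero.matrix_eq_of_subsingleton _ _

end toCocycle

/-! ### Matrices of complexes of locally free sheaves -/

section sections

variable {X : TopCat.{0}} {O : TopCat.Sheaf CommRingCat.{0} X}

/-- The sections of a sheaf of modules. -/
abbrev Sect (M : SheafOfModules.{0} (ringSheaf O)) (V : Opens X) : Type := M.val.obj (op V)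

/-- Restriction of sections. -/
def sectRes (M : SheafOfModules.{0} (ringSheaf O)) {V W : Opens X} (f : V ⟶ W) :
    Sect M W →ₛₗ[(O.obj.map f.op).hom] Sect M V :=
  M.val.restrictₛₗ f.op

/-- Maps of sheaves on sections. -/
def sectMap {M N : SheafOfModules.{0} (ringSheaf O)} (φ : M ⟶ N) (V : Opens X) :
    Sect M V →ₗ[O.obj.obj (op V)] Sect N V :=
  (φ.val.app (op V)).hom

theorem sectRes_sectRes (M : SheafOfModules.{0} (ringSheaf O)) {V W Z : Opens X} (f : V ⟶ W)
    (g : W ⟶ Z) (h : V ⟶ Z) (z : Sect M Z) : sectRes M f (sectRes M g z) = sectRes M h z :=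
  (M.val.map_comp_apply g.op f.op z).symm

theorem sectMap_sectRes {M N : SheafOfModules.{0} (ringSheaf O)} (φ : M ⟶ N) {V W : Opens X}
    (f : V ⟶ W) (z : Sect M W) : sectMap φ V (sectRes M f z) = sectRes N f (sectMap φ W z) :=
  PresheafOfModules.naturality_apply φ.val f.op z

theorem sectMap_comp {M N P : SheafOfModules.{0} (ringSheaf O)} (φ : M ⟶ N) (ψ : N ⟶ P)
    {V : Opens X} (z : Sect M V) : sectMap (φ ≫ ψ) V z = sectMap ψ V (sectMap φ V z) := rfl

end sections

/-! ### The cocycle of a complex of sheaves with frames. -/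

section locallyFreeMatrices

variable {X : TopCat.{0}} {O : TopCat.Sheaf CommRingCat.{0} X} {S : Set ℤ} {ι : Type}
  {U : ι → Opens X}

namespace LocallyFreeComplex

variable (G : LocallyFreeComplex O S U)

/-- The restrictions of the frames. -/
def fr {V : Opens X} {α : ι} (h : V ≤ U α) (n : ℤ) (x : ℕ) : Sect (G.E.X n) V :=
  sectRes (G.E.X n) (homOfLE h) (G.frame α n x)

theorem isFrame_fr {V : Opens X} {α : ι} (h : V ≤ U α) (n : ℤ) :
    IsFrame (O.obj.obj (op V)) ((G.rank α).1 n) (G.fr h n) :=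
  G.isFrame α n V (homOfLE h)

theorem sectRes_fr {V W : Opens X} {α : ι} (f : V ⟶ W) (h : W ≤ U α) (n : ℤ) (x : ℕ) :
    sectRes (G.E.X n) f (G.fr h n x) = G.fr ((leOfHom f).trans h) n x :=
  sectRes_sectRes _ _ _ _ _

/-- The product over all degrees of the sections. -/
abbrev TotSect (V : Opens X) : Type := ∀ n, Sect (G.E.X n) V

/-- The restrictions of the frames as bases of the total module. -/
abbrev basisVec {V : Opens X} {α : ι} (h : V ≤ U α) (c : Ix) : G.TotSect V :=
  totalFrame (G.fr h) c

/-- The differential of the total module. -/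
def totD (V : Opens X) : G.TotSect V →ₗ[O.obj.obj (op V)] G.TotSect V :=
  LinearMap.pi fun m => sectMap (G.E.d (m - 1) m) V ∘ₗ LinearMap.proj (m - 1)

theorem totD_apply {V : Opens X} (z : G.TotSect V) {k m : ℤ} (h : k + 1 = m) :
    G.totD V z m = sectMap (G.E.d k m) V (z k) := by
  obtain rfl : k = m - 1 := by omega
  rfl

theorem totD_totD {V : Opens X} (z : G.TotSect V) : G.totD V (G.totD V z) = 0 := by
  funext m
  rw [G.totD_apply _ (show m - 1 + 1 = m by omega),
    G.totD_apply _ (show m - 2 + 1 = m - 1 by omega), ← sectMap_comp, G.E.d_comp_d]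
  rfl

/-- Restriction on the total modules. -/
def totRes {V W : Opens X} (f : V ⟶ W) :
    G.TotSect W →ₛₗ[(O.obj.map f.op).hom] G.TotSect V where
  toFun z n := sectRes (G.E.X n) f (z n)
  map_add' z w := funext fun n => map_add (sectRes (G.E.X n) f) (z n) (w n)
  map_smul' a z := funext fun n => LinearMap.map_smulₛₗ (sectRes (G.E.X n) f) a (z n)

theorem totRes_totD {V W : Opens X} (f : V ⟶ W) (z : G.TotSect W) :
    G.totRes f (G.totD W z) = G.totD V (G.totRes f z) := by
  funext m
  obtain ⟨k, rfl⟩ : ∃ k, k + 1 = m := ⟨m - 1, by omega⟩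
  rw [G.totD_apply _ rfl]
  change sectRes _ f (G.totD W z (k + 1)) = _
  rw [G.totD_apply _ rfl]
  exact (sectMap_sectRes _ f (z k)).symm

theorem totRes_basisVec {V W : Opens X} (f : V ⟶ W) {α : ι} (h : W ≤ U α) (x : Ix) :
    G.totRes f (G.basisVec h x) = G.basisVec ((leOfHom f).trans h) x := by
  obtain ⟨n, x⟩ := x
  funext k
  change sectRes _ f (totalFrame (G.fr h) ⟨n, x⟩ k) = _
  by_cases hk : k = n
  · subst hk
    exact (congrArg (sectRes _ f) (totalFrame_apply _ _ _)).trans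
      ((G.sectRes_fr f h k x).trans (totalFrame_apply _ _ _).symm)
  · refine (congrArg (sectRes _ f) (isHomogeneous_totalFrame (G.fr h) ⟨n, x⟩ k hk)).trans ?_
    rw [map_zero]
    exact (isHomogeneous_totalFrame (G.fr ((leOfHom f).trans h)) ⟨n, x⟩ k hk).symm

theorem isBasisOn_basisVec {V : Opens X} {α : ι} (h : V ≤ U α) :
    IsBasisOn (O.obj.obj (op V)) (basis (G.rank α)) (G.basisVec h) :=
  isBasisOn_totalFrame _ _ (G.isFrame_fr h)

/-- The matrix of the differential in a frame. -/
def dMat {V : Opens X} {α : ι} (h : V ≤ U α) : Matrix Ix Ix (O.obj.obj (op V)) :=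
  (G.isBasisOn_basisVec h).mat fun c => G.totD V (G.basisVec h c)

/-- The change of frame matrices. -/
def gMat {V : Opens X} {α β : ι} (h : V ≤ U α) (h' : V ≤ U β) :
    Matrix Ix Ix (O.obj.obj (op V)) :=
  (G.isBasisOn_basisVec h).mat (G.basisVec h')

section matrices

variable {V : Opens X} {α β γ : ι} (h : V ≤ U α) (h' : V ≤ U β) (h'' : V ≤ U γ)

theorem lc_dMat : lc (basis (G.rank α)) (G.basisVec h) (G.dMat h) =
    fun c => G.totD V (G.basisVec h c) :=
  IsBasisOn.lc_mat _ _

theorem lc_gMat : lc (basis (G.rank α)) (G.basisVec h) (G.gMat h h') = G.basisVec h' :=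
  IsBasisOn.lc_mat _ _

theorem isHomogeneous_totD_basisVec :
    IsHomogeneous (fun c : Ix => c.1 + 1) fun c => G.totD V (G.basisVec h c) := by
  intro x n hn
  obtain ⟨k, rfl⟩ : ∃ k, k + 1 = n := ⟨n - 1, by omega⟩
  change G.totD V (G.basisVec h x) (k + 1) = 0
  change k + 1 ≠ x.1 + 1 at hn
  have hk : G.basisVec h x k = 0 := isHomogeneous_totalFrame _ x k (show k ≠ x.1 by omega)
  rw [G.totD_apply _ rfl, hk, map_zero]

theorem isHom_dMat : IsHom (G.rank α) (G.rank α) 1 (G.dMat h) :=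
  IsBasisOn.isHom_mat _ (isHomogeneous_totalFrame _) (G.isHomogeneous_totD_basisVec h)
    fun x hx => by rw [(G.isBasisOn_basisVec h).zero x hx, map_zero]

theorem isHom_gMat : IsHom (G.rank β) (G.rank α) 0 (G.gMat h h') := by
  refine IsBasisOn.isHom_mat _ (isHomogeneous_totalFrame _) ?_ ?_
  · intro x n hn
    exact isHomogeneous_totalFrame _ x n (by simpa using hn)
  · exact (G.isBasisOn_basisVec h').zero

theorem totD_lc {C : Type} (s : Finset Ix) (e : Ix → G.TotSect V)
    (M : Matrix Ix C (O.obj.obj (op V))) :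
    lc s (fun x => G.totD V (e x)) M = fun y => G.totD V (lc s e M y) :=
  funext fun y => (map_lc_linear (G.totD V) s e M y).symm

theorem totRes_lc {W : Opens X} (f : V ⟶ W) {C : Type} (s : Finset Ix) (e : Ix → G.TotSect W)
    (M : Matrix Ix C (O.obj.obj (op W))) :
    lc s (fun x => G.totRes f (e x)) (resMat O.obj f M) = fun y => G.totRes f (lc s e M y) :=
  funext fun y => (map_lc (G.totRes f) s e M y).symm

end matrices

/-- The cocycle of matrices of a complex of sheaves in its frames. -/
def cocycle : Cocycle O.obj S U where
  rank := G.rank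
  d h := G.dMat h
  g h h' := G.gMat h h'
  isHom_d h := G.isHom_dMat h
  isHom_g h h' := G.isHom_gMat h h'
  sq h := (G.isBasisOn_basisVec h).matrix_ext ((IsBasisOn.rowSupp_mat _ _).mcomp _ _)
    (fun _ _ h => absurd rfl h) (by
      rw [lc_mcomp, lc_dMat, totD_lc, lc_dMat]
      funext x
      rw [totD_totD]
      simp [lc])
  comm h h' := (G.isBasisOn_basisVec h).matrix_ext ((IsBasisOn.rowSupp_mat _ _).mcomp _ _)
    ((IsBasisOn.rowSupp_mat _ _).mcomp _ _) (by
      rw [lc_mcomp, lc_mcomp, lc_gMat, lc_dMat, lc_dMat, totD_lc, lc_gMat])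
  g_self h := (G.isBasisOn_basisVec h).matrix_ext (IsBasisOn.rowSupp_mat _ _) (rowSupp_idMat _)
    ((G.lc_gMat h h).trans (lc_idMat (G.isBasisOn_basisVec h).zero).symm)
  g_comp h h' h'' := (G.isBasisOn_basisVec h).matrix_ext ((IsBasisOn.rowSupp_mat _ _).mcomp _ _)
    (IsBasisOn.rowSupp_mat _ _) (by rw [lc_mcomp, lc_gMat, lc_gMat, lc_gMat])
  d_res {V W α} f h := by
    refine (G.isBasisOn_basisVec ((leOfHom f).trans h)).matrix_ext
      ((IsBasisOn.rowSupp_mat _ _).map _) (IsBasisOn.rowSupp_mat _ _) ?_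
    have h1 : G.basisVec ((leOfHom f).trans h) = fun x => G.totRes f (G.basisVec h x) :=
      funext fun x => (G.totRes_basisVec f h x).symm
    refine Eq.trans ?_ (G.lc_dMat ((leOfHom f).trans h)).symm
    rw [h1]
    refine (G.totRes_lc f _ _ _).trans (funext fun y => ?_)
    rw [lc_dMat]
    exact G.totRes_totD f _
  g_res {V W α β} f h h' := by
    refine (G.isBasisOn_basisVec ((leOfHom f).trans h)).matrix_ext
      ((IsBasisOn.rowSupp_mat _ _).map _) (IsBasisOn.rowSupp_mat _ _) ?_
    have h1 : G.basisVec ((leOfHom f).trans h) = fun x => G.totRes f (G.basisVec h x) :=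
      funext fun x => (G.totRes_basisVec f h x).symm
    refine Eq.trans ?_ (G.lc_gMat ((leOfHom f).trans h) ((leOfHom f).trans h')).symm
    rw [h1]
    refine (G.totRes_lc f _ _ _).trans (funext fun y => ?_)
    rw [lc_gMat]
    exact G.totRes_basisVec f h' y

/-- The matrices of the complex of sheaves are those of the cocycle. -/
structure HasMatrices (c : Cocycle O.obj S U) : Prop where
  rank : c.rank = G.rank
  d : ∀ {V : Opens X} {α : ι} (h : V ≤ U α) (n : ℤ) (y : ℕ),
    sectMap (G.E.d n (n + 1)) V (G.fr h n y) =
      ∑ x ∈ Finset.range ((G.rank α).1 (n + 1)), c.d h ⟨n + 1, x⟩ ⟨n, y⟩ • G.fr h (n + 1) x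
  g : ∀ {V : Opens X} {α β : ι} (h : V ≤ U α) (h' : V ≤ U β) (n : ℤ) (y : ℕ),
    G.fr h' n y = ∑ x ∈ Finset.range ((G.rank α).1 n), c.g h h' ⟨n, x⟩ ⟨n, y⟩ • G.fr h n x

variable {G}

/-- The degreewise formula characterises the matrix among matrices of the right degree and support,
since a frame is a basis. -/
theorem d_iff {V : Opens X} {α : ι} (h : V ≤ U α) {M : Matrix Ix Ix (O.obj.obj (op V))}
    (hM : IsHom (G.rank α) (G.rank α) 1 M) :
    M = G.dMat h ↔ ∀ (n : ℤ) (y : ℕ), sectMap (G.E.d n (n + 1)) V (G.fr h n y) =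
      ∑ x ∈ Finset.range ((G.rank α).1 (n + 1)), M ⟨n + 1, x⟩ ⟨n, y⟩ • G.fr h (n + 1) x := by
  have h1 : M = G.dMat h ↔ lc (basis (G.rank α)) (G.basisVec h) M =
      fun c => G.totD V (G.basisVec h c) :=
    ⟨fun e => e ▸ G.lc_dMat h, fun e => (G.isBasisOn_basisVec h).matrix_ext hM.rowSupp
      (IsBasisOn.rowSupp_mat _ _) (e.trans (G.lc_dMat h).symm)⟩
  rw [h1, lc_totalFrame_eq_iff _ _ (deg := fun c => c.1 + 1) (fun x y hxy => (hM x y hxy).2.2)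
    (G.isHomogeneous_totD_basisVec h)]
  have h2 : ∀ (n : ℤ) (y : ℕ), G.totD V (G.basisVec h ⟨n, y⟩) (n + 1) =
      sectMap (G.E.d n (n + 1)) V (G.fr h n y) := fun n y => by
    rw [G.totD_apply _ rfl]
    exact congrArg _ (totalFrame_apply _ _ _)
  exact ⟨fun e n y => (h2 n y).symm.trans (e ⟨n, y⟩), fun e y => (h2 y.1 y.2).trans (e y.1 y.2)⟩

theorem g_iff {V : Opens X} {α β : ι} (h : V ≤ U α) (h' : V ≤ U β)
    {M : Matrix Ix Ix (O.obj.obj (op V))} (hM : IsHom (G.rank β) (G.rank α) 0 M) :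
    M = G.gMat h h' ↔ ∀ (n : ℤ) (y : ℕ), G.fr h' n y =
      ∑ x ∈ Finset.range ((G.rank α).1 n), M ⟨n, x⟩ ⟨n, y⟩ • G.fr h n x := by
  have h1 : M = G.gMat h h' ↔ lc (basis (G.rank α)) (G.basisVec h) M = G.basisVec h' :=
    ⟨fun e => e ▸ G.lc_gMat h h', fun e => (G.isBasisOn_basisVec h).matrix_ext hM.rowSupp
      (IsBasisOn.rowSupp_mat _ _) (e.trans (G.lc_gMat h h').symm)⟩
  rw [h1, lc_totalFrame_eq_iff _ _ (deg := fun c => c.1)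
    (fun x y hxy => ((hM x y hxy).2.2).trans (add_zero _)) (isHomogeneous_totalFrame _)]
  exact ⟨fun e n y => (totalFrame_apply _ _ _).symm.trans (e ⟨n, y⟩),
    fun e y => (totalFrame_apply _ _ _).trans (e y.1 y.2)⟩

/-- Existence and uniqueness of coordinates; hence a framed complex has exactly one cocycle. -/
theorem hasMatrices_iff {c : Cocycle O.obj S U} : G.HasMatrices c ↔ c = G.cocycle := by
  constructor
  · intro H
    have hr := H.rank
    refine Cocycle.ext hr (funext fun V => funext fun α => funext fun h => ?_)
      (funext fun V => funext fun α => funext fun β => funext fun h => funext fun h' => ?_)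
    · exact (d_iff h (hr ▸ c.isHom_d h)).2 (H.d h)
    · exact (g_iff h h' (hr ▸ c.isHom_g h h')).2 (H.g h h')
  · rintro rfl
    exact ⟨rfl, fun h => (d_iff h (G.isHom_dMat h)).1 rfl,
      fun h h' => (g_iff h h' (G.isHom_gMat h h')).1 rfl⟩

end LocallyFreeComplex

end locallyFreeMatrices

/-! ### Matrices on intersections of tuples compared with matrices on all small open sets. -/

section matricesOfVertices

variable {X : TopCat.{0}} {O : TopCat.Sheaf CommRingCat.{0} X} {S : Set ℤ} {ι : Type}
  {U : ι → Opens X}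

theorem sect_eq_of_subsingleton (M : SheafOfModules.{0} (ringSheaf O)) {V : Opens X}
    [Subsingleton (O.obj.obj (op V))] (z w : Sect M V) : z = w :=
  (Module.subsingleton (O.obj.obj (op V)) (Sect M V)).elim z w

namespace LocallyFreeComplex

variable {G G' : LocallyFreeComplex O S U}

/-- Formulas on the intersection of a tuple restrict to every nonempty open subset; conversely that
intersection is itself one of the open sets that a cocycle sees. -/
theorem isMatrixOf_iff_hasMatrices (v : TotZero O.obj (coreNerveFree S) U)
    (hU : ∀ α, (U α : Set X).Nonempty)
    (hO : ∀ V : Opens X, ¬ (V : Set X).Nonempty → Subsingleton (O.obj.obj (op V))) :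
    G.IsMatrixOf v ↔ G.HasMatrices (v.toCocycle hU hO) := by
  constructor
  · intro H
    have hr : v.cocycleRank hU = G.rank := funext fun α => (H (CechSimplex.single hU α)).1 0
    refine ⟨hr, fun {V α} h n y => ?_, fun {V α β} h h' n y => ?_⟩
    · by_cases hV : (V : Set X).Nonempty
      · let σ : CechSimplex U ⦋0⦌ := CechSimplex.ofLE hV (b := ⦋0⦌) (fun _ => α) fun _ => h
        let a : V ⟶ σ.opens := σ.homOfLE fun _ => h
        have h1 : v.cocycleD h = _ := TotZero.cocycleD_eq (v := v) hV σ 0 a h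
        have h2 := congrArg (sectRes (G.E.X (n + 1)) a) ((H σ).2.1 0 n y)
        rw [map_sum] at h2
        refine Eq.trans ?_ (h2.trans (Finset.sum_congr rfl fun x _ => ?_))
        · refine Eq.trans ?_ (sectMap_sectRes (G.E.d n (n + 1)) a (G.fr (σ.opens_le 0) n y))
          exact congrArg _ (G.sectRes_fr a (σ.opens_le 0) n y).symm
        · refine (LinearMap.map_smulₛₗ (sectRes (G.E.X (n + 1)) a) _ _).trans ?_
          refine congrArg₂ (· • ·) ?_ (G.sectRes_fr a (σ.opens_le 0) (n + 1) x)
          exact (congrFun (congrFun h1 _) _).symm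
      · have := hO V hV
        exact sect_eq_of_subsingleton _ _ _
    · by_cases hV : (V : Set X).Nonempty
      · let σ : CechSimplex U ⦋1⦌ := CechSimplex.ofLE hV (b := ⦋1⦌) ![α, β]
          (TotZero.forall_le_pair h h')
        let a : V ⟶ σ.opens := σ.homOfLE (TotZero.forall_le_pair h h')
        have h1 : v.cocycleG h h' = _ := TotZero.cocycleG_eq (v := v) hV σ (Fin.zero_le 1) a h h'
        have h2 := congrArg (sectRes (G.E.X n) a) ((H σ).2.2 0 1 (Fin.zero_le 1) n y)
        rw [map_sum] at h2
        refine Eq.trans ?_ (h2.trans (Finset.sum_congr rfl fun x _ => ?_))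
        · exact (G.sectRes_fr a (σ.opens_le 1) n y).symm
        · refine (LinearMap.map_smulₛₗ (sectRes (G.E.X n) a) _ _).trans ?_
          refine congrArg₂ (· • ·) ?_ (G.sectRes_fr a (σ.opens_le 0) n x)
          exact (congrFun (congrFun h1 _) _).symm
      · have := hO V hV
        exact sect_eq_of_subsingleton _ _ _
  · intro H b σ
    have hσ : ((σ.opens : Opens X) : Set X).Nonempty := σ.nonempty
    have hr : v.cocycleRank hU = G.rank := H.rank
    refine ⟨fun i => (TotZero.cocycleRank_eq hU σ i).symm.trans (congrFun hr _),
      fun i n y => ?_, fun i j h n y => ?_⟩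
    · have h1 : v.cocycleD (σ.opens_le i) = (v.cpx σ i).d :=
        (TotZero.cocycleD_eq hσ σ i (𝟙 _) (σ.opens_le i)).trans (resMat_id _ _)
      refine (H.d (σ.opens_le i) n y).trans (Finset.sum_congr rfl fun x _ => ?_)
      exact congrArg (· • G.fr (σ.opens_le i) (n + 1) x) (congrFun (congrFun h1 _) _)
    · have h1 : v.cocycleG (σ.opens_le i) (σ.opens_le j) = ChainMap.mat (v.chg σ h) :=
        (TotZero.cocycleG_eq hσ σ h (𝟙 _) (σ.opens_le i) (σ.opens_le j)).trans (resMat_id _ _)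
      refine (H.g (σ.opens_le i) (σ.opens_le j) n y).trans (Finset.sum_congr rfl fun x _ => ?_)
      exact congrArg (· • G.fr (σ.opens_le i) n x) (congrFun (congrFun h1 _) _)

theorem HasMatrices.of_iso {c : Cocycle O.obj S U} (H : G.HasMatrices c) (e : G.Iso G') :
    G'.HasMatrices c := by
  obtain ⟨hr, f, hf⟩ := e
  have hfr : ∀ {V : Opens X} {α : ι} (h : V ≤ U α) (n : ℤ) (x : ℕ),
      sectMap (f.hom.f n) V (G.fr h n x) = G'.fr h n x := fun {V α} h n x =>
    (sectMap_sectRes (f.hom.f n) (homOfLE h) (G.frame α n x)).trans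
      (congrArg (sectRes _ _) (hf α n x))
  have hsum : ∀ {V : Opens X} {α : ι} (h : V ≤ U α) (n : ℤ) (a : ℕ → O.obj.obj (op V))
      (s : Finset ℕ), sectMap (f.hom.f n) V (∑ x ∈ s, a x • G.fr h n x) =
        ∑ x ∈ s, a x • G'.fr h n x := by
    intro V α h n a s
    rw [map_sum]
    refine Finset.sum_congr rfl fun x _ => ?_
    rw [map_smul, hfr]
  refine ⟨H.rank.trans hr, fun {V α} h n y => ?_, fun {V α β} h h' n y => ?_⟩
  · rw [← hfr, ← hr, ← hsum, ← H.d h n y, ← sectMap_comp, ← sectMap_comp]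
    exact congrArg (fun φ => sectMap φ V (G.fr h n y)) (f.hom.comm n (n + 1))
  · rw [← hfr, ← hr, ← hsum, ← H.g h h' n y]

end LocallyFreeComplex

end matricesOfVertices

/-! ### Sheaves glued from cocycles -/

section gluing

variable {X : TopCat.{0}} (O : TopCat.Sheaf CommRingCat.{0} X)

/-- The empty family covers the empty set, so locality identifies any two sections. -/
theorem subsingleton_of_not_nonempty (V : Opens X) (hV : ¬ (V : Set X).Nonempty) :
    Subsingleton (O.obj.obj (op V)) := by
  refine ⟨fun s t => O.eq_of_locally_eq' (fun i : Empty => i.elim) V (fun i => i.elim) ?_ s t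
    fun i => i.elim⟩
  exact fun x hx => absurd ⟨x, hx⟩ hV

variable {A B κ : Type} {V : Opens X} {W : κ → Opens X} (f : ∀ i, W i ⟶ V)

theorem resMat_ext (hW : V ≤ iSup W) {M N : Matrix A B (O.obj.obj (op V))}
    (h : ∀ i, resMat O.obj (f i) M = resMat O.obj (f i) N) : M = N :=
  funext fun a => funext fun b => O.eq_of_locally_eq' W V f hW _ _ fun i =>
    congrFun (congrFun (h i) a) b

theorem exists_resMat_eq (hW : V ≤ iSup W) (M : ∀ i, Matrix A B (O.obj.obj (op (W i))))
    (h : ∀ i j, resMat O.obj (Opens.infLELeft (W i) (W j)) (M i) =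
      resMat O.obj (Opens.infLERight (W i) (W j)) (M j)) :
    ∃ N : Matrix A B (O.obj.obj (op V)), ∀ i, resMat O.obj (f i) N = M i := by
  have h1 := fun a b => (O.existsUnique_gluing' W V f hW (fun i => M i a b) fun i j =>
    congrFun (congrFun (h i j) a) b).exists
  choose N hN using h1
  exact ⟨N, fun i => funext fun a => funext fun b => hN a b i⟩

end gluing

/-! ### Sections of the sheaves glued from a cocycle. -/

section gluedSections

variable {X : Type} [TopologicalSpace X] {ι : Type} {O : (Opens X)ᵒᵖ ⥤ CommRingCat.{0}}
  {S : Set ℤ} {U : ι → Opens X}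

theorem resMat_mem_vecs {V W : Opens X} (f : V ⟶ W) {r : Rk S} {n : ℤ}
    {z : Matrix Ix Unit (O.obj (op W))} (hz : z ∈ vecs (O.obj (op W)) r n) :
    resMat O f z ∈ vecs (O.obj (op V)) r n := fun x u h =>
  hz x u fun h0 => h ((congrArg (O.map f.op).hom h0).trans (map_zero _))

theorem mcomp_mem_vecs {R : Type} [CommRing R] {r s : Rk S} {q : ℤ} {M : Matrix Ix Ix R}
    (hM : IsHom r s q M) {n m : ℤ} (h : n + q = m) {z : Matrix Ix Unit R} (hz : z ∈ vecs R r n) :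
    mcomp (basis r) M z ∈ vecs R s m := by
  intro x u hxu
  obtain ⟨b, -, hb⟩ := Finset.exists_ne_zero_of_sum_ne_zero hxu
  have h1 := hM x b (left_ne_zero_of_mul hb)
  exact ⟨h1.1, by rw [h1.2.2, (hz b u (right_ne_zero_of_mul hb)).2, h]⟩

theorem mcomp_add_vec {A B C R : Type} [CommRing R] (s : Finset B) (M : Matrix A B R)
    (N N' : Matrix B C R) : mcomp s M (N + N') = mcomp s M N + mcomp s M N' := by
  ext
  simp [mcomp, mul_add, Finset.sum_add_distrib]

theorem mcomp_neg_vec {A B C R : Type} [CommRing R] (s : Finset B) (M : Matrix A B R)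
    (N : Matrix B C R) : mcomp s M (-N) = -mcomp s M N := by
  ext
  simp [mcomp]

theorem mcomp_smul_vec {A B C R : Type} [CommRing R] (s : Finset B) (M : Matrix A B R)
    (a : R) (N : Matrix B C R) : mcomp s M (a • N) = a • mcomp s M N := by
  ext
  simp only [mcomp, Matrix.smul_apply, smul_eq_mul, Finset.mul_sum]
  exact Finset.sum_congr rfl fun _ _ => by ring

theorem idMat_mcomp_vec {R : Type} [CommRing R] {r : Rk S} {n : ℤ} {z : Matrix Ix Unit R}
    (hz : z ∈ vecs R r n) : mcomp (basis r) (idMat R r) z = z := by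
  ext x u
  simp only [mcomp, idMat, ite_mul, one_mul, zero_mul]
  by_cases hx : x ∈ basis r
  · rw [Finset.sum_eq_single x]
    · rw [if_pos ⟨rfl, hx⟩]
    · intro b _ hb
      rw [if_neg (fun h' => hb h'.1.symm)]
    · exact fun h' => absurd hx h'
  · rw [not_ne_iff.1 fun h0 => hx (hz x u h0).1, Finset.sum_eq_zero]
    intro b _
    rw [if_neg]
    rintro ⟨rfl, hb⟩
    exact hx hb

namespace Cocycle

variable (c : Cocycle O S U)

/-- The open subsets of `V` that are contained in members of the family `U`. -/
abbrev Local (U : ι → Opens X) (V : Opens X) : Type :=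
  {p : Opens X × ι // p.1 ≤ V ∧ p.1 ≤ U p.2}

/-- The sections of degree `n` over `V` of the complex of sheaves glued from a cocycle: families of
columns on the open subsets of `V` that are contained in members of the family `U`, compatible with
restriction and with changes of frame. -/
def glued (n : ℤ) (V : Opens X) : AddSubgroup (∀ p : Local U V,
    Matrix Ix Unit (O.obj (op p.1.1))) where
  -- Values on the sets `V ⊓ U α` would suffice. With all small `W` as indices, restriction is a
  -- mere reindexing and the presheaf laws hold by `rfl`.
  carrier := {s | (∀ W α h h', s ⟨(W, α), h, h'⟩ ∈ vecs (O.obj (op W)) (c.rank α) n) ∧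
    (∀ (W' W : Opens X) (α : ι) (f : W' ⟶ W) (h : W ≤ V) (h' : W ≤ U α),
      resMat O f (s ⟨(W, α), h, h'⟩) = s ⟨(W', α), (leOfHom f).trans h, (leOfHom f).trans h'⟩) ∧
    ∀ (W : Opens X) (α β : ι) (h : W ≤ V) (hα : W ≤ U α) (hβ : W ≤ U β),
      mcomp (basis (c.rank β)) (c.g hα hβ) (s ⟨(W, β), h, hβ⟩) = s ⟨(W, α), h, hα⟩}
  add_mem' {s t} hs ht := ⟨fun W α h h' => Submodule.add_mem _ (hs.1 W α h h') (ht.1 W α h h'),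
    fun W' W α f h h' => (add_map _ _ _).trans
      (congrArg₂ (· + ·) (hs.2.1 W' W α f h h') (ht.2.1 W' W α f h h')),
    fun W α β h hα hβ => (mcomp_add_vec _ _ _ _).trans
      (congrArg₂ (· + ·) (hs.2.2 W α β h hα hβ) (ht.2.2 W α β h hα hβ))⟩
  zero_mem' := ⟨fun W α h h' => Submodule.zero_mem _, fun W' W α f h h' => zero_map _,
    fun W α β h hα hβ => mcomp_zero _ _⟩
  neg_mem' {s} hs := ⟨fun W α h h' => Submodule.neg_mem _ (hs.1 W α h h'),
    fun W' W α f h h' => by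
      refine Eq.trans ?_ (congrArg Neg.neg (hs.2.1 W' W α f h h'))
      ext
      simp [resMat],
    fun W α β h hα hβ => (mcomp_neg_vec _ _ _).trans
      (congrArg Neg.neg (hs.2.2 W α β h hα hβ))⟩

variable {c}

/-- The values of a section. -/
def gval {n : ℤ} {V : Opens X} (s : c.glued n V) (W : Opens X) (α : ι) (h : W ≤ V)
    (h' : W ≤ U α) : Matrix Ix Unit (O.obj (op W)) :=
  s.1 ⟨(W, α), h, h'⟩

theorem gval_mem {n : ℤ} {V : Opens X} (s : c.glued n V) {W : Opens X} {α : ι} (h : W ≤ V)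
    (h' : W ≤ U α) : gval s W α h h' ∈ vecs (O.obj (op W)) (c.rank α) n :=
  s.2.1 W α h h'

theorem resMat_gval {n : ℤ} {V : Opens X} (s : c.glued n V) {W W' : Opens X} {α : ι}
    (f : W' ⟶ W) (h : W ≤ V) (h' : W ≤ U α) : resMat O f (gval s W α h h') =
      gval s W' α ((leOfHom f).trans h) ((leOfHom f).trans h') :=
  s.2.2.1 W' W α f h h'

theorem mcomp_gval {n : ℤ} {V : Opens X} (s : c.glued n V) {W : Opens X} {α β : ι}
    (h : W ≤ V) (hα : W ≤ U α) (hβ : W ≤ U β) :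
    mcomp (basis (c.rank β)) (c.g hα hβ) (gval s W β h hβ) = gval s W α h hα :=
  s.2.2.2 W α β h hα hβ

theorem glued_ext {n : ℤ} {V : Opens X} {s t : c.glued n V}
    (h : ∀ W α hV hα, gval s W α hV hα = gval t W α hV hα) : s = t :=
  Subtype.ext (funext fun p => h p.1.1 p.1.2 p.2.1 p.2.2)

/-- A function on `V` acts on the column over `W` through its restriction to `W`. -/
instance (n : ℤ) (V : Opens X) : Module (O.obj (op V)) (c.glued n V) where
  smul a s := ⟨fun p => (O.map (homOfLE p.2.1).op).hom a • s.1 p,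
    fun W α h h' => Submodule.smul_mem _ _ (s.2.1 W α h h'), fun W' W α f h h' => by
      refine Eq.trans ?_ (congrArg ((O.map (homOfLE ((leOfHom f).trans h)).op).hom a • ·)
        (s.2.2.1 W' W α f h h'))
      ext x u
      have h1 : O.map (homOfLE ((leOfHom f).trans h)).op =
        O.map (homOfLE h).op ≫ O.map f.op := by rw [← O.map_comp]; rfl
      rw [h1]
      simp [resMat], fun W α β h hα hβ => by
      rw [mcomp_smul_vec, s.2.2.2 W α β h hα hβ]⟩
  one_smul s := glued_ext fun W α h h' => by
    change (O.map (homOfLE h).op).hom 1 • gval s W α h h' = _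
    rw [map_one, one_smul]
  mul_smul a b s := glued_ext fun W α h h' => by
    change (O.map (homOfLE h).op).hom (a * b) • gval s W α h h' = _
    rw [map_mul, mul_smul]
    rfl
  smul_zero a := glued_ext fun W α h h' => smul_zero _
  smul_add a s t := glued_ext fun W α h h' => smul_add _ _ _
  add_smul a b s := glued_ext fun W α h h' => by
    change (O.map (homOfLE h).op).hom (a + b) • gval s W α h h' = _
    rw [map_add, add_smul]
    rfl
  zero_smul s := glued_ext fun W α h h' => by
    change (O.map (homOfLE h).op).hom 0 • gval s W α h h' = _
    rw [map_zero, zero_smul]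
    rfl

theorem glued_smul_val {n : ℤ} {V : Opens X} (a : O.obj (op V)) (s : c.glued n V) {W : Opens X}
    {α : ι} (h : W ≤ V) (h' : W ≤ U α) :
    gval (a • s) W α h h' = (O.map (homOfLE h).op).hom a • gval s W α h h' := rfl

variable (c) in
/-- Restriction of sections of the glued sheaves. -/
def gluedRes (n : ℤ) {V V' : Opens X} (f : V' ⟶ V) : c.glued n V →+ c.glued n V' where
  toFun s := ⟨fun p => s.1 ⟨p.1, p.2.1.trans (leOfHom f), p.2.2⟩,
    fun W α h h' => s.2.1 W α (h.trans (leOfHom f)) h',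
    fun W' W α g h h' => s.2.2.1 W' W α g (h.trans (leOfHom f)) h',
    fun W α β h hα hβ => s.2.2.2 W α β (h.trans (leOfHom f)) hα hβ⟩
  map_zero' := rfl
  map_add' _ _ := rfl

variable (c) in
/-- The presheaf of abelian groups of sections. -/
def gluedAb (n : ℤ) : (Opens X)ᵒᵖ ⥤ AddCommGrpCat.{0} where
  obj V := AddCommGrpCat.of (c.glued n V.unop)
  map f := AddCommGrpCat.ofHom (c.gluedRes n f.unop)
  map_id _ := rfl
  map_comp _ _ := rfl

theorem gluedRes_smul (n : ℤ) {V V' : Opens X} (f : V' ⟶ V) (a : O.obj (op V)) (s : c.glued n V) :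
    c.gluedRes n f (a • s) = (O.map f.op).hom a • c.gluedRes n f s := glued_ext fun W α h h' => by
  rw [glued_smul_val]
  change (O.map (homOfLE (h.trans (leOfHom f))).op).hom a •
    gval s W α (h.trans (leOfHom f)) h' = _
  have h1 : O.map (homOfLE (h.trans (leOfHom f))).op =
      O.map f.op ≫ O.map (homOfLE h).op := by rw [← O.map_comp]; rfl
  rw [h1]
  rfl

end Cocycle

end gluedSections

/-! ### The sheaf property. -/

section gluedSheaf

variable {X : TopCat.{0}} {O : TopCat.Sheaf CommRingCat.{0} X} {S : Set ℤ} {ι : Type}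
  {U : ι → Opens X}

namespace Cocycle

variable (c : Cocycle O.obj S U)

instance (n : ℤ) (V : (Opens X)ᵒᵖ) : Module ((ringSheaf O).obj.obj V) ((c.gluedAb n).obj V) :=
  inferInstanceAs (Module (O.obj.obj (op V.unop)) (c.glued n V.unop))

/-- The presheaf of modules of sections. -/
def gluedPresheaf (n : ℤ) : PresheafOfModules.{0} (ringSheaf O).obj :=
  PresheafOfModules.ofPresheaf (c.gluedAb n) fun _ _ f a s => gluedRes_smul n f.unop a s

/-- Columns glue entry by entry because `O` is a sheaf, and the conditions on a family (degree,
restriction, change of frame) are equations between sections, so they can be checked locally. -/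
theorem isSheaf_gluedAb (n : ℤ) : TopCat.Presheaf.IsSheaf (X := X) (c.gluedAb n) := by
  rw [TopCat.Presheaf.isSheaf_iff_isSheafUniqueGluing]
  intro κ Y sf hsf
  let sf' : ∀ i, c.glued n (Y i) := sf
  have hsf' : ∀ (i j : κ) (W : Opens X) (α : ι) (hi : W ≤ Y i) (hj : W ≤ Y j) (hα : W ≤ U α),
      gval (sf' i) W α hi hα = gval (sf' j) W α hj hα := fun i j W α hi hj hα =>
    congrArg (fun s : c.glued n (Y i ⊓ Y j) => gval s W α (le_inf hi hj) hα) (hsf i j)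
  have hcov : ∀ W : Opens X, W ≤ iSup Y → W ≤ iSup fun i => W ⊓ Y i := fun W h x hx => by
    obtain ⟨i, hi⟩ := Opens.mem_iSup.1 (h hx)
    exact Opens.mem_iSup.2 ⟨i, hx, hi⟩
  -- A small set `W` need not lie in any `Y i`; its column is glued from those on the sets `W ⊓ Y
  -- i`.
  have hex : ∀ (W : Opens X) (α : ι) (h : W ≤ iSup Y) (hα : W ≤ U α),
      ∃ M : Matrix Ix Unit (O.obj.obj (op W)), ∀ i, resMat O.obj (Opens.infLELeft W (Y i)) M =
        gval (sf' i) (W ⊓ Y i) α inf_le_right (inf_le_left.trans hα) := fun W α h hα => by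
    refine exists_resMat_eq O (fun i => Opens.infLELeft W (Y i)) (hcov W h)
      (fun i => gval (sf' i) (W ⊓ Y i) α inf_le_right (inf_le_left.trans hα)) fun i j => ?_
    rw [resMat_gval, resMat_gval]
    exact hsf' _ _ _ _ _ _ _
  choose M hM using hex
  -- The glued column has the expected restriction to every open subset of some `Y i`, which is the
  -- form used for all local checks.
  have hM' : ∀ (W : Opens X) (α : ι) (h : W ≤ iSup Y) (hα : W ≤ U α) (Z : Opens X) (f : Z ⟶ W)
      (i : κ) (hi : Z ≤ Y i), resMat O.obj f (M W α h hα) =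
        gval (sf' i) Z α hi ((leOfHom f).trans hα) := fun W α h hα Z f i hi => by
    rw [← resMat_resMat (homOfLE (le_inf (leOfHom f) hi)) (Opens.infLELeft W (Y i)) f, hM]
    exact resMat_gval _ _ _ _
  have hloc : ∀ {A B : Type} (W : Opens X) (h : W ≤ iSup Y) {P Q : Matrix A B (O.obj.obj (op W))},
      (∀ (i : κ) (f : W ⊓ Y i ⟶ W), resMat O.obj f P = resMat O.obj f Q) → P = Q :=
    fun W h _ _ e => resMat_ext O (fun i => Opens.infLELeft W (Y i)) (hcov W h) fun i => e i _
  let s : c.glued n (iSup Y) := ⟨fun p => M p.1.1 p.1.2 p.2.1 p.2.2, fun W α h hα x u hxu => by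
      by_contra hx
      refine hxu (O.eq_of_locally_eq' _ W (fun i => Opens.infLELeft W (Y i)) (hcov W h) _ _
        fun i => ?_)
      refine (congrFun (congrFun (hM W α h hα i) x) u).trans (Eq.trans ?_ (map_zero _).symm)
      exact not_ne_iff.1 fun h0 => hx (gval_mem (sf' i) inf_le_right
        (inf_le_left.trans hα) x u h0),
    fun W' W α f h hα => hloc W' ((leOfHom f).trans h) fun i g => by
      rw [resMat_resMat g f (g ≫ f), hM' _ _ _ _ _ _ i inf_le_right,
        hM' _ _ _ _ _ _ i inf_le_right],
    fun W α β h hα hβ => hloc W h fun i g => by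
      refine (mcomp_map _ _ _ _).trans (Eq.trans ?_ (hM' W α h hα _ g i inf_le_right).symm)
      refine Eq.trans ?_ (mcomp_gval (sf' i) inf_le_right ((leOfHom g).trans hα)
        ((leOfHom g).trans hβ))
      exact congrArg₂ (mcomp (basis (c.rank β))) (c.g_res g hα hβ)
        (hM' W β h hβ _ g i inf_le_right)⟩
  refine ⟨s, fun i => ?_, fun t ht => ?_⟩
  · refine glued_ext (c := c) fun W α hW hα => ?_
    exact (resMat_id (O := O.obj) (𝟙 W) _).symm.trans (hM' W α _ hα W (𝟙 W) i hW)
  · refine glued_ext (c := c) fun W α hW hα => hloc W hW fun i g => ?_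
    let t' : c.glued n (iSup Y) := t
    refine Eq.trans ?_ (hM' W α hW hα _ g i inf_le_right).symm
    refine (resMat_gval t' g hW hα).trans ?_
    exact congrArg (fun s : c.glued n (Y i) => gval s (W ⊓ Y i) α inf_le_right
      (inf_le_left.trans hα)) (ht i)

/-- The sheaf of modules glued from a cocycle. -/
def gluedSheaf (n : ℤ) : SheafOfModules.{0} (ringSheaf O) where
  val := c.gluedPresheaf n
  isSheaf := c.isSheaf_gluedAb n

end Cocycle

end gluedSheaf

/-! ### The complex of sheaves glued from a cocycle -/

theorem IsFrame.map_linearEquiv {R M M' : Type} [CommRing R] [AddCommGroup M] [Module R M]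
    [AddCommGroup M'] [Module R M'] {r : ℕ} {e : ℕ → M} (h : IsFrame R r e) (L : M ≃ₗ[R] M') :
    IsFrame R r fun x => L (e x) := by
  refine ⟨fun x hx => (congrArg L (h.1 x hx)).trans (map_zero L), ?_⟩
  have h1 : (fun c : Fin r → R => ∑ x : Fin r, c x • L (e x)) =
      L ∘ fun c : Fin r → R => ∑ x : Fin r, c x • e x := funext fun c => by
    simp [map_sum]
  rw [h1]
  exact L.bijective.comp h.2

section gluedComplex

variable {X : TopCat.{0}} {O : TopCat.Sheaf CommRingCat.{0} X} {S : Set ℤ} {ι : Type}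
  {U : ι → Opens X}

namespace Cocycle

variable (c : Cocycle O.obj S U)

/-- The differential on sections of the glued sheaves. -/
def gluedD (n : ℤ) (V : Opens X) : c.glued n V →ₗ[O.obj.obj (op V)] c.glued (n + 1) V where
  toFun s := ⟨fun p => mcomp (basis (c.rank p.1.2)) (c.d p.2.2) (s.1 p),
    fun W α h h' => mcomp_mem_vecs (c.isHom_d h') rfl (gval_mem s h h'),
    fun W' W α f h h' => (mcomp_map _ _ _ _).trans
      (congrArg₂ (mcomp (basis (c.rank α))) (c.d_res f h') (resMat_gval s f h h')),
    -- Invariance under change of frame holds because the matrices `g` commute with the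
    -- differentials.
    fun W α β h hα hβ => by
      refine ((mcomp_assoc _ _ _ _ _).symm.trans ?_).trans
        (congrArg (mcomp (basis (c.rank α)) (c.d hα)) (mcomp_gval s h hα hβ))
      rw [c.comm, mcomp_assoc]
      rfl⟩
  map_add' s t := glued_ext (c := c) fun W α h h' => mcomp_add_vec _ _ _ _
  map_smul' a s := glued_ext (c := c) fun W α h h' => mcomp_smul_vec _ _ _ _

theorem gval_gluedD {n : ℤ} {V : Opens X} (s : c.glued n V) {W : Opens X} {α : ι} (h : W ≤ V)
    (h' : W ≤ U α) : gval (c.gluedD n V s) W α h h' =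
      mcomp (basis (c.rank α)) (c.d h') (gval s W α h h') := rfl

theorem gluedD_gluedD {n : ℤ} {V : Opens X} (s : c.glued n V) :
    c.gluedD (n + 1) V (c.gluedD n V s) = 0 := glued_ext (c := c) fun W α h h' => by
  refine (mcomp_assoc _ _ _ _ _).symm.trans ?_
  rw [c.sq]
  exact zero_mcomp _ _

/-- The differential of the glued sheaves. -/
def gluedDiff (n : ℤ) : c.gluedSheaf n ⟶ c.gluedSheaf (n + 1) where
  val :=
    { app V := ModuleCat.ofHom (c.gluedD n V.unop)
      naturality _ := rfl }

/-- The complex of sheaves glued from a cocycle. -/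
def gluedCpx : CochainComplex (SheafOfModules.{0} (ringSheaf O)) ℤ :=
  CochainComplex.of c.gluedSheaf c.gluedDiff fun n => by
    refine SheafOfModules.hom_ext (PresheafOfModules.hom_ext fun V => ?_)
    exact ModuleCat.hom_ext (LinearMap.ext fun s => c.gluedD_gluedD s)

theorem sectMap_gluedCpx_d (n : ℤ) {V : Opens X} (s : c.glued n V) :
    sectMap (c.gluedCpx.d n (n + 1)) V s = c.gluedD n V s :=
  congrArg (fun u : c.gluedSheaf n ⟶ c.gluedSheaf (n + 1) => sectMap u V s)
    (CochainComplex.of_d c.gluedSheaf c.gluedDiff n)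

/-- The section with a given column in one of the frames. -/
def ofVec {V : Opens X} {α : ι} (h : V ≤ U α) (n : ℤ) :
    vecs (O.obj.obj (op V)) (c.rank α) n ≃ₗ[O.obj.obj (op V)] c.glued n V where
  toFun z := ⟨fun p => mcomp (basis (c.rank α)) (c.g p.2.2 (p.2.1.trans h))
      (resMat O.obj (homOfLE p.2.1) z.1),
    fun W β hW hβ => mcomp_mem_vecs (c.isHom_g hβ (hW.trans h)) (add_zero n)
      (resMat_mem_vecs _ z.2),
    fun W' W β f hW hβ => (mcomp_map _ _ _ _).trans
      (congrArg₂ (mcomp (basis (c.rank α))) (c.g_res f hβ (hW.trans h))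
        (resMat_resMat _ _ _ _)),
    fun W β γ hW hβ hγ => by
      refine (mcomp_assoc _ _ _ _ _).symm.trans ?_
      rw [c.g_comp]⟩
  -- Since `V` lies in `U α`, the set `V` itself is an admissible index, and the column there
  -- determines all the others.
  invFun s := ⟨gval s V α le_rfl h, gval_mem s le_rfl h⟩
  left_inv z := Subtype.ext (by
    refine (congrArg₂ (mcomp (basis (c.rank α))) (c.g_self h) (resMat_id _ z.1)).trans ?_
    exact idMat_mcomp_vec z.2)
  right_inv s := glued_ext (c := c) fun W β hW hβ => by
    refine Eq.trans ?_ (mcomp_gval s hW hβ (hW.trans h))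
    exact congrArg (mcomp (basis (c.rank α)) (c.g hβ (hW.trans h)))
      (resMat_gval s (homOfLE hW) le_rfl h)
  map_add' z w := glued_ext (c := c) fun W β hW hβ => by
    refine Eq.trans ?_ (mcomp_add_vec _ _ _ _)
    exact congrArg (mcomp (basis (c.rank α)) (c.g hβ (hW.trans h))) (add_map _ _ _)
  map_smul' a z := glued_ext (c := c) fun W β hW hβ => by
    refine Eq.trans ?_ (mcomp_smul_vec _ _ _ _)
    refine congrArg (mcomp (basis (c.rank α)) (c.g hβ (hW.trans h))) ?_
    ext x u
    exact map_mul (O.obj.map (homOfLE hW).op).hom a (z.1 x u)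

theorem gluedRes_ofVec {V W : Opens X} (f : V ⟶ W) {α : ι} (h : W ≤ U α) (n : ℤ)
    (z : vecs (O.obj.obj (op W)) (c.rank α) n) : c.gluedRes n f (c.ofVec h n z) =
      c.ofVec ((leOfHom f).trans h) n ⟨resMat O.obj f z.1, resMat_mem_vecs f z.2⟩ :=
  glued_ext (c := c) fun _ _ hW hβ => congrArg (mcomp (basis (c.rank α))
    (c.g hβ (hW.trans ((leOfHom f).trans h)))) (resMat_resMat (O := O.obj) _ f _ z.1).symm

theorem ofVec_eq_ofVec {V : Opens X} {α β : ι} (h : V ≤ U α) (h' : V ≤ U β) (n : ℤ)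
    (z : vecs (O.obj.obj (op V)) (c.rank β) n) : c.ofVec h' n z =
      c.ofVec h n ⟨mcomp (basis (c.rank β)) (c.g h h') z.1,
        mcomp_mem_vecs (c.isHom_g h h') (add_zero n) z.2⟩ :=
  (LinearEquiv.eq_symm_apply (c.ofVec h n)).1 (Subtype.ext (congrArg (mcomp (basis (c.rank β))
    (c.g h h')) (resMat_id _ z.1))).symm |>.symm

theorem gluedD_ofVec {V : Opens X} {α : ι} (h : V ≤ U α) (n : ℤ)
    (z : vecs (O.obj.obj (op V)) (c.rank α) n) : c.gluedD n V (c.ofVec h n z) =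
      c.ofVec h (n + 1) ⟨mcomp (basis (c.rank α)) (c.d h) z.1,
        mcomp_mem_vecs (c.isHom_d h) rfl z.2⟩ := by
  refine (LinearEquiv.symm_apply_eq (c.ofVec h (n + 1))).1 (Subtype.ext ?_)
  exact congrArg (mcomp (basis (c.rank α)) (c.d h))
    (congrArg Subtype.val ((c.ofVec h n).symm_apply_apply z))

/-- The standard basis vectors, as columns. -/
def stdVec (R : Type) [CommRing R] (r : Rk S) (n : ℤ) (x : ℕ) : vecs R r n :=
  vecsCol (isHom_idMat (R := R) r).hasDeg_zero n ⟨n, x⟩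

theorem isIsoMat_idMat (R : Type) [CommRing R] (r : Rk S) : IsIsoMat r r (idMat R r) :=
  ⟨idMat R r, isHom_idMat r, idMat_mcomp (isHom_idMat r), idMat_mcomp (isHom_idMat r)⟩

theorem isFrame_stdVec (R : Type) [CommRing R] (r : Rk S) (n : ℤ) :
    IsFrame R (r.1 n) (stdVec R r n) :=
  (IsIsoMat.isColumnBasis (isHom_idMat r) (isIsoMat_idMat R r)).isFrame
    (fun x y h => (isHom_idMat r x y h).2.1) n

/-- The product `M e_y` is the column `y` of `M`; this reads matrix entries as coefficients in a
frame. -/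
theorem sum_smul_stdVec {R : Type} [CommRing R] {r s : Rk S} {q : ℤ} {M : Matrix Ix Ix R}
    (hM : IsHom r s q M) {n m : ℤ} (h : n + q = m) (y : ℕ)
    (hz : mcomp (basis r) M (stdVec R r n y).1 ∈ vecs R s m) :
    (⟨mcomp (basis r) M (stdVec R r n y).1, hz⟩ : vecs R s m) =
      ∑ x ∈ Finset.range (s.1 m), M ⟨m, x⟩ ⟨n, y⟩ • stdVec R s m x := by
  have h1 : mcomp (basis s) (idMat R s) M = M := idMat_mcomp hM
  have h2 : HasDeg s (fun y : Ix => y.1 + q) (mcomp (basis s) (idMat R s) M) := by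
    rw [h1]
    exact hM.hasDeg
  refine Eq.trans ?_ (sum_smul_vecsCol (isHom_idMat (R := R) s).hasDeg_zero hM.hasDeg h2 m ⟨n, y⟩
    h).symm
  refine Subtype.ext (funext fun x => funext fun u => ?_)
  rw [vecsCol_apply, h1]
  have h3 : (stdVec R r n y).1 = fun x _ => idMat R r x ⟨n, y⟩ :=
    vecsCol_val (isHom_idMat (R := R) r).hasDeg_zero (⟨n, y⟩ : Ix)
  refine (congrFun (congrFun (congrArg (mcomp (basis r) M) h3) x) u).trans ?_
  refine (congrFun (congrFun (mcomp_idMat hM) x) ⟨n, y⟩).trans ?_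
  split_ifs with hx
  · rfl
  · by_contra h4
    exact hx ((hM _ _ h4).2.2.trans h)

/-- The frames of the glued complex. -/
def gluedFrame (α : ι) (n : ℤ) (x : ℕ) : c.glued n (U α) :=
  c.ofVec le_rfl n (stdVec _ (c.rank α) n x)

theorem resMat_stdVec {V W : Opens X} (f : V ⟶ W) (r : Rk S) (n : ℤ) (x : ℕ)
    (h : resMat O.obj f (stdVec (O.obj.obj (op W)) r n x).1 ∈ vecs (O.obj.obj (op V)) r n) :
    (⟨resMat O.obj f (stdVec (O.obj.obj (op W)) r n x).1, h⟩ : vecs _ r n) =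
      stdVec (O.obj.obj (op V)) r n x := by
  refine Subtype.ext (funext fun y => funext fun u => ?_)
  refine Eq.trans ?_ (vecsCol_apply _ _ _ _ _).symm
  refine (congrArg (O.obj.map f.op).hom (vecsCol_apply _ _ _ _ _)).trans ?_
  rw [apply_ite (O.obj.map f.op).hom, map_zero]
  exact congrArg (fun a => if y.1 = n then a else 0)
    (congrFun (congrFun (idMat_map (O.obj.map f.op).hom r) y) ⟨n, x⟩)

theorem gluedRes_gluedFrame {V : Opens X} {α : ι} (h : V ≤ U α) (n : ℤ) (x : ℕ) :
    c.gluedRes n (homOfLE h) (c.gluedFrame α n x) = c.ofVec h n (stdVec _ (c.rank α) n x) :=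
  (c.gluedRes_ofVec _ _ _ _).trans (congrArg (c.ofVec h n) (resMat_stdVec _ _ _ _ _))

theorem isFrame_ofVec {V : Opens X} {α : ι} (h : V ≤ U α) (n : ℤ) :
    IsFrame (O.obj.obj (op V)) ((c.rank α).1 n) fun x => c.ofVec h n (stdVec _ (c.rank α) n x) :=
  IsFrame.map_linearEquiv (isFrame_stdVec _ _ n) (c.ofVec h n)

end Cocycle

end gluedComplex

/-- Invariant basis number for nontrivial commutative rings. -/
theorem IsFrame.length_unique {R M : Type} [CommRing R] [Nontrivial R] [AddCommGroup M]
    [Module R M] {r r' : ℕ} {e e' : ℕ → M} (h : IsFrame R r e) (h' : IsFrame R r' e') : r = r' := by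
  let φ : (Fin r → R) ≃ₗ[R] M :=
    LinearEquiv.ofBijective (Fintype.linearCombination R fun x : Fin r => e x) h.2
  let φ' : (Fin r' → R) ≃ₗ[R] M :=
    LinearEquiv.ofBijective (Fintype.linearCombination R fun x : Fin r' => e' x) h'.2
  simpa using card_eq_of_linearEquiv R (φ.trans φ'.symm)

/-! ### Constancy of ranks, and boundedness of the glued complex. -/

section gluedLocallyFree

variable {X : TopCat.{0}} {O : TopCat.Sheaf CommRingCat.{0} X} {S : Set ℤ} {ι : Type}
  {U : ι → Opens X}

namespace Cocycle

variable (c : Cocycle O.obj S U)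

/-- Over the overlap both members provide frames of the same module of sections. -/
theorem rank_eq_of_nonempty
    (hO : ∀ V : Opens X, (V : Set X).Nonempty → Nontrivial (O.obj.obj (op V)))
    {α β : ι} (h : ((U α ⊓ U β : Opens X) : Set X).Nonempty) : c.rank α = c.rank β := by
  have := hO _ h
  exact Subtype.ext (Finsupp.ext fun n =>
    (c.isFrame_ofVec (V := U α ⊓ U β) inf_le_left n).length_unique
    (c.isFrame_ofVec inf_le_right n))

/-- The rank of any member through `x` is a well-defined, locally constant function of `x`, hence
constant. -/
theorem rank_eq [PreconnectedSpace X] (hU : ∀ x : X, ∃ α, x ∈ U α)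
    (hU' : ∀ α, (U α : Set X).Nonempty)
    (hO : ∀ V : Opens X, (V : Set X).Nonempty → Nontrivial (O.obj.obj (op V)))
    (α β : ι) : c.rank α = c.rank β := by
  choose a ha using hU
  have h1 : ∀ (x : X) (α : ι), x ∈ U α → c.rank (a x) = c.rank α := fun x α hx =>
    c.rank_eq_of_nonempty hO ⟨x, ha x, hx⟩
  have h2 : IsLocallyConstant fun x => c.rank (a x) :=
    (IsLocallyConstant.iff_exists_open _).2 fun x => ⟨U (a x), (U (a x)).isOpen, ha x,
      fun y hy => h1 y (a x) hy⟩
  obtain ⟨x, hx⟩ := hU' α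
  obtain ⟨y, hy⟩ := hU' β
  rw [← h1 x α hx, ← h1 y β hy]
  exact h2.apply_eq_of_preconnectedSpace x y

theorem isZero_gluedSheaf {n : ℤ} (h : ∀ α, (c.rank α).1 n = 0) :
    Limits.IsZero (c.gluedSheaf n) := by
  have h1 : ∀ {V : Opens X} (s : c.glued n V), s = 0 := fun {V} s =>
    glued_ext (c := c) fun W α hV hα => funext fun x => funext fun u => by
      by_contra hx
      obtain ⟨h2, h3⟩ := gval_mem s hV hα x u hx
      obtain ⟨k, x⟩ := x
      obtain rfl : k = n := h3
      rw [mem_basis, h α] at h2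
      omega
  rw [Limits.IsZero.iff_id_eq_zero]
  refine SheafOfModules.hom_ext (PresheafOfModules.hom_ext fun V => ?_)
  exact ModuleCat.hom_ext (LinearMap.ext fun s => h1 (V := V.unop) s)

/-- Each member bounds the degrees only over itself, and the family may be infinite; constancy of
the ranks gives a common bound. -/
theorem exists_isZero_gluedSheaf [PreconnectedSpace X] (hU : ∀ x : X, ∃ α, x ∈ U α)
    (hU' : ∀ α, (U α : Set X).Nonempty)
    (hO : ∀ V : Opens X, (V : Set X).Nonempty → Nontrivial (O.obj.obj (op V))) :
    ∃ F : Finset ℤ, ∀ n, n ∉ F → Limits.IsZero (c.gluedSheaf n) := by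
  rcases isEmpty_or_nonempty ι with hι | ⟨⟨α⟩⟩
  · exact ⟨∅, fun n _ => c.isZero_gluedSheaf fun α => hι.elim α⟩
  · refine ⟨(c.rank α).1.support, fun n hn => c.isZero_gluedSheaf fun β => ?_⟩
    rw [c.rank_eq hU hU' hO β α]
    exact Finsupp.notMem_support_iff.1 hn

/-- The complex of sheaves glued from a cocycle, with its frames. -/
def gluedComplex (hb : ∃ F : Finset ℤ, ∀ n, n ∉ F → Limits.IsZero (c.gluedSheaf n)) :
    LocallyFreeComplex O S U where
  E := c.gluedCpx
  bounded := hb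
  rank := c.rank
  frame α n x := c.gluedFrame α n x
  isFrame α n V h := by
    have h1 : (fun x => c.gluedRes n h (c.gluedFrame α n x)) =
        fun x => c.ofVec (leOfHom h) n (stdVec _ (c.rank α) n x) :=
      funext fun x => c.gluedRes_gluedFrame (leOfHom h) n x
    exact h1 ▸ c.isFrame_ofVec (leOfHom h) n

/-- In the frame of `α`, the differential and the change of frame act on columns by the matrices of
`c`, by construction (`gluedD_ofVec`, `ofVec_eq_ofVec`). -/
theorem hasMatrices_gluedComplex
    (hb : ∃ F : Finset ℤ, ∀ n, n ∉ F → Limits.IsZero (c.gluedSheaf n)) :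
    (c.gluedComplex hb).HasMatrices c := by
  have hfr : ∀ {V : Opens X} {α : ι} (h : V ≤ U α) (n : ℤ) (x : ℕ),
      (c.gluedComplex hb).fr h n x = c.ofVec h n (stdVec _ (c.rank α) n x) := fun h n x =>
    c.gluedRes_gluedFrame h n x
  have hsum : ∀ {V : Opens X} {α : ι} (h : V ≤ U α) (n : ℤ) (a : ℕ → O.obj.obj (op V))
      (s : Finset ℕ), c.ofVec h n (∑ x ∈ s, a x • stdVec _ (c.rank α) n x) =
        ∑ x ∈ s, a x • (c.gluedComplex hb).fr h n x := by
    intro V α h n a s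
    rw [map_sum]
    refine Finset.sum_congr rfl fun x _ => ?_
    rw [map_smul]
    exact congrArg (a x • ·) (hfr h n x).symm
  refine ⟨rfl, fun {V α} h n y => ?_, fun {V α β} h h' n y => ?_⟩
  · refine (congrArg (sectMap (c.gluedCpx.d n (n + 1)) V) (hfr h n y)).trans ?_
    refine (c.sectMap_gluedCpx_d n _).trans ((c.gluedD_ofVec h n _).trans ?_)
    rw [sum_smul_stdVec (c.isHom_d h) rfl]
    exact hsum h (n + 1) _ _
  · refine (hfr h' n y).trans ((c.ofVec_eq_ofVec h h' n _).trans ?_)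
    rw [sum_smul_stdVec (c.isHom_g h h') (add_zero n)]
    exact hsum h n _ _

end Cocycle

end gluedLocallyFree

/-! ### Reconstruction of a complex of locally free sheaves from its matrices -/

section sectionGluing

variable {X : TopCat.{0}} {O : TopCat.Sheaf CommRingCat.{0} X}
  (M : SheafOfModules.{0} (ringSheaf O)) {κ : Type} {V : Opens X} {W : κ → Opens X}
  (f : ∀ i, W i ⟶ V)

/-- The sheaf of abelian groups underlying a sheaf of modules. -/
def abSheaf : TopCat.Sheaf AddCommGrpCat.{0} X := ⟨M.val.presheaf, M.isSheaf⟩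

theorem sect_ext (hW : V ≤ iSup W) {s t : Sect M V}
    (h : ∀ i, sectRes M (f i) s = sectRes M (f i) t) : s = t :=
  (abSheaf M).eq_of_locally_eq' W V f hW s t h

theorem exists_sectRes_eq (hW : V ≤ iSup W) (s : ∀ i, Sect M (W i))
    (h : ∀ i j, sectRes M (Opens.infLELeft (W i) (W j)) (s i) =
      sectRes M (Opens.infLERight (W i) (W j)) (s j)) :
    ∃ t : Sect M V, ∀ i, sectRes M (f i) t = s i := by
  let s' : ∀ i, ToType ((abSheaf M).obj.obj (op (W i))) := s
  have h' : TopCat.Presheaf.IsCompatible (abSheaf M).obj W s' := h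
  exact ((abSheaf M).existsUnique_gluing' W V f hW s' h').exists

end sectionGluing

section reconstruction

variable {X : TopCat.{0}} {O : TopCat.Sheaf CommRingCat.{0} X} {S : Set ℤ} {ι : Type}
  {U : ι → Opens X}

theorem sum_smul_stdVec_self {R : Type} [CommRing R] {r : Rk S} {n : ℤ} (z : vecs R r n) :
    ∑ x ∈ Finset.range (r.1 n), z.1 ⟨n, x⟩ () • Cocycle.stdVec R r n x = z := by
  obtain ⟨a, ha⟩ := (Cocycle.isFrame_stdVec R r n).2.2 z
  have h1 : ∀ x : Fin (r.1 n), z.1 ⟨n, x⟩ () = a x := fun x => by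
    rw [← ha]
    change (∑ y : Fin (r.1 n), a y • Cocycle.stdVec R r n y).1 ⟨n, x⟩ () = _
    rw [Submodule.coe_sum, Matrix.sum_apply]
    have h2 : ∀ y : Fin (r.1 n), (a y • Cocycle.stdVec R r n y).1 ⟨n, x⟩ () =
        if x = y then a y else 0 := fun y => by
      refine (congrArg (a y * ·) (vecsCol_apply _ _ _ _ _)).trans ?_
      have h3 : (⟨n, x⟩ : Ix) = ⟨n, y⟩ ↔ x = y := by
        rw [Sigma.mk.injEq, heq_eq_eq, Fin.val_inj, and_iff_right rfl]
      rw [if_pos rfl, idMat]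
      by_cases hxy : x = y
      · rw [if_pos ⟨h3.2 hxy, mem_basis.2 y.2⟩, if_pos hxy, mul_one]
      · rw [if_neg fun h => hxy (h3.1 h.1), if_neg hxy, mul_zero]
    rw [Finset.sum_congr rfl fun y _ => h2 y]
    simp
  refine Eq.trans ?_ ha
  rw [Finset.sum_range]
  exact Finset.sum_congr rfl fun x _ => by rw [h1]

namespace LocallyFreeComplex

variable (G : LocallyFreeComplex O S U)

/-- Sections from their coordinates in a frame. -/
def ofCoord {V : Opens X} {α : ι} (h : V ≤ U α) (n : ℤ) :
    vecs (O.obj.obj (op V)) (G.rank α) n ≃ₗ[O.obj.obj (op V)] Sect (G.E.X n) V :=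
  ((Cocycle.isFrame_stdVec _ (G.rank α) n).exists_linearEquiv (G.isFrame_fr h n)).choose

theorem ofCoord_stdVec {V : Opens X} {α : ι} (h : V ≤ U α) (n : ℤ) (x : ℕ) :
    G.ofCoord h n (Cocycle.stdVec _ (G.rank α) n x) = G.fr h n x :=
  ((Cocycle.isFrame_stdVec _ (G.rank α) n).exists_linearEquiv (G.isFrame_fr h n)).choose_spec x

theorem ofCoord_sum {V : Opens X} {α : ι} (h : V ≤ U α) (n : ℤ) (s : Finset ℕ)
    (a : ℕ → O.obj.obj (op V)) : G.ofCoord h n (∑ x ∈ s, a x • Cocycle.stdVec _ (G.rank α) n x) =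
      ∑ x ∈ s, a x • G.fr h n x := by
  rw [map_sum]
  refine Finset.sum_congr rfl fun x _ => ?_
  rw [map_smul, ofCoord_stdVec]

theorem ofCoord_apply {V : Opens X} {α : ι} (h : V ≤ U α) (n : ℤ)
    (z : vecs (O.obj.obj (op V)) (G.rank α) n) : G.ofCoord h n z =
      ∑ x ∈ Finset.range ((G.rank α).1 n), z.1 ⟨n, x⟩ () • G.fr h n x := by
  conv_lhs => rw [← sum_smul_stdVec_self z]
  exact G.ofCoord_sum h n _ _

theorem sectRes_ofCoord {V W : Opens X} (f : V ⟶ W) {α : ι} (h : W ≤ U α) (n : ℤ)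
    (z : vecs (O.obj.obj (op W)) (G.rank α) n) : sectRes (G.E.X n) f (G.ofCoord h n z) =
      G.ofCoord ((leOfHom f).trans h) n ⟨resMat O.obj f z.1, resMat_mem_vecs f z.2⟩ := by
  rw [ofCoord_apply, ofCoord_apply, map_sum]
  refine Finset.sum_congr rfl fun x _ => ?_
  rw [LinearMap.map_smulₛₗ, sectRes_fr]
  rfl

variable {G} {c : Cocycle O.obj S U}

/-- Both sides are linear in `z`, so it suffices to compare them on the standard frame, where this
is the definition of the change-of-frame matrix. -/
theorem HasMatrices.ofCoord_eq (H : G.HasMatrices c) {V : Opens X} {α β : ι} (h : V ≤ U α)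
    (h' : V ≤ U β) (n : ℤ) (z : vecs (O.obj.obj (op V)) (G.rank β) n)
    (hg : IsHom (G.rank β) (G.rank α) 0 (c.g h h')) : G.ofCoord h' n z = G.ofCoord h n
      ⟨mcomp (basis (G.rank β)) (c.g h h') z.1, mcomp_mem_vecs hg (add_zero n) z.2⟩ := by
  refine (Cocycle.isFrame_stdVec _ (G.rank β) n).map_eq (ρ := RingHom.id (O.obj.obj (op V)))
    (f := (G.ofCoord h' n).toLinearMap)
    (g := (G.ofCoord h n).toLinearMap.comp (vecsMap (RingHom.id _) hg (add_zero n)))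
    (fun y => ?_) z
  refine (G.ofCoord_stdVec h' n y).trans ((H.g h h' n y).trans ?_)
  have h1 := G.ofCoord_sum h n (Finset.range ((G.rank α).1 n)) fun x => c.g h h' ⟨n, x⟩ ⟨n, y⟩
  exact h1.symm.trans (congrArg (G.ofCoord h n) (Cocycle.sum_smul_stdVec hg (add_zero n) y _).symm)

theorem HasMatrices.sectMap_ofCoord (H : G.HasMatrices c) {V : Opens X} {α : ι} (h : V ≤ U α)
    (n : ℤ) (z : vecs (O.obj.obj (op V)) (G.rank α) n)
    (hd : IsHom (G.rank α) (G.rank α) 1 (c.d h)) :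
    sectMap (G.E.d n (n + 1)) V (G.ofCoord h n z) = G.ofCoord h (n + 1)
      ⟨mcomp (basis (G.rank α)) (c.d h) z.1, mcomp_mem_vecs hd rfl z.2⟩ := by
  refine (Cocycle.isFrame_stdVec _ (G.rank α) n).map_eq (ρ := RingHom.id (O.obj.obj (op V)))
    (f := (sectMap (G.E.d n (n + 1)) V).comp (G.ofCoord h n).toLinearMap)
    (g := (G.ofCoord h (n + 1)).toLinearMap.comp (vecsMap (RingHom.id _) hd rfl))
    (fun y => ?_) z
  refine (congrArg (sectMap (G.E.d n (n + 1)) V) (G.ofCoord_stdVec h n y)).trans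
    ((H.d h n y).trans ?_)
  have h1 := G.ofCoord_sum h (n + 1) (Finset.range ((G.rank α).1 (n + 1)))
    fun x => c.d h ⟨n + 1, x⟩ ⟨n, y⟩
  exact h1.symm.trans (congrArg (G.ofCoord h (n + 1)) (Cocycle.sum_smul_stdVec hd rfl y _).symm)

end LocallyFreeComplex

end reconstruction

/-! ### A framed complex is isomorphic to the one glued from its matrices. -/

section coordinates

variable {X : TopCat.{0}} {O : TopCat.Sheaf CommRingCat.{0} X} {S : Set ℤ} {ι : Type}
  {U : ι → Opens X}

namespace LocallyFreeComplex

variable (G : LocallyFreeComplex O S U)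

theorem hasMatrices_cocycle : G.HasMatrices G.cocycle := hasMatrices_iff.2 rfl

theorem resMat_ofCoord_symm {V W : Opens X} (f : V ⟶ W) {α : ι} (h : W ≤ U α) (n : ℤ)
    (s : Sect (G.E.X n) W) : resMat O.obj f ((G.ofCoord h n).symm s).1 =
      ((G.ofCoord ((leOfHom f).trans h) n).symm (sectRes (G.E.X n) f s)).1 := by
  have h1 := G.sectRes_ofCoord f h n ((G.ofCoord h n).symm s)
  rw [LinearEquiv.apply_symm_apply] at h1
  rw [h1, LinearEquiv.symm_apply_apply]

theorem gMat_ofCoord_symm {V : Opens X} {α β : ι} (h : V ≤ U α) (h' : V ≤ U β) (n : ℤ)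
    (s : Sect (G.E.X n) V) :
    mcomp (basis (G.rank β)) (G.gMat h h') ((G.ofCoord h' n).symm s).1 =
      ((G.ofCoord h n).symm s).1 := by
  have h1 := G.hasMatrices_cocycle.ofCoord_eq h h' n ((G.ofCoord h' n).symm s) (G.isHom_gMat h h')
  rw [LinearEquiv.apply_symm_apply] at h1
  exact (congrArg Subtype.val ((G.ofCoord h n).symm_apply_eq.2 h1)).symm

/-- The coordinates of a section in all frames. -/
def coord (n : ℤ) (V : Opens X) :
    Sect (G.E.X n) V →ₗ[O.obj.obj (op V)] G.cocycle.glued n V where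
  toFun s := ⟨fun p => ((G.ofCoord p.2.2 n).symm (sectRes (G.E.X n) (homOfLE p.2.1) s)).1,
    fun W α h h' => ((G.ofCoord h' n).symm (sectRes (G.E.X n) (homOfLE h) s)).2,
    fun W' W α f h h' => (G.resMat_ofCoord_symm f h' n _).trans
      (congrArg (fun t => ((G.ofCoord ((leOfHom f).trans h') n).symm t).1)
        (sectRes_sectRes _ f _ _ s)),
    fun W α β h hα hβ => G.gMat_ofCoord_symm hα hβ n _⟩
  map_add' s t := Cocycle.glued_ext (c := G.cocycle) fun W α h h' => by
    change ((G.ofCoord h' n).symm (sectRes (G.E.X n) (homOfLE h) (s + t))).1 = _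
    rw [map_add, map_add]
    rfl
  map_smul' a s := Cocycle.glued_ext (c := G.cocycle) fun W α h h' => by
    change ((G.ofCoord h' n).symm (sectRes (G.E.X n) (homOfLE h) (a • s))).1 = _
    rw [LinearMap.map_smulₛₗ, map_smul]
    rfl

theorem gval_coord {n : ℤ} {V : Opens X} (s : Sect (G.E.X n) V) {W : Opens X} {α : ι}
    (h : W ≤ V) (h' : W ≤ U α) : Cocycle.gval (G.coord n V s) W α h h' =
      ((G.ofCoord h' n).symm (sectRes (G.E.X n) (homOfLE h) s)).1 := rfl

/-- Over each `V ⊓ U α` coordinates are bijective. Injectivity is locality of the sheaf; for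
surjectivity the local sections with prescribed coordinates agree on overlaps by the change-of-frame
condition, and glue. -/
theorem coord_bijective (hU : ∀ x : X, ∃ α, x ∈ U α) (n : ℤ) (V : Opens X) :
    Function.Bijective (G.coord n V) := by
  have hcov : V ≤ iSup fun α => V ⊓ U α := fun x hx => by
    obtain ⟨α, hα⟩ := hU x
    exact Opens.mem_iSup.2 ⟨α, hx, hα⟩
  constructor
  · intro s t hst
    refine sect_ext (G.E.X n) (fun α => Opens.infLELeft V (U α)) hcov fun α => ?_
    refine (G.ofCoord (V := V ⊓ U α) inf_le_right n).symm.injective (Subtype.ext ?_)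
    exact congrArg (fun u => Cocycle.gval u (V ⊓ U α) α inf_le_left inf_le_right) hst
  · intro t
    obtain ⟨s, hs⟩ := exists_sectRes_eq (G.E.X n) (fun α => Opens.infLELeft V (U α)) hcov
      (fun α => G.ofCoord (V := V ⊓ U α) inf_le_right n
        ⟨Cocycle.gval t (V ⊓ U α) α inf_le_left inf_le_right,
          Cocycle.gval_mem t inf_le_left inf_le_right⟩) fun α β => by
        let Z : Opens X := (V ⊓ U α) ⊓ (V ⊓ U β)
        have hα : Z ≤ U α := inf_le_left.trans inf_le_right
        have hβ : Z ≤ U β := inf_le_right.trans inf_le_right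
        have hZ : Z ≤ V := inf_le_left.trans inf_le_left
        refine (G.sectRes_ofCoord _ _ _ _).trans (Eq.trans ?_ (G.sectRes_ofCoord _ _ _ _).symm)
        refine Eq.trans ?_ (G.hasMatrices_cocycle.ofCoord_eq hα hβ n _ (G.isHom_gMat hα hβ)).symm
        refine congrArg (G.ofCoord hα n) (Subtype.ext ?_)
        refine (Cocycle.resMat_gval t (Opens.infLELeft (V ⊓ U α) (V ⊓ U β))
          inf_le_left inf_le_right).trans ?_
        refine (Cocycle.mcomp_gval t hZ hα hβ).symm.trans ?_
        exact congrArg (mcomp (basis (G.rank β)) (G.gMat hα hβ))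
          (Cocycle.resMat_gval t (Opens.infLERight (V ⊓ U α) (V ⊓ U β))
            inf_le_left inf_le_right).symm
    refine ⟨s, Cocycle.glued_ext (c := G.cocycle) fun W α h h' => ?_⟩
    -- The gluing prescribes `s` on the sets `V ⊓ U α`; a small set `W` in `U α` lies in one of
    -- them, so the restriction factors.
    have h1 : sectRes (G.E.X n) (homOfLE h) s = G.ofCoord h' n
        ⟨Cocycle.gval t W α h h', Cocycle.gval_mem t h h'⟩ := by
      rw [← sectRes_sectRes (G.E.X n) (homOfLE (le_inf h h')) (Opens.infLELeft V (U α)), hs]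
      refine (G.sectRes_ofCoord _ _ _ _).trans ?_
      exact congrArg (G.ofCoord h' n) (Subtype.ext
        (Cocycle.resMat_gval t (homOfLE (le_inf h h')) inf_le_left inf_le_right))
    rw [gval_coord, h1, LinearEquiv.symm_apply_apply]

/-- A sheaf in the complex is isomorphic to the sheaf glued from the matrices. -/
def coordIso (hU : ∀ x : X, ∃ α, x ∈ U α) (n : ℤ) : G.E.X n ≅ G.cocycle.gluedSheaf n :=
  (SheafOfModules.fullyFaithfulForget (ringSheaf O)).preimageIso
    (PresheafOfModules.isoMk (fun V => LinearEquiv.toModuleIso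
      (R := (ringSheaf O).obj.obj V)
      (LinearEquiv.ofBijective (G.coord n V.unop) (G.coord_bijective hU n V.unop)))
      fun V W f => by
        refine ModuleCat.hom_ext (LinearMap.ext fun s => ?_)
        refine Cocycle.glued_ext (c := G.cocycle) fun Z α h h' => ?_
        exact congrArg (fun t => ((G.ofCoord h' n).symm t).1)
          (sectRes_sectRes (G.E.X n) (homOfLE h) f.unop _ s))

theorem sectMap_hom_ext {M N : SheafOfModules.{0} (ringSheaf O)} {φ ψ : M ⟶ N}
    (h : ∀ (V : Opens X) (s : Sect M V), sectMap φ V s = sectMap ψ V s) : φ = ψ :=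
  SheafOfModules.hom_ext (PresheafOfModules.hom_ext fun V =>
    ModuleCat.hom_ext (LinearMap.ext fun s => h V.unop s))

theorem gluedD_coord (n : ℤ) {V : Opens X} (s : Sect (G.E.X n) V) :
    G.cocycle.gluedD n V (G.coord n V s) =
      G.coord (n + 1) V (sectMap (G.E.d n (n + 1)) V s) :=
  Cocycle.glued_ext (c := G.cocycle) fun W α h h' => by
    rw [gval_coord, ← sectMap_sectRes, Cocycle.gval_gluedD, gval_coord]
    have h1 := G.hasMatrices_cocycle.sectMap_ofCoord h' n
      ((G.ofCoord h' n).symm (sectRes (G.E.X n) (homOfLE h) s)) (G.isHom_dMat h')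
    rw [LinearEquiv.apply_symm_apply] at h1
    exact (congrArg Subtype.val ((G.ofCoord h' (n + 1)).symm_apply_eq.2 h1)).symm

/-- Coordinates commute with the differentials and send the chosen frames to standard basis vectors.
-/
theorem iso_gluedComplex (hU : ∀ x : X, ∃ α, x ∈ U α)
    (hb : ∃ F : Finset ℤ, ∀ n, n ∉ F → Limits.IsZero (G.cocycle.gluedSheaf n)) :
    G.Iso (G.cocycle.gluedComplex hb) := by
  refine ⟨rfl, HomologicalComplex.Hom.isoOfComponents (fun n => G.coordIso hU n) ?_,
    fun α n x => ?_⟩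
  · rintro n _ rfl
    refine sectMap_hom_ext fun V s => ?_
    refine (G.cocycle.sectMap_gluedCpx_d n (G.coord n V s)).trans ?_
    exact G.gluedD_coord n s
  · refine (LinearEquiv.symm_apply_eq (G.cocycle.ofVec (le_refl (U α)) n)).1 (Subtype.ext ?_)
    refine (G.gval_coord (G.frame α n x) le_rfl le_rfl).trans ?_
    have h1 : (G.ofCoord (le_refl (U α)) n).symm (G.fr le_rfl n x) =
        Cocycle.stdVec _ (G.rank α) n x :=
      (LinearEquiv.symm_apply_eq _).2 (G.ofCoord_stdVec le_rfl n x).symm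
    exact congrArg Subtype.val h1

end LocallyFreeComplex

/-- The cocycle is a complete isomorphism invariant of framed complexes, and gluing realises every
cocycle. -/
theorem exists_equiv_locallyFreeComplex [PreconnectedSpace X] (hU : ∀ x : X, ∃ α, x ∈ U α)
    (hU' : ∀ α, (U α : Set X).Nonempty)
    (hO : ∀ V : Opens X, (V : Set X).Nonempty → Nontrivial (O.obj.obj (op V))) :
    ∃ Φ : TotZero O.obj (coreNerveFree S) U ≃
        Quot (LocallyFreeComplex.Iso (O := O) (S := S) (U := U)),
      ∀ v G, Φ v = Quot.mk _ G ↔ G.IsMatrixOf v := by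
  obtain ⟨Φ, hΦ⟩ := exists_equiv_quot_of_section
    (totZeroEquivCocycle (O := O.obj) (S := S) hU' (subsingleton_of_not_nonempty O))
    (LocallyFreeComplex.Iso (O := O) (S := S) (U := U)) LocallyFreeComplex.HasMatrices
    (fun c => c.gluedComplex (c.exists_isZero_gluedSheaf hU hU' hO))
    (fun G => ⟨G.cocycle, G.hasMatrices_cocycle⟩)
    (fun G c c' h h' => (LocallyFreeComplex.hasMatrices_iff.1 h).trans
      (LocallyFreeComplex.hasMatrices_iff.1 h').symm)
    (fun c => c.hasMatrices_gluedComplex _)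
    (fun G c h => by
      obtain rfl := LocallyFreeComplex.hasMatrices_iff.1 h
      exact G.iso_gluedComplex hU _)
    (fun G G' c h h' => h'.of_iso h)
  exact ⟨Φ, fun v G => (hΦ v G).trans
    (G.isMatrixOf_iff_hasMatrices v hU' (subsingleton_of_not_nonempty O)).symm⟩

end coordinates

/-! ### Rings of holomorphic functions. -/

section holomorphic

variable {E : Type} [NormedAddCommGroup E] [NormedSpace ℂ E] {X : Type} [TopologicalSpace X]
  [ChartedSpace E X]

theorem nontrivial_holSheaf (V : Opens X) (hV : (V : Set X).Nonempty) :
    Nontrivial ((holSheaf E X).obj.obj (op V)) := by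
  obtain ⟨x, hx⟩ := hV
  refine ⟨0, 1, fun h => ?_⟩
  have h1 : ((0 : (holSheaf E X).obj.obj (op V)).1 ⟨x, hx⟩ : ℂ) =
    (1 : (holSheaf E X).obj.obj (op V)).1 ⟨x, hx⟩ := by rw [h]
  exact zero_ne_one h1

end holomorphic

end CechTot

end

theorem theorem4p1p1 {E : Type} [NormedAddCommGroup E] [NormedSpace ℂ E] [FiniteDimensional ℂ E]
    {X : Type} [TopologicalSpace X] [T2Space X] [ParacompactSpace X] [ConnectedSpace X]
    [ChartedSpace E X] [IsManifold 𝓘(ℂ, E) ω X]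
    {ι : Type} (U : ι → Opens X) (hU : CechTot.IsSteinCover E U) (S : Set ℤ) :
    (∃ Φ : CechTot.TotZero (CechTot.holSheaf E X).obj (CechTot.coreNerveFree S) U ≃
        Quot (CechTot.LocallyFreeComplex.Iso (O := CechTot.holSheaf E X) (S := S) (U := U)),
      ∀ v G, Φ v = Quot.mk _ G ↔ G.IsMatrixOf v) ∧
    (∃ Φ : CechTot.TotZero (CechTot.holSheaf E X).obj (CechTot.Twist S) U ≃
        CechTot.TwistingCochain (CechTot.holSheaf E X).obj S U,
      ∀ v, (Φ v).IsDataOf v) ∧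
    (∃ Φ : CechTot.TotZero (CechTot.holSheaf E X).obj (CechTot.Green S) U ≃
        Quot (CechTot.GreenComplex.Iso (O := (CechTot.holSheaf E X).obj) (S := S) (U := U)),
      ∀ v G, Φ v = Quot.mk _ G ↔ G.IsMatrixOf v) ∧
    (∃ Φ : CechTot.TotZero (CechTot.holSheaf E X).obj (CechTot.sTwist S) U ≃
        CechTot.SimplicialTwistingCochain (CechTot.holSheaf E X).obj S U,
      ∀ v, (Φ v).IsDataOf v) :=
  -- Connectedness and nontrivial rings of functions enter in (a), for the ranks; nonempty members
  -- make tuples with a single index available in (a) and (b).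
  ⟨CechTot.exists_equiv_locallyFreeComplex (X := TopCat.of X) hU.covers hU.nonempty
      CechTot.nontrivial_holSheaf,
    CechTot.exists_equiv_twistingCochain hU.nonempty, CechTot.exists_equiv_greenComplex,
    CechTot.exists_equiv_simplicialTwistingCochain⟩
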